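/- **Theorem.** Let $S\in\{\mathrm{MSMP},\mathrm{MCMP}\}$ and $T\in\{\mathrm{SCMP},\mathrm{DMP},\mathrm{SMP},\mathrm{MP},\mathrm{MCBS},\mathrm{SCBS},\mathrm{BS},\mathrm{CMV},\mathrm{CMV}^+,\mathrm{LCMV},\mathrm{LCMV}^+\}$. There is no good encoding from $S$ into $T$. *The calculi.* MCMP (mixed choice multiparty session calculus) has processes $P::=0\mid\checkmark\mid X\mid\mu X.P\mid\sum_{i\in I}\pi_i.P_i\mid\mathsf{if}\ v\ \mathsf{then}\ P\ \mathsf{else}\ P$ (guarded recursion, $I\neq\emptyset$ finite) with prefixes $\pi::=p!\ell\langle v\rangle\mid p?\ell(x)$, and sessions $M::=p\triangleleft P\mid M\mid M$ with pairwise different participants $p$. Communication is synchronous: $p\triangleleft(q?\ell(x).P+R)\mid q\triangleleft(p!\ell\langle v\rangle.Q+R')\longrightarrow p\triangleleft P\{v/x\}\mid q\triangleleft Q$; conditionals reduce as usual, and reduction is closed under parallel composition and structural congruence. The other calculi of this family restrict every choice: in MSMP, the prefixes with the same partner are all outputs or all inputs; in SCMP, all prefixes are outputs or all are inputs; in DMP,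 all prefixes have the same partner; SMP combines the restrictions of SCMP and DMP; in MP a choice is a sum of inputs from one partner or a single output. MCBS, SCBS, BS are MCMP, SCMP, MP limited to two parties. The terms of all these calculi are the sessions that are typed (local types with subtyping, and a safe local context) and deadlock-free (every reachable session reduces or is, up to $\equiv$, a composition of terminated participants $p\triangleleft0$, $p\triangleleft\checkmark$). $\mathrm{CMV}^+$ is the typed calculus of (binary) mixed sessions of Casal, Mordido and Vasconcelos, with base values numbers and booleans; CMV is the variant with output, input, selection and branching instead of mixed choice; $\mathrm{LCMV}^+$ and LCMV are their linear fragments (no $\mathsf{un}$ in types, at most one restriction, no delegation). Their terms are the typed processes. *Good encodings.* An encoding $\llbracket\cdot\rrbracket$ translates processes and sessions of the source calculus $S$ such that source terms become terms of the target calculus $T$. It is *good* if, for some equivalence $\asymp$ on the target that is a weak reduction bisimulation ($N_1\asymp N_2$ and $N_1\longrightarrow^*N_1'$ imply $N_2\longrightarrow^*N_2'$ with $N_1'\asymp N_2'$) and respects success ($N_1\asymp N_2$ implies $N_1\Downarrow_\checkmark$ iff $N_2\Downarrow_\checkmark$, where $N\Downarrow_\checkmark$ means that $N$ may reach a state with a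 top-level unguarded $\checkmark$), it satisfies: 1. *Compositionality.* For every operator $\mathbf{op}$ of arity $n$ (recursion, choice with given prefixes, conditional, $p\triangleleft\cdot$, parallel composition) and every finite set $\mathbb P$ of participants there is a target context $\mathcal C^{\mathbb P}_{\mathbf{op}}$ with $n$ holes such that $\llbracket\mathbf{op}(M_1,\dots,M_n)\rrbracket=\mathcal C^{\mathbb P}_{\mathbf{op}}[\llbracket M_1\rrbracket,\dots,\llbracket M_n\rrbracket]$ for all $M_1,\dots,M_n$ whose participants together form $\mathbb P$ and such that $\mathbf{op}(M_1,\dots,M_n)$ occurs in a source term. 2. *Name invariance.* There is a renaming policy $\varphi$ that maps every participant to a vector of $k$ target names, with different participants sent to disjoint vectors of distinct names, such that for every source term $M$ and every map $\sigma$ on participants for which $M\sigma$ is a source term: $\llbracket M\sigma\rrbracket=\llbracket M\rrbracket\sigma'$ (up to renaming of bound names for CMV and its variants) if $\sigma$ is injective, and $\llbracket M\sigma\rrbracket\asymp\llbracket M\rrbracket\sigma'$ otherwise, where $\sigma'(\varphi(a))=\varphi(\sigma(a))$ for all $a$ and $\sigma'$ fixes all names outside the vectors $\varphi(a)$. 3.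 *Operational correspondence.* For all source terms $M$: if $M\longrightarrow^*M'$ for a source term $M'$, then $\llbracket M\rrbracket\longrightarrow^*\asymp\llbracket M'\rrbracket$; and if $\llbracket M\rrbracket\longrightarrow^*N$, then $M\longrightarrow^*M'$ and $N\longrightarrow^*\asymp\llbracket M'\rrbracket$ for some source term $M'$. 4. *Divergence reflection.* If $\llbracket M\rrbracket$ has an infinite execution, then so has the source term $M$. 5. *Success sensitiveness.* $M\Downarrow_\checkmark$ iff $\llbracket M\rrbracket\Downarrow_\checkmark$ for every source term $M$. 6. *Preservation of distributability.* A term $M$ is distributable into $M_1,\dots,M_n$ if $M\equiv M_1\mid\dots\mid M_n$, where $\equiv$ does not unfold recursion. If a source term $M$ is distributable into source terms $M_1,\dots,M_n$, then $\llbracket M\rrbracket$ is distributable into some $N_1,\dots,N_n$ with $N_i\asymp\llbracket M_i\rrbracket$ for all $i$. -/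

import Mathlib

namespace MixedChoice

/-! ## Names and values

Participants, labels, value variables (and channel endpoints) and recursion variables are drawn
from countably infinite sets. -/

abbrev Part := ℕ
abbrev Label := ℕ
abbrev Name := ℕ

inductive Const where
  | num (n : ℕ)
  | bool (b : Bool)

inductive Val where
  | var (x : Name)
  | const (c : Const)

/-- `snd` is the polarity `!`, `rcv` the polarity `?`. -/
inductive Pol where
  | snd
  | rcv

/-! ## The calculus MCMP: syntax -/

/-- Prefixes `p!ℓ⟨v⟩` and `p?ℓ(x)`. -/
inductive Prefix where
  | out (p : Part) (l : Label) (v : Val)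
  | inp (p : Part) (l : Label) (x : Name)

namespace Prefix

def pol : Prefix → Pol
  | out _ _ _ => .snd
  | inp _ _ _ => .rcv

def partner : Prefix → Part
  | out p _ _ => p
  | inp p _ _ => p

def label : Prefix → Label
  | out _ l _ => l
  | inp _ l _ => l

/-- The value variables occurring free in a prefix. -/
def fv : Prefix → Set Name
  | out _ _ (.var x) => {x}
  | _ => ∅

/-- The value variables bound by a prefix in its continuation. -/
def bv : Prefix → Set Name
  | inp _ _ x => {x}
  | _ => ∅

def map (f g : ℕ → ℕ) : Prefix → Prefix
  | out p l (.var x) => out (f p) l (.var (g x))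
  | out p l (.const c) => out (f p) l (.const c)
  | inp p l x => inp (f p) l (g x)

end Prefix

/-- Processes with holes labelled by `H`.  A process proper has no holes (`H = Empty`); a context
with `n` holes is an element of `Proc (Fin n)`.  A choice is nonempty. -/
inductive Proc (H : Type) : Type where
  | hole (h : H)
  | nil
  | tick
  | pvar (X : Name)
  | mu (X : Name) (P : Proc H)
  | choice {n : ℕ} (pre : Fin (n + 1) → Prefix) (P : Fin (n + 1) → Proc H)
  | cond (v : Val) (P Q : Proc H)

/-- Multiparty sessions, with process holes `H` and session holes `K`. -/
inductive Sess (H K : Type) : Type where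
  | hole (k : K)
  | loc (p : Part) (P : Proc H)
  | par (M N : Sess H K)

abbrev Proc0 := Proc Empty
abbrev Sess0 := Sess Empty Empty

namespace Proc

/-- Insert processes into the holes; as usual for contexts, free variables may be captured. -/
def fill {H K : Type} (s : H → Proc K) : Proc H → Proc K
  | hole h => s h
  | nil => nil
  | tick => tick
  | pvar X => pvar X
  | mu X P => mu X (P.fill s)
  | choice pre P => choice pre (fun i => (P i).fill s)
  | cond v P Q => cond v (P.fill s) (Q.fill s)

/-- Rename all participants by `f`, all value variables by `g`, all recursion variables by `r`
(free and bound occurrences). -/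
def map {H : Type} (f g r : ℕ → ℕ) : Proc H → Proc H
  | hole h => hole h
  | nil => nil
  | tick => tick
  | pvar X => pvar (r X)
  | mu X P => mu (r X) (P.map f g r)
  | choice pre P => choice (fun i => (pre i).map f g) (fun i => (P i).map f g r)
  | cond (.var x) P Q => cond (.var (g x)) (P.map f g r) (Q.map f g r)
  | cond (.const c) P Q => cond (.const c) (P.map f g r) (Q.map f g r)

/-- The participants occurring in a process. -/
def parts {H : Type} : Proc H → Finset Part
  | hole _ => ∅
  | nil => ∅
  | tick => ∅
  | pvar _ => ∅
  | mu _ P => P.parts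
  | choice pre P => Finset.univ.biUnion (fun i => insert (pre i).partner (P i).parts)
  | cond _ P Q => P.parts ∪ Q.parts

/-- Free value variables. -/
def fv {H : Type} : Proc H → Set Name
  | hole _ => ∅
  | nil => ∅
  | tick => ∅
  | pvar _ => ∅
  | mu _ P => P.fv
  | choice pre P => ⋃ i, ((pre i).fv ∪ ((P i).fv \ (pre i).bv))
  | cond (.var x) P Q => {x} ∪ P.fv ∪ Q.fv
  | cond (.const _) P Q => P.fv ∪ Q.fv

/-- Bound value variables. -/
def bv {H : Type} : Proc H → Set Name
  | hole _ => ∅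
  | nil => ∅
  | tick => ∅
  | pvar _ => ∅
  | mu _ P => P.bv
  | choice pre P => ⋃ i, ((pre i).bv ∪ (P i).bv)
  | cond _ P Q => P.bv ∪ Q.bv

/-- Free recursion variables. -/
def fpv {H : Type} : Proc H → Set Name
  | hole _ => ∅
  | nil => ∅
  | tick => ∅
  | pvar X => {X}
  | mu X P => P.fpv \ {X}
  | choice _ P => ⋃ i, (P i).fpv
  | cond _ P Q => P.fpv ∪ Q.fpv

/-- Bound recursion variables. -/
def bpv {H : Type} : Proc H → Set Name
  | hole _ => ∅
  | nil => ∅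
  | tick => ∅
  | pvar _ => ∅
  | mu X P => {X} ∪ P.bpv
  | choice _ P => ⋃ i, (P i).bpv
  | cond _ P Q => P.bpv ∪ Q.bpv

/-- Substitution of the constant `c` for the value variable `x`. -/
def subst {H : Type} (x : Name) (c : Const) : Proc H → Proc H
  | hole h => hole h
  | nil => nil
  | tick => tick
  | pvar X => pvar X
  | mu X P => mu X (P.subst x c)
  | choice pre P =>
      choice
        (fun i => match pre i with
          | .out p l (.var y) => if y = x then .out p l (.const c) else .out p l (.var y)
          | .out p l (.const d) => .out p l (.const d)
          | .inp p l y => .inp p l y)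
        (fun i => match pre i with
          | .out _ _ _ => (P i).subst x c
          | .inp _ _ y => if y = x then P i else (P i).subst x c)
  | cond (.var y) P Q =>
      cond (if y = x then .const c else .var y) (P.subst x c) (Q.subst x c)
  | cond (.const d) P Q => cond (.const d) (P.subst x c) (Q.subst x c)

/-- Substitution of the process `S` for the recursion variable `X` (used only where no variable
of `S` can be captured). -/
def psubst {H : Type} (X : Name) (S : Proc H) : Proc H → Proc H
  | hole h => hole h
  | nil => nil
  | tick => tick
  | pvar Y => if Y = X then S else pvar Y
  | mu Y P => if Y = X then mu Y P else mu Y (psubst X S P)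
  | choice pre P => choice pre (fun i => psubst X S (P i))
  | cond v P Q => cond v (psubst X S P) (psubst X S Q)

/-- The recursion variables that occur free and unguarded, i.e. neither below a prefix nor below
a conditional. -/
def unguarded {H : Type} : Proc H → Set Name
  | pvar X => {X}
  | mu X P => P.unguarded \ {X}
  | _ => ∅

/-- Every recursion is guarded. -/
def Guarded {H : Type} : Proc H → Prop
  | mu X P => X ∉ P.unguarded ∧ P.Guarded
  | choice _ P => ∀ i, (P i).Guarded
  | cond _ P Q => P.Guarded ∧ Q.Guarded
  | _ => True

/-- A top-level unguarded occurrence of success. -/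
def Success {H : Type} : Proc H → Prop
  | tick => True
  | mu _ P => P.Success
  | _ => False

/-- Every choice of the process satisfies `C`. -/
def AllChoices {H : Type} (C : ∀ n : ℕ, (Fin (n + 1) → Prefix) → Prop) : Proc H → Prop
  | mu _ P => P.AllChoices C
  | choice pre P => C _ pre ∧ ∀ i, (P i).AllChoices C
  | cond _ P Q => P.AllChoices C ∧ Q.AllChoices C
  | _ => True

/-- `Sub P Q`: the process `P` occurs as a subterm of `Q`. -/
inductive Sub {H : Type} : Proc H → Proc H → Prop
  | refl (P) : Sub P P
  | mu {P Q} (X) : Sub P Q → Sub P (mu X Q)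
  | choice {P} {n : ℕ} (pre : Fin (n + 1) → Prefix) (Q : Fin (n + 1) → Proc H) (i) :
      Sub P (Q i) → Sub P (choice pre Q)
  | condL {P} (v Q R) : Sub P Q → Sub P (cond v Q R)
  | condR {P} (v Q R) : Sub P R → Sub P (cond v Q R)

end Proc

namespace Sess

def fill {H K H' K' : Type} (s : H → Proc H') (t : K → Sess H' K') : Sess H K → Sess H' K'
  | hole k => t k
  | loc p P => loc p (P.fill s)
  | par M N => par (M.fill s t) (N.fill s t)

/-- Rename the participants of a session. -/
def rename {H K : Type} (f : ℕ → ℕ) : Sess H K → Sess H K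
  | hole k => hole k
  | loc p P => loc (f p) (P.map f id id)
  | par M N => par (M.rename f) (N.rename f)

/-- The participants occurring in a session (as locations or inside the processes). -/
def parts {H K : Type} : Sess H K → Finset Part
  | hole _ => ∅
  | loc p P => insert p P.parts
  | par M N => M.parts ∪ N.parts

/-- The locations `p ◁ P` of a session. -/
def locs {H K : Type} : Sess H K → List (Part × Proc H)
  | hole _ => []
  | loc p P => [(p, P)]
  | par M N => M.locs ++ N.locs

def Success {H K : Type} (M : Sess H K) : Prop := ∃ l ∈ M.locs, l.2.Success

/-- `Sub M N`: the session `M` occurs as a subterm of `N`. -/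
inductive Sub {H K : Type} : Sess H K → Sess H K → Prop
  | refl (M) : Sub M M
  | parL {M N} (L) : Sub M N → Sub M (par N L)
  | parR {M N} (L) : Sub M N → Sub M (par L N)

end Sess

/-! ## MCMP: structural congruence and reduction -/

/-- Identification of processes up to renaming of bound variables and reordering of summands. -/
inductive PIdent : Proc0 → Proc0 → Prop
  | refl (P) : PIdent P P
  | symm {P Q} : PIdent P Q → PIdent Q P
  | trans {P Q R} : PIdent P Q → PIdent Q R → PIdent P R
  | ctx {P Q} (C : Proc (Fin 1)) :
      PIdent P Q → PIdent (C.fill (fun _ => P)) (C.fill (fun _ => Q))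
  | alphaMu (X Y : Name) (P : Proc0) : Y ∉ P.fpv →
      PIdent (.mu X P) (.mu Y (P.map id id (Equiv.swap X Y)))
  | alphaInp {n : ℕ} (pre : Fin (n + 1) → Prefix) (P : Fin (n + 1) → Proc0) (i : Fin (n + 1))
      (p l x y) : pre i = .inp p l x → y ∉ (P i).fv →
      PIdent (.choice pre P)
        (.choice (Function.update pre i (.inp p l y))
          (Function.update P i ((P i).map id (Equiv.swap x y) id)))
  | perm {n : ℕ} (pre : Fin (n + 1) → Prefix) (P : Fin (n + 1) → Proc0)
      (e : Equiv.Perm (Fin (n + 1))) :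
      PIdent (.choice pre P) (.choice (pre ∘ e) (P ∘ e))

/-- Structural congruence of processes; recursions may be unfolded only if `u = true`. -/
inductive PCong (u : Bool) : Proc0 → Proc0 → Prop
  | ident {P Q} : PIdent P Q → PCong u P Q
  | symm {P Q} : PCong u P Q → PCong u Q P
  | trans {P Q R} : PCong u P Q → PCong u Q R → PCong u P R
  | unfold (X : Name) (P : Proc0) : u = true →
      Disjoint P.fv P.bv → Disjoint (Proc.mu X P).fpv P.bpv →
      PCong u (.mu X P) (Proc.psubst X (.mu X P) P)

/-- Structural congruence of sessions; recursions may be unfolded only if `u = true`. -/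
inductive SCong (u : Bool) : Sess0 → Sess0 → Prop
  | refl (M) : SCong u M M
  | symm {M N} : SCong u M N → SCong u N M
  | trans {M N L} : SCong u M N → SCong u N L → SCong u M L
  | loc (p) {P Q} : PCong u P Q → SCong u (.loc p P) (.loc p Q)
  | par {M N} (L) : SCong u M N → SCong u (.par M L) (.par N L)
  | nil (p M) : SCong u (.par (.loc p .nil) M) M
  | comm (M N) : SCong u (.par M N) (.par N M)
  | assoc (M N L) : SCong u (.par (.par M N) L) (.par M (.par N L))

/-- Reduction of sessions. -/
inductive SStep : Sess0 → Sess0 → Prop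
  | comm (p q l x c) {n m : ℕ} (pre : Fin (n + 1) → Prefix) (P : Fin (n + 1) → Proc0)
      (pre' : Fin (m + 1) → Prefix) (Q : Fin (m + 1) → Proc0) (i : Fin (n + 1))
      (j : Fin (m + 1)) :
      pre i = .inp q l x → pre' j = .out p l (.const c) →
      SStep (.par (.loc p (.choice pre P)) (.loc q (.choice pre' Q)))
        (.par (.loc p ((P i).subst x c)) (.loc q (Q j)))
  | ifTrue (p P Q) : SStep (.loc p (.cond (.const (.bool true)) P Q)) (.loc p P)
  | ifFalse (p P Q) : SStep (.loc p (.cond (.const (.bool false)) P Q)) (.loc p Q)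
  | par {M N} (L) : SStep M N → SStep (.par M L) (.par N L)
  | cong {M M' N N'} : SCong true M M' → SStep M' N' → SCong true N' N → SStep M N

/-! ## MCMP: types -/

/-- Payload types. -/
inductive Pay where
  | nat
  | bool

/-- A type prefix `p!ℓ(U)` or `p?ℓ(U)`. -/
structure LAct where
  pol : Pol
  partner : Part
  label : Label
  pay : Pay

/-- Local types; recursion variables are de Bruijn indices. -/
inductive LType : Type where
  | fin
  | tvar (k : ℕ)
  | mu (T : LType)
  | choice {n : ℕ} (a : Fin (n + 1) → LAct) (T : Fin (n + 1) → LType)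

namespace LType

/-- Replace the variable `k` by the closed type `S`. -/
def subst (S : LType) : ℕ → LType → LType
  | _, fin => fin
  | k, tvar m => if m = k then S else tvar m
  | k, mu T => mu (subst S (k + 1) T)
  | k, choice a T => choice a (fun i => subst S k (T i))

/-- The variable `k` does not occur unguarded. -/
def Guards : ℕ → LType → Prop
  | _, fin => True
  | k, tvar m => m ≠ k
  | k, mu T => Guards (k + 1) T
  | _, choice _ _ => True

/-- Well-formed types whose free variables are below `k`: recursion is guarded and the triples of
partner, polarity and label of a choice are pairwise distinct. -/
def WFAt : ℕ → LType → Prop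
  | _, fin => True
  | k, tvar m => m < k
  | k, mu T => Guards 0 T ∧ WFAt (k + 1) T
  | k, choice a T =>
      Function.Injective (fun i => ((a i).partner, (a i).pol, (a i).label)) ∧ ∀ i, WFAt k (T i)

/-- Closed well-formed types. -/
def WF (T : LType) : Prop := T.WFAt 0

/-- `T.Act a T'`: after unfolding recursion at the top, `T` is a choice with a summand `a.T'`. -/
inductive Act : LType → LAct → LType → Prop
  | choice {n : ℕ} (a : Fin (n + 1) → LAct) (T : Fin (n + 1) → LType) (i) :
      Act (choice a T) (a i) (T i)
  | mu {T a T'} : Act (subst (mu T) 0 T) a T' → Act (mu T) a T'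

/-- One unfolding of the coinductive rules of subtyping, stated on the summands that the two types
have after unfolding (a closed well-formed type without summands is `end` up to unfolding).
The choices are compared separately for each partner and polarity: both have outputs to
(inputs from) the same partners; the subtype has at most the outputs and at least the inputs of
the supertype. -/
def SubStep (R : LType → LType → Prop) (T T' : LType) : Prop :=
  (∀ d p, (∃ l U S, T.Act ⟨d, p, l, U⟩ S) ↔ (∃ l U S, T'.Act ⟨d, p, l, U⟩ S)) ∧
  (∀ p l U S, T.Act ⟨.snd, p, l, U⟩ S → ∃ S', T'.Act ⟨.snd, p, l, U⟩ S' ∧ R S S') ∧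
  (∀ p l U S', T'.Act ⟨.rcv, p, l, U⟩ S' → ∃ S, T.Act ⟨.rcv, p, l, U⟩ S ∧ R S S')

/-- Subtyping: the largest relation that is closed backwards under the rules. -/
def Subtype (T T' : LType) : Prop :=
  ∃ R : LType → LType → Prop, R T T' ∧ ∀ S S', R S S' → SubStep R S S'

end LType

/-- Local contexts; participants outside the domain have type `end`. -/
abbrev LCtx := Part → LType

/-- Reduction of local contexts: `p` sends to `q`. -/
inductive LStep : LCtx → LCtx → Prop
  | comm (D : LCtx) (p q l U T T') : p ≠ q → (D p).Act ⟨.snd, q, l, U⟩ T →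
      (D q).Act ⟨.rcv, p, l, U⟩ T' →
      LStep D (Function.update (Function.update D p T) q T')

/-- Safety: whenever `p` may send to `q` while `q` may receive from `p`, every message that `p`
may send is expected by `q`; and this is preserved by reduction. -/
def Safe (D : LCtx) : Prop :=
  ∀ E, Relation.ReflTransGen LStep D E →
    ∀ p q l l' U U' T T', p ≠ q → (E p).Act ⟨.snd, q, l, U⟩ T → (E q).Act ⟨.rcv, p, l', U'⟩ T' →
      ∃ T'', (E q).Act ⟨.rcv, p, l, U⟩ T''

/-- Typing of values. -/
inductive VTyped (G : Name → Option Pay) : Val → Pay → Prop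
  | var {x U} : G x = some U → VTyped G (.var x) U
  | num (n) : VTyped G (.const (.num n)) .nat
  | bool (b) : VTyped G (.const (.bool b)) .bool

/-- Typing of processes.  In the rule for choice, the summands with a common prefix are typed by a
common summand of the type. -/
inductive PTyped : (Name → Option Pay) → (Name → Option LType) → Proc0 → LType → Prop
  | nil (G E) : PTyped G E .nil .fin
  | tick (G E) : PTyped G E .tick .fin
  | pvar {G E X T} : E X = some T → PTyped G E (.pvar X) T
  | mu {G E X P T} : T.WF → PTyped G (Function.update E X (some T)) P T →
      PTyped G E (.mu X P) T
  | cond {G E v P Q T} : VTyped G v .bool → PTyped G E P T → PTyped G E Q T →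
      PTyped G E (.cond v P Q) T
  | choice {G E} {n m : ℕ} (pre : Fin (n + 1) → Prefix) (P : Fin (n + 1) → Proc0)
      (a : Fin (m + 1) → LAct) (T : Fin (m + 1) → LType) (f : Fin (n + 1) → Fin (m + 1)) :
      (LType.choice a T).WF → Function.Surjective f →
      (∀ i, (pre i).partner = (a (f i)).partner ∧ (pre i).pol = (a (f i)).pol ∧
        (pre i).label = (a (f i)).label) →
      (∀ i p l v, pre i = .out p l v → VTyped G v (a (f i)).pay) →
      (∀ i p l v, pre i = .out p l v → PTyped G E (P i) (T (f i))) →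
      (∀ i p l x, pre i = .inp p l x →
        PTyped (Function.update G x (some (a (f i)).pay)) E (P i) (T (f i))) →
      PTyped G E (.choice pre P) (.choice a T)
  | sub {G E P T T'} : PTyped G E P T → T'.WF → T.Subtype T' → PTyped G E P T'

/-- A session is typed if its (closed) processes are typed by a safe local context. -/
def STyped (M : Sess0) : Prop :=
  ∃ D : LCtx, Safe D ∧ (∀ p, (D p).WF) ∧
    (∀ l ∈ M.locs, PTyped (fun _ => none) (fun _ => none) l.2 (D l.1)) ∧
    ∀ p, p ∉ M.locs.map Prod.fst → D p = .fin

/-- All participants have terminated (the constant for success counts as terminated). -/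
def AllDone (M : Sess0) : Prop := ∀ l ∈ M.locs, l.2 = .nil ∨ l.2 = .tick

def DeadlockFree (M : Sess0) : Prop :=
  ∀ N, Relation.ReflTransGen SStep M N →
    (∃ N', SCong true N N' ∧ AllDone N') ∨ ∃ N', SStep N N'

/-! ## The family of MCMP -/

inductive Family where
  | MCMP
  | MSMP
  | SCMP
  | DMP
  | SMP
  | MP
  | MCBS
  | SCBS
  | BS

namespace Family

/-- The choices that are allowed by the syntax. -/
def Choice (F : Family) (n : ℕ) (pre : Fin (n + 1) → Prefix) : Prop :=
  match F with
  | MCMP | MCBS => True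
  | MSMP => ∀ i j, (pre i).partner = (pre j).partner → (pre i).pol = (pre j).pol
  | SCMP | SCBS => ∀ i j, (pre i).pol = (pre j).pol
  | DMP => ∀ i j, (pre i).partner = (pre j).partner
  | SMP => ∀ i j, (pre i).partner = (pre j).partner ∧ (pre i).pol = (pre j).pol
  | MP | BS =>
      (∀ i j, (pre i).pol = .rcv ∧ (pre i).partner = (pre j).partner) ∨
        (n = 0 ∧ ∀ i, (pre i).pol = .snd)

/-- The binary calculi are limited to two parties. -/
def Parties (F : Family) (s : Finset Part) : Prop :=
  match F with
  | MCBS | SCBS | BS => s.card ≤ 2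
  | _ => True

/-- The terms of a calculus of the family: the typed and deadlock-free sessions with pairwise
different participants, guarded recursion, and the respective restriction of the syntax. -/
structure IsTerm (F : Family) (M : Sess0) : Prop where
  distinct : (M.locs.map Prod.fst).Nodup
  guarded : ∀ l ∈ M.locs, l.2.Guarded
  choices : ∀ l ∈ M.locs, l.2.AllChoices F.Choice
  parties : F.Parties M.parts
  typed : STyped M
  deadlockFree : DeadlockFree M

/-- Processes that occur in a term of the calculus. -/
def OccursP (F : Family) (P : Proc0) : Prop :=
  ∃ M, F.IsTerm M ∧ ∃ l ∈ M.locs, P.Sub l.2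

/-- Sessions that occur in a term of the calculus. -/
def OccursS (F : Family) (N : Sess0) : Prop := ∃ M, F.IsTerm M ∧ N.Sub M

end Family

/-! ## Mixed sessions: syntax

One syntax with the constructs of CMV⁺ and of CMV; the two calculi are the fragments
`InCMVplus` and `InCMV` below. -/

inductive Qual where
  | lin
  | un

/-- Branch prefixes `ℓ!v` and `ℓ?x`. -/
inductive BPre where
  | out (l : Label) (v : Val)
  | inp (l : Label) (x : Name)

namespace BPre

def pol : BPre → Pol
  | out _ _ => .snd
  | inp _ _ => .rcv

def label : BPre → Label
  | out l _ => l
  | inp l _ => l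

end BPre

/-- Processes with holes labelled by `H`:
`choice q y pre P` is the CMV⁺ choice on the endpoint `y`;
`out y v P`, `inp q y x P`, `sel y l P` and `bran y l P` are output, input, selection and
branching of CMV. -/
inductive Mix (H : Type) : Type where
  | hole (h : H)
  | nil
  | tick
  | par (P Q : Mix H)
  | res (y z : Name) (P : Mix H)
  | cond (v : Val) (P Q : Mix H)
  | choice (q : Qual) (y : Name) {n : ℕ} (pre : Fin (n + 1) → BPre) (P : Fin (n + 1) → Mix H)
  | out (y : Name) (v : Val) (P : Mix H)
  | inp (q : Qual) (y x : Name) (P : Mix H)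
  | sel (y : Name) (l : Label) (P : Mix H)
  | bran (y : Name) {n : ℕ} (l : Fin (n + 1) → Label) (P : Fin (n + 1) → Mix H)

abbrev Mix0 := Mix Empty

namespace Val

def fv : Val → Set Name
  | var x => {x}
  | const _ => ∅

def map (f : Name → Name) : Val → Val
  | var x => var (f x)
  | const c => const c

def subst (x : Name) (v : Val) : Val → Val
  | var y => if y = x then v else var y
  | const c => const c

/-- The channel endpoint `y` after the substitution of `v` for `x`. -/
def substChan (x : Name) (v : Val) (y : Name) : Name :=
  match v with
  | var w => if y = x then w else y
  | const _ => y

end Val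

namespace BPre

def fv : BPre → Set Name
  | out _ v => v.fv
  | inp _ _ => ∅

def bv : BPre → Set Name
  | out _ _ => ∅
  | inp _ x => {x}

def map (f : Name → Name) : BPre → BPre
  | out l v => out l (v.map f)
  | inp l x => inp l (f x)

/-- Rename the free occurrences only. -/
def mapFree (f : Name → Name) : BPre → BPre
  | out l v => out l (v.map f)
  | inp l x => inp l x

def subst (x : Name) (v : Val) : BPre → BPre
  | out l w => out l (Val.subst x v w)
  | inp l y => inp l y

/-- The renaming that applies in the continuation, where the bound variable is kept. -/
def under (f : Name → Name) : BPre → Name → Name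
  | out _ _ => f
  | inp _ x => Function.update f x x

end BPre

namespace Mix

def fill {H K : Type} (s : H → Mix K) : Mix H → Mix K
  | hole h => s h
  | nil => nil
  | tick => tick
  | par P Q => par (P.fill s) (Q.fill s)
  | res y z P => res y z (P.fill s)
  | cond v P Q => cond v (P.fill s) (Q.fill s)
  | choice q y pre P => choice q y pre (fun i => (P i).fill s)
  | out y v P => out y v (P.fill s)
  | inp q y x P => inp q y x (P.fill s)
  | sel y l P => sel y l (P.fill s)
  | bran y l P => bran y l (fun i => (P i).fill s)

/-- Rename all names, free and bound. -/
def map {H : Type} (f : Name → Name) : Mix H → Mix H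
  | hole h => hole h
  | nil => nil
  | tick => tick
  | par P Q => par (P.map f) (Q.map f)
  | res y z P => res (f y) (f z) (P.map f)
  | cond v P Q => cond (v.map f) (P.map f) (Q.map f)
  | choice q y pre P => choice q (f y) (fun i => (pre i).map f) (fun i => (P i).map f)
  | out y v P => out (f y) (v.map f) (P.map f)
  | inp q y x P => inp q (f y) (f x) (P.map f)
  | sel y l P => sel (f y) l (P.map f)
  | bran y l P => bran (f y) l (fun i => (P i).map f)

/-- Rename the free names (used only where no renamed name is captured). -/
def mapFree {H : Type} (f : Name → Name) : Mix H → Mix H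
  | hole h => hole h
  | nil => nil
  | tick => tick
  | par P Q => par (P.mapFree f) (Q.mapFree f)
  | res y z P => res y z (P.mapFree (Function.update (Function.update f y y) z z))
  | cond v P Q => cond (v.map f) (P.mapFree f) (Q.mapFree f)
  | choice q y pre P =>
      choice q (f y) (fun i => (pre i).mapFree f) (fun i => (P i).mapFree ((pre i).under f))
  | out y v P => out (f y) (v.map f) (P.mapFree f)
  | inp q y x P => inp q (f y) x (P.mapFree (Function.update f x x))
  | sel y l P => sel (f y) l (P.mapFree f)
  | bran y l P => bran (f y) l (fun i => (P i).mapFree f)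

/-- Free names. -/
def fv {H : Type} : Mix H → Set Name
  | hole _ => ∅
  | nil => ∅
  | tick => ∅
  | par P Q => P.fv ∪ Q.fv
  | res y z P => P.fv \ {y, z}
  | cond v P Q => v.fv ∪ P.fv ∪ Q.fv
  | choice _ y pre P => {y} ∪ ⋃ i, ((pre i).fv ∪ ((P i).fv \ (pre i).bv))
  | out y v P => {y} ∪ v.fv ∪ P.fv
  | inp _ y x P => {y} ∪ (P.fv \ {x})
  | sel y _ P => {y} ∪ P.fv
  | bran y _ P => {y} ∪ ⋃ i, (P i).fv

/-- Bound names. -/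
def bv {H : Type} : Mix H → Set Name
  | hole _ => ∅
  | nil => ∅
  | tick => ∅
  | par P Q => P.bv ∪ Q.bv
  | res y z P => {y, z} ∪ P.bv
  | cond _ P Q => P.bv ∪ Q.bv
  | choice _ _ pre P => ⋃ i, ((pre i).bv ∪ (P i).bv)
  | out _ _ P => P.bv
  | inp _ _ x P => {x} ∪ P.bv
  | sel _ _ P => P.bv
  | bran _ _ P => ⋃ i, (P i).bv

open Classical in
/-- Substitution of the value `v` for `x` (used only where `v` is not captured). -/
noncomputable def subst {H : Type} (x : Name) (v : Val) : Mix H → Mix H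
  | hole h => hole h
  | nil => nil
  | tick => tick
  | par P Q => par (P.subst x v) (Q.subst x v)
  | res y z P => if x = y ∨ x = z then res y z P else res y z (P.subst x v)
  | cond w P Q => cond (Val.subst x v w) (P.subst x v) (Q.subst x v)
  | choice q y pre P =>
      choice q (Val.substChan x v y) (fun i => (pre i).subst x v)
        (fun i => if x ∈ (pre i).bv then P i else (P i).subst x v)
  | out y w P => out (Val.substChan x v y) (Val.subst x v w) (P.subst x v)
  | inp q y w P => inp q (Val.substChan x v y) w (if x = w then P else P.subst x v)
  | sel y l P => sel (Val.substChan x v y) l (P.subst x v)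
  | bran y l P => bran (Val.substChan x v y) l (fun i => (P i).subst x v)

/-- A top-level unguarded occurrence of success. -/
def Success {H : Type} : Mix H → Prop
  | tick => True
  | par P Q => P.Success ∨ Q.Success
  | res _ _ P => P.Success
  | _ => False

/-- The number of restrictions in a process. -/
def numRes {H : Type} : Mix H → ℕ
  | hole _ => 0
  | nil => 0
  | tick => 0
  | par P Q => P.numRes + Q.numRes
  | res _ _ P => P.numRes + 1
  | cond _ P Q => P.numRes + Q.numRes
  | choice _ _ _ P => ∑ i, (P i).numRes
  | out _ _ P => P.numRes
  | inp _ _ _ P => P.numRes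
  | sel _ _ P => P.numRes
  | bran _ _ P => ∑ i, (P i).numRes

/-- Processes of CMV⁺: no output, input, selection and branching of CMV. -/
def InCMVplus {H : Type} : Mix H → Prop
  | hole _ => True
  | nil => True
  | tick => True
  | par P Q => P.InCMVplus ∧ Q.InCMVplus
  | res _ _ P => P.InCMVplus
  | cond _ P Q => P.InCMVplus ∧ Q.InCMVplus
  | choice _ _ _ P => ∀ i, (P i).InCMVplus
  | _ => False

/-- Processes of CMV: no mixed choice. -/
def InCMV {H : Type} : Mix H → Prop
  | hole _ => True
  | nil => True
  | tick => True
  | par P Q => P.InCMV ∧ Q.InCMV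
  | res _ _ P => P.InCMV
  | cond _ P Q => P.InCMV ∧ Q.InCMV
  | choice _ _ _ _ => False
  | out _ _ P => P.InCMV
  | inp _ _ _ P => P.InCMV
  | sel _ _ P => P.InCMV
  | bran _ _ P => ∀ i, (P i).InCMV

end Mix

/-! ## Mixed sessions: structural congruence and reduction -/

/-- Identification up to renaming of bound names and reordering of branches. -/
inductive MIdent : Mix0 → Mix0 → Prop
  | refl (P) : MIdent P P
  | symm {P Q} : MIdent P Q → MIdent Q P
  | trans {P Q R} : MIdent P Q → MIdent Q R → MIdent P R
  | ctx {P Q} (C : Mix (Fin 1)) :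
      MIdent P Q → MIdent (C.fill (fun _ => P)) (C.fill (fun _ => Q))
  | alphaResL (y z w : Name) (P : Mix0) : y ≠ z → w ≠ z → w ∉ P.fv →
      MIdent (.res y z P) (.res w z (P.map (Equiv.swap y w)))
  | alphaResR (y z w : Name) (P : Mix0) : y ≠ z → w ≠ y → w ∉ P.fv →
      MIdent (.res y z P) (.res y w (P.map (Equiv.swap z w)))
  | alphaBranch (q y) {n : ℕ} (pre : Fin (n + 1) → BPre) (P : Fin (n + 1) → Mix0)
      (i : Fin (n + 1)) (l x w) : pre i = .inp l x → w ∉ (P i).fv →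
      MIdent (.choice q y pre P)
        (.choice q y (Function.update pre i (.inp l w))
          (Function.update P i ((P i).map (Equiv.swap x w))))
  | alphaInp (q y x w) (P : Mix0) : w ∉ P.fv →
      MIdent (.inp q y x P) (.inp q y w (P.map (Equiv.swap x w)))
  | permChoice (q y) {n : ℕ} (pre : Fin (n + 1) → BPre) (P : Fin (n + 1) → Mix0)
      (e : Equiv.Perm (Fin (n + 1))) :
      MIdent (.choice q y pre P) (.choice q y (pre ∘ e) (P ∘ e))
  | permBran (y) {n : ℕ} (l : Fin (n + 1) → Label) (P : Fin (n + 1) → Mix0)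
      (e : Equiv.Perm (Fin (n + 1))) :
      MIdent (.bran y l P) (.bran y (l ∘ e) (P ∘ e))

/-- Structural congruence. -/
inductive MCong : Mix0 → Mix0 → Prop
  | ident {P Q} : MIdent P Q → MCong P Q
  | symm {P Q} : MCong P Q → MCong Q P
  | trans {P Q R} : MCong P Q → MCong Q R → MCong P R
  | ctx {P Q} (C : Mix (Fin 1)) :
      MCong P Q → MCong (C.fill (fun _ => P)) (C.fill (fun _ => Q))
  | comm (P Q) : MCong (.par P Q) (.par Q P)
  | assoc (P Q R) : MCong (.par (.par P Q) R) (.par P (.par Q R))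
  | nil (P) : MCong (.par P .nil) P
  | resNil (y z) : MCong (.res y z .nil) .nil
  | resSwap (y z P) : MCong (.res y z P) (.res z y P)
  | extrude (y z P Q) : y ∉ P.fv → z ∉ P.fv →
      MCong (.par P (.res y z Q)) (.res y z (.par P Q))
  | resRes (w x y z P) : [w, x, y, z].Nodup →
      MCong (.res w x (.res y z P)) (.res y z (.res w x P))

/-- The choice after a step: an unrestricted choice persists, a linear one is consumed. -/
def keep (q : Qual) (C P : Mix0) : Mix0 :=
  match q with
  | .lin => P
  | .un => .par P C

/-- Reduction.  The four rules of CMV⁺ for linear and unrestricted choices are instances of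
`choice`, the two communication rules of CMV are instances of `com`. -/
inductive MStep : Mix0 → Mix0 → Prop
  | ifTrue (P Q) : MStep (.cond (.const (.bool true)) P Q) P
  | ifFalse (P Q) : MStep (.cond (.const (.bool false)) P Q) Q
  | choice (y z q q' l v x R) {n m : ℕ} (pre : Fin (n + 1) → BPre) (P : Fin (n + 1) → Mix0)
      (pre' : Fin (m + 1) → BPre) (Q : Fin (m + 1) → Mix0) (i : Fin (n + 1))
      (j : Fin (m + 1)) :
      y ≠ z → pre i = .out l v → pre' j = .inp l x → Disjoint v.fv (Q j).bv →
      MStep (.res y z (.par (.par (.choice q y pre P) (.choice q' z pre' Q)) R))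
        (.res y z (.par (.par (keep q (.choice q y pre P) (P i))
          (keep q' (.choice q' z pre' Q) ((Q j).subst x v))) R))
  | com (y z q v x P Q R) : y ≠ z → Disjoint v.fv Q.bv →
      MStep (.res y z (.par (.par (.out y v P) (.inp q z x Q)) R))
        (.res y z (.par (.par P (keep q (.inp q z x Q) (Q.subst x v))) R))
  | case (y z P R) {n : ℕ} (l : Fin (n + 1) → Label) (Q : Fin (n + 1) → Mix0)
      (j : Fin (n + 1)) : y ≠ z →
      MStep (.res y z (.par (.par (.sel y (l j) P) (.bran z l Q)) R))
        (.res y z (.par (.par P (Q j)) R))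
  | par {P P'} (Q) : MStep P P' → MStep (.par P Q) (.par P' Q)
  | res {P P'} (y z) : MStep P P' → MStep (.res y z P) (.res y z P')
  | struct {P P' Q Q'} : MCong P Q → MStep Q Q' → MCong Q' P' → MStep P P'

/-! ## Mixed sessions: types -/

/-- `int` is the view `⊕`, `ext` the view `&`. -/
inductive View where
  | int
  | ext

/-- Types of CMV⁺ (`choice`) and of CMV (`com`, `lab`); recursion variables are de Bruijn
indices. -/
inductive Ty : Type where
  | fin
  | nat
  | bool
  | tvar (k : ℕ)
  | mu (T : Ty)
  | choice (q : Qual) (w : View) {n : ℕ} (l : Fin (n + 1) → Label) (d : Fin (n + 1) → Pol)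
      (T U : Fin (n + 1) → Ty)
  | com (q : Qual) (d : Pol) (T U : Ty)
  | lab (q : Qual) (w : View) {n : ℕ} (l : Fin (n + 1) → Label) (T : Fin (n + 1) → Ty)

def Pol.dual : Pol → Pol
  | .snd => .rcv
  | .rcv => .snd

def View.dual : View → View
  | .int => .ext
  | .ext => .int

namespace Ty

/-- Replace the variable `k` by the closed type `S`. -/
def subst (S : Ty) : ℕ → Ty → Ty
  | _, fin => fin
  | _, nat => nat
  | _, bool => bool
  | k, tvar m => if m = k then S else tvar m
  | k, mu T => mu (subst S (k + 1) T)
  | k, choice q w l d T U =>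
      choice q w l d (fun i => subst S k (T i)) (fun i => subst S k (U i))
  | k, com q d T U => com q d (subst S k T) (subst S k U)
  | k, lab q w l T => lab q w l (fun i => subst S k (T i))

/-- The variable `k` does not occur directly below recursions only. -/
def Guards : ℕ → Ty → Prop
  | k, tvar m => m ≠ k
  | k, mu T => Guards (k + 1) T
  | _, _ => True

/-- Contractive types with free variables below `k` and pairwise distinct branches. -/
def WFAt : ℕ → Ty → Prop
  | _, fin => True
  | _, nat => True
  | _, bool => True
  | k, tvar m => m < k
  | k, mu T => Guards 0 T ∧ WFAt (k + 1) T
  | k, choice _ _ l d T U =>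
      Function.Injective (fun i => (l i, d i)) ∧ ∀ i, WFAt k (T i) ∧ WFAt k (U i)
  | k, com _ _ T U => WFAt k T ∧ WFAt k U
  | k, lab _ _ l T => Function.Injective l ∧ ∀ i, WFAt k (T i)

def WF (T : Ty) : Prop := T.WFAt 0

/-- One unfolding of the coinductive rules of type equivalence. -/
inductive EqvStep (R : Ty → Ty → Prop) : Ty → Ty → Prop
  | fin : EqvStep R fin fin
  | nat : EqvStep R nat nat
  | bool : EqvStep R bool bool
  | choice (q w) {n : ℕ} (l d) (T U : Fin (n + 1) → Ty) (l' d') (T' U' : Fin (n + 1) → Ty)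
      (e : Equiv.Perm (Fin (n + 1))) :
      (∀ i, l i = l' (e i) ∧ d i = d' (e i)) → (∀ i, R (T i) (T' (e i))) →
      (∀ i, R (U i) (U' (e i))) → EqvStep R (choice q w l d T U) (choice q w l' d' T' U')
  | com (q d) {T U T' U'} : R T T' → R U U' → EqvStep R (com q d T U) (com q d T' U')
  | lab (q w) {n : ℕ} (l) (T : Fin (n + 1) → Ty) (l') (T' : Fin (n + 1) → Ty)
      (e : Equiv.Perm (Fin (n + 1))) :
      (∀ i, l i = l' (e i)) → (∀ i, R (T i) (T' (e i))) →
      EqvStep R (lab q w l T) (lab q w l' T')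
  | muL {T U} : R (subst (mu T) 0 T) U → EqvStep R (mu T) U
  | muR {T U} : R T (subst (mu U) 0 U) → EqvStep R T (mu U)

def Eqv (T U : Ty) : Prop :=
  ∃ R : Ty → Ty → Prop, R T U ∧ ∀ S S', R S S' → EqvStep R S S'

/-- One unfolding of the coinductive rules of duality. -/
inductive DualStep (R : Ty → Ty → Prop) : Ty → Ty → Prop
  | fin : DualStep R fin fin
  | choice (q w) {n : ℕ} (l d) (T U : Fin (n + 1) → Ty) (l' d') (T' U' : Fin (n + 1) → Ty)
      (e : Equiv.Perm (Fin (n + 1))) :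
      (∀ i, l i = l' (e i) ∧ d' (e i) = (d i).dual) → (∀ i, Eqv (T i) (T' (e i))) →
      (∀ i, R (U i) (U' (e i))) → DualStep R (choice q w l d T U) (choice q w.dual l' d' T' U')
  | com (q d) {T U T' U'} : Eqv T T' → R U U' → DualStep R (com q d T U) (com q d.dual T' U')
  | lab (q w) {n : ℕ} (l) (T : Fin (n + 1) → Ty) (l') (T' : Fin (n + 1) → Ty)
      (e : Equiv.Perm (Fin (n + 1))) :
      (∀ i, l i = l' (e i)) → (∀ i, R (T i) (T' (e i))) →
      DualStep R (lab q w l T) (lab q w.dual l' T')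
  | muL {T U} : R (subst (mu T) 0 T) U → DualStep R (mu T) U
  | muR {T U} : R T (subst (mu U) 0 U) → DualStep R T (mu U)

def Dual (T U : Ty) : Prop :=
  ∃ R : Ty → Ty → Prop, R T U ∧ ∀ S S', R S S' → DualStep R S S'

/-- Comparison of payloads: contravariant for sending, covariant for receiving. -/
def PaySub (R : Ty → Ty → Prop) (d : Pol) (T T' : Ty) : Prop :=
  match d with
  | .snd => R T' T
  | .rcv => R T T'

/-- One unfolding of the coinductive rules of subtyping.  In `int` (`ext`) the map `f` matches the
branches of the supertype (subtype) with branches of the other type. -/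
inductive SubStep (R : Ty → Ty → Prop) : Ty → Ty → Prop
  | fin : SubStep R fin fin
  | nat : SubStep R nat nat
  | bool : SubStep R bool bool
  | int (q) {n m : ℕ} (l d) (T U : Fin (n + 1) → Ty) (l' d') (T' U' : Fin (m + 1) → Ty)
      (f : Fin (m + 1) → Fin (n + 1)) :
      (∀ j, l (f j) = l' j ∧ d (f j) = d' j) → (∀ j, PaySub R (d' j) (T (f j)) (T' j)) →
      (∀ j, R (U (f j)) (U' j)) → SubStep R (choice q .int l d T U) (choice q .int l' d' T' U')
  | ext (q) {n m : ℕ} (l d) (T U : Fin (n + 1) → Ty) (l' d') (T' U' : Fin (m + 1) → Ty)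
      (f : Fin (n + 1) → Fin (m + 1)) :
      (∀ i, l' (f i) = l i ∧ d' (f i) = d i) → (∀ i, PaySub R (d i) (T i) (T' (f i))) →
      (∀ i, R (U i) (U' (f i))) → SubStep R (choice q .ext l d T U) (choice q .ext l' d' T' U')
  | com (q d) {T U T' U'} : PaySub R d T T' → R U U' → SubStep R (com q d T U) (com q d T' U')
  | labInt (q) {n m : ℕ} (l) (T : Fin (n + 1) → Ty) (l') (T' : Fin (m + 1) → Ty)
      (f : Fin (m + 1) → Fin (n + 1)) :
      (∀ j, l (f j) = l' j) → (∀ j, R (T (f j)) (T' j)) →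
      SubStep R (lab q .int l T) (lab q .int l' T')
  | labExt (q) {n m : ℕ} (l) (T : Fin (n + 1) → Ty) (l') (T' : Fin (m + 1) → Ty)
      (f : Fin (n + 1) → Fin (m + 1)) :
      (∀ i, l' (f i) = l i) → (∀ i, R (T i) (T' (f i))) →
      SubStep R (lab q .ext l T) (lab q .ext l' T')
  | muL {T U} : R (subst (mu T) 0 T) U → SubStep R (mu T) U
  | muR {T U} : R T (subst (mu U) 0 U) → SubStep R T (mu U)

def Subtype (T U : Ty) : Prop :=
  ∃ R : Ty → Ty → Prop, R T U ∧ ∀ S S', R S S' → SubStep R S S'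

/-- Unrestricted types. -/
def Un : Ty → Prop
  | fin => True
  | nat => True
  | bool => True
  | tvar _ => False
  | mu T => T.Un
  | choice q _ _ _ _ _ => q = .un
  | com q _ _ _ => q = .un
  | lab q _ _ _ => q = .un

/-- Types of CMV⁺. -/
def InCMVplus : Ty → Prop
  | mu T => T.InCMVplus
  | choice _ _ _ _ T U => ∀ i, (T i).InCMVplus ∧ (U i).InCMVplus
  | com _ _ _ _ => False
  | lab _ _ _ _ => False
  | _ => True

/-- Types of CMV. -/
def InCMV : Ty → Prop
  | mu T => T.InCMV
  | choice _ _ _ _ _ _ => False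
  | com _ _ T U => T.InCMV ∧ U.InCMV
  | lab _ _ _ T => ∀ i, (T i).InCMV
  | _ => True

/-- Linear types without delegation: no `un`, and only values of base type are communicated. -/
def Linear : Ty → Prop
  | mu T => T.Linear
  | choice q _ _ _ T U => q = .lin ∧ ∀ i, (T i = nat ∨ T i = bool) ∧ (U i).Linear
  | com q _ T U => q = .lin ∧ (T = nat ∨ T = bool) ∧ U.Linear
  | lab q _ _ T => q = .lin ∧ ∀ i, (T i).Linear
  | _ => True

end Ty

/-- Typing contexts. -/
abbrev Env := Name → Option Ty

namespace Env

def Un (G : Env) : Prop := ∀ x T, G x = some T → T.Un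

/-- `G₁ ∘ G₂ = G`. -/
def Split (G G₁ G₂ : Env) : Prop :=
  ∀ x, (G x = none ∧ G₁ x = none ∧ G₂ x = none) ∨
    ∃ T, G x = some T ∧
      ((T.Un ∧ G₁ x = some T ∧ G₂ x = some T) ∨
        (¬ T.Un ∧ G₁ x = some T ∧ G₂ x = none) ∨
        (¬ T.Un ∧ G₁ x = none ∧ G₂ x = some T))

/-- `G + x:T` is defined. -/
def CanAdd (G : Env) (x : Name) (T : Ty) : Prop := G x = none ∨ (T.Un ∧ G x = some T)

/-- The extension `G, x:T` with a bound name `x`; since bound names may be renamed, an unrestricted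
assignment to the same name may be hidden. -/
def CanBind (G : Env) (x : Name) : Prop := ∀ T, G x = some T → T.Un

def ext (G : Env) (x : Name) (T : Ty) : Env := Function.update G x (some T)

end Env

/-- Typing of values, where only types satisfying `ok` are available. -/
inductive MVTyped (ok : Ty → Prop) : Env → Val → Ty → Prop
  | num {G : Env} (n) : G.Un → MVTyped ok G (.const (.num n)) .nat
  | bool {G : Env} (b) : G.Un → MVTyped ok G (.const (.bool b)) .bool
  | var {G : Env} {x T} : G x = some T → (∀ y S, y ≠ x → G y = some S → S.Un) →
      MVTyped ok G (.var x) T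
  | sub {G : Env} {v T U} : MVTyped ok G v T → U.WF → ok U → T.Subtype U → MVTyped ok G v U

/-- Typing of processes, where only types satisfying `ok` are available. -/
inductive MTyped (ok : Ty → Prop) : Env → Mix0 → Prop
  | nil {G : Env} : G.Un → MTyped ok G .nil
  | tick {G : Env} : G.Un → MTyped ok G .tick
  | par {G G₁ G₂ : Env} {P Q} : G.Split G₁ G₂ → MTyped ok G₁ P → MTyped ok G₂ Q →
      MTyped ok G (.par P Q)
  | cond {G G₁ G₂ : Env} {v P Q} : G.Split G₁ G₂ → MVTyped ok G₁ v .bool → MTyped ok G₂ P →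
      MTyped ok G₂ Q → MTyped ok G (.cond v P Q)
  | res {G : Env} {y z P} (T U : Ty) : T.WF → U.WF → ok T → ok U → T.Dual U → y ≠ z →
      G.CanBind y → G.CanBind z → MTyped ok ((G.ext y T).ext z U) P → MTyped ok G (.res y z P)
  | choice {G G₁ G₂ : Env} {q y} {n m : ℕ} (pre : Fin (n + 1) → BPre) (P : Fin (n + 1) → Mix0)
      (q' w l d) (T U : Fin (m + 1) → Ty) (f : Fin (n + 1) → Fin (m + 1))
      (A B : Fin (n + 1) → Env) :
      G.Split G₁ G₂ → (q = .un → G.Un) → MVTyped ok G₁ (.var y) (.choice q' w l d T U) →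
      Function.Surjective f → (∀ j, (pre j).label = l (f j) ∧ (pre j).pol = d (f j)) →
      (∀ j, G₂.CanAdd y (U (f j))) →
      (∀ j l v, pre j = .out l v → (G₂.ext y (U (f j))).Split (A j) (B j)) →
      (∀ j l v, pre j = .out l v → MVTyped ok (A j) v (T (f j))) →
      (∀ j l v, pre j = .out l v → MTyped ok (B j) (P j)) →
      (∀ j l x, pre j = .inp l x → (G₂.ext y (U (f j))).CanBind x) →
      (∀ j l x, pre j = .inp l x → MTyped ok ((G₂.ext y (U (f j))).ext x (T (f j))) (P j)) →
      MTyped ok G (.choice q y pre P)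
  | out {G G₁ G₂ G₃ G₄ : Env} {y v P} (q T U) : G.Split G₁ G₂ →
      MVTyped ok G₁ (.var y) (.com q .snd T U) → G₂.CanAdd y U →
      (G₂.ext y U).Split G₃ G₄ → MVTyped ok G₃ v T → MTyped ok G₄ P →
      MTyped ok G (.out y v P)
  | inp {G G₁ G₂ : Env} {q y x P} (q' T U) : G.Split G₁ G₂ → (q = .un → G.Un) →
      MVTyped ok G₁ (.var y) (.com q' .rcv T U) → G₂.CanAdd y U → (G₂.ext y U).CanBind x →
      MTyped ok ((G₂.ext y U).ext x T) P → MTyped ok G (.inp q y x P)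
  | bran {G G₁ G₂ : Env} {y} {n : ℕ} (l : Fin (n + 1) → Label) (P : Fin (n + 1) → Mix0) (q)
      (l' : Fin (n + 1) → Label) (T : Fin (n + 1) → Ty) (e : Equiv.Perm (Fin (n + 1))) :
      G.Split G₁ G₂ → MVTyped ok G₁ (.var y) (.lab q .ext l' T) → (∀ i, l i = l' (e i)) →
      (∀ i, G₂.CanAdd y (T (e i))) → (∀ i, MTyped ok (G₂.ext y (T (e i))) (P i)) →
      MTyped ok G (.bran y l P)
  | sel {G G₁ G₂ : Env} {y l P} (q) (T : Ty) : G.Split G₁ G₂ →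
      MVTyped ok G₁ (.var y) (.lab (n := 0) q .int (fun _ => l) (fun _ => T)) →
      G₂.CanAdd y T → MTyped ok (G₂.ext y T) P → MTyped ok G (.sel y l P)

/-- A process is typed if it is typed in some typing context. -/
def MixTyped (ok : Ty → Prop) (P : Mix0) : Prop :=
  ∃ G : Env, (∀ x T, G x = some T → T.WF ∧ ok T) ∧ MTyped ok G P

/-- Capture-avoiding renaming of the free names by `f`, up to renaming of bound names. -/
def MRenames (f : Name → Name) (P P' : Mix0) : Prop :=
  ∃ Q, MIdent P Q ∧ (∀ b ∈ Q.bv, ∀ a ∈ Q.fv, f a ≠ b) ∧ MIdent (Q.mapFree f) P'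

/-! ## Calculi as targets of encodings -/

/-- The data of a calculus that the criteria on encodings refer to.  Contexts have process holes
and, if they build sessions, also session holes. -/
structure Calculus where
  P : Type
  S : Type
  PCtx : ℕ → Type
  SCtx : ℕ → ℕ → Type
  pfill : ∀ {n : ℕ}, PCtx n → (Fin n → P) → P
  sfill : ∀ {n m : ℕ}, SCtx n m → (Fin n → P) → (Fin m → S) → S
  /-- The terms of the calculus. -/
  IsTerm : S → Prop
  /-- Reduction. -/
  Step : S → S → Prop
  /-- Structural congruence without unfolding of recursion. -/
  Cong : S → S → Prop
  par : S → S → S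
  /-- A top-level unguarded occurrence of success. -/
  Success : S → Prop
  /-- `Renames f M N`: renaming the free names of `M` by `f` yields `N`. -/
  Renames : (ℕ → ℕ) → S → S → Prop

namespace Calculus

variable (C : Calculus)

/-- `M ⟶* N`. -/
def Steps (M N : C.S) : Prop := Relation.ReflTransGen C.Step M N

/-- `M` may reach success. -/
def MaySucceed (M : C.S) : Prop := ∃ N, C.Steps M N ∧ C.Success N

/-- `M ⟶^ω`. -/
def Diverges (M : C.S) : Prop := ∃ f : ℕ → C.S, f 0 = M ∧ ∀ i, C.Step (f i) (f (i + 1))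

/-- The parallel composition of the nonempty family `N`. -/
def parAll : {n : ℕ} → (Fin (n + 1) → C.S) → C.S
  | 0, N => N 0
  | _ + 1, N => C.par (N 0) (parAll (fun i => N i.succ))

/-- `M` is distributable into the components `N i`. -/
def Distributable (M : C.S) {n : ℕ} (N : Fin (n + 1) → C.S) : Prop := C.Cong M (C.parAll N)

/-- An equivalence that is a success respecting weak reduction bisimulation. -/
structure IsSuccessBisim (R : C.S → C.S → Prop) : Prop where
  equiv : Equivalence R
  simulates : ∀ M N M', R M N → C.Steps M M' → ∃ N', C.Steps N N' ∧ R M' N'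
  success : ∀ M N, R M N → (C.MaySucceed M ↔ C.MaySucceed N)

end Calculus

/-- The calculi of the family of MCMP. -/
def Family.calculus (F : Family) : Calculus where
  P := Proc0
  S := Sess0
  PCtx n := Proc (Fin n)
  SCtx n m := Sess (Fin n) (Fin m)
  pfill C s := C.fill s
  sfill C s t := C.fill s t
  IsTerm := F.IsTerm
  Step := SStep
  Cong := SCong false
  par := .par
  Success := Sess.Success
  Renames f M N := N = M.rename f

/-- A calculus of mixed sessions with the given terms; there is no recursion to unfold. -/
def mixCalculus (isTerm : Mix0 → Prop) : Calculus where
  P := Mix0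
  S := Mix0
  PCtx n := Mix (Fin n)
  SCtx n m := Mix (Fin n ⊕ Fin m)
  pfill C s := C.fill s
  sfill C s t := C.fill (Sum.elim s t)
  IsTerm := isTerm
  Step := MStep
  Cong := MCong
  par := .par
  Success := Mix.Success
  Renames := MRenames

def CMVplus : Calculus := mixCalculus fun P => P.InCMVplus ∧ MixTyped Ty.InCMVplus P

def CMV : Calculus := mixCalculus fun P => P.InCMV ∧ MixTyped Ty.InCMV P

/-- The linear fragment of CMV⁺: no unrestricted types, no delegation, at most one restriction. -/
def LCMVplus : Calculus := mixCalculus fun P =>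
  P.InCMVplus ∧ P.numRes ≤ 1 ∧ MixTyped (fun T => T.InCMVplus ∧ T.Linear) P

/-- The linear fragment of CMV. -/
def LCMV : Calculus := mixCalculus fun P =>
  P.InCMV ∧ P.numRes ≤ 1 ∧ MixTyped (fun T => T.InCMV ∧ T.Linear) P

/-! ## Good encodings -/

section Encodings

variable (F : Family) (C : Calculus) (encP : Proc0 → C.P) (encS : Sess0 → C.S)

/-- For every operator and every set of participants there is a context that translates the
operator, for all arguments with these participants.  (The constants, i.e. `0`, success and
recursion variables, have no arguments, so nothing is required for them.) -/
structure Compositional : Prop where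
  mu : ∀ (X : Name) (s : Finset Part), ∃ K : C.PCtx 1, ∀ P : Proc0, P.parts = s →
    F.OccursP (.mu X P) → encP (.mu X P) = C.pfill K (fun _ => encP P)
  choice : ∀ (n : ℕ) (pre : Fin (n + 1) → Prefix) (s : Finset Part), ∃ K : C.PCtx (n + 1),
    ∀ P : Fin (n + 1) → Proc0, Finset.univ.biUnion (fun i => (P i).parts) = s →
      F.OccursP (.choice pre P) → encP (.choice pre P) = C.pfill K (fun i => encP (P i))
  cond : ∀ (v : Val) (s : Finset Part), ∃ K : C.PCtx 2, ∀ P Q : Proc0,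
    P.parts ∪ Q.parts = s → F.OccursP (.cond v P Q) →
      encP (.cond v P Q) = C.pfill K ![encP P, encP Q]
  loc : ∀ (p : Part) (s : Finset Part), ∃ K : C.SCtx 1 0, ∀ P : Proc0, P.parts = s →
    F.OccursS (.loc p P) → encS (.loc p P) = C.sfill K (fun _ => encP P) Fin.elim0
  par : ∀ s : Finset Part, ∃ K : C.SCtx 0 2, ∀ M N : Sess0, M.parts ∪ N.parts = s →
    F.OccursS (.par M N) → encS (.par M N) = C.sfill K Fin.elim0 ![encS M, encS N]

/-- `f` is the renaming of target names induced by the renaming `r` of source names and the renaming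
policy `phi`: it maps `phi a` to `phi (r a)` and keeps the reserved names. -/
def Induced {k : ℕ} (phi : Part → Fin k → ℕ) (r f : ℕ → ℕ) : Prop :=
  (∀ a i, f (phi a i) = phi (r a) i) ∧ ∀ b, (∀ a i, phi a i ≠ b) → f b = b

/-- Name invariance, with a renaming policy that maps different names to disjoint vectors. -/
def NameInvariant (E : C.S → C.S → Prop) : Prop :=
  ∃ (k : ℕ) (phi : Part → Fin k → ℕ), Function.Injective (fun b : Part × Fin k => phi b.1 b.2) ∧
    ∀ (M : Sess0) (r f : ℕ → ℕ), F.IsTerm M → F.IsTerm (M.rename r) → Induced phi r f →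
      (Function.Injective r → C.Renames f (encS M) (encS (M.rename r))) ∧
      (¬ Function.Injective r → ∃ N, C.Renames f (encS M) N ∧ E (encS (M.rename r)) N)

structure OperationalCorrespondence (E : C.S → C.S → Prop) : Prop where
  complete : ∀ M M', F.IsTerm M → F.IsTerm M' → F.calculus.Steps M M' →
    ∃ N, C.Steps (encS M) N ∧ E N (encS M')
  sound : ∀ M N, F.IsTerm M → C.Steps (encS M) N →
    ∃ M' N', F.IsTerm M' ∧ F.calculus.Steps M M' ∧ C.Steps N N' ∧ E N' (encS M')

def DivergenceReflecting : Prop :=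
  ∀ M, F.IsTerm M → C.Diverges (encS M) → F.calculus.Diverges M

def SuccessSensitive : Prop :=
  ∀ M, F.IsTerm M → (F.calculus.MaySucceed M ↔ C.MaySucceed (encS M))

def DistributabilityPreserving (E : C.S → C.S → Prop) : Prop :=
  ∀ (M : Sess0) (n : ℕ) (L : Fin (n + 1) → Sess0), F.IsTerm M → (∀ i, F.IsTerm (L i)) →
    F.calculus.Distributable M L →
    ∃ N : Fin (n + 1) → C.S, C.Distributable (encS M) N ∧ ∀ i, E (N i) (encS (L i))

/-- The pair `encP`, `encS` of translations of processes and sessions is a good encoding from the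
calculus `F` into the calculus `C`. -/
def IsGoodEncoding : Prop :=
  (∀ M, F.IsTerm M → C.IsTerm (encS M)) ∧
  ∃ E : C.S → C.S → Prop, C.IsSuccessBisim E ∧
    Compositional F C encP encS ∧ NameInvariant F C encS E ∧
    OperationalCorrespondence F C encS E ∧ DivergenceReflecting F C encS ∧
    SuccessSensitive F C encS ∧ DistributabilityPreserving F C encS E

end Encodings

/-- There is a good encoding from `F` into `C`. -/
def HasGoodEncoding (F : Family) (C : Calculus) : Prop :=
  ∃ (encP : Proc0 → C.P) (encS : Sess0 → C.S), IsGoodEncoding F C encP encS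

end MixedChoice

/-!
The target calculi fall into two classes, each excluded by a problem that the source calculi solve.

*Restrictions of mixed choice multiparty sessions: leader election.*  On a ring whose participants
all run `ring`, each participant chooses between sending to the right and receiving from the left.
If there are three of them, then every run stays able to succeed; if there are four, then no run
succeeds.  Suppose that an encoding translates both rings into a calculus in which two prefixes of a
choice have the same polarity or the same partner.  By compositionality and name invariance, the
translation of each ring is a ring of cells that are renamings of one *template*, the same one for
both rings (`RingEncoding.exists_template`).  Consider a state in which all cells are renamings of one
template and a step in which a component `j` of some cell receives from a component `j'` of this cell
or of a neighbour.  If `j = j'`, then by symmetry this component also offers an output to the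
other neighbour, contradicting the restriction.  So `j ≠ j'`, and all cells can do the
same step one after the other, which leads to a ring with a new template (`TStep.ringSess`,
`TStep.of_ringSess`).  The ring of three participants terminates, hence by divergence reflection so
does its translation, and thus the steps of the templates are well-founded.  Following them, both
translations reach final states that agree on success (`exists_final`).  By operational
correspondence and success sensitiveness these have to differ.  In a calculus for two parties there
is nothing to translate the ring of three into, because its participants are translated to disjoint
nonempty sets of locations (`RingEncoding.three_le_card`).  Both cases are combined in
`Family.not_hasGoodEncoding`.

*Mixed sessions and their fragments: the square.*  Two rows `a | c` and `b | d` are such that none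
succeeds on its own, but `a` and `b` together do.  The translation of both rows is structurally
congruent to a composition `N₀ | N₁` of translations of the rows, up to an equivalence that respects
success, by preservation of distributability.  Processes communicate only on channels whose two ends
are bound by the same restriction, and no restriction reaches over both `N₀` and `N₁`.  So the two
parts evolve independently, and one of them succeeds on its own (`maySucceed_of_par`,
`not_hasGoodEncoding_mixCalculus`).  The invariant is the relation `Proj P R B`: the threads of `P` are
divided into the parts `R` and `B`, and each restriction belongs to one part.  It is compatible with
structural congruence (`MCong.proj_iff`) and with reduction (`Proj.step`).

The second argument needs that reduction does not create free names, for otherwise a name might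
appear in the part that does not own its restriction.  This is not a matter of syntax: the
substitution of a constant for a name keeps the occurrences of the name as an endpoint, which then
are no longer bound.  Typing prevents this.  Since reduction starts from typed processes only, it is enough
to know that a relaxed type system is preserved by structural congruence and reduction:
the predicate `Sec` assigns a type to every name, so that no typing context has to be split, and asks
only that linear names are not shared and endpoints are used as their types say (`MTyped.sec`,
`MCong.sec_iff`, `Sec.step`).
-/

namespace MixedChoice

/-! ### Invariants of structural congruence -/

/-- Polarity and partner of a prefix: the data that renaming of bound variables preserves and that
the restrictions on choices refer to. -/
def Prefix.key (a : Prefix) : Pol × Part := (a.pol, a.partner)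

@[simp] theorem Prefix.pol_map (f g : ℕ → ℕ) (a : Prefix) : (a.map f g).pol = a.pol := by
  rcases a with ⟨p, l, _ | _⟩ | _ <;> rfl

@[simp] theorem Prefix.partner_map (f g : ℕ → ℕ) (a : Prefix) :
    (a.map f g).partner = f a.partner := by
  rcases a with ⟨p, l, _ | _⟩ | _ <;> rfl

theorem Prefix.key_map_id (g : ℕ → ℕ) (a : Prefix) : (a.map id g).key = a.key := by
  simp [Prefix.key]

/-- What a process offers after unfolding its recursions at the top; a choice is described by the
keys of its prefixes. -/
inductive Shape where
  | idle
  | tick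
  | cond
  | choice (K : Set (Pol × Part))

namespace Proc

/-- The shape of a process, seen through the recursions at its top; constants of a conditional and
continuations are forgotten. -/
def shape {H : Type} : Proc H → Shape
  | mu _ P => P.shape
  | tick => .tick
  | choice pre _ => .choice (Set.range fun i => (pre i).key)
  | cond _ _ _ => .cond
  | _ => .idle

theorem shape_fill {H K : Type} {s t : H → Proc K} (h : ∀ k, (s k).shape = (t k).shape)
    (C : Proc H) : (C.fill s).shape = (C.fill t).shape := by
  induction C with
  | hole k => exact h k
  | mu X P ih => exact ih
  | _ => rfl

theorem shape_map {H : Type} (g r : ℕ → ℕ) (P : Proc H) : (P.map id g r).shape = P.shape := by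
  induction P with
  | mu X P ih => exact ih
  | choice pre P ih => simp [map, shape, Prefix.key_map_id]
  | cond v P Q => cases v <;> rfl
  | _ => rfl

theorem shape_psubst {H : Type} (X : Name) (S P : Proc H) :
    (psubst X S P).shape = P.shape ∨ P.shape = .idle ∧ (psubst X S P).shape = S.shape := by
  induction P with
  | mu Y P ih =>
    by_cases h : Y = X
    · simp [psubst, h, shape]
    · simpa [psubst, h, shape] using ih
  | pvar Y =>
    by_cases h : Y = X <;> simp [psubst, h, shape]
  | _ => exact Or.inl rfl

/-- Every two prefixes of a common choice have keys related by `c`. -/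
def AllKeys {H : Type} (c : Pol × Part → Pol × Part → Prop) (P : Proc H) : Prop :=
  P.AllChoices fun _ pre => ∀ i j, c (pre i).key (pre j).key

theorem allKeys_fill {H K : Type} {c : Pol × Part → Pol × Part → Prop} {s t : H → Proc K}
    (h : ∀ k, (s k).AllKeys c ↔ (t k).AllKeys c) (C : Proc H) :
    (C.fill s).AllKeys c ↔ (C.fill t).AllKeys c := by
  induction C with
  | hole k => exact h k
  | mu X P ih => exact ih
  | choice pre P ih => exact and_congr_right fun _ => forall_congr' ih
  | cond v P Q ihP ihQ => exact and_congr ihP ihQ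
  | _ => rfl

theorem allKeys_map {H : Type} {c : Pol × Part → Pol × Part → Prop} (g r : ℕ → ℕ) (P : Proc H) :
    (P.map id g r).AllKeys c ↔ P.AllKeys c := by
  induction P with
  | mu X P ih => exact ih
  | choice pre P ih =>
    simp only [AllKeys, map, AllChoices, Prefix.key_map_id] at ih ⊢
    exact and_congr_right fun _ => forall_congr' ih
  | cond v P Q ihP ihQ => cases v <;> exact and_congr ihP ihQ
  | _ => rfl

theorem allKeys_psubst {H : Type} {c : Pol × Part → Pol × Part → Prop} {X : Name} {S : Proc H}
    (P : Proc H) (h : P.AllKeys c) (hS : S.AllKeys c) : (psubst X S P).AllKeys c := by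
  induction P with
  | mu Y P ih =>
    by_cases hY : Y = X
    · simpa [psubst, hY] using h
    · simp only [psubst, hY, if_false]
      exact ih h
  | pvar Y =>
    by_cases hY : Y = X
    · simpa [psubst, hY] using hS
    · simpa [psubst, hY] using h
  | choice pre P ih => exact ⟨h.1, fun i => ih i (h.2 i)⟩
  | cond v P Q ihP ihQ => exact ⟨ihP h.1, ihQ h.2⟩
  | _ => exact h

theorem AllKeys.of_psubst {H : Type} {c : Pol × Part → Pol × Part → Prop} {X : Name} {S : Proc H}
    (P : Proc H) (h : (psubst X S P).AllKeys c) : P.AllKeys c := by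
  induction P with
  | mu Y P ih =>
    by_cases hY : Y = X
    · simpa [psubst, hY] using h
    · simp only [psubst, hY, if_false] at h
      exact ih h
  | pvar Y => trivial
  | choice pre P ih => exact ⟨h.1, fun i => ih i (h.2 i)⟩
  | cond v P Q ihP ihQ => exact ⟨ihP h.1, ihQ h.2⟩
  | _ => exact h

theorem allKeys_subst {H : Type} {c : Pol × Part → Pol × Part → Prop} {x : Name} {k : Const}
    (P : Proc H) (h : P.AllKeys c) : (P.subst x k).AllKeys c := by
  induction P with
  | mu Y P ih => exact ih h
  | choice pre P ih =>
    refine ⟨?_, fun i => ?_⟩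
    · intro i j
      have h1 := h.1 i j
      dsimp only
      generalize pre i = a at *
      generalize pre j = b at *
      rcases a with ⟨p, l, y | d⟩ | ⟨p, l, y⟩ <;> rcases b with ⟨p', l', y' | d'⟩ | ⟨p', l', y'⟩ <;>
        dsimp only <;> (try split) <;> (try split) <;> exact h1
    · have := h.2 i
      dsimp only
      split
      · exact ih i this
      · split
        · exact this
        · exact ih i this
  | cond v P Q ihP ihQ => cases v <;> exact ⟨ihP h.1, ihQ h.2⟩
  | _ => exact h

end Proc

theorem PIdent.shape_eq {P Q : Proc0} (h : PIdent P Q) : P.shape = Q.shape := by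
  induction h with
  | refl => rfl
  | symm _ ih => exact ih.symm
  | trans _ _ ih ih' => exact ih.trans ih'
  | ctx C _ ih => exact Proc.shape_fill (fun _ => ih) C
  | alphaMu X Y P _ => exact (Proc.shape_map _ _ P).symm
  | alphaInp pre P i p l x y h _ =>
    simp only [Proc.shape]
    congr 2
    funext j
    by_cases hj : j = i
    · subst hj; simp [h, Prefix.key, Prefix.pol, Prefix.partner]
    · simp [hj]
  | perm pre P e =>
    simp only [Proc.shape]
    congr 1
    exact (e.surjective.range_comp fun i => (pre i).key).symm

theorem PCong.shape_eq {u : Bool} {P Q : Proc0} (h : PCong u P Q) : P.shape = Q.shape := by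
  induction h with
  | ident h => exact h.shape_eq
  | symm _ ih => exact ih.symm
  | trans _ _ ih ih' => exact ih.trans ih'
  | unfold X P _ _ _ =>
    rcases Proc.shape_psubst X (.mu X P) P with h | ⟨_, h⟩
    · exact h.symm
    · exact h.symm

theorem PIdent.allKeys_iff {c : Pol × Part → Pol × Part → Prop} {P Q : Proc0} (h : PIdent P Q) :
    P.AllKeys c ↔ Q.AllKeys c := by
  induction h with
  | refl => rfl
  | symm _ ih => exact ih.symm
  | trans _ _ ih ih' => exact ih.trans ih'
  | ctx C _ ih => exact Proc.allKeys_fill (fun _ => ih) C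
  | alphaMu X Y P _ => exact (Proc.allKeys_map (c := c) _ _ P).symm
  | alphaInp pre P i p l x y h _ =>
    refine and_congr ?_ (forall_congr' fun j => ?_)
    · have : ∀ j, (Function.update pre i (.inp p l y) j).key = (pre j).key := by
        intro j
        by_cases hj : j = i
        · subst hj; simp [h, Prefix.key, Prefix.pol, Prefix.partner]
        · simp [hj]
      simp only [this]
    · by_cases hj : j = i
      · subst hj
        simp only [Function.update_self]
        exact (Proc.allKeys_map (c := c) (Equiv.swap x y) id (P j)).symm
      · simp [hj]
  | perm pre P e =>
    refine and_congr ⟨fun h i j => h _ _, fun h i j => ?_⟩ ⟨fun h i => h _, fun h i => ?_⟩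
    · simpa using h (e.symm i) (e.symm j)
    · simpa using h (e.symm i)

theorem PCong.allKeys_iff {c : Pol × Part → Pol × Part → Prop} {u : Bool} {P Q : Proc0}
    (h : PCong u P Q) : P.AllKeys c ↔ Q.AllKeys c := by
  induction h with
  | ident h => exact h.allKeys_iff
  | symm _ ih => exact ih.symm
  | trans _ _ ih ih' => exact ih.trans ih'
  | unfold X P _ _ _ =>
    exact ⟨fun h => Proc.allKeys_psubst P h h, fun h => Proc.AllKeys.of_psubst (c := c) P h⟩

/-! ### Renaming of participants -/

@[simp] theorem Prefix.map_id_id (a : Prefix) : a.map id id = a := by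
  rcases a with ⟨p, l, _ | _⟩ | _ <;> rfl

theorem Prefix.map_map (f g f' g' : ℕ → ℕ) (a : Prefix) :
    (a.map f g).map f' g' = a.map (f' ∘ f) (g' ∘ g) := by
  rcases a with ⟨p, l, _ | _⟩ | _ <;> rfl

@[simp] theorem Prefix.fv_map (f : ℕ → ℕ) (a : Prefix) : (a.map f id).fv = a.fv := by
  rcases a with ⟨p, l, _ | _⟩ | _ <;> rfl

@[simp] theorem Prefix.bv_map (f : ℕ → ℕ) (a : Prefix) : (a.map f id).bv = a.bv := by
  rcases a with ⟨p, l, _ | _⟩ | _ <;> rfl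

namespace Proc

theorem map_map {H : Type} (f g r f' g' r' : ℕ → ℕ) (P : Proc H) :
    (P.map f g r).map f' g' r' = P.map (f' ∘ f) (g' ∘ g) (r' ∘ r) := by
  induction P with
  | mu X P ih => simp [map, ih]
  | choice pre P ih => simp [map, ih, Prefix.map_map]
  | cond v P Q ihP ihQ => cases v <;> simp [map, ihP, ihQ]
  | _ => rfl

theorem map_fill {H K : Type} (f g r : ℕ → ℕ) (s : H → Proc K) (C : Proc H) :
    (C.fill s).map f g r = (C.map f g r).fill (fun h => (s h).map f g r) := by
  induction C with
  | mu X P ih => simp [map, fill, ih]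
  | choice pre P ih => simp [map, fill, ih]
  | cond v P Q ihP ihQ => cases v <;> simp [map, fill, ihP, ihQ]
  | _ => rfl

@[simp] theorem fv_map {H : Type} (f r : ℕ → ℕ) (P : Proc H) : (P.map f id r).fv = P.fv := by
  induction P with
  | mu X P ih => simp [map, fv, ih]
  | choice pre P ih => simp [map, fv, ih]
  | cond v P Q ihP ihQ => cases v <;> simp [map, fv, ihP, ihQ]
  | _ => rfl

@[simp] theorem bv_map {H : Type} (f r : ℕ → ℕ) (P : Proc H) : (P.map f id r).bv = P.bv := by
  induction P with
  | mu X P ih => simp [map, bv, ih]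
  | choice pre P ih => simp [map, bv, ih]
  | cond v P Q ihP ihQ => cases v <;> simp [map, bv, ihP, ihQ]
  | _ => rfl

@[simp] theorem fpv_map {H : Type} (f g : ℕ → ℕ) (P : Proc H) : (P.map f g id).fpv = P.fpv := by
  induction P with
  | mu X P ih => simp [map, fpv, ih]
  | choice pre P ih => simp [map, fpv, ih]
  | cond v P Q ihP ihQ => cases v <;> simp [map, fpv, ihP, ihQ]
  | _ => rfl

@[simp] theorem bpv_map {H : Type} (f g : ℕ → ℕ) (P : Proc H) : (P.map f g id).bpv = P.bpv := by
  induction P with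
  | mu X P ih => simp [map, bpv, ih]
  | choice pre P ih => simp [map, bpv, ih]
  | cond v P Q ihP ihQ => cases v <;> simp [map, bpv, ihP, ihQ]
  | _ => rfl

theorem map_psubst {H : Type} (f g : ℕ → ℕ) (X : Name) (S P : Proc H) :
    (psubst X S P).map f g id = psubst X (S.map f g id) (P.map f g id) := by
  induction P with
  | mu Y P ih => by_cases h : Y = X <;> simp [psubst, map, h, ih]
  | pvar Y => by_cases h : Y = X <;> simp [psubst, map, h]
  | choice pre P ih => simp [psubst, map, ih]
  | cond v P Q ihP ihQ => cases v <;> simp [psubst, map, ihP, ihQ]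
  | _ => rfl

theorem map_subst {H : Type} (f : ℕ → ℕ) (x : Name) (c : Const) (P : Proc H) :
    (P.subst x c).map f id id = (P.map f id id).subst x c := by
  induction P with
  | mu Y P ih => simp [subst, map, ih]
  | choice pre P ih =>
    simp only [subst, map]
    congr 1
    · funext i
      rcases pre i with ⟨p, l, y | d⟩ | ⟨p, l, y⟩
      · by_cases hy : y = x <;> simp [Prefix.map, hy]
      · rfl
      · rfl
    · funext i
      have := ih i
      rcases pre i with ⟨p, l, y | d⟩ | ⟨p, l, y⟩
      · exact this
      · exact this
      · by_cases hy : y = x <;> simp [Prefix.map, hy, this]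
  | cond v P Q ihP ihQ =>
    cases v with
    | var y => by_cases hy : y = x <;> simp [subst, map, hy, ihP, ihQ]
    | const d => simp [subst, map, ihP, ihQ]
  | _ => rfl

@[simp] theorem map_id {H : Type} (P : Proc H) : P.map id id id = P := by
  induction P with
  | mu X P ih => simp [map, ih]
  | choice pre P ih => simp [map, ih]
  | cond v P Q ihP ihQ => cases v <;> simp [map, ihP, ihQ]
  | _ => rfl

end Proc

theorem PIdent.map {P Q : Proc0} (f : ℕ → ℕ) (h : PIdent P Q) :
    PIdent (P.map f id id) (Q.map f id id) := by
  induction h with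
  | refl P => exact .refl _
  | symm _ ih => exact ih.symm
  | trans _ _ ih ih' => exact ih.trans ih'
  | ctx C _ ih =>
    rw [Proc.map_fill, Proc.map_fill]
    exact .ctx _ ih
  | alphaMu X Y P h =>
    have := PIdent.alphaMu X Y (P.map f id id) (by simpa using h)
    simpa [Proc.map, Proc.map_map] using this
  | alphaInp pre P i p l x y h hy =>
    have := PIdent.alphaInp (fun i => (pre i).map f id) (fun i => (P i).map f id id) i (f p) l x y
      (by simp [h, Prefix.map]) (by simpa using hy)
    simp only [Proc.map]
    convert this using 2
    · funext j
      by_cases hj : j = i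
      · subst hj; simp [Prefix.map]
      · simp [hj]
    · funext j
      by_cases hj : j = i
      · subst hj; simp [Proc.map_map]
      · simp [hj]
  | perm pre P e => exact .perm (fun i => (pre i).map f id) (fun i => (P i).map f id id) e

theorem PCong.map {u : Bool} {P Q : Proc0} (f : ℕ → ℕ) (h : PCong u P Q) :
    PCong u (P.map f id id) (Q.map f id id) := by
  induction h with
  | ident h => exact .ident (h.map f)
  | symm _ ih => exact ih.symm
  | trans _ _ ih ih' => exact ih.trans ih'
  | unfold X P hu h1 h2 =>
    rw [Proc.map_psubst]
    refine .unfold X _ hu (by simpa using h1) ?_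
    simpa [Proc.fpv] using h2

theorem PCong.refl {u : Bool} (P : Proc0) : PCong u P P := .ident (.refl P)

/-! ### Sessions as multisets of located classes of processes -/

/-- Processes up to structural congruence. -/
def procSetoid : Setoid Proc0 where
  r := PCong true
  iseqv := ⟨PCong.refl, PCong.symm, PCong.trans⟩

abbrev PClass := Quotient procSetoid

/-- The class of a process. -/
def PClass.mk (P : Proc0) : PClass := Quotient.mk procSetoid P

theorem PClass.mk_eq {P Q : Proc0} : PClass.mk P = PClass.mk Q ↔ PCong true P Q :=
  Quotient.eq (r := procSetoid)

/-- After unfolding, the process is a choice or a conditional. -/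
def Proc.Live (P : Proc0) : Prop := P.shape ≠ .idle ∧ P.shape ≠ .tick

open Classical in
/-- The located choices and conditionals of a session, up to structural congruence. -/
noncomputable def Sess.flat : Sess0 → Multiset (Part × PClass)
  | .hole _ => 0
  | .loc p P => if P.Live then {(p, PClass.mk P)} else 0
  | .par M N => M.flat + N.flat

/-- The located classes are invariant under structural congruence, so reduction can be analysed without
reasoning about rearrangements. -/
theorem SCong.flat_eq {u : Bool} {M N : Sess0} (h : SCong u M N) : M.flat = N.flat := by
  induction h with
  | refl => rfl
  | symm _ ih => exact ih.symm
  | trans _ _ ih ih' => exact ih.trans ih'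
  | @loc p P Q h =>
    have h' := h.shape_eq
    have hc : PCong true P Q := by
      clear h'
      induction h with
      | ident h => exact .ident h
      | symm _ ih => exact ih.symm
      | trans _ _ ih ih' => exact ih.trans ih'
      | unfold X P _ h1 h2 => exact .unfold X P rfl h1 h2
    have hl : P.Live ↔ Q.Live := by simp only [Proc.Live, h']
    by_cases hP : P.Live
    · simp only [Sess.flat, if_pos hP, if_pos (hl.1 hP), PClass.mk_eq.2 hc]
    · simp only [Sess.flat, if_neg hP, if_neg fun h => hP (hl.2 h)]
  | par L _ ih => simp [Sess.flat, ih]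
  | nil p M => simp [Sess.flat, Proc.Live, Proc.shape]
  | comm M N => exact add_comm _ _
  | assoc M N L => exact add_assoc _ _ _

theorem Sess.mem_flat {M : Sess0} {a : Part × PClass} (h : a ∈ M.flat) :
    ∃ P, (a.1, P) ∈ M.locs ∧ PClass.mk P = a.2 := by
  induction M with
  | hole k => exact k.elim
  | loc p P =>
    simp only [flat] at h
    split at h
    · simp only [Multiset.mem_singleton] at h
      subst h
      exact ⟨P, by simp [locs], rfl⟩
    · simp at h
  | par M N ihM ihN =>
    rcases Multiset.mem_add.1 h with h | h
    · obtain ⟨P, h1, h2⟩ := ihM h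
      exact ⟨P, by simp [locs, h1], h2⟩
    · obtain ⟨P, h1, h2⟩ := ihN h
      exact ⟨P, by simp [locs, h1], h2⟩

/-- A redex of a session: either a conditional on a boolean constant or a pair of matching
prefixes at two locations. -/
def Enabled (m : Multiset (Part × PClass)) : Prop :=
  (∃ p b P Q, (p, PClass.mk (.cond (.const (.bool b)) P Q)) ∈ m) ∨
  ∃ (p q l x : ℕ) (c : Const) (n n' : ℕ) (pre : Fin (n + 1) → Prefix) (P : Fin (n + 1) → Proc0)
    (pre' : Fin (n' + 1) → Prefix) (Q : Fin (n' + 1) → Proc0) (i : Fin (n + 1)) (j : Fin (n' + 1)),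
    pre i = .inp q l x ∧ pre' j = .out p l (.const c) ∧
    ({(p, PClass.mk (.choice pre P)), (q, PClass.mk (.choice pre' Q))} : Multiset _) ≤ m

/-- A session that reduces has a redex. -/
theorem SStep.enabled {M N : Sess0} (h : SStep M N) : Enabled M.flat := by
  induction h with
  | comm p q l x c pre P pre' Q i j h1 h2 =>
    refine .inr ⟨p, q, l, x, c, _, _, pre, P, pre', Q, i, j, h1, h2, ?_⟩
    simp [Sess.flat, Proc.Live, Proc.shape]
  | ifTrue p P Q => exact .inl ⟨p, true, P, Q, by simp [Sess.flat, Proc.Live, Proc.shape]⟩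
  | ifFalse p P Q => exact .inl ⟨p, false, P, Q, by simp [Sess.flat, Proc.Live, Proc.shape]⟩
  | par L _ ih =>
    rcases ih with ⟨p, b, P, Q, h⟩ | ⟨p, q, l, x, c, n, n', pre, P, pre', Q, i, j, h1, h2, h⟩
    · exact .inl ⟨p, b, P, Q, Multiset.mem_add.2 (.inl h)⟩
    · exact .inr ⟨p, q, l, x, c, n, n', pre, P, pre', Q, i, j, h1, h2,
        h.trans (Multiset.le_add_right _ _)⟩
  | cong h _ _ ih => rwa [h.flat_eq]

theorem Proc.success_iff {P : Proc0} : P.Success ↔ P.shape = .tick := by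
  induction P with
  | mu X P ih => exact ih
  | tick => simp [Success, shape]
  | _ => simp [Success, shape]

theorem Sess.success_par {M N : Sess0} : (Sess.par M N).Success ↔ M.Success ∨ N.Success := by
  simp [Success, locs, or_and_right, exists_or]

theorem SCong.success_iff {u : Bool} {M N : Sess0} (h : SCong u M N) : M.Success ↔ N.Success := by
  induction h with
  | refl => rfl
  | symm _ ih => exact ih.symm
  | trans _ _ ih ih' => exact ih.trans ih'
  | loc p h => simp [Sess.Success, Sess.locs, Proc.success_iff, h.shape_eq]
  | par L _ ih => simp [Sess.success_par, ih]
  | nil p M => rw [Sess.success_par]; simp [Sess.Success, Sess.locs, Proc.Success]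
  | comm M N => rw [Sess.success_par, Sess.success_par, or_comm]
  | assoc M N L => simp only [Sess.success_par, or_assoc]

/-! ### Finite protocols and the sessions that implement them -/

/-- A summand of a state of a protocol: it sends (`send = true`) or receives the label `label`
over the port `port` and continues with the state `next`. -/
structure Summand (κ S : Type) where
  send : Bool
  port : κ
  label : Label
  next : S

/-- A protocol for one participant.  A state without summands is terminated, successfully if
`tick` holds. -/
structure Protocol (κ S : Type) where
  acts : S → List (Summand κ S)
  tick : S → Bool

namespace Protocol

variable {κ S : Type} (A : Protocol κ S)

/-- The prefix of a summand if the ports are connected to the participants `ρ`.  All messages carry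
the same value, which no receiver uses. -/
def pref (ρ : κ → Part) (a : Summand κ S) : Prefix :=
  if a.send then .out (ρ a.port) a.label (.const (.bool true)) else .inp (ρ a.port) a.label 0

/-- The process of a state, cut off after `f` communications. -/
def proc (ρ : κ → Part) : ℕ → S → Proc0
  | 0, _ => .nil
  | f + 1, s =>
    match A.acts s with
    | [] => if A.tick s then .tick else .nil
    | a :: as => .choice (n := as.length) (fun i => pref ρ ((a :: as).get i))
        (fun i => proc ρ f ((a :: as).get i).next)

/-- The action of the local type that belongs to a summand. -/
def lact (ρ : κ → Part) (a : Summand κ S) : LAct :=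
  ⟨if a.send then .snd else .rcv, ρ a.port, a.label, .bool⟩

/-- The local type of a state, cut off after `f` communications. -/
def ty (ρ : κ → Part) : ℕ → S → LType
  | 0, _ => .fin
  | f + 1, s =>
    match A.acts s with
    | [] => .fin
    | a :: as => .choice (n := as.length) (fun i => lact ρ ((a :: as).get i))
        (fun i => ty ρ f ((a :: as).get i).next)

/-- The state `s` terminates within less than `f` communications, and the summands of each choice
differ in partner, polarity or label. -/
def Bounded [DecidableEq κ] : ℕ → S → Bool
  | 0, _ => false
  | f + 1, s => decide ((A.acts s).map fun a => (a.port, a.send, a.label)).Nodup &&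
      (A.acts s).all fun a => Bounded f a.next

/-- `P` implements the state `s`: up to recursions without effect it has the tree of
communications of `s`. -/
inductive Real (ρ : κ → Part) : Proc0 → S → Prop
  | nil {s} : A.acts s = [] → A.tick s = false → Real ρ .nil s
  | tick {s} : A.acts s = [] → A.tick s = true → Real ρ .tick s
  | mu {s} (X P) : Real ρ P s → Real ρ (.mu X P) s
  | choice {s} {n : ℕ} (pre : Fin (n + 1) → Prefix) (P : Fin (n + 1) → Proc0)
      (g : Fin (n + 1) → Summand κ S) :
      (∀ i, g i ∈ A.acts s) → (∀ a ∈ A.acts s, ∃ i, g i = a) →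
      (∀ i, (∃ c, (g i).send = true ∧ pre i = .out (ρ (g i).port) (g i).label (.const c)) ∨
        ∃ x, (g i).send = false ∧ pre i = .inp (ρ (g i).port) (g i).label x) →
      (∀ i, Real ρ (P i) (g i).next) → Real ρ (.choice pre P) s

variable {A} {ρ : κ → Part}

theorem real_proc [DecidableEq κ] {f : ℕ} {s : S} (h : A.Bounded f s) :
    A.Real ρ (A.proc ρ f s) s := by
  induction f generalizing s with
  | zero => simp [Bounded] at h
  | succ f ih =>
    simp only [Bounded, Bool.and_eq_true, List.all_eq_true] at h
    unfold proc
    split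
    · next h0 =>
      split
      · next ht => exact .tick h0 ht
      · next ht => exact .nil h0 (by simpa using ht)
    · next a as h0 =>
      refine .choice _ _ (fun i => (a :: as).get i) ?_ ?_ ?_ ?_
      · intro i; rw [h0]; exact List.get_mem _ _
      · intro b hb; rw [h0] at hb; exact List.get_of_mem hb
      · intro i
        cases hs : ((a :: as).get i).send
        · exact .inr ⟨0, rfl, by simp only [pref, hs]; simp⟩
        · exact .inl ⟨.bool true, rfl, by simp only [pref, hs]; simp⟩
      · intro i
        exact ih (h.2 _ (by rw [h0]; exact List.get_mem _ _))

theorem Real.psubst_eq {P : Proc0} {s : S} (h : A.Real ρ P s) (X : Name) (Q : Proc0) :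
    Proc.psubst X Q P = P := by
  induction h with
  | nil => rfl
  | tick => rfl
  | mu Y P _ ih => by_cases hY : Y = X <;> simp [Proc.psubst, hY, ih]
  | choice pre P g _ _ _ _ ih => simp [Proc.psubst, ih]

theorem Real.fpv_eq {P : Proc0} {s : S} (h : A.Real ρ P s) : P.fpv = ∅ := by
  induction h with
  | nil => rfl
  | tick => rfl
  | mu Y P _ ih => simp [Proc.fpv, ih]
  | choice pre P g _ _ _ _ ih => simp [Proc.fpv, ih]

theorem Real.map {P : Proc0} {s : S} (g r : ℕ → ℕ) (h : A.Real ρ P s) :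
    A.Real ρ (P.map id g r) s := by
  induction h with
  | nil h h' => exact .nil h h'
  | tick h h' => exact .tick h h'
  | mu Y P _ ih => exact .mu _ _ ih
  | choice pre P e h1 h2 h3 _ ih =>
    refine .choice _ _ e h1 h2 (fun i => ?_) ih
    rcases h3 i with ⟨c, h, h'⟩ | ⟨x, h, h'⟩
    · exact .inl ⟨c, h, by simp [h', Prefix.map]⟩
    · exact .inr ⟨g x, h, by simp [h', Prefix.map]⟩

theorem Real.subst {P : Proc0} {s : S} (x : Name) (c : Const) (h : A.Real ρ P s) :
    A.Real ρ (P.subst x c) s := by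
  induction h with
  | nil h h' => exact .nil h h'
  | tick h h' => exact .tick h h'
  | mu Y P _ ih => exact .mu _ _ ih
  | choice pre P e h1 h2 h3 h4 ih =>
    refine .choice _ _ e h1 h2 (fun i => ?_) (fun i => ?_)
    · rcases h3 i with ⟨c, h, h'⟩ | ⟨x, h, h'⟩
      · exact .inl ⟨c, h, by simp only [h']⟩
      · exact .inr ⟨x, h, by simp only [h']⟩
    · split
      · exact ih i
      · split
        · exact h4 i
        · exact ih i

theorem real_fill {P Q : Proc0} (h : ∀ s, A.Real ρ P s → A.Real ρ Q s) (C : Proc (Fin 1)) {s : S}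
    (hC : A.Real ρ (C.fill fun _ => P) s) : A.Real ρ (C.fill fun _ => Q) s := by
  induction C generalizing s with
  | hole k => exact h s hC
  | nil => exact hC
  | tick => exact hC
  | pvar X => exact hC
  | mu X C ih =>
    cases hC with
    | mu _ _ h => exact .mu _ _ (ih h)
  | choice pre D ih =>
    cases hC with
    | choice _ _ g h1 h2 h3 h4 => exact .choice _ _ g h1 h2 h3 fun i => ih i (h4 i)
  | cond v C D => cases hC

theorem fv_fill {P Q : Proc0} (h : P.fv = Q.fv) (C : Proc (Fin 1)) :
    (C.fill fun _ => P).fv = (C.fill fun _ => Q).fv := by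
  induction C with
  | hole k => exact h
  | mu X C ih => exact ih
  | choice pre D ih => simp [Proc.fill, Proc.fv, ih]
  | cond v C D ihC ihD => cases v <;> simp [Proc.fill, Proc.fv, ihC, ihD]
  | _ => rfl

theorem fv_map_swap (x y : Name) (P : Proc0) :
    (P.map id (Equiv.swap x y) id).fv = Equiv.swap x y '' P.fv := by
  induction P with
  | hole h => exact h.elim
  | mu X P ih => exact ih
  | choice pre P ih =>
    have h1 : ∀ a : Prefix, (a.map id (Equiv.swap x y)).fv = Equiv.swap x y '' a.fv := by
      rintro (⟨p, l, _ | _⟩ | _) <;> simp [Prefix.map, Prefix.fv]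
    have h2 : ∀ a : Prefix, (a.map id (Equiv.swap x y)).bv = Equiv.swap x y '' a.bv := by
      rintro (⟨p, l, _ | _⟩ | _) <;> simp [Prefix.map, Prefix.bv]
    simp only [Proc.map, Proc.fv, ih, h1, h2, Set.image_iUnion, Set.image_union,
      Set.image_sdiff (Equiv.swap x y).injective]
  | cond v P Q ihP ihQ =>
    cases v <;> simp [Proc.map, Proc.fv, ihP, ihQ, Set.image_union, Set.image_insert_eq]
  | _ => simp [Proc.map, Proc.fv]

theorem fv_subst (x : Name) (c : Const) (P : Proc0) : (P.subst x c).fv ⊆ P.fv \ {x} := by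
  induction P with
  | hole h => exact h.elim
  | mu X P ih => exact ih
  | choice pre P ih =>
    simp only [Proc.subst, Proc.fv]
    refine Set.iUnion_subset fun i => ?_
    have hi := ih i
    intro z hz
    rw [Set.mem_sdiff, Set.mem_iUnion]
    refine ⟨⟨i, ?_⟩, ?_⟩
    · rcases hp : pre i with ⟨p, l, y | d⟩ | ⟨p, l, y⟩ <;> simp only [hp] at hz ⊢
      · rcases hz with hz | hz
        · left
          split at hz
          · simp [Prefix.fv] at hz
          · exact hz
        · exact .inr ⟨(hi hz.1).1, fun h => h⟩
      · rcases hz with hz | hz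
        · simp [Prefix.fv] at hz
        · exact .inr ⟨(hi hz.1).1, fun h => h⟩
      · rcases hz with hz | hz
        · exact .inl hz
        · refine .inr ⟨?_, hz.2⟩
          have := hz.1
          split at this
          · exact this
          · exact (hi this).1
    · rintro rfl
      rcases hp : pre i with ⟨p, l, y | d⟩ | ⟨p, l, y⟩ <;> simp only [hp] at hz
      · rcases hz with hz | hz
        · split at hz
          · simp [Prefix.fv] at hz
          · next h => exact h (by simpa [Prefix.fv] using hz.symm)
        · exact (hi hz.1).2 rfl
      · rcases hz with hz | hz
        · simp [Prefix.fv] at hz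
        · exact (hi hz.1).2 rfl
      · rcases hz with hz | hz
        · simp [Prefix.fv] at hz
        · have h1 := hz.1
          split at h1
          · next h => exact hz.2 (by simp [Prefix.bv, h])
          · exact (hi h1).2 rfl
  | cond v P Q ihP ihQ =>
    cases v with
    | var y =>
      by_cases h : y = x
      · simp only [Proc.subst, h, if_true, Proc.fv]
        rintro z (hz | hz)
        · exact ⟨.inl (.inr (ihP hz).1), (ihP hz).2⟩
        · exact ⟨.inr (ihQ hz).1, (ihQ hz).2⟩
      · simp only [Proc.subst, h, if_false, Proc.fv]
        rintro z ((hz | hz) | hz)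
        · refine ⟨.inl (.inl hz), ?_⟩
          rw [Set.mem_singleton_iff] at hz ⊢
          exact fun h' => h (hz.symm.trans h')
        · exact ⟨.inl (.inr (ihP hz).1), (ihP hz).2⟩
        · exact ⟨.inr (ihQ hz).1, (ihQ hz).2⟩
    | const d =>
      rintro z (hz | hz)
      · exact ⟨.inl (ihP hz).1, (ihP hz).2⟩
      · exact ⟨.inr (ihQ hz).1, (ihQ hz).2⟩
  | _ => simp [Proc.subst, Proc.fv]

/-- Implementing a state is invariant under the identification of processes. -/
theorem real_ident {P Q : Proc0} (h : PIdent P Q) : ∀ s, A.Real ρ P s ↔ A.Real ρ Q s := by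
  have back : ∀ (x y : Name) (P : Proc0),
      (P.map id (Equiv.swap x y) id).map id (Equiv.swap x y) id = P ∧
      (P.map id id (Equiv.swap x y)).map id id (Equiv.swap x y) = P := by
    intro x y P
    have : (Equiv.swap x y : ℕ → ℕ) ∘ (Equiv.swap x y : ℕ → ℕ) = id := by
      funext z; simp
    constructor <;> rw [Proc.map_map, this] <;> exact Proc.map_id P
  induction h with
  | refl => exact fun _ => Iff.rfl
  | symm _ ih => exact fun s => (ih s).symm
  | trans _ _ ih ih' => exact fun s => (ih s).trans (ih' s)
  | ctx C _ ih => exact fun s => ⟨real_fill (fun s => (ih s).1) C, real_fill (fun s => (ih s).2) C⟩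
  | alphaMu X Y P _ =>
    refine fun s => ⟨fun h => ?_, fun h => ?_⟩
    · cases h with
      | mu _ _ h => exact .mu _ _ (h.map _ _)
    · cases h with
      | mu _ _ h =>
        have := h.map id (Equiv.swap X Y)
        rw [(back X Y P).2] at this
        exact .mu _ _ this
  | alphaInp pre P i p l x y hp _ =>
    refine fun s => ⟨fun h => ?_, fun h => ?_⟩
    · cases h with
      | choice _ _ g h1 h2 h3 h4 =>
        refine .choice _ _ g h1 h2 (fun j => ?_) fun j => ?_
        · by_cases hj : j = i
          · subst hj
            rcases h3 j with ⟨c, _, h⟩ | ⟨z, h, h'⟩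
            · rw [hp] at h; cases h
            · rw [hp] at h'; cases h'
              exact .inr ⟨y, h, by simp⟩
          · simpa [hj] using h3 j
        · by_cases hj : j = i
          · subst hj; simpa using (h4 j).map _ _
          · simpa [hj] using h4 j
    · cases h with
      | choice _ _ g h1 h2 h3 h4 =>
        refine .choice _ _ g h1 h2 (fun j => ?_) fun j => ?_
        · by_cases hj : j = i
          · subst hj
            rcases h3 j with ⟨c, _, h⟩ | ⟨z, h, h'⟩
            · simp at h
            · simp only [Function.update_self, Prefix.inp.injEq] at h'
              exact .inr ⟨x, h, by rw [hp, h'.1, h'.2.1]⟩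
          · simpa [hj] using h3 j
        · by_cases hj : j = i
          · subst hj
            have := (h4 j).map (Equiv.swap x y) id
            simpa only [Function.update_self, (back x y (P j)).1] using this
          · simpa [hj] using h4 j
  | perm pre P e =>
    refine fun s => ⟨fun h => ?_, fun h => ?_⟩
    · cases h with
      | choice _ _ g h1 h2 h3 h4 =>
        refine .choice _ _ (g ∘ e) (fun i => h1 _) (fun a ha => ?_) (fun i => h3 _) fun i => h4 _
        obtain ⟨i, hi⟩ := h2 a ha
        exact ⟨e.symm i, by simpa using hi⟩
    · cases h with
      | choice _ _ g h1 h2 h3 h4 =>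
        refine .choice _ _ (g ∘ e.symm) (fun i => h1 _) (fun a ha => ?_) (fun i => ?_) fun i => ?_
        · obtain ⟨i, hi⟩ := h2 a ha
          exact ⟨e i, by simpa using hi⟩
        · simpa using h3 (e.symm i)
        · simpa using h4 (e.symm i)

theorem fv_ident {P Q : Proc0} (h : PIdent P Q) : P.fv = Q.fv := by
  induction h with
  | refl => rfl
  | symm _ ih => exact ih.symm
  | trans _ _ ih ih' => exact ih.trans ih'
  | ctx C _ ih => exact fv_fill ih C
  | alphaMu X Y P _ => exact (Proc.fv_map id _ P).symm
  | alphaInp pre P i p l x y hp hy =>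
    simp only [Proc.fv]
    refine Set.iUnion_congr fun j => ?_
    by_cases hj : j = i
    · subst hj
      simp only [Function.update_self, hp, fv_map_swap, Prefix.fv, Prefix.bv, Set.empty_union]
      ext z
      simp only [Set.mem_sdiff, Set.mem_singleton_iff, Set.mem_image]
      constructor
      · rintro ⟨hz, hx⟩
        have hzy : z ≠ y := fun h => hy (h ▸ hz)
        exact ⟨⟨z, hz, Equiv.swap_apply_of_ne_of_ne hx hzy⟩, hzy⟩
      · rintro ⟨⟨w, hw, rfl⟩, h⟩
        have hwy : w ≠ y := fun h => hy (h ▸ hw)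
        have hwx : w ≠ x := fun h' => h (by simp [h'])
        rw [Equiv.swap_apply_of_ne_of_ne hwx hwy]
        exact ⟨hw, hwx⟩
    · simp [hj]
  | perm pre P e =>
    simp only [Proc.fv]
    exact (e.surjective.iUnion_comp fun i => (pre i).fv ∪ ((P i).fv \ (pre i).bv)).symm

theorem Real.of_psubst {X : Name} {Q P : Proc0} (hQ : ∀ s, ¬ A.Real ρ Q s) {s : S}
    (h : A.Real ρ (Proc.psubst X Q P) s) : Proc.psubst X Q P = P := by
  induction P generalizing s with
  | pvar Y =>
    by_cases hY : Y = X
    · simp only [Proc.psubst, hY, if_true] at h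
      exact (hQ _ h).elim
    · simp [Proc.psubst, hY]
  | mu Y P ih =>
    by_cases hY : Y = X
    · simp [Proc.psubst, hY]
    · simp only [Proc.psubst, hY, if_false] at h ⊢
      cases h with
      | mu _ _ h => rw [ih h]
  | choice pre P ih =>
    simp only [Proc.psubst] at h ⊢
    cases h with
    | choice _ _ g _ _ _ h4 => congr 1; funext i; exact ih i (h4 i)
  | cond v P Q => cases h
  | _ => rfl

/-- `P` is a process without free value variables that implements `s`. -/
def Closed (A : Protocol κ S) (ρ : κ → Part) (P : Proc0) (s : S) : Prop :=
  A.Real ρ P s ∧ P.fv = ∅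

/-- Implementing a state is invariant under structural congruence, including the unfolding of
recursion. -/
theorem closed_cong {u : Bool} {P Q : Proc0} (h : PCong u P Q) (s : S) :
    A.Closed ρ P s ↔ A.Closed ρ Q s := by
  induction h with
  | ident h => rw [Closed, Closed, real_ident h, fv_ident h]
  | symm _ ih => exact ih.symm
  | trans _ _ ih ih' => exact ih.trans ih'
  | unfold X P _ _ _ =>
    have key : ∀ s, A.Real ρ P s → (A.Closed ρ (.mu X P) s ↔
        A.Closed ρ (Proc.psubst X (.mu X P) P) s) := by
      intro s h
      rw [h.psubst_eq]
      exact and_congr ⟨fun _ => h, fun _ => .mu _ _ h⟩ Iff.rfl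
    constructor
    · intro h
      cases h.1 with
      | mu _ _ h' => exact (key s h').1 h
    · intro h
      by_cases hQ : ∃ t, A.Real ρ (.mu X P) t
      · obtain ⟨t, ht⟩ := hQ
        cases ht with
        | mu _ _ h' =>
          have : A.Real ρ P s := by have := h.1; rwa [h'.psubst_eq] at this
          exact (key s this).2 h
      · have h' := h.1
        rw [h'.of_psubst fun t ht => hQ ⟨t, ht⟩] at h'
        exact (key s h').2 h

end Protocol

namespace Protocol

variable {κ S : Type} {A : Protocol κ S} {ρ : κ → Part}

/-! ### Implementations of finite protocols are terms -/

theorem PCong_mu_of_closed {X : Name} {P : Proc0} {s : S} (h : A.Closed ρ (.mu X P) s) :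
    PCong true (.mu X P) P ∧ A.Closed ρ P s := by
  obtain ⟨h1, h2⟩ := h
  cases h1 with
  | mu _ _ h1 =>
    refine ⟨?_, h1, h2⟩
    have h3 : P.fv = ∅ := h2
    have := PCong.unfold (u := true) X P rfl (by simp [h3]) (by simp [Proc.fpv, h1.fpv_eq])
    rwa [h1.psubst_eq] at this

/-- A closed implementation is structurally congruent to one without recursion at the top. -/
theorem Closed.exists_head {P : Proc0} {s : S} (h : A.Closed ρ P s) :
    ∃ Q, PCong true P Q ∧ A.Closed ρ Q s ∧
      (Q = .nil ∨ Q = .tick ∨ ∃ (n : ℕ) (pre : Fin (n + 1) → Prefix) (R : Fin (n + 1) → Proc0),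
        Q = .choice pre R) := by
  induction P with
  | mu X P ih =>
    obtain ⟨h1, h2⟩ := PCong_mu_of_closed h
    obtain ⟨Q, h3, h4⟩ := ih h2
    exact ⟨Q, h1.trans h3, h4⟩
  | nil => exact ⟨_, .refl _, h, .inl rfl⟩
  | tick => exact ⟨_, .refl _, h, .inr (.inl rfl)⟩
  | choice pre P => exact ⟨_, .refl _, h, .inr (.inr ⟨_, pre, P, rfl⟩)⟩
  | hole k => exact k.elim
  | pvar X => cases h.1
  | cond v P Q => cases h.1

/-- The state has terminated without success. -/
def isDead (A : Protocol κ S) (s : S) : Bool := (A.acts s).isEmpty && !A.tick s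

theorem isDead_iff {s : S} : A.isDead s = true ↔ A.acts s = [] ∧ A.tick s = false := by
  simp [isDead]

theorem Closed.cong_of_acts_eq_nil {P : Proc0} {s : S} (h : A.Closed ρ P s) (hs : A.acts s = []) :
    PCong true P (if A.tick s then .tick else .nil) := by
  obtain ⟨Q, h1, h2, rfl | rfl | ⟨n, pre, R, rfl⟩⟩ := h.exists_head
  · cases h2.1 with
    | nil _ ht => simpa [ht] using h1
  · cases h2.1 with
    | tick _ ht => simpa [ht] using h1
  · cases h2.1 with
    | choice _ _ g hg => exact absurd (hg 0) (by simp [hs])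

variable (A) {n : ℕ} (ν : Fin n → Part) (w : Fin n → κ → Fin n)

/-- The participant `ν i` in state `s`, unless it has terminated without success. -/
def sing (i : Fin n) (s : S) : Multiset (Fin n × S) := if A.isDead s then 0 else {(i, s)}

/-- The session implements the participants and states in the multiset; all its other locations
are terminated. -/
inductive Impl : Sess0 → Multiset (Fin n × S) → Prop
  | idle {P : Proc0} (p : Part) : PCong true P .nil → Impl (.loc p P) 0
  | loc {P : Proc0} {i : Fin n} {s : S} : A.isDead s = false → A.Closed (ν ∘ w i) P s →
      Impl (.loc (ν i) P) {(i, s)}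
  | par {M N : Sess0} {m m' : Multiset (Fin n × S)} : Impl M m → Impl N m' →
      Impl (.par M N) (m + m')

variable {A ν w}

theorem Impl.sing {P : Proc0} {i : Fin n} {s : S} (h : A.Closed (ν ∘ w i) P s) :
    A.Impl ν w (.loc (ν i) P) (A.sing i s) := by
  unfold Protocol.sing
  split
  · next hd =>
    obtain ⟨h1, h2⟩ := isDead_iff.1 hd
    have := h.cong_of_acts_eq_nil h1
    exact .idle _ (by simpa [h2] using this)
  · next hd => exact .loc (by simpa using hd) h

theorem impl_cong {u : Bool} {M N : Sess0} (h : SCong u M N) :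
    ∀ m, A.Impl ν w M m ↔ A.Impl ν w N m := by
  have toTrue : ∀ {P Q : Proc0}, PCong u P Q → PCong true P Q := by
    intro P Q h
    induction h with
    | ident h => exact .ident h
    | symm _ ih => exact ih.symm
    | trans _ _ ih ih' => exact ih.trans ih'
    | unfold X P _ h1 h2 => exact .unfold X P rfl h1 h2
  have comm : ∀ {M N : Sess0} {m}, A.Impl ν w (.par M N) m → A.Impl ν w (.par N M) m := by
    intro M N m h
    cases h with
    | par h1 h2 => rw [add_comm]; exact .par h2 h1
  induction h with
  | refl => exact fun _ => Iff.rfl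
  | symm _ ih => exact fun m => (ih m).symm
  | trans _ _ ih ih' => exact fun m => (ih m).trans (ih' m)
  | loc p h =>
    intro m
    have h := toTrue h
    constructor
    · intro hm
      cases hm with
      | idle _ h' => exact .idle _ (h.symm.trans h')
      | loc hd h' => exact .loc hd ((closed_cong h _).1 h')
    · intro hm
      cases hm with
      | idle _ h' => exact .idle _ (h.trans h')
      | loc hd h' => exact .loc hd ((closed_cong h _).2 h')
  | par L _ ih =>
    intro m
    constructor
    · intro h; cases h with
      | par h1 h2 => exact .par ((ih _).1 h1) h2
    · intro h; cases h with
      | par h1 h2 => exact .par ((ih _).2 h1) h2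
  | nil p M =>
    intro m
    constructor
    · intro h
      cases h with
      | par h1 h2 =>
        cases h1 with
        | idle => simpa using h2
        | loc hd h1 =>
          cases h1.1 with
          | nil ha ht => simp [isDead, ha, ht] at hd
    · intro h
      rw [← zero_add m]
      exact .par (.idle _ (.refl _)) h
  | comm M N => exact fun m => ⟨comm, comm⟩
  | assoc M N L =>
    intro m
    constructor
    · intro h
      cases h with
      | par h1 h2 => cases h1 with
        | par h3 h4 => rw [add_assoc]; exact .par h3 (.par h4 h2)
    · intro h
      cases h with
      | par h1 h2 => cases h2 with
        | par h3 h4 => rw [← add_assoc]; exact .par (.par h1 h3) h4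

/-- A communication between two participants of the multiset. -/
def MStep (A : Protocol κ S) (w : Fin n → κ → Fin n) (m m' : Multiset (Fin n × S)) : Prop :=
  ∃ (i j : Fin n) (s t : S) (a b : Summand κ S) (r : Multiset (Fin n × S)),
    a ∈ A.acts s ∧ b ∈ A.acts t ∧ a.send = true ∧ b.send = false ∧ w i a.port = j ∧
    w j b.port = i ∧ b.label = a.label ∧ m = {(i, s)} + {(j, t)} + r ∧
    m' = A.sing i a.next + A.sing j b.next + r

/-- Every step of an implementation is a communication of the protocol. -/
theorem Impl.step (hν : Function.Injective ν) {M N : Sess0} (h : SStep M N)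
    {m : Multiset (Fin n × S)} (hM : A.Impl ν w M m) :
    ∃ m', MStep A w m m' ∧ A.Impl ν w N m' := by
  induction h generalizing m with
  | comm p q l x c pre P pre' Q i j hi hj =>
    cases hM with
    | par h1 h2 =>
    cases h1 with
    | idle _ h => exact absurd h.shape_eq (by simp [Proc.shape])
    | @loc _ a s hs h1 =>
    cases h2 with
    | idle _ h => exact absurd h.shape_eq (by simp [Proc.shape])
    | @loc _ b t ht h2 =>
    obtain ⟨h1, f1⟩ := h1
    obtain ⟨h2, f2⟩ := h2
    cases h1 with
    | choice _ _ g g1 g2 g3 g4 =>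
    cases h2 with
    | choice _ _ k k1 k2 k3 k4 =>
    have e1 : (g i).send = false ∧ ν (w a (g i).port) = ν b ∧ (g i).label = l := by
      rcases g3 i with ⟨d, _, h⟩ | ⟨y, hy, h⟩
      · rw [hi] at h; cases h
      · rw [hi, Prefix.inp.injEq] at h; exact ⟨hy, h.1.symm, h.2.1.symm⟩
    have e2 : (k j).send = true ∧ ν (w b (k j).port) = ν a ∧ (k j).label = l := by
      rcases k3 j with ⟨d, hd, h⟩ | ⟨y, hy, h⟩
      · rw [hj, Prefix.out.injEq] at h; exact ⟨hd, h.1.symm, h.2.1.symm⟩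
      · rw [hj] at h; cases h
    have f1' : ((P i).subst x c).fv = ∅ := by
      refine Set.eq_empty_of_subset_empty ((fv_subst x c (P i)).trans ?_)
      rw [← f1]
      refine fun z hz => Set.mem_iUnion.2 ⟨i, .inr ?_⟩
      simpa [hi, Prefix.bv] using hz
    have f2' : (Q j).fv = ∅ := by
      refine Set.eq_empty_of_subset_empty ?_
      rw [← f2]
      refine fun z hz => Set.mem_iUnion.2 ⟨j, .inr ?_⟩
      simpa [hj, Prefix.bv] using hz
    refine ⟨A.sing a (g i).next + A.sing b (k j).next, ⟨b, a, t, s, k j, g i, 0, k1 j, g1 i,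
      e2.1, e1.1, hν e2.2.1, hν e1.2.1, e1.2.2.trans e2.2.2.symm, ?_, ?_⟩, ?_⟩
    · rw [add_zero, add_comm]
    · rw [add_zero, add_comm]
    · exact .par (.sing ⟨(g4 i).subst x c, f1'⟩) (.sing ⟨k4 j, f2'⟩)
  | ifTrue p P Q =>
    cases hM with
    | idle _ h => exact absurd h.shape_eq (by simp [Proc.shape])
    | loc _ h => cases h.1
  | ifFalse p P Q =>
    cases hM with
    | idle _ h => exact absurd h.shape_eq (by simp [Proc.shape])
    | loc _ h => cases h.1
  | par L _ ih =>
    cases hM with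
    | @par _ _ m1 m2 h1 h2 =>
    obtain ⟨m', ⟨i, j, s, t, a, b, r, h3, h4, h5, h6, h7, h8, h9, rfl, rfl⟩, hN⟩ := ih h1
    exact ⟨_, ⟨i, j, s, t, a, b, r + m2, h3, h4, h5, h6, h7, h8, h9, add_assoc _ _ _, rfl⟩,
      by rw [← add_assoc]; exact .par hN h2⟩
  | cong h1 _ h2 ih =>
    obtain ⟨m', h, h'⟩ := ih ((impl_cong h1 _).1 hM)
    exact ⟨m', h, (impl_cong h2 _).1 h'⟩

theorem SCong.parR {u : Bool} {M N : Sess0} (L : Sess0) (h : SCong u M N) :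
    SCong u (.par L M) (.par L N) :=
  (SCong.comm _ _).trans ((SCong.par L h).trans (.comm _ _))

/-- The process of a participant can be brought to the front of the session. -/
theorem Impl.extract {M : Sess0} {m m' : Multiset (Fin n × S)} (h : A.Impl ν w M m) {i : Fin n}
    {s : S} (hm : m = {(i, s)} + m') :
    ∃ P M', SCong true M (.par (.loc (ν i) P) M') ∧ A.Closed (ν ∘ w i) P s ∧
      A.Impl ν w M' m' := by
  induction h generalizing m' with
  | idle p h => exact absurd (congrArg Multiset.card hm) (by simp)
  | @loc P j t hd h =>
    have h0 : m' = 0 := by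
      have := congrArg Multiset.card hm
      simp only [Multiset.card_singleton, Multiset.card_add] at this
      exact Multiset.card_eq_zero.1 (by omega)
    subst h0
    have : (j, t) = (i, s) := by simpa using hm
    cases this
    exact ⟨P, .loc 0 .nil, ((SCong.comm _ _).trans (.nil 0 _)).symm, h, .idle _ (.refl _)⟩
  | @par M N m1 m2 h1 h2 ih1 ih2 =>
    have : (i, s) ∈ m1 + m2 := by rw [hm]; simp
    rcases Multiset.mem_add.1 this with h | h
    · obtain ⟨r, hr⟩ := Multiset.exists_cons_of_mem h
      obtain ⟨P, M', c1, c2, c3⟩ := ih1 (m' := r) (by rw [hr, Multiset.singleton_add])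
      refine ⟨P, .par M' N, (SCong.par _ c1).trans (.assoc _ _ _), c2, ?_⟩
      have : m' = r + m2 := by
        rw [hr, ← Multiset.singleton_add, add_assoc] at hm
        exact (add_left_cancel hm).symm
      rw [this]; exact .par c3 h2
    · obtain ⟨r, hr⟩ := Multiset.exists_cons_of_mem h
      obtain ⟨P, M', c1, c2, c3⟩ := ih2 (m' := r) (by rw [hr, Multiset.singleton_add])
      refine ⟨P, .par M' M, (SCong.comm _ _).trans ((SCong.par _ c1).trans (.assoc _ _ _)), c2, ?_⟩
      have : m' = r + m1 := by
        rw [hr, ← Multiset.singleton_add, add_comm, add_assoc] at hm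
        exact (add_left_cancel hm).symm
      rw [this]; exact .par c3 h1

theorem Closed.exists_choice {P : Proc0} {s : S} (h : A.Closed ρ P s) {a : Summand κ S}
    (ha : a ∈ A.acts s) :
    ∃ (n : ℕ) (pre : Fin (n + 1) → Prefix) (R : Fin (n + 1) → Proc0) (i : Fin (n + 1)),
      PCong true P (.choice pre R) ∧ A.Real ρ (R i) a.next ∧ (R i).fv ⊆ (pre i).bv ∧
      ((∃ c, a.send = true ∧ pre i = .out (ρ a.port) a.label (.const c)) ∨
        ∃ x, a.send = false ∧ pre i = .inp (ρ a.port) a.label x) := by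
  obtain ⟨Q, h1, h2, rfl | rfl | ⟨n, pre, R, rfl⟩⟩ := h.exists_head
  · cases h2.1 with
    | nil h => simp [h] at ha
  · cases h2.1 with
    | tick h => simp [h] at ha
  · obtain ⟨h2, h3⟩ := h2
    cases h2 with
    | choice _ _ g g1 g2 g3 g4 =>
      obtain ⟨i, rfl⟩ := g2 a ha
      refine ⟨n, pre, R, i, h1, g4 i, fun z hz => ?_, g3 i⟩
      by_contra hb
      have : z ∈ (Proc.choice pre R).fv := Set.mem_iUnion.2 ⟨i, .inr ⟨hz, hb⟩⟩
      rw [h3] at this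
      exact this

/-- Every communication of the protocol is a step of the implementation. -/
theorem Impl.progress {M : Sess0} {m m' : Multiset (Fin n × S)} (hM : A.Impl ν w M m)
    (h : MStep A w m m') : ∃ N, SStep M N ∧ A.Impl ν w N m' := by
  obtain ⟨i, j, s, t, a, b, r, ha, hb, sa, sb, wi, wj, hl, rfl, rfl⟩ := h
  obtain ⟨P, M1, c1, k1, hM⟩ := hM.extract (by rw [add_assoc])
  obtain ⟨Q, M2, c2, k2, hM⟩ := hM.extract rfl
  obtain ⟨_, pre, R, y, d1, r1, f1, ⟨c, _, e1⟩ | ⟨_, h, _⟩⟩ := k1.exists_choice ha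
  swap
  · simp [sa] at h
  obtain ⟨_, pre', R', y', d2, r2, f2, ⟨_, h, _⟩ | ⟨x, _, e2⟩⟩ := k2.exists_choice hb
  · simp [sb] at h
  have step := SStep.comm (ν j) (ν i) a.label x c pre' R' pre R y' y
    (by simp [e2, wj, hl]) (by simp [e1, wi])
  refine ⟨_, .cong ?_ (.par M2 step) (.refl _), ?_⟩
  · refine c1.trans ((SCong.parR _ c2).trans ?_)
    refine (SCong.assoc _ _ _).symm.trans (.par _ ?_)
    exact (SCong.comm _ _).trans ((SCong.par _ (.loc _ d2)).trans (SCong.parR _ (.loc _ d1)))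
  · rw [add_comm (A.sing i a.next)]
    refine .par (.par (.sing ⟨r2.subst x c, ?_⟩) (.sing ⟨r1, ?_⟩)) hM
    · refine Set.eq_empty_of_subset_empty ((fv_subst x c _).trans ?_)
      rw [e2] at f2
      exact (Set.sdiff_subset_sdiff_left f2).trans (by simp [Prefix.bv])
    · rw [e1] at f1
      exact Set.eq_empty_of_subset_empty f1

/-- An implementation all of whose states are terminated is a composition of terminated participants. -/
theorem Impl.done {M : Sess0} {m : Multiset (Fin n × S)} (hM : A.Impl ν w M m)
    (h : ∀ a ∈ m, A.acts a.2 = []) : ∃ N, SCong true M N ∧ AllDone N := by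
  induction hM with
  | idle p hP => exact ⟨_, .loc p hP, by simp [AllDone, Sess.locs]⟩
  | @loc P i s _ hc =>
    refine ⟨_, .loc _ (hc.cong_of_acts_eq_nil (h (i, s) (by simp))), ?_⟩
    cases A.tick s <;> simp [AllDone, Sess.locs]
  | par _ _ ih1 ih2 =>
    obtain ⟨N1, c1, d1⟩ := ih1 fun a ha => h a (Multiset.mem_add.2 (.inl ha))
    obtain ⟨N2, c2, d2⟩ := ih2 fun a ha => h a (Multiset.mem_add.2 (.inr ha))
    refine ⟨.par N1 N2, (SCong.par _ c1).trans (SCong.parR _ c2), fun l hl => ?_⟩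
    simp only [Sess.locs, List.mem_append] at hl
    exact hl.elim (d1 l) (d2 l)

theorem Impl.success_iff {M : Sess0} {m : Multiset (Fin n × S)} (hM : A.Impl ν w M m) :
    M.Success ↔ ∃ a ∈ m, A.acts a.2 = [] ∧ A.tick a.2 = true := by
  induction hM with
  | idle p h => simp [Sess.Success, Sess.locs, Proc.success_iff, h.shape_eq, Proc.shape]
  | @loc P i s hd hc =>
    obtain ⟨Q, h1, h2, rfl | rfl | ⟨n, pre, R, rfl⟩⟩ := hc.exists_head
    · cases h2.1 with
      | nil ha ht => simp [isDead, ha, ht] at hd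
    · cases h2.1 with
      | tick ha ht =>
        simp [Sess.Success, Sess.locs, Proc.success_iff, h1.shape_eq, Proc.shape, ha, ht]
    · cases h2.1 with
      | choice _ _ g hg =>
        simp only [Sess.Success, Sess.locs, Proc.success_iff, List.mem_singleton, exists_eq_left,
          h1.shape_eq, Proc.shape, Multiset.mem_singleton]
        refine ⟨fun h => (by cases h), fun h => ?_⟩
        have := hg 0
        simp [h.1] at this
  | par _ _ ih1 ih2 =>
    rw [Sess.success_par, ih1, ih2]
    simp [or_and_right, exists_or]

end Protocol

namespace Protocol

variable {κ S : Type} {A : Protocol κ S} {n : ℕ} {ν : Fin n → Part} {w : Fin n → κ → Fin n}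

/-! ### Global states of a protocol -/

variable (A) in
/-- The global states that are reached from `c` by one communication, where the port `k` of
participant `i` is connected to participant `w i k`. -/
def next (w : Fin n → κ → Fin n) (c : Fin n → S) : List (Fin n → S) :=
  (List.finRange n).flatMap fun i => (A.acts (c i)).flatMap fun a =>
    if a.send && decide (w i a.port ≠ i) then
      (A.acts (c (w i a.port))).flatMap fun b =>
        if !b.send && decide (w (w i a.port) b.port = i) && decide (b.label = a.label) then
          [Function.update (Function.update c i a.next) (w i a.port) b.next]
        else []
    else []

theorem mem_next {c c' : Fin n → S} : c' ∈ A.next w c ↔ ∃ i a b, a ∈ A.acts (c i) ∧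
    b ∈ A.acts (c (w i a.port)) ∧ a.send = true ∧ b.send = false ∧ w i a.port ≠ i ∧
    w (w i a.port) b.port = i ∧ b.label = a.label ∧
    c' = Function.update (Function.update c i a.next) (w i a.port) b.next := by
  simp only [next, List.mem_flatMap, List.mem_finRange, true_and]
  constructor
  · rintro ⟨i, a, ha, h⟩
    split at h
    · next h1 =>
      simp only [Bool.and_eq_true, decide_eq_true_eq] at h1
      obtain ⟨b, hb, h⟩ := List.mem_flatMap.1 h
      split at h
      · next h2 =>
        simp only [Bool.and_eq_true, decide_eq_true_eq, Bool.not_eq_true'] at h2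
        exact ⟨i, a, b, ha, hb, h1.1, h2.1.1, h1.2, h2.1.2, h2.2, by simpa using h⟩
      · simp at h
    · simp at h
  · rintro ⟨i, a, b, ha, hb, h1, h2, h3, h4, h5, rfl⟩
    refine ⟨i, a, ha, ?_⟩
    rw [if_pos (by simp [h1, h3])]
    refine List.mem_flatMap.2 ⟨b, hb, ?_⟩
    rw [if_pos (by simp [h2, h4, h5])]
    simp

/-- Reachability of global states. -/
def Reach (A : Protocol κ S) (w : Fin n → κ → Fin n) : (Fin n → S) → (Fin n → S) → Prop :=
  Relation.ReflTransGen fun c c' => c' ∈ A.next w c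

variable (A) in
/-- All runs from `c` are shorter than `f` and their states satisfy `p`. -/
def run (w : Fin n → κ → Fin n) (p : (Fin n → S) → Bool) : ℕ → (Fin n → S) → Bool
  | 0, _ => false
  | f + 1, c => p c && (A.next w c).all (run w p f)

theorem run_iff {p : (Fin n → S) → Bool} {f : ℕ} {c : Fin n → S} :
    A.run w p (f + 1) c = true ↔ p c = true ∧ ∀ c' ∈ A.next w c, A.run w p f c' = true := by
  simp [run]

/-- A bounded exploration decides properties of all reachable global states. -/
theorem run_sound {p : (Fin n → S) → Bool} {f : ℕ} {c c' : Fin n → S} (h : A.run w p f c = true)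
    (hc : A.Reach w c c') : p c' = true ∧ ∃ f, A.run w p f c' = true := by
  induction hc with
  | refl =>
    cases f with
    | zero => simp [run] at h
    | succ f => exact ⟨(run_iff.1 h).1, _, h⟩
  | tail _ hs ih =>
    obtain ⟨_, f, h⟩ := ih
    cases f with
    | zero => simp [run] at h
    | succ f =>
      have h' := (run_iff.1 h).2 _ hs
      cases f with
      | zero => simp [run] at h'
      | succ f => exact ⟨(run_iff.1 h').1, _, h'⟩

theorem run_acc {p : (Fin n → S) → Bool} {f : ℕ} {c : Fin n → S} (h : A.run w p f c = true) :
    Acc (fun c' c => c' ∈ A.next w c) c := by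
  induction f generalizing c with
  | zero => simp [run] at h
  | succ f ih => exact ⟨_, fun c' hc => ih ((run_iff.1 h).2 c' hc)⟩

/-! ### Global states and sessions -/

variable (A) in
/-- The multiset of the participants with their states. -/
def conf (c : Fin n → S) : Multiset (Fin n × S) := ∑ i, A.sing i (c i)

theorem conf_eq {i j : Fin n} (h : j ≠ i) (c : Fin n → S) :
    A.conf c = A.sing i (c i) + (A.sing j (c j) +
      ∑ k ∈ (Finset.univ.erase i).erase j, A.sing k (c k)) := by
  rw [Finset.add_sum_erase _ (fun k => A.sing k (c k)) (by simp [h]),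
    Finset.add_sum_erase _ (fun k => A.sing k (c k)) (by simp), conf]

theorem conf_update {i j : Fin n} (h : j ≠ i) (c : Fin n → S) (s t : S) :
    A.conf (Function.update (Function.update c i s) j t) = A.sing i s + (A.sing j t +
      ∑ k ∈ (Finset.univ.erase i).erase j, A.sing k (c k)) := by
  rw [conf_eq h]
  congr 2
  · simp [h.symm]
  · simp
  · refine Finset.sum_congr rfl fun k hk => ?_
    simp only [Finset.mem_erase, Finset.mem_univ, and_true] at hk
    simp [hk.1, hk.2]

theorem mem_sum_sing {c : Fin n → S} {u : Finset (Fin n)} {a : Fin n × S} :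
    a ∈ ∑ k ∈ u, A.sing k (c k) ↔ a.1 ∈ u ∧ a.2 = c a.1 ∧ A.isDead (c a.1) = false := by
  rw [Multiset.mem_sum]
  constructor
  · rintro ⟨k, hk, h⟩
    unfold sing at h
    split at h
    · simp at h
    · next hd =>
      simp only [Multiset.mem_singleton] at h
      subst h
      exact ⟨hk, rfl, by simpa using hd⟩
  · rintro ⟨h1, h2, h3⟩
    refine ⟨a.1, h1, ?_⟩
    simp only [sing, h3]
    simp [← h2]

theorem sing_eq {i : Fin n} {s : S} {a : Summand κ S} (h : a ∈ A.acts s) :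
    A.sing i s = {(i, s)} := by
  have : A.isDead s ≠ true := fun hd => by simp [(isDead_iff.1 hd).1] at h
  simp [sing, this]

theorem mstep_conf {c : Fin n → S} {m' : Multiset (Fin n × S)} :
    MStep A w (A.conf c) m' ↔ ∃ c' ∈ A.next w c, m' = A.conf c' := by
  constructor
  · rintro ⟨i, j, s, t, a, b, r, ha, hb, sa, sb, wi, wj, hl, hm, rfl⟩
    have hi : (i, s) ∈ A.conf c := by rw [hm]; simp
    obtain ⟨-, hs, hd⟩ := mem_sum_sing.1 hi
    dsimp only at hs hd
    subst hs
    have h1 : A.conf c = {(i, c i)} + ∑ k ∈ Finset.univ.erase i, A.sing k (c k) := by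
      rw [← sing_eq (i := i) ha, Finset.add_sum_erase _ (fun k => A.sing k (c k)) (by simp), conf]
    rw [h1, add_assoc] at hm
    have h2 := add_left_cancel hm
    have hj : (j, t) ∈ ∑ k ∈ Finset.univ.erase i, A.sing k (c k) := by rw [h2]; simp
    obtain ⟨hji, ht, -⟩ := mem_sum_sing.1 hj
    dsimp only at ht hji
    subst ht
    have hji : j ≠ i := (Finset.mem_erase.1 hji).1
    have h3 : r = ∑ k ∈ (Finset.univ.erase i).erase j, A.sing k (c k) := by
      rw [← Finset.add_sum_erase _ (fun k => A.sing k (c k)) (by simp [hji] : j ∈ _),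
        sing_eq (i := j) hb] at h2
      exact (add_left_cancel h2).symm
    subst wi
    refine ⟨_, mem_next.2 ⟨i, a, b, ha, hb, sa, sb, hji, wj, hl, rfl⟩, ?_⟩
    rw [conf_update hji, h3, add_assoc]
  · rintro ⟨c', hc, rfl⟩
    obtain ⟨i, a, b, ha, hb, sa, sb, hji, wj, hl, rfl⟩ := mem_next.1 hc
    refine ⟨i, _, _, _, a, b, ∑ k ∈ (Finset.univ.erase i).erase (w i a.port), A.sing k (c k), ha,
      hb, sa, sb, rfl, wj, hl, ?_, ?_⟩
    · rw [conf_eq hji, sing_eq (i := i) ha, sing_eq (i := w i a.port) hb, add_assoc]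
    · rw [conf_update hji, add_assoc]

/-- A session all of whose reducts are described by the global states reachable from `c`. -/
def Runs (A : Protocol κ S) (ν : Fin n → Part) (w : Fin n → κ → Fin n) (M : Sess0)
    (c : Fin n → S) : Prop := A.Impl ν w M (A.conf c)

theorem Runs.steps (hν : Function.Injective ν) {M N : Sess0} {c : Fin n → S}
    (hM : A.Runs ν w M c) (h : Relation.ReflTransGen SStep M N) :
    ∃ c', A.Reach w c c' ∧ A.Runs ν w N c' := by
  induction h with
  | refl => exact ⟨c, .refl, hM⟩
  | tail _ hs ih =>
    obtain ⟨c1, h1, h2⟩ := ih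
    obtain ⟨m', h3, h4⟩ := h2.step hν hs
    obtain ⟨c2, h5, rfl⟩ := mstep_conf.1 h3
    exact ⟨c2, h1.tail h5, h4⟩

theorem Runs.progress {M : Sess0} {c c' : Fin n → S} (hM : A.Runs ν w M c)
    (h : c' ∈ A.next w c) : ∃ N, SStep M N ∧ A.Runs ν w N c' :=
  Impl.progress hM (mstep_conf.2 ⟨c', h, rfl⟩)

variable (A) in
/-- Some participant has terminated with success. -/
def hasTick (c : Fin n → S) : Bool :=
  (List.finRange n).any fun i => (A.acts (c i)).isEmpty && A.tick (c i)

theorem Runs.success_iff {M : Sess0} {c : Fin n → S} (hM : A.Runs ν w M c) :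
    M.Success ↔ A.hasTick c = true := by
  rw [Impl.success_iff hM]
  simp only [hasTick, List.any_eq_true, List.mem_finRange, true_and, Bool.and_eq_true,
    List.isEmpty_iff]
  constructor
  · rintro ⟨a, ha, h⟩
    obtain ⟨-, h2, -⟩ := mem_sum_sing.1 ha
    rw [h2] at h
    exact ⟨a.1, h⟩
  · rintro ⟨i, h⟩
    exact ⟨(i, c i), mem_sum_sing.2 ⟨by simp, rfl, by simp [isDead, h.2]⟩, h⟩

theorem Runs.acc (hν : Function.Injective ν) {M : Sess0} {c : Fin n → S} (hM : A.Runs ν w M c)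
    (hc : Acc (fun c' c => c' ∈ A.next w c) c) : Acc (fun N M => SStep M N) M := by
  induction hc generalizing M with
  | intro c _ ih =>
    refine ⟨_, fun N hN => ?_⟩
    obtain ⟨m', h3, h4⟩ := Impl.step hν hN hM
    obtain ⟨c', h5, rfl⟩ := mstep_conf.1 h3
    exact ih c' h5 h4

variable (A) in
/-- Whenever `i` may send to `j` while `j` may receive from `i`, every message that `i` may send to
`j` is expected. -/
def safeConf (w : Fin n → κ → Fin n) (c : Fin n → S) : Bool :=
  (List.finRange n).all fun i => (A.acts (c i)).all fun a =>
    !a.send || (A.acts (c (w i a.port))).all fun b =>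
      b.send || !decide (w (w i a.port) b.port = i) ||
        (A.acts (c (w i a.port))).any fun b' =>
          !b'.send && decide (w (w i a.port) b'.port = i) && decide (b'.label = a.label)

variable (A) in
/-- Safety and deadlock-freedom of a global state. -/
def goodConf (w : Fin n → κ → Fin n) (c : Fin n → S) : Bool :=
  A.safeConf w c &&
    (!(A.next w c).isEmpty || (List.finRange n).all fun i => (A.acts (c i)).isEmpty)

theorem Runs.deadlockFree (hν : Function.Injective ν) {M : Sess0} {c : Fin n → S} {f : ℕ}
    (hM : A.Runs ν w M c) (h : A.run w (A.goodConf w) f c = true) : DeadlockFree M := by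
  intro N hN
  obtain ⟨c', h1, h2⟩ := hM.steps hν hN
  have h3 := (run_sound h h1).1
  simp only [goodConf, Bool.and_eq_true, Bool.or_eq_true, Bool.not_eq_true', List.all_eq_true,
    List.mem_finRange, true_implies, List.isEmpty_iff] at h3
  rcases h3.2 with h3 | h3
  · obtain ⟨c'', hc⟩ := List.exists_mem_of_ne_nil (A.next w c') (fun h => by simp [h] at h3)
    obtain ⟨N', hN', _⟩ := h2.progress hc
    exact .inr ⟨N', hN'⟩
  · refine .inl (Impl.done h2 fun a ha => ?_)
    rw [(mem_sum_sing.1 ha).2.1]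
    exact h3 _

/-! ### Types of finite protocols -/

theorem act_ty {ρ : κ → Part} {f : ℕ} {s : S} {a : LAct} {T : LType}
    (h : (A.ty ρ f s).Act a T) : ∃ f' b, f = f' + 1 ∧ b ∈ A.acts s ∧ a = lact ρ b ∧
      T = A.ty ρ f' b.next := by
  cases f with
  | zero => cases h
  | succ f =>
    unfold ty at h
    split at h
    · cases h
    · next b bs hb =>
      cases h with
      | choice _ _ i => exact ⟨f, _, rfl, by rw [hb]; exact List.get_mem _ _, rfl, rfl⟩

theorem ty_act {ρ : κ → Part} {f : ℕ} {s : S} {b : Summand κ S} (hb : b ∈ A.acts s) :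
    ∃ T, (A.ty ρ (f + 1) s).Act (lact ρ b) T := by
  unfold ty
  split
  · next h => simp [h] at hb
  · next a as h =>
    rw [h] at hb
    obtain ⟨i, rfl⟩ := List.get_of_mem hb
    exact ⟨_, .choice _ _ i⟩

theorem Bounded.next [DecidableEq κ] {f : ℕ} {s : S} (h : A.Bounded (f + 1) s = true)
    {a : Summand κ S} (ha : a ∈ A.acts s) : A.Bounded f a.next = true := by
  simp only [Bounded, Bool.and_eq_true, List.all_eq_true] at h
  exact h.2 a ha

theorem ty_wf [DecidableEq κ] {ρ : κ → Part} (hρ : Function.Injective ρ) {f : ℕ} {s : S}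
    (h : A.Bounded f s = true) : (A.ty ρ f s).WF := by
  induction f generalizing s with
  | zero => simp [Bounded] at h
  | succ f ih =>
    unfold ty
    split
    · trivial
    · next a as hs =>
      refine ⟨fun i j hij => ?_, fun i => ih (Bounded.next h ?_)⟩
      · simp only [Bounded, Bool.and_eq_true, decide_eq_true_eq, hs] at h
        have h1 := h.1
        rw [List.nodup_iff_injective_get] at h1
        have hlen : (List.map (fun a : Summand κ S => (a.port, a.send, a.label))
          (a :: as)).length = as.length + 1 := by simp
        have := @h1 (i.cast hlen.symm) (j.cast hlen.symm) (by
          simp only [lact, Prod.mk.injEq] at hij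
          simp only [List.get_eq_getElem, List.getElem_map, Fin.val_cast, Prod.mk.injEq]
          refine ⟨hρ hij.1, ?_, hij.2.2⟩
          have h2 := hij.2.1
          simp only [List.get_eq_getElem] at h2
          generalize ((a :: as)[(i : ℕ)]).send = x at h2 ⊢
          generalize ((a :: as)[(j : ℕ)]).send = y at h2 ⊢
          cases x <;> cases y <;> simp_all)
        exact Fin.ext (by simpa using congrArg Fin.val this)
      · rw [hs]; exact List.get_mem _ _

theorem pref_eq (ρ : κ → Part) (a : Summand κ S) :
    (pref ρ a).partner = (lact ρ a).partner ∧ (pref ρ a).pol = (lact ρ a).pol ∧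
      (pref ρ a).label = (lact ρ a).label := by
  simp only [pref, lact]
  split <;> simp [Prefix.partner, Prefix.pol, Prefix.label]

theorem proc_typed [DecidableEq κ] {ρ : κ → Part} (hρ : Function.Injective ρ) {f : ℕ} {s : S}
    (h : A.Bounded f s = true) (G : Name → Option Pay) (E : Name → Option LType) :
    PTyped G E (A.proc ρ f s) (A.ty ρ f s) := by
  induction f generalizing s G with
  | zero => simp [Bounded] at h
  | succ f ih =>
    have hw := ty_wf (A := A) hρ h
    unfold ty at hw ⊢
    unfold proc
    split at hw
    · next hs =>
      split
      · exact .tick _ _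
      · exact .nil _ _
    · next a as hs =>
      have hn : ∀ i : Fin (as.length + 1), A.Bounded f ((a :: as).get i).next = true :=
        fun i => Bounded.next h (by rw [hs]; exact List.get_mem _ _)
      refine .choice _ _ _ _ id hw Function.surjective_id (fun i => ?_) (fun i p l v hi => ?_)
        (fun i p l v _ => ih (hn i) G) (fun i p l x _ => ih (hn i) _)
      · exact pref_eq _ _
      · simp only [pref] at hi
        split at hi
        · cases hi; exact .bool _
        · cases hi

open Classical in
variable (A ν w) in
/-- The local context of a global state. -/
noncomputable def ctx (f : ℕ) (c : Fin n → S) : LCtx := fun p =>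
  if h : ∃ i, ν i = p then A.ty (ν ∘ w h.choose) f (c h.choose) else .fin

theorem ctx_apply (hν : Function.Injective ν) (f : ℕ) (c : Fin n → S) (i : Fin n) :
    A.ctx ν w f c (ν i) = A.ty (ν ∘ w i) f (c i) := by
  have h : ∃ j, ν j = ν i := ⟨i, rfl⟩
  simp only [ctx, dif_pos h, hν h.choose_spec]

/-- The local context types the global state, where the types may be cut off at different
depths. -/
def Typing [DecidableEq κ] (A : Protocol κ S) (ν : Fin n → Part) (w : Fin n → κ → Fin n)
    (D : LCtx) (c : Fin n → S) : Prop :=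
  (∀ i, ∃ f, A.Bounded f (c i) = true ∧ D (ν i) = A.ty (ν ∘ w i) f (c i)) ∧
    ∀ p, (∀ i, ν i ≠ p) → D p = .fin

theorem Typing.act [DecidableEq κ] {D : LCtx} {c : Fin n → S} (h : Typing A ν w D c) {p : Part}
    {a : LAct} {T : LType} (ha : (D p).Act a T) : ∃ i f b, p = ν i ∧
      A.Bounded (f + 1) (c i) = true ∧ b ∈ A.acts (c i) ∧
      a = lact (ν ∘ w i) b ∧ T = A.ty (ν ∘ w i) f b.next := by
  by_cases hp : ∃ i, ν i = p
  · obtain ⟨i, rfl⟩ := hp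
    obtain ⟨f, hf, h2⟩ := h.1 i
    rw [h2] at ha
    obtain ⟨f', b, rfl, hb, h3, h4⟩ := act_ty ha
    exact ⟨i, f', b, rfl, hf, hb, h3, h4⟩
  · rw [h.2 p (not_exists.1 hp)] at ha
    cases ha

/-- Steps of the local context are communications of the protocol. -/
theorem Typing.step [DecidableEq κ] (hν : Function.Injective ν) {D E : LCtx} {c : Fin n → S}
    (h : Typing A ν w D c) (hs : LStep D E) : ∃ c' ∈ A.next w c, Typing A ν w E c' := by
  cases hs with
  | comm p q l U T T' hpq h1 h2 =>
    obtain ⟨i, f, a, rfl, hf, ha, ea, rfl⟩ := h.act h1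
    obtain ⟨j, g, b, rfl, hg, hb, eb, rfl⟩ := h.act h2
    simp only [lact, LAct.mk.injEq, Function.comp] at ea eb
    have sa : a.send = true := by
      by_contra hn; simp [hn] at ea
    have sb : b.send = false := by
      by_contra hn; simp [hn] at eb
    have wi : w i a.port = j := (hν ea.2.1).symm
    have wj : w j b.port = i := (hν eb.2.1).symm
    have hji : j ≠ i := fun h => hpq (by rw [h])
    subst wi
    refine ⟨_, mem_next.2 ⟨i, a, b, ha, hb, sa, sb, hji, wj, eb.2.2.1.symm.trans ea.2.2.1, rfl⟩,
      fun k => ?_, fun p hp => ?_⟩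
    · by_cases hk : k = w i a.port
      · subst hk
        exact ⟨g, by simpa using Bounded.next hg hb, by simp⟩
      · by_cases hk' : k = i
        · subst hk'
          exact ⟨f, by simpa [hk] using Bounded.next hf ha, by simp [hν.ne hk, hk]⟩
        · obtain ⟨e, he⟩ := h.1 k
          exact ⟨e, by simpa [hk, hk'] using he.1, by simpa [hk, hk', hν.ne hk, hν.ne hk'] using he.2⟩
    · rw [Function.update_of_ne (hp _).symm, Function.update_of_ne (hp _).symm]
      exact h.2 p hp

theorem Typing.safe [DecidableEq κ] (hν : Function.Injective ν) {D : LCtx} {c : Fin n → S} {f : ℕ}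
    (h : Typing A ν w D c) (hr : A.run w (A.goodConf w) f c = true) : Safe D := by
  intro E hE
  have : ∃ c', A.Reach w c c' ∧ Typing A ν w E c' := by
    induction hE with
    | refl => exact ⟨c, .refl, h⟩
    | tail _ hs ih =>
      obtain ⟨c1, h1, h2⟩ := ih
      obtain ⟨c2, h3, h4⟩ := h2.step hν hs
      exact ⟨c2, h1.tail h3, h4⟩
  obtain ⟨c', hc, hE⟩ := this
  have hg := (run_sound hr hc).1
  simp only [goodConf, safeConf, Bool.and_eq_true, List.all_eq_true, List.mem_finRange,
    true_implies, Bool.or_eq_true, Bool.not_eq_true', List.any_eq_true, decide_eq_true_eq,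
    decide_eq_false_iff_not] at hg
  intro p q l l' U U' T T' _ h1 h2
  obtain ⟨i, f, a, rfl, hf, ha, ea, rfl⟩ := hE.act h1
  obtain ⟨j, g, b, rfl, hg', hb, eb, rfl⟩ := hE.act h2
  simp only [lact, LAct.mk.injEq, Function.comp] at ea eb
  have sa : a.send = true := by
    by_contra hn; simp [hn] at ea
  have sb : b.send = false := by
    by_contra hn; simp [hn] at eb
  have wi : w i a.port = j := (hν ea.2.1).symm
  have wj : w j b.port = i := (hν eb.2.1).symm
  subst wi
  obtain ⟨b', hb', ⟨h3, h4⟩, h5⟩ := ((hg.1 i a ha).resolve_left (by simp [sa]) b hb).resolve_left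
    (by simp [sb, wj])
  obtain ⟨e, he, hD⟩ := hE.1 (w i a.port)
  rw [hD]
  cases e with
  | zero => simp [Bounded] at he
  | succ e =>
    obtain ⟨T, hT⟩ := ty_act (f := e) (ρ := ν ∘ w (w i a.port)) hb'
    refine ⟨T, ?_⟩
    have : lact (ν ∘ w (w i a.port)) b' = ⟨.rcv, ν i, l, U⟩ := by
      simp only [lact, h3, Function.comp, h4, h5, ← ea.2.2.1, ea.2.2.2]
      simp
    rwa [← this]

/-! ### The session of a global state -/

variable (A ν w) in
/-- The parallel composition of the participants in a nonempty list. -/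
def sess (f : ℕ) (c : Fin n → S) : Fin n → List (Fin n) → Sess0
  | i, [] => .loc (ν i) (A.proc (ν ∘ w i) f (c i))
  | i, j :: js => .par (.loc (ν i) (A.proc (ν ∘ w i) f (c i))) (sess f c j js)

theorem locs_sess (f : ℕ) (c : Fin n → S) (i : Fin n) (is : List (Fin n)) :
    (A.sess ν w f c i is).locs =
      (i :: is).map fun i => (ν i, A.proc (ν ∘ w i) f (c i)) := by
  induction is generalizing i with
  | nil => rfl
  | cons j js ih => simp [sess, Sess.locs, ih]

theorem closed_proc [DecidableEq κ] {ρ : κ → Part} {f : ℕ} {s : S} (h : A.Bounded f s = true) :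
    A.Closed ρ (A.proc ρ f s) s := by
  refine ⟨real_proc h, ?_⟩
  clear h
  induction f generalizing s with
  | zero => rfl
  | succ f ih =>
    unfold proc
    split
    · split <;> rfl
    · simp only [Proc.fv, ih]
      simp only [Set.empty_sdiff, Set.union_empty, Set.iUnion_eq_empty]
      intro i
      simp only [pref]
      split <;> rfl

theorem runs_sess [DecidableEq κ] {f : ℕ} {c : Fin n → S} {i : Fin n} {is : List (Fin n)}
    (hb : ∀ i, A.Bounded f (c i) = true) (hd : (i :: is).Nodup)
    (hc : ∀ j, j ∉ i :: is → A.isDead (c j) = true) :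
    A.Runs ν w (A.sess ν w f c i is) c := by
  have key : ∀ i is, A.Impl ν w (A.sess ν w f c i is)
      ((i :: is).map fun i => A.sing i (c i)).sum := by
    intro i is
    induction is generalizing i with
    | nil => simpa [sess] using Impl.sing (closed_proc (hb i))
    | cons j js ih => exact .par (.sing (closed_proc (hb i))) (ih j)
  have h := key i is
  rw [← List.sum_toFinset _ hd] at h
  unfold Runs conf
  rwa [Finset.sum_subset (Finset.subset_univ _) fun j _ hj => ?_] at h
  simp only [List.mem_toFinset] at hj
  simp [sing, hc j hj]

/-- In every state each port is used for sending only or for receiving only. -/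
def Separate (A : Protocol κ S) : Prop :=
  ∀ s, ∀ a ∈ A.acts s, ∀ b ∈ A.acts s, a.port = b.port → a.send = b.send

theorem proc_guarded (ρ : κ → Part) (f : ℕ) (s : S) : (A.proc ρ f s).Guarded := by
  induction f generalizing s with
  | zero => trivial
  | succ f ih =>
    unfold proc
    split
    · split <;> trivial
    · exact fun i => ih _

theorem proc_choices (hA : A.Separate) {ρ : κ → Part} (hρ : Function.Injective ρ) (f : ℕ) (s : S) :
    (A.proc ρ f s).AllChoices Family.MSMP.Choice := by
  induction f generalizing s with
  | zero => trivial
  | succ f ih =>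
    unfold proc
    split
    · split <;> trivial
    · next a as hs =>
      refine ⟨fun i j hij => ?_, fun i => ih _⟩
      have hp : ∀ b : Summand κ S, (pref ρ b).partner = ρ b.port := by
        intro b; simp only [pref]; split <;> rfl
      rw [hp, hp] at hij
      have := hA s _ (by rw [hs]; exact List.get_mem (a :: as) i) _ (by rw [hs]; exact List.get_mem (a :: as) j)
        (hρ hij)
      simp only [pref, this]
      split <;> rfl

theorem isTerm_mixed {M : Sess0} (h : Family.MSMP.IsTerm M) : Family.MCMP.IsTerm M := by
  refine ⟨h.distinct, h.guarded, fun l hl => ?_, trivial, h.typed, h.deadlockFree⟩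
  have := h.choices l hl
  generalize l.2 = P at this
  clear hl
  induction P with
  | mu X P ih => exact ih this
  | choice pre P ih => exact ⟨trivial, fun i => ih i (this.2 i)⟩
  | cond v P Q ihP ihQ => exact ⟨ihP this.1, ihQ this.2⟩
  | _ => trivial

/-- The session of a protocol is a term of both source calculi if a bounded exploration confirms that
all reachable global states are safe and not deadlocked. -/
theorem isTerm_sess [DecidableEq κ] {F : Family} (hF : F = .MSMP ∨ F = .MCMP)
    (hν : Function.Injective ν) (hw : ∀ i, Function.Injective (w i)) (hA : A.Separate) {f f' : ℕ}
    {c : Fin n → S} {i : Fin n} {is : List (Fin n)}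
    (hb : ∀ i, A.Bounded f (c i) = true) (hd : (i :: is).Nodup)
    (hc : ∀ j, j ∉ i :: is → A.isDead (c j) = true)
    (hr : A.run w (A.goodConf w) f' c = true) : F.IsTerm (A.sess ν w f c i is) := by
  suffices h : Family.MSMP.IsTerm (A.sess ν w f c i is) by
    rcases hF with rfl | rfl
    exacts [h, isTerm_mixed h]
  have hρ : ∀ i, Function.Injective (ν ∘ w i) := fun i => hν.comp (hw i)
  have hl : ∀ l ∈ (A.sess ν w f c i is).locs, ∃ j, l = (ν j, A.proc (ν ∘ w j) f (c j)) := by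
    intro l hl
    rw [locs_sess] at hl
    obtain ⟨j, _, rfl⟩ := List.mem_map.1 hl
    exact ⟨j, rfl⟩
  refine ⟨?_, ?_, ?_, trivial, ⟨A.ctx ν w f c, ?_, ?_, ?_, ?_⟩, ?_⟩
  · rw [locs_sess, List.map_map]
    exact hd.map hν
  · intro l h
    obtain ⟨j, rfl⟩ := hl l h
    exact proc_guarded _ _ _
  · intro l h
    obtain ⟨j, rfl⟩ := hl l h
    exact proc_choices hA (hρ j) _ _
  · refine Typing.safe hν ⟨fun i => ⟨f, hb i, ctx_apply hν f c i⟩, fun p hp => ?_⟩ hr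
    simp only [ctx]
    rw [dif_neg (not_exists.2 hp)]
  · intro p
    simp only [ctx]
    split
    · exact ty_wf (hρ _) (hb _)
    · trivial
  · intro l h
    obtain ⟨j, rfl⟩ := hl l h
    rw [ctx_apply hν]
    exact proc_typed (hρ j) (hb j) _ _
  · intro p hp
    simp only [ctx]
    split
    · next h =>
      have h1 := h.choose_spec
      have h2 : h.choose ∉ i :: is := by
        intro hm
        apply hp
        rw [locs_sess, List.map_map]
        exact List.mem_map.2 ⟨_, hm, h1⟩
      have h3 := (isDead_iff.1 (hc _ h2)).1
      cases f with
      | zero => rfl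
      | succ f => unfold ty; rw [h3]
    · rfl
  · exact (runs_sess hb hd hc).deadlockFree hν hr

theorem map_proc (ρ : κ → Part) (r : ℕ → ℕ) (f : ℕ) (s : S) :
    (A.proc ρ f s).map r id id = A.proc (r ∘ ρ) f s := by
  induction f generalizing s with
  | zero => rfl
  | succ f ih =>
    unfold proc
    split
    · split <;> rfl
    · simp only [Proc.map, ih]
      congr 1
      funext i
      simp only [pref]
      split <;> rfl

end Protocol

open Protocol

/-! ### Leader election on rings -/

/-- The states of a participant in a ring. -/
inductive RingState where
  | start
  | gotLeft
  | sentRight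
  | lead
  | follow
  | await
  | odd
  | even
  | lose
  | win

namespace RingState

/-- The labels of the messages between neighbours. -/
def first : Label := 0
def second : Label := 1
def tellOdd : Label := 2
def tellEven : Label := 3

end RingState

open RingState

/-- The protocol of a participant in a ring, with the ports `false` to the left and `true` to the
right neighbour.  In the mixed choice of its initial state a participant sends to the right or
receives from the left.  On a ring of three participants these choices break the
symmetry in every run and some participant succeeds; on a ring of four participants no run
leads to success. -/
def ring : Protocol Bool RingState where
  acts
    | start => [⟨true, true, first, gotLeft⟩, ⟨false, false, first, sentRight⟩,
        ⟨false, false, second, sentRight⟩]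
    | sentRight => [⟨true, true, second, lead⟩]
    | gotLeft => [⟨false, false, first, lead⟩, ⟨false, false, second, follow⟩]
    | lead => [⟨false, false, tellOdd, even⟩, ⟨false, false, tellEven, odd⟩]
    | follow => [⟨true, true, tellOdd, await⟩]
    | await => [⟨false, false, tellEven, lose⟩, ⟨false, false, tellOdd, win⟩]
    | odd => [⟨true, true, tellOdd, lose⟩]
    | even => [⟨true, true, tellEven, lose⟩]
    | lose => []
    | win => []
  tick
    | win => true
    | _ => false

/-- The neighbours of a participant in the ring of `n` participants. -/
def ringWire (n : ℕ) [NeZero n] (i : Fin n) (k : Bool) : Fin n := if k then i + 1 else i - 1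

/-- The process of a participant with left neighbour `l` and right neighbour `r`. -/
def cell (l r : Part) : Proc0 := ring.proc (fun k => if k then r else l) 5 start

theorem cell_parts (l r : Part) : (cell l r).parts = {l, r} := by
  ext a
  simp [cell, ring, proc, Proc.parts, pref, Prefix.partner, Fin.exists_fin_succ]
  tauto

/-- The ring of the participants `ν 0`, `ν 1` and `ν 2`. -/
def ring3 (ν : ℕ → Part) : Sess0 :=
  .par (.loc (ν 0) (cell (ν 2) (ν 1)))
    (.par (.loc (ν 1) (cell (ν 0) (ν 2))) (.loc (ν 2) (cell (ν 1) (ν 0))))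

/-- The ring of the participants `ν 0`, `ν 1`, `ν 2` and `ν 3`. -/
def ring4 (ν : ℕ → Part) : Sess0 :=
  .par (.loc (ν 0) (cell (ν 3) (ν 1))) (.par (.loc (ν 1) (cell (ν 0) (ν 2)))
    (.par (.loc (ν 2) (cell (ν 1) (ν 3))) (.loc (ν 3) (cell (ν 2) (ν 0)))))

theorem cell_eq {n : ℕ} [NeZero n] (ν : ℕ → Part) (i : Fin n) :
    ring.proc ((fun i : Fin n => ν i) ∘ ringWire n i) 5 start =
      cell (ν (i - 1 : Fin n)) (ν (i + 1 : Fin n)) := by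
  unfold cell
  congr 1
  funext k
  cases k <;> rfl

theorem ring3_eq (ν : ℕ → Part) : ring3 ν =
    ring.sess (fun i : Fin 3 => ν i) (ringWire 3) 5 (fun _ => start) 0 [1, 2] := by
  simp only [sess, cell_eq]
  rfl

theorem ring4_eq (ν : ℕ → Part) : ring4 ν =
    ring.sess (fun i : Fin 4 => ν i) (ringWire 4) 5 (fun _ => start) 0 [1, 2, 3] := by
  simp only [sess, cell_eq]
  rfl

theorem ring_separate : ring.Separate := by
  rintro (_ | _) a ha b hb <;> revert a b <;> simp [ring]

theorem ring_bounded : ring.Bounded 5 start = true := by decide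

set_option maxRecDepth 100000 in
theorem ring3_isTerm {F : Family} (hF : F = .MSMP ∨ F = .MCMP) {ν : ℕ → Part}
    (hν : Function.Injective fun i : Fin 3 => ν i) : F.IsTerm (ring3 ν) := by
  rw [ring3_eq]
  -- The recursion depth 13 exceeds the length of every run of the two rings.
  refine isTerm_sess (f' := 13) hF hν ?_ ring_separate (fun _ => ring_bounded) (by decide) ?_ ?_
  · unfold Function.Injective; decide
  · decide
  · decide

set_option maxRecDepth 100000 in
theorem ring4_isTerm {F : Family} (hF : F = .MSMP ∨ F = .MCMP) {ν : ℕ → Part}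
    (hν : Function.Injective fun i : Fin 4 => ν i) : F.IsTerm (ring4 ν) := by
  rw [ring4_eq]
  refine isTerm_sess (f' := 13) hF hν ?_ ring_separate (fun _ => ring_bounded) (by decide) ?_ ?_
  · unfold Function.Injective; decide
  · decide
  · decide

theorem ring3_runs (ν : ℕ → Part) :
    ring.Runs (fun i : Fin 3 => ν i) (ringWire 3) (ring3 ν) fun _ => start := by
  rw [ring3_eq]
  exact runs_sess (fun _ => ring_bounded) (by decide) (by decide)

theorem ring4_runs (ν : ℕ → Part) :
    ring.Runs (fun i : Fin 4 => ν i) (ringWire 4) (ring4 ν) fun _ => start := by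
  rw [ring4_eq]
  exact runs_sess (fun _ => ring_bounded) (by decide) (by decide)

namespace Protocol

variable {κ S : Type} {A : Protocol κ S} {n : ℕ} {ν : Fin n → Part} {w : Fin n → κ → Fin n}

theorem Runs.not_maySucceed (hν : Function.Injective ν) {M : Sess0} {c : Fin n → S} {f : ℕ}
    (hM : A.Runs ν w M c) (h : A.run w (fun c => !A.hasTick c) f c = true) {N : Sess0}
    (hN : Relation.ReflTransGen SStep M N) : ¬ N.Success := by
  obtain ⟨c', h1, h2⟩ := hM.steps hν hN
  rw [h2.success_iff]
  simpa using (run_sound h h1).1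

theorem Runs.maySucceed (hν : Function.Injective ν) {M : Sess0} {c : Fin n → S} {f : ℕ}
    (hM : A.Runs ν w M c)
    (h : A.run w (fun c => !(A.next w c).isEmpty || A.hasTick c) f c = true) {N : Sess0}
    (hN : Relation.ReflTransGen SStep M N) :
    ∃ N', Relation.ReflTransGen SStep N N' ∧ N'.Success := by
  obtain ⟨c', h1, h2⟩ := hM.steps hν hN
  obtain ⟨-, g, hg⟩ := run_sound h h1
  clear h1 hN hM h
  induction g generalizing c' N with
  | zero => simp [run] at hg
  | succ g ih =>
    obtain ⟨h3, h4⟩ := run_iff.1 hg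
    simp only [Bool.or_eq_true, Bool.not_eq_true'] at h3
    rcases h3 with h3 | h3
    · obtain ⟨c'', hc⟩ := List.exists_mem_of_ne_nil (A.next w c') (fun h => by simp [h] at h3)
      obtain ⟨N', h5, h6⟩ := h2.progress hc
      obtain ⟨N'', h7, h8⟩ := ih _ h6 (h4 _ hc)
      exact ⟨N'', h7.head h5, h8⟩
    · exact ⟨N, .refl, h2.success_iff.2 h3⟩

end Protocol

set_option maxRecDepth 100000 in
theorem ring3_maySucceed {N : Sess0} (h : Relation.ReflTransGen SStep (ring3 id) N) :
    ∃ N', Relation.ReflTransGen SStep N N' ∧ N'.Success :=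
  (ring3_runs id).maySucceed (f := 13) Fin.val_injective (by decide) h

set_option maxRecDepth 100000 in
theorem ring4_not_success {N : Sess0} (h : Relation.ReflTransGen SStep (ring4 id) N) :
    ¬ N.Success :=
  (ring4_runs id).not_maySucceed (f := 13) Fin.val_injective (by decide) h

set_option maxRecDepth 100000 in
theorem ring3_acc : Acc (fun N M => SStep M N) (ring3 id) :=
  (ring3_runs id).acc Fin.val_injective
    (run_acc (p := fun _ => true) (f := 13) (by decide))

theorem cell_map (r : ℕ → ℕ) (a b : Part) : (cell a b).map r id id = cell (r a) (r b) := by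
  unfold cell
  rw [map_proc]
  congr 1
  funext k
  cases k <;> rfl

theorem ring3_rename (r : ℕ → ℕ) : (ring3 id).rename r = ring3 r := by
  simp [ring3, Sess.rename, cell_map]

theorem ring4_rename (r : ℕ → ℕ) : (ring4 id).rename r = ring4 r := by
  simp [ring4, Sess.rename, cell_map]

/-! ### Terminated sessions -/

/-- The protocol without communication. -/
def idle : Protocol Empty Bool where
  acts _ := []
  tick := id

/-- The terminated participant that has succeeded if `b = true`. -/
def halt (b : Bool) : Proc0 := if b then .tick else .nil

theorem idle_proc (ρ : Empty → Part) (b : Bool) : idle.proc ρ 1 b = halt b := by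
  cases b <;> rfl

theorem idle_bounded (b : Bool) : idle.Bounded 1 b = true := by
  cases b <;> rfl

theorem idle_isTerm {F : Family} (hF : F = .MSMP ∨ F = .MCMP) {n : ℕ} (c : Fin n → Bool)
    {i : Fin n} {is : List (Fin n)} (hd : (i :: is).Nodup) (hc : ∀ j, j ∈ i :: is) :
    F.IsTerm (idle.sess (fun i => i) (fun _ => Empty.elim) 1 c i is) := by
  refine isTerm_sess (f' := 1) hF Fin.val_injective (fun _ => Function.injective_of_subsingleton _)
    (by intro s a ha; simp [idle] at ha) (fun _ => idle_bounded _) hd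
    (fun j hj => absurd (hc j) hj) ?_
  rw [run_iff]
  simp [goodConf, safeConf, idle, next]

theorem idle_maySucceed_iff {n : ℕ} (c : Fin n → Bool) {i : Fin n} {is : List (Fin n)}
    (hd : (i :: is).Nodup) (hc : ∀ j, j ∈ i :: is) :
    (∃ N, Relation.ReflTransGen SStep
      (idle.sess (fun i => i) (fun _ => Empty.elim) 1 c i is) N ∧ N.Success) ↔
      ∃ i, c i = true := by
  have hr : idle.Runs (fun i => i) (fun _ => Empty.elim)
      (idle.sess (fun i => i) (fun _ => Empty.elim) 1 c i is) c :=
    runs_sess (fun _ => idle_bounded _) hd (fun j hj => absurd (hc j) hj)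
  have key : ∀ M : Sess0, idle.Runs (fun i => i) (fun _ => Empty.elim) M c →
      (M.Success ↔ ∃ i, c i = true) := by
    intro M hM
    rw [hM.success_iff]
    simp [hasTick, idle]
  constructor
  · rintro ⟨N, h1, h2⟩
    obtain ⟨c', h3, h4⟩ := hr.steps Fin.val_injective h1
    have : c' = c := by
      induction h3 with
      | refl => rfl
      | tail _ h => simp [next, idle] at h
    subst this
    exact (key N h4).1 h2
  · exact fun h => ⟨_, .refl, (key _ hr).2 h⟩

/-! ### Communication in a square -/

/-- The states of the participants in a square: the corners `a` and `d` may send to the corners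
`b` and `c`. -/
inductive SquareState where
  | a
  | b
  | c
  | d
  | lose
  | win

/-- Two rows `a`, `c` and `b`, `d`: each of `a` and `d` sends to `b` or to `c`.  Within a row
there is only the communication without success, but if `a` and `b` communicate, then `b`
succeeds. -/
def square : Protocol (Fin 4) SquareState where
  acts
    | .a => [⟨true, 1, 0, .lose⟩, ⟨true, 2, 0, .lose⟩]
    | .b => [⟨false, 0, 0, .win⟩, ⟨false, 3, 0, .lose⟩]
    | .c => [⟨false, 0, 0, .lose⟩, ⟨false, 3, 0, .lose⟩]
    | .d => [⟨true, 1, 0, .lose⟩, ⟨true, 2, 0, .lose⟩]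
    | .lose => []
    | .win => []
  tick
    | .win => true
    | _ => false

/-- The process of a corner, where the ports are the names of the corners. -/
def squareProc (s : SquareState) : Proc0 := square.proc (fun i => i) 2 s

/-- The row of `a` and `c`. -/
def row0 : Sess0 := .par (.loc 0 (squareProc .a)) (.loc 2 (squareProc .c))

/-- The row of `b` and `d`. -/
def row1 : Sess0 := .par (.loc 1 (squareProc .b)) (.loc 3 (squareProc .d))

/-- Both rows in parallel, associated to the right. -/
def rows : Sess0 :=
  .par (.loc 0 (squareProc .a)) (.par (.loc 2 (squareProc .c)) row1)

theorem rows_cong : SCong false rows (.par row0 row1) := .symm (.assoc _ _ _)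

theorem row0_eq : row0 = square.sess (fun i : Fin 4 => i) (fun _ => id) 2
    ![.a, .lose, .c, .lose] 0 [2] := rfl

theorem row1_eq : row1 = square.sess (fun i : Fin 4 => i) (fun _ => id) 2
    ![.lose, .b, .lose, .d] 1 [3] := rfl

theorem rows_eq : rows = square.sess (fun i : Fin 4 => i) (fun _ => id) 2
    ![.a, .b, .c, .d] 0 [2, 1, 3] := rfl

theorem square_separate : square.Separate := by
  rintro (_ | _) a ha b hb <;> revert a b <;> simp [square]

theorem square_bounded (s : SquareState) : square.Bounded 2 s = true := by
  cases s <;> decide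

set_option maxRecDepth 100000 in
theorem rows_isTerm {F : Family} (hF : F = .MSMP ∨ F = .MCMP) : F.IsTerm rows := by
  rw [rows_eq]
  exact isTerm_sess (f' := 5) hF Fin.val_injective (fun _ => Function.injective_id) square_separate
    (fun _ => square_bounded _) (by decide) (by decide) (by decide)

set_option maxRecDepth 100000 in
theorem row0_isTerm {F : Family} (hF : F = .MSMP ∨ F = .MCMP) : F.IsTerm row0 := by
  rw [row0_eq]
  exact isTerm_sess (f' := 5) hF Fin.val_injective (fun _ => Function.injective_id) square_separate
    (fun _ => square_bounded _) (by decide) (by decide) (by decide)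

set_option maxRecDepth 100000 in
theorem row1_isTerm {F : Family} (hF : F = .MSMP ∨ F = .MCMP) : F.IsTerm row1 := by
  rw [row1_eq]
  exact isTerm_sess (f' := 5) hF Fin.val_injective (fun _ => Function.injective_id) square_separate
    (fun _ => square_bounded _) (by decide) (by decide) (by decide)

set_option maxRecDepth 100000 in
/-- If `a` sends to `b`, then both rows together reach success. -/
theorem rows_maySucceed : ∃ N, Relation.ReflTransGen SStep rows N ∧ N.Success := by
  have hr : square.Runs (fun i : Fin 4 => i) (fun _ => id) rows ![.a, .b, .c, .d] := by
    rw [rows_eq]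
    exact runs_sess (fun _ => square_bounded _) (by decide) (by decide)
  obtain ⟨c', h1, h2⟩ := List.any_eq_true.1 (show (square.next (fun _ => id)
    (![.a, .b, .c, .d] : Fin 4 → _)).any square.hasTick = true by decide)
  obtain ⟨N, h3, h4⟩ := hr.progress h1
  exact ⟨N, .single h3, h4.success_iff.2 h2⟩

set_option maxRecDepth 100000 in
theorem row0_not_success {N : Sess0} (h : Relation.ReflTransGen SStep row0 N) : ¬ N.Success := by
  have hr : square.Runs (fun i : Fin 4 => i) (fun _ => id) row0 ![.a, .lose, .c, .lose] := by
    rw [row0_eq]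
    exact runs_sess (fun _ => square_bounded _) (by decide) (by decide)
  exact hr.not_maySucceed (f := 5) Fin.val_injective (by decide) h

set_option maxRecDepth 100000 in
theorem row1_not_success {N : Sess0} (h : Relation.ReflTransGen SStep row1 N) : ¬ N.Success := by
  have hr : square.Runs (fun i : Fin 4 => i) (fun _ => id) row1 ![.lose, .b, .lose, .d] := by
    rw [row1_eq]
    exact runs_sess (fun _ => square_bounded _) (by decide) (by decide)
  exact hr.not_maySucceed (f := 5) Fin.val_injective (by decide) h

/-! ### Parallel compositions of lists of located processes -/

/-- The parallel composition of located processes, with a terminated participant added. -/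
def sessOf : List (Part × Proc0) → Sess0
  | [] => .loc 0 .nil
  | a :: L => .par (.loc a.1 a.2) (sessOf L)

theorem SCong.parR {u : Bool} {M N : Sess0} (L : Sess0) (h : SCong u M N) :
    SCong u (.par L M) (.par L N) :=
  (SCong.comm _ _).trans ((h.par L).trans (.comm _ _))

theorem sessOf_append {u : Bool} (L L' : List (Part × Proc0)) :
    SCong u (sessOf (L ++ L')) (.par (sessOf L) (sessOf L')) := by
  induction L with
  | nil => exact .symm (.nil _ _)
  | cons a L ih => exact (SCong.parR _ ih).trans (.symm (.assoc _ _ _))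

theorem sessOf_locs {u : Bool} (M : Sess0) : SCong u M (sessOf M.locs) := by
  induction M with
  | hole k => exact k.elim
  | loc p P => exact (SCong.nil 0 _).symm.trans (.comm _ _)
  | par M N ihM ihN =>
    exact (ihM.par _).trans ((SCong.parR _ ihN).trans (.symm (sessOf_append _ _)))

theorem sessOf_perm {u : Bool} {L L' : List (Part × Proc0)} (h : L.Perm L') :
    SCong u (sessOf L) (sessOf L') := by
  induction h with
  | nil => exact .refl _
  | cons a _ ih => exact .parR _ ih
  | swap a b L =>
    exact (SCong.assoc _ _ _).symm.trans (((SCong.comm _ _).par _).trans (.assoc _ _ _))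
  | trans _ _ ih ih' => exact ih.trans ih'

theorem sessOf_success {L : List (Part × Proc0)} :
    (sessOf L).Success ↔ ∃ a ∈ L, a.2.Success := by
  induction L with
  | nil => simp [sessOf, Sess.Success, Sess.locs, Proc.Success]
  | cons a L ih =>
    simp only [sessOf, Sess.success_par, ih]
    simp [Sess.Success, Sess.locs]

theorem mem_flat_sessOf {L : List (Part × Proc0)} {a : Part × PClass}
    (h : a ∈ (sessOf L).flat) : ∃ P, (a.1, P) ∈ L ∧ PClass.mk P = a.2 := by
  induction L with
  | nil => simp [sessOf, Sess.flat, Proc.Live, Proc.shape] at h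
  | cons b L ih =>
    rcases Multiset.mem_add.1 h with h | h
    · obtain ⟨P, h1, h2⟩ := Sess.mem_flat h
      simp only [Sess.locs, List.mem_singleton] at h1
      exact ⟨P, by simp [h1], h2⟩
    · obtain ⟨P, h1, h2⟩ := ih h
      exact ⟨P, by simp [h1], h2⟩

theorem flat_sessOf_fst_le (L : List (Part × Proc0)) :
    (sessOf L).flat.map Prod.fst ≤ ((L.map Prod.fst : List Part) : Multiset Part) := by
  induction L with
  | nil => simp [sessOf, Sess.flat, Proc.Live, Proc.shape]
  | cons a L ih =>
    simp only [sessOf, Sess.flat, Multiset.map_add, List.map_cons, ← Multiset.cons_coe,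
      ← Multiset.singleton_add]
    refine add_le_add ?_ ih
    split <;> simp

/-! ### Families of located processes -/

section Family

variable {ι : Type} (I : List ι) (nm : ι → Part)

/-- The session with the process `σ a` at the location `nm a` for the indices `a` in `I`. -/
def famSess (σ : ι → Proc0) : Sess0 := sessOf (I.map fun a => (nm a, σ a))

variable {I nm}

theorem famSess_comm {σ σ' : ι → Proc0} (hI : I.Nodup) {a b : ι} (ha : a ∈ I) (hb : b ∈ I)
    (hab : a ≠ b) {l x : ℕ} {c : Const} {n m : ℕ} {pre : Fin (n + 1) → Prefix}
    {P : Fin (n + 1) → Proc0} {pre' : Fin (m + 1) → Prefix} {Q : Fin (m + 1) → Proc0}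
    {i : Fin (n + 1)} {j : Fin (m + 1)} (h1 : PCong true (σ a) (.choice pre P))
    (h2 : pre i = .inp (nm b) l x) (h3 : PCong true (σ b) (.choice pre' Q))
    (h4 : pre' j = .out (nm a) l (.const c)) (h5 : σ' a = (P i).subst x c) (h6 : σ' b = Q j)
    (h7 : ∀ z, z ≠ a → z ≠ b → σ' z = σ z) : SStep (famSess I nm σ) (famSess I nm σ') := by
  classical
  have hp : I.Perm (a :: b :: (I.erase a).erase b) :=
    (List.perm_cons_erase ha).trans
      (.cons _ (List.perm_cons_erase ((List.mem_erase_of_ne hab.symm).2 hb)))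
  have hn := (hp.nodup_iff.1 hI)
  simp only [List.nodup_cons, List.mem_cons, not_or] at hn
  have hr : ((I.erase a).erase b).map (fun z => (nm z, σ z)) =
      ((I.erase a).erase b).map (fun z => (nm z, σ' z)) :=
    List.map_congr_left fun z hz => by
      rw [h7 z (fun h => hn.1.2 (h ▸ hz)) (fun h => hn.2.1 (h ▸ hz))]
  refine .cong (.trans (sessOf_perm (hp.map _)) ?_)
    (.par (sessOf (((I.erase a).erase b).map fun z => (nm z, σ z)))
      (.comm (nm a) (nm b) l x c pre P pre' Q i j h2 h4))
    (.trans ?_ (sessOf_perm (hp.map _).symm))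
  · exact (((SCong.loc _ h1).par _).trans (SCong.parR _ ((SCong.loc _ h3).par _))).trans
      (.symm (.assoc _ _ _))
  · rw [hr, ← h5, ← h6]
    exact .assoc _ _ _

theorem famSess_cond {σ σ' : ι → Proc0} (hI : I.Nodup) {a : ι} (ha : a ∈ I) {b : Bool}
    {P Q : Proc0} (h1 : PCong true (σ a) (.cond (.const (.bool b)) P Q))
    (h2 : σ' a = if b then P else Q) (h3 : ∀ z, z ≠ a → σ' z = σ z) :
    SStep (famSess I nm σ) (famSess I nm σ') := by
  classical
  have hp : I.Perm (a :: I.erase a) := List.perm_cons_erase ha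
  have hn := (hp.nodup_iff.1 hI)
  have hr : (I.erase a).map (fun z => (nm z, σ z)) = (I.erase a).map (fun z => (nm z, σ' z)) :=
    List.map_congr_left fun z hz => by
      rw [h3 z fun h => (List.nodup_cons.1 hn).1 (h ▸ hz)]
  have hs : SStep (.loc (nm a) (.cond (.const (.bool b)) P Q)) (.loc (nm a) (σ' a)) := by
    rw [h2]
    cases b
    · exact .ifFalse _ _ _
    · exact .ifTrue _ _ _
  refine .cong (.trans (sessOf_perm (hp.map _)) ?_)
    (.par (sessOf ((I.erase a).map fun z => (nm z, σ z))) hs)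
    (.trans ?_ (sessOf_perm (hp.map _).symm))
  · exact (SCong.loc _ h1).par _
  · rw [hr]
    exact .refl _

/-- Steps that involve pairwise disjoint sets `U i` of indices can be done one after the other. -/
theorem famSess_steps {n : ℕ} [NeZero n] {σ σ' : ι → Proc0} (U : Fin n → Set ι)
    (hU : ∀ i i' z, z ∈ U i → z ∈ U i' → i = i') (hc : ∀ z, (∀ i, z ∉ U i) → σ z = σ' z)
    (h : ∀ i ρ ρ', (∀ z ∈ U i, ρ z = σ z ∧ ρ' z = σ' z) → (∀ z, z ∉ U i → ρ' z = ρ z) →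
      SStep (famSess I nm ρ) (famSess I nm ρ')) :
    Relation.TransGen SStep (famSess I nm σ) (famSess I nm σ') := by
  classical
  have key : ∀ l : List (Fin n), l.Nodup → l ≠ [] →
      Relation.TransGen SStep (famSess I nm σ)
        (famSess I nm fun z => if ∃ i ∈ l, z ∈ U i then σ' z else σ z) := by
    intro l hl hne
    induction l with
    | nil => exact absurd rfl hne
    | cons i l ih =>
      rw [List.nodup_cons] at hl
      have hs : SStep (famSess I nm fun z => if ∃ i ∈ l, z ∈ U i then σ' z else σ z)
          (famSess I nm fun z => if ∃ i' ∈ i :: l, z ∈ U i' then σ' z else σ z) := by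
        refine h i _ _ (fun z hz => ⟨if_neg ?_, if_pos ⟨i, by simp, hz⟩⟩) fun z hz => ?_
        · rintro ⟨i', hi', hz'⟩
          exact hl.1 (hU i i' z hz hz' ▸ hi')
        · simp [hz]
      cases l with
      | nil => exact .single (by simpa using hs)
      | cons i' l => exact (ih hl.2 (by simp)).tail hs
  have := key (List.finRange n) (List.nodup_finRange n)
    (List.ne_nil_of_mem (List.mem_finRange (0 : Fin n)))
  convert this using 2
  funext z
  split_ifs with hz
  · rfl
  · exact (hc z fun i hi => hz ⟨i, List.mem_finRange i, hi⟩).symm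

end Family

/-! ### Renamings of target names -/

section Induce

variable {k : ℕ} {φ : Part → Fin k → ℕ}

open Classical in
variable (φ) in
/-- The renaming of target names that is induced by the renaming `r` of source names and the
renaming policy `φ`. -/
noncomputable def induce (r : ℕ → ℕ) (b : ℕ) : ℕ :=
  if h : ∃ a : Part × Fin k, φ a.1 a.2 = b then φ (r h.choose.1) h.choose.2 else b

variable (hφ : Function.Injective fun b : Part × Fin k => φ b.1 b.2)
include hφ

theorem induce_apply (r : ℕ → ℕ) (a : Part) (j : Fin k) : induce φ r (φ a j) = φ (r a) j := by
  have h : ∃ b : Part × Fin k, φ b.1 b.2 = φ a j := ⟨(a, j), rfl⟩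
  have h1 : h.choose = (a, j) := hφ h.choose_spec
  rw [induce, dif_pos h, h1]

omit hφ in
theorem induce_reserved (r : ℕ → ℕ) {b : ℕ} (h : ∀ a j, φ a j ≠ b) : induce φ r b = b :=
  dif_neg fun ⟨_, ha⟩ => h _ _ ha

theorem induced_induce (r : ℕ → ℕ) : Induced φ r (induce φ r) :=
  ⟨induce_apply hφ r, fun _ h => induce_reserved r h⟩

theorem induce_comp (r r' : ℕ → ℕ) : induce φ r ∘ induce φ r' = induce φ (r ∘ r') := by
  funext b
  by_cases h : ∃ a j, φ a j = b
  · obtain ⟨a, j, rfl⟩ := h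
    simp [induce_apply hφ]
  · have h' : ∀ a j, φ a j ≠ b := fun a j hb => h ⟨a, j, hb⟩
    simp [induce_reserved _ h']

theorem induce_id : induce φ id = id := by
  funext b
  by_cases h : ∃ a j, φ a j = b
  · obtain ⟨a, j, rfl⟩ := h
    simp [induce_apply hφ]
  · exact induce_reserved _ fun a j hb => h ⟨a, j, hb⟩

theorem induce_symm (e : Equiv.Perm ℕ) (P : Proc0) :
    (P.map (induce φ e) id id).map (induce φ e.symm) id id = P := by
  rw [Proc.map_map, induce_comp hφ]
  simp [induce_id hφ]

end Induce

/-- The rotation of the ring of the names below `n` that maps `0`, `1`, `2` to the participant `i`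
and its neighbours, more precisely to `i - 1`, `i`, `i + 1`. -/
def rot (n : ℕ) [NeZero n] (i : Fin n) : Equiv.Perm ℕ :=
  (Equiv.addRight (i - 1)).extendDomain Fin.equivSubtype

theorem rot_apply {n : ℕ} [NeZero n] (i a : Fin n) : rot n i a = (a + (i - 1) : Fin n) :=
  Equiv.Perm.extendDomain_apply_image _ Fin.equivSubtype a

theorem rot_symm_apply {n : ℕ} [NeZero n] (i a : Fin n) :
    (rot n i).symm a = (a - (i - 1) : Fin n) := by
  rw [Equiv.symm_apply_eq, rot_apply]
  simp

/-! ### Templates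

A template gives the processes of one cell of a ring of translated cells.  The other cells have the
same processes, up to a renaming. -/

section Template

variable {k : ℕ} (φ : Part → Fin k → ℕ) (js : List (Fin k))

/-- The ring of `n` cells with the template `τ`. -/
noncomputable def ringSess (n : ℕ) [NeZero n] (τ : Fin k → Proc0) : Sess0 :=
  famSess (List.product (List.finRange n) js) (fun a => φ a.1 a.2)
    (fun a => (τ a.2).map (induce φ (rot n a.1)) id id)

/-- A step of a template, which all the cells of a ring can do: a conditional is decided, or
component `j` of each cell receives from component `j'` of the cell itself or of one of its
neighbours.  From the point of view of the cell `1`, the sender is in cell `e` and, vice versa, the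
receiver is in cell `2 - e`. -/
inductive TStep : (Fin k → Proc0) → (Fin k → Proc0) → Prop
  | cond {τ} (j b P Q) : j ∈ js → PCong true (τ j) (.cond (.const (.bool b)) P Q) →
      TStep τ (Function.update τ j (if b then P else Q))
  | comm {τ} (j j') (e l x : ℕ) (c) {n m : ℕ} (pre : Fin (n + 1) → Prefix) (P : Fin (n + 1) → Proc0)
      (pre' : Fin (m + 1) → Prefix) (Q : Fin (m + 1) → Proc0) (i i') :
      j ∈ js → j' ∈ js → j ≠ j' → e ≤ 2 → PCong true (τ j) (.choice pre P) →
      pre i = .inp (φ e j') l x → PCong true (τ j') (.choice pre' Q) →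
      pre' i' = .out (φ (2 - e) j) l (.const c) →
      TStep τ (Function.update (Function.update τ j ((P i).subst x c)) j' (Q i'))

/-- The condition on two prefixes of a choice of a template: they have the same polarity or the same
partner, which is not a component of a cell other than `0`, `1` and `2`. -/
def Restr (a b : Pol × Part) : Prop :=
  (a.1 = b.1 ∨ a.2 = b.2) ∧ ∀ (c : ℕ) (j : Fin k), φ c j = b.2 → c ≤ 2

/-- The restriction for all processes of a template. -/
def Restricted (τ : Fin k → Proc0) : Prop := ∀ j ∈ js, (τ j).AllKeys (Restr φ)

variable {φ js}

theorem TStep.restricted {τ τ' : Fin k → Proc0} (h : TStep φ js τ τ') (hτ : Restricted φ js τ) :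
    Restricted φ js τ' := by
  cases h with
  | cond j b P Q hj h =>
    intro i hi
    by_cases hij : i = j
    · subst hij
      have := h.allKeys_iff.1 (hτ i hi)
      rw [Function.update_self]
      split
      exacts [this.1, this.2]
    · rw [Function.update_of_ne hij]
      exact hτ i hi
  | comm j j' e l x c pre P pre' Q i i' hj hj' hjj he h1 h2 h3 h4 =>
    intro a ha
    by_cases haj' : a = j'
    · subst haj'
      rw [Function.update_self]
      exact (h3.allKeys_iff.1 (hτ a ha)).2 i'
    · rw [Function.update_of_ne haj']
      by_cases haj : a = j
      · subst haj
        rw [Function.update_self]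
        exact Proc.allKeys_subst _ ((h1.allKeys_iff.1 (hτ a ha)).2 i)
      · rw [Function.update_of_ne haj]
        exact hτ a ha

variable (hφ : Function.Injective fun b : Part × Fin k => φ b.1 b.2) (hjs : js.Nodup)
include hφ hjs

/-- Every step of a template can be done by all cells of a ring, one after the other. -/
theorem TStep.ringSess {n : ℕ} [NeZero n] (hn : 3 ≤ n) {τ τ' : Fin k → Proc0}
    (h : TStep φ js τ τ') : Relation.TransGen SStep (ringSess φ js n τ) (ringSess φ js n τ') := by
  have hI : (List.product (List.finRange n) js).Nodup := (List.nodup_finRange n).product hjs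
  have hm : ∀ i : Fin n, ∀ j, j ∈ js → (i, j) ∈ List.product (List.finRange n) js :=
    fun i j hj => List.mem_product.2 ⟨List.mem_finRange i, hj⟩
  cases h with
  | cond j b P Q hj h =>
    refine famSess_steps (fun i => {(i, j)}) ?_ ?_ ?_
    · rintro i i' z rfl h
      exact congrArg Prod.fst h
    · rintro ⟨i, j'⟩ h
      have : j' ≠ j := fun hj => h i (by simp [hj])
      simp [this]
    · intro i ρ ρ' h1 h2
      obtain ⟨h3, h4⟩ := h1 (i, j) rfl
      refine famSess_cond hI (hm i j hj) (b := b) (P := P.map (induce φ (rot n i)) id id)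
        (Q := Q.map (induce φ (rot n i)) id id) ?_ ?_ fun z hz => h2 z hz
      · rw [h3]
        exact h.map _
      · rw [h4]
        cases b <;> simp
  | comm j j' e l x c pre P pre' Q i i' hj hj' hjj he h1 h2 h3 h4 =>
    have hen : e < n := by omega
    have hen' : 2 - e < n := by omega
    have hr : ∀ a : Fin n, rot n a e = ((⟨e, hen⟩ + (a - 1) : Fin n) : ℕ) :=
      fun a => rot_apply a ⟨e, hen⟩
    have hr' : ∀ a : Fin n, rot n (⟨e, hen⟩ + (a - 1)) (2 - e : ℕ) = a := by
      intro a
      rw [rot_apply _ ⟨2 - e, hen'⟩]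
      congr 1
      have h2 : (⟨2 - e, hen'⟩ + ⟨e, hen⟩ : Fin n) = 1 + 1 := by
        apply Fin.ext
        have h1 : ((1 : Fin n) : ℕ) = 1 := by
          rw [Fin.val_one']; exact Nat.mod_eq_of_lt (by omega)
        rw [Fin.val_add, Fin.val_add, h1]
        congr 1
        show 2 - e + e = 2
        omega
      rw [add_sub_assoc, ← add_assoc, h2]
      abel
    refine famSess_steps (fun a => {(a, j), (⟨e, hen⟩ + (a - 1), j')}) ?_ ?_ ?_
    · rintro a a' z (rfl | rfl) (h | h)
      · exact congrArg Prod.fst h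
      · exact absurd (congrArg Prod.snd h) hjj
      · exact absurd (congrArg Prod.snd h).symm hjj
      · have := congrArg Prod.fst h
        simpa using this
    · rintro ⟨a, b⟩ h
      have hb : b ≠ j := fun hb => h a (by simp [hb])
      have hb' : b ≠ j' := fun hb => h (a + 1 - ⟨e, hen⟩) (by
        right
        rw [Set.mem_singleton_iff, hb]
        congr 1
        abel)
      simp [hb, hb']
    · intro a ρ ρ' g1 g2
      obtain ⟨g3, g4⟩ := g1 (a, j) (by simp)
      obtain ⟨g5, g6⟩ := g1 (⟨e, hen⟩ + (a - 1), j') (by simp)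
      refine famSess_comm (l := l) (x := x) (c := c)
        (pre := fun i => (pre i).map (induce φ (rot n a)) id)
        (P := fun i => (P i).map (induce φ (rot n a)) id id)
        (pre' := fun i => (pre' i).map (induce φ (rot n (⟨e, hen⟩ + (a - 1)))) id)
        (Q := fun i => (Q i).map (induce φ (rot n (⟨e, hen⟩ + (a - 1)))) id id)
        (i := i) (j := i') hI (hm a j hj)
        (hm (⟨e, hen⟩ + (a - 1)) j' hj') ?_ ?_ ?_ ?_ ?_ ?_ ?_ ?_
      · intro h
        exact hjj (congrArg Prod.snd h)
      · rw [g3]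
        exact h1.map _
      · simp only [h2, Prefix.map, induce_apply hφ, hr, id]
      · rw [g5]
        exact h3.map _
      · simp only [h4, Prefix.map, induce_apply hφ, hr']
      · rw [g4, ← Proc.map_subst]
        simp [hjj]
      · rw [g6]
        simp
      · intro z h h'
        exact g2 z (by simp [h, h'])

/-- Every step of a ring is an instance of a step of the template: because of the restriction of
choices a component does not communicate with the same component of a neighbour. -/
theorem TStep.of_ringSess {n : ℕ} [NeZero n] (hn : 3 ≤ n) {τ : Fin k → Proc0} {N : Sess0}
    (hτ : Restricted φ js τ) (h : SStep (MixedChoice.ringSess φ js n τ) N) :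
    ∃ τ', TStep φ js τ τ' := by
  have hmem : ∀ {a : Part × PClass}, a ∈ (MixedChoice.ringSess φ js n τ).flat →
      ∃ i : Fin n, ∃ j ∈ js, a.1 = φ i j ∧
        PClass.mk ((τ j).map (induce φ (rot n i)) id id) = a.2 := by
    intro a ha
    obtain ⟨P, h1, h2⟩ := mem_flat_sessOf ha
    obtain ⟨⟨i, j⟩, h3, h4⟩ := List.mem_map.1 h1
    obtain ⟨h5, h6⟩ := Prod.mk.inj h4
    exact ⟨i, j, (List.mem_product.1 h3).2, h5.symm, by rw [← h2, ← h6]⟩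
  rcases h.enabled with ⟨p, b, P, Q, h⟩ | ⟨p, q, l, x, c, m, m', pre, P, pre', Q, i, i', h1, h2, h⟩
  · obtain ⟨i, j, hj, -, h⟩ := hmem h
    have h := (PClass.mk_eq.1 h).map (induce φ (rot n i).symm)
    rw [induce_symm hφ] at h
    exact ⟨_, .cond j b _ _ hj h⟩
  · have hpq : p ≠ q := by
      have h3 := (Multiset.map_le_map (f := Prod.fst) h).trans (flat_sessOf_fst_le _)
      have hd : ((List.product (List.finRange n) js).map
          fun a => ((φ a.1 a.2, (τ a.2).map (induce φ (rot n a.1)) id id) : Part × Proc0)).map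
            Prod.fst |>.Nodup := by
        rw [List.map_map]
        refine List.Nodup.map ?_ ((List.nodup_finRange n).product hjs)
        rintro ⟨a, b⟩ ⟨a', b'⟩ hab
        have := hφ (a₁ := ((a : ℕ), b)) (a₂ := ((a' : ℕ), b')) hab
        simp only [Prod.mk.injEq] at this
        exact Prod.ext (Fin.ext this.1) this.2
      have h4 := Multiset.nodup_of_le h3 (Multiset.coe_nodup.2 hd)
      simpa using h4
    obtain ⟨a, j, hj, hp, h3⟩ := hmem (Multiset.mem_of_le h (Multiset.mem_cons_self _ _))
    obtain ⟨a', j', hj', hq, h4⟩ := hmem (Multiset.mem_of_le h (Multiset.mem_cons_of_mem (Multiset.mem_singleton_self _)))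
    dsimp only at hp hq
    subst hp hq
    have h3 := (PClass.mk_eq.1 h3).map (induce φ (rot n a).symm)
    have h4 := (PClass.mk_eq.1 h4).map (induce φ (rot n a').symm)
    rw [induce_symm hφ] at h3 h4
    have h1 : (pre i).map (induce φ (rot n a).symm) id =
        .inp (φ ((a' - (a - 1) : Fin n) : ℕ) j') l x := by
      rw [h1]
      simp only [Prefix.map, induce_apply hφ, rot_symm_apply, id]
    have h2 : (pre' i').map (induce φ (rot n a').symm) id =
        .out (φ ((a - (a' - 1) : Fin n) : ℕ) j) l (.const c) := by
      rw [h2]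
      simp only [Prefix.map, induce_apply hφ, rot_symm_apply]
    have k3 := h3.allKeys_iff.1 (hτ j hj)
    have k4 := h4.allKeys_iff.1 (hτ j' hj')
    have b3 := (k3.1 i i).2 ((a' - (a - 1) : Fin n) : ℕ) j' (by
      simp only [Prefix.key, h1, Prefix.partner])
    have b4 := (k4.1 i' i').2 ((a - (a' - 1) : Fin n) : ℕ) j (by
      simp only [Prefix.key, h2, Prefix.partner])
    -- Seen from each other, the two cells are in the positions `u` and `v` with `u + v = 2` modulo
    -- `n`; both positions are at most `2`, so this holds in `ℕ`.
    have hsum : ((a - (a' - 1) : Fin n) : ℕ) = 2 - ((a' - (a - 1) : Fin n) : ℕ) := by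
      have h5 : (a' - (a - 1)) + (a - (a' - 1)) = (1 + 1 : Fin n) := by abel
      have h6 := congrArg Fin.val h5
      have h7 : ((1 : Fin n) : ℕ) = 1 := by
        rw [Fin.val_one']; exact Nat.mod_eq_of_lt (by omega)
      rw [Fin.val_add, Fin.val_add, h7, Nat.mod_eq_of_lt (by omega : 1 + 1 < n)] at h6
      clear h1 h2
      generalize ((a' - (a - 1) : Fin n) : ℕ) = u at b3 h6 ⊢
      generalize ((a - (a' - 1) : Fin n) : ℕ) = v at b4 h6 ⊢
      by_cases hlt : u + v < n
      · rw [Nat.mod_eq_of_lt hlt] at h6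
        omega
      · rw [Nat.mod_eq_sub_mod (by omega), Nat.mod_eq_of_lt (by omega)] at h6
        omega
    rw [hsum] at h2
    refine ⟨_, .comm j j' _ l x c _ _ _ _ i i' hj hj' ?_ b3 h3 h1 h4 h2⟩
    rintro rfl
    -- If the partners were the same component of two cells, then this component would have an input
    -- and an output in one choice, hence with one partner, and the two cells would coincide.
    have hs := h3.shape_eq.symm.trans h4.shape_eq
    simp only [Proc.map, Proc.shape, Shape.choice.injEq] at hs
    have hk : ((pre' i').map (induce φ (rot n a').symm) id).key ∈
        Set.range fun i => ((pre i).map (induce φ (rot n a).symm) id).key := by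
      rw [hs]; exact ⟨i', rfl⟩
    obtain ⟨i'', hi⟩ := hk
    have hres := (k3.1 i i'').1
    dsimp only at hi hres
    rw [hi, h1, h2] at hres
    simp only [Prefix.key, Prefix.pol, Prefix.partner, reduceCtorEq, false_or] at hres
    have he : ((a' - (a - 1) : Fin n) : ℕ) = 2 - ((a' - (a - 1) : Fin n) : ℕ) :=
      congrArg Prod.fst (hφ (a₁ := (_, j)) (a₂ := (_, j)) hres)
    have h8 : (a' - (a - 1) : Fin n) = 1 := by
      apply Fin.ext
      rw [Fin.val_one', Nat.mod_eq_of_lt (by omega : 1 < n)]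
      omega
    have h9 : a' = a := by
      have := congrArg (fun z => z + (a - 1)) h8
      simpa using this
    exact hpq (by rw [h9])

/-- If the ring of three cells with a template terminates, then the rings of all sizes may reach
sessions without steps that agree on success. -/
theorem exists_final {τ : Fin k → Proc0} (hτ : Restricted φ js τ)
    (ht : Acc (fun N M => SStep M N) (MixedChoice.ringSess φ js 3 τ)) :
    ∃ b : Prop, ∀ (n : ℕ) [NeZero n], 3 ≤ n → ∃ N,
      Relation.ReflTransGen SStep (MixedChoice.ringSess φ js n τ) N ∧ (∀ N', ¬ SStep N N') ∧
        (N.Success ↔ b) := by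
  replace ht := ht.transGen
  generalize hM : MixedChoice.ringSess φ js 3 τ = M at ht
  induction ht generalizing τ with
  | intro M _ ih =>
    subst hM
    by_cases h : ∃ τ', TStep φ js τ τ'
    · obtain ⟨τ', h⟩ := h
      have h3 := h.ringSess hφ hjs le_rfl
      obtain ⟨b, hb⟩ := ih _ (Relation.transGen_swap.2 h3) (h.restricted hτ) rfl
      refine ⟨b, fun n _ hn => ?_⟩
      obtain ⟨N, h1, h2⟩ := hb n hn
      exact ⟨N, (h.ringSess hφ hjs hn).to_reflTransGen.trans h1, h2⟩
    · refine ⟨∃ j ∈ js, (τ j).Success, fun n _ hn => ⟨_, .refl, ?_, ?_⟩⟩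
      · exact fun N' hN => h (TStep.of_ringSess hφ hjs hn hτ hN)
      · have hs : ∀ (f : ℕ → ℕ) (P : Proc0), (P.map f id id).Success ↔ P.Success := by
          intro f P
          induction P with
          | mu X P ih => exact ih
          | cond v P Q => cases v <;> rfl
          | _ => rfl
        rw [MixedChoice.ringSess, famSess, sessOf_success]
        constructor
        · rintro ⟨a, ha, h1⟩
          obtain ⟨b, hb, rfl⟩ := List.mem_map.1 ha
          exact ⟨b.2, (List.mem_product.1 hb).2, (hs _ _).1 h1⟩
        · rintro ⟨j, hj, h1⟩
          exact ⟨_, List.mem_map.2 ⟨((0 : Fin n), j),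
            List.mem_product.2 ⟨List.mem_finRange _, hj⟩, rfl⟩, (hs _ _).2 h1⟩

end Template

/-! ### Locations of sessions and contexts -/

namespace Sess

variable {H K H' K' : Type}

/-- The session holes of a context, from left to right. -/
def holes : Sess H K → List K
  | hole k => [k]
  | loc _ _ => []
  | par M N => M.holes ++ N.holes

/-- The names of the locations. -/
def names (M : Sess H K) : List Part := M.locs.map Prod.fst

theorem locs_fill (s : H → Proc H') (t : K → Sess H' K') {C : Sess H K} (hC : C.locs = []) :
    (C.fill s t).locs = C.holes.flatMap fun k => (t k).locs := by
  induction C with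
  | hole k => simp [fill, holes]
  | loc p P => simp [locs] at hC
  | par M N ihM ihN =>
    simp only [locs, List.append_eq_nil_iff] at hC
    simp [fill, locs, holes, ihM hC.1, ihN hC.2]

theorem names_fill (s : H → Proc H') (t : K → Sess H' K') (C : Sess H K) :
    (C.fill s t).names.Perm (C.names ++ C.holes.flatMap fun k => (t k).names) := by
  induction C with
  | hole k => simp [fill, holes, names, locs]
  | loc p P => simp [fill, holes, names, locs]
  | par M N ihM ihN =>
    simp only [names, fill, locs, List.map_append, holes, List.flatMap_append] at ihM ihN ⊢
    refine (ihM.append ihN).trans ?_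
    simp only [List.append_assoc]
    refine List.Perm.append_left _ ?_
    simp only [← List.append_assoc]
    exact List.Perm.append_right _ List.perm_append_comm

theorem names_fill_of_isEmpty [IsEmpty K] (s : H → Proc H') (t : K → Sess H' K') (C : Sess H K) :
    (C.fill s t).names = C.names := by
  induction C with
  | hole k => exact isEmptyElim k
  | loc p P => rfl
  | par M N ihM ihN =>
    simp only [names, fill, locs, List.map_append] at ihM ihN ⊢
    rw [ihM, ihN]

theorem fill_congr (s : H → Proc H') {t t' : K → Sess H' K'} {C : Sess H K}
    (h : ∀ k ∈ C.holes, t k = t' k) : C.fill s t = C.fill s t' := by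
  induction C with
  | hole k => exact h k (by simp [holes])
  | loc p P => rfl
  | par M N ihM ihN =>
    simp only [holes, List.mem_append] at h
    simp only [fill]
    rw [ihM fun k hk => h k (.inl hk), ihN fun k hk => h k (.inr hk)]

theorem fill_inj {s : H → Proc H'} {t t' : K → Sess H' K'} {C : Sess H K}
    (h : C.fill s t = C.fill s t') : ∀ k ∈ C.holes, t k = t' k := by
  induction C with
  | hole k => simpa [fill, holes] using h
  | loc p P => simp [holes]
  | par M N ihM ihN =>
    simp only [fill, par.injEq] at h
    intro k hk
    exact (List.mem_append.1 hk).elim (ihM h.1 k) (ihN h.2 k)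

theorem rename_fill (s : H → Proc H') (t : K → Sess H' K') {C : Sess H K} (hC : C.locs = [])
    (f : ℕ → ℕ) : (C.fill s t).rename f = C.fill s fun k => (t k).rename f := by
  induction C with
  | hole k => rfl
  | loc p P => simp [locs] at hC
  | par M N ihM ihN =>
    simp only [locs, List.append_eq_nil_iff] at hC
    simp [fill, rename, ihM hC.1, ihN hC.2]

theorem locs_rename (f : ℕ → ℕ) (M : Sess H K) :
    (M.rename f).locs = M.locs.map fun a => (f a.1, a.2.map f id id) := by
  induction M with
  | hole k => rfl
  | loc p P => rfl
  | par M N ihM ihN => simp [rename, locs, ihM, ihN]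

theorem names_rename (f : ℕ → ℕ) (M : Sess H K) : (M.rename f).names = M.names.map f := by
  simp [names, locs_rename, Function.comp_def]

theorem names_ne_nil (M : Sess0) : M.names ≠ [] := by
  induction M with
  | hole k => exact k.elim
  | loc p P => simp [names, locs]
  | par M N ihM _ =>
    simp only [names, locs, List.map_append] at ihM ⊢
    exact List.append_ne_nil_of_left_ne_nil ihM _

theorem names_subset_parts (M : Sess H K) : ∀ b ∈ M.names, b ∈ M.parts := by
  induction M with
  | hole k => simp [names, locs]
  | loc p P => simp [names, locs, parts]
  | par M N ihM ihN =>
    intro b hb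
    simp only [names, locs, List.map_append, List.mem_append] at ihM ihN hb
    exact Finset.mem_union.2 (hb.imp (ihM b) (ihN b))

theorem parts_of_mem_locs {M : Sess H K} {a : Part × Proc H} (h : a ∈ M.locs) :
    a.2.parts ⊆ M.parts := by
  induction M with
  | hole k => simp [locs] at h
  | loc p P =>
    simp only [locs, List.mem_singleton] at h
    subst h
    exact Finset.subset_insert _ _
  | par M N ihM ihN =>
    rcases List.mem_append.1 h with h | h
    · exact (ihM h).trans Finset.subset_union_left
    · exact (ihN h).trans Finset.subset_union_right

end Sess

theorem Prefix.map_partner_of_eq {f : ℕ → ℕ} {a : Prefix} (h : a.map f id = a) :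
    f a.partner = a.partner := by
  have := congrArg Prefix.partner h
  simpa using this

theorem Proc.map_eq_self {H : Type} {f : ℕ → ℕ} {P : Proc H} (h : P.map f id id = P) :
    ∀ b ∈ P.parts, f b = b := by
  induction P with
  | mu X P ih => exact ih (by simpa [map] using h)
  | choice pre P ih =>
    simp only [map, choice.injEq, heq_eq_eq, true_and] at h
    intro b hb
    simp only [parts, Finset.mem_biUnion, Finset.mem_univ, true_and, Finset.mem_insert] at hb
    obtain ⟨i, rfl | hb⟩ := hb
    · exact Prefix.map_partner_of_eq (congrFun h.1 i)
    · exact ih i (congrFun h.2 i) b hb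
  | cond v P Q ihP ihQ =>
    have h : P.map f id id = P ∧ Q.map f id id = Q := by
      cases v <;> simpa [map] using h
    intro b hb
    exact (Finset.mem_union.1 hb).elim (ihP h.1 b) (ihQ h.2 b)
  | _ => simp [parts]

theorem Sess.rename_eq_self {H K : Type} {f : ℕ → ℕ} {M : Sess H K} (h : M.rename f = M) :
    ∀ b ∈ M.parts, f b = b := by
  induction M with
  | hole k => simp [parts]
  | loc p P =>
    simp only [rename, loc.injEq] at h
    intro b hb
    rcases Finset.mem_insert.1 hb with rfl | hb
    · exact h.1
    · exact Proc.map_eq_self h.2 b hb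
  | par M N ihM ihN =>
    simp only [rename, par.injEq] at h
    intro b hb
    exact (Finset.mem_union.1 hb).elim (ihM h.1 b) (ihN h.2 b)

theorem Proc.allKeys_of_allChoices {H : Type} {C : ∀ n : ℕ, (Fin (n + 1) → Prefix) → Prop}
    {c : Pol × Part → Pol × Part → Prop} {s : Finset Part}
    (h : ∀ n pre, C n pre → (∀ i, (pre i).partner ∈ s) → ∀ i j, c (pre i).key (pre j).key)
    {P : Proc H} (hC : P.AllChoices C) (hs : P.parts ⊆ s) : P.AllKeys c := by
  induction P with
  | mu X P ih => exact ih hC hs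
  | choice pre P ih =>
    refine ⟨h _ _ hC.1 fun i => hs ?_, fun i => ih i (hC.2 i) fun b hb => hs ?_⟩
    · exact Finset.mem_biUnion.2 ⟨i, Finset.mem_univ i, Finset.mem_insert_self _ _⟩
    · exact Finset.mem_biUnion.2 ⟨i, Finset.mem_univ i, Finset.mem_insert_of_mem hb⟩
  | cond v P Q ihP ihQ =>
    exact ⟨ihP hC.1 (Finset.subset_union_left.trans hs),
      ihQ hC.2 (Finset.subset_union_right.trans hs)⟩
  | _ => trivial

/-- A context that puts its two arguments once each side by side, without own locations. -/
structure IsParCtx (C : Sess (Fin 0) (Fin 2)) : Prop where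
  locs : C.locs = []
  holes : C.holes.Perm [0, 1]

namespace IsParCtx

variable {C : Sess (Fin 0) (Fin 2)} {s : Fin 0 → Proc0}

theorem locs_perm (hC : IsParCtx C) (M N : Sess0) :
    (C.fill s ![M, N]).locs.Perm (M.locs ++ N.locs) := by
  rw [Sess.locs_fill _ _ hC.locs]
  exact (hC.holes.flatMap_right _).trans (by simp)

theorem rename (hC : IsParCtx C) {M N M' N' : Sess0} {f : ℕ → ℕ}
    (h : C.fill s ![M', N'] = (C.fill s ![M, N]).rename f) :
    M' = M.rename f ∧ N' = N.rename f := by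
  rw [Sess.rename_fill _ _ hC.locs] at h
  have h := Sess.fill_inj h
  exact ⟨h 0 (hC.holes.mem_iff.2 (by simp)), h 1 (hC.holes.mem_iff.2 (by simp))⟩

/-- A context with both holes that can be nested without duplicating a location has no locations
and each hole only once. -/
theorem of_nodup (h0 : 0 ∈ C.holes) (h1 : 1 ∈ C.holes) {L M N : Sess0}
    (h : (C.fill s ![L, C.fill s ![M, N]]).names.Nodup) : IsParCtx C := by
  have h := (Sess.names_fill _ _ _).nodup_iff.1 h
  rw [List.nodup_append'] at h
  have hn : C.names = [] := by
    refine List.eq_nil_iff_forall_not_mem.2 fun b hb => h.2.2 hb ?_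
    refine List.mem_flatMap.2 ⟨1, h1, ?_⟩
    exact (Sess.names_fill _ _ _).mem_iff.2 (List.mem_append_left _ hb)
  refine ⟨by simpa [Sess.names] using hn, ?_⟩
  have hd : C.holes.Nodup := by
    refine ((List.nodup_flatMap.1 h.2.1).2).imp fun {a b} hab => ?_
    rintro rfl
    obtain ⟨x, hx⟩ := List.exists_mem_of_ne_nil _
      (Sess.names_ne_nil ((![L, C.fill s ![M, N]] : Fin 2 → Sess0) a))
    exact hab hx hx
  refine (List.perm_ext_iff_of_nodup hd (by decide)).2 fun a => ?_
  fin_cases a <;> simp [h0, h1]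

end IsParCtx

open Protocol

/-! ### Encodings into the family of MCMP -/

/-- What is used of a good encoding `encS` from the calculus `F` into a calculus of the family. -/
structure RingEncoding (F T : Family) {k : ℕ} (φ : Part → Fin k → ℕ) (encS : Sess0 → Sess0) :
    Prop where
  source : F = .MSMP ∨ F = .MCMP
  isTerm : ∀ M, F.IsTerm M → T.IsTerm (encS M)
  par : ∀ s : Finset Part, ∃ K : Sess (Fin 0) (Fin 2), ∀ M N : Sess0, M.parts ∪ N.parts = s →
    F.OccursS (.par M N) → encS (.par M N) = K.fill Fin.elim0 ![encS M, encS N]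
  loc : ∀ (p : Part) (s : Finset Part), ∃ (K : Sess (Fin 1) (Fin 0)) (encP : Proc0 → Proc0),
    ∀ P : Proc0, P.parts = s → F.OccursS (.loc p P) →
      encS (.loc p P) = K.fill (fun _ => encP P) Fin.elim0
  inj : Function.Injective fun b : Part × Fin k => φ b.1 b.2
  rename : ∀ (M : Sess0) (r : Equiv.Perm ℕ), F.IsTerm M → F.IsTerm (M.rename r) →
    encS (M.rename r) = (encS M).rename (induce φ r)
  success : ∀ M, F.IsTerm M → ((∃ N, Relation.ReflTransGen SStep M N ∧ N.Success) ↔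
    ∃ N, Relation.ReflTransGen SStep (encS M) N ∧ N.Success)

/-- The terminated session with the participants in the list, of which those with `c` have
succeeded. -/
abbrev idleSess {n : ℕ} (c : Fin n → Bool) (i : Fin n) (is : List (Fin n)) : Sess0 :=
  idle.sess (fun i : Fin n => (i : ℕ)) (fun _ => Empty.elim) 1 c i is

theorem idleSess_parts {n : ℕ} (c : Fin n → Bool) (i : Fin n) (is : List (Fin n)) :
    (idleSess c i is).parts = ((i :: is).map fun i : Fin n => (i : ℕ)).toFinset := by
  have hp : ∀ b, (halt b).parts = ∅ := by intro b; cases b <;> rfl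
  induction is generalizing i with
  | nil => simp [idleSess, sess, Sess.parts, idle_proc, hp]
  | cons j js ih =>
    have := ih j
    simp only [idleSess] at this
    simp only [idleSess, sess, Sess.parts, idle_proc, hp, this]
    simp only [List.map_cons, List.toFinset_cons]
    rfl

theorem idleSess_congr {n : ℕ} {c c' : Fin n → Bool} {i : Fin n} {is : List (Fin n)}
    (h : ∀ a ∈ i :: is, c a = c' a) : idleSess c i is = idleSess c' i is := by
  induction is generalizing i with
  | nil => simp [idleSess, sess, h i (by simp)]
  | cons j js ih =>
    have h1 := ih (i := j) fun a ha => h a (List.mem_cons_of_mem _ ha)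
    simp only [idleSess] at h1
    simp only [idleSess, sess, h1, h i (by simp)]

theorem toFinset_map_val {n : ℕ} {is : List (Fin n)} (h : ∀ a, a ∈ is) :
    (is.map fun i : Fin n => (i : ℕ)).toFinset = Finset.range n := by
  ext a
  simp only [List.mem_toFinset, List.mem_map, Finset.mem_range]
  exact ⟨fun ⟨b, _, hb⟩ => hb ▸ b.2, fun ha => ⟨⟨a, ha⟩, h _, rfl⟩⟩

theorem rot_zero {n : ℕ} [NeZero n] (i : Fin n) : rot n i 0 = (i - 1 : Fin n) := by
  simpa using rot_apply i 0

theorem rot_one {n : ℕ} [NeZero n] (hn : 1 < n) (i : Fin n) : rot n i 1 = i := by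
  have h := rot_apply i 1
  rw [Fin.val_one', Nat.mod_eq_of_lt hn] at h
  rw [h]
  congr 1
  abel

theorem rot_two {n : ℕ} [NeZero n] (hn : 3 ≤ n) (i : Fin n) : rot n i 2 = (i + 1 : Fin n) := by
  have h := rot_apply i (1 + 1)
  rw [Fin.val_add, Fin.val_one', Nat.mod_eq_of_lt (by omega : 1 < n),
    Nat.mod_eq_of_lt (by omega : 1 + 1 < n)] at h
  rw [show 2 = 1 + 1 from rfl, h]
  congr 1
  abel

namespace RingEncoding

variable {F T : Family} {k : ℕ} {φ : Part → Fin k → ℕ} {encS : Sess0 → Sess0}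
  (h : RingEncoding F T φ encS)
include h

/-- For sessions with the participants below `n` parallel composition is translated by a context
that puts its arguments side by side: since success is preserved, both arguments occur, and since
the context is used twice in the translation of a ring, there is nothing else. -/
theorem exists_parCtx {n : ℕ} {i j : Fin n} {js : List (Fin n)} (hd : (i :: j :: js).Nodup)
    (ha : ∀ a, a ∈ i :: j :: js) {X Y Z : Sess0} (ht : F.IsTerm (.par X (.par Y Z)))
    (h1 : X.parts ∪ (Y.parts ∪ Z.parts) = Finset.range n)
    (h2 : Y.parts ∪ Z.parts = Finset.range n) :
    ∃ K, IsParCtx K ∧ ∀ M N : Sess0, M.parts ∪ N.parts = Finset.range n →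
      F.OccursS (.par M N) → encS (.par M N) = K.fill Fin.elim0 ![encS M, encS N] := by
  obtain ⟨K, hK⟩ := h.par (Finset.range n)
  refine ⟨K, ?_, hK⟩
  have hidle : ∀ c : Fin n → Bool, encS (idleSess c i (j :: js)) =
      K.fill Fin.elim0 ![encS (.loc i (halt (c i))), encS (idleSess c j js)] := by
    intro c
    have h3 : idleSess c i (j :: js) = .par (.loc i (halt (c i))) (idleSess c j js) := by
      simp only [idleSess, sess, idle_proc]
    have h4 := idleSess_parts c i (j :: js)
    rw [toFinset_map_val ha, h3] at h4
    have h5 := idle_isTerm h.source c hd ha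
    rw [h3]
    refine hK _ _ h4 ⟨_, h5, ?_⟩
    change Sess.Sub _ (idleSess c i (j :: js))
    rw [h3]
    exact .refl _
  have hne : ∀ c : Fin n → Bool, (∃ a, c a = true) →
      encS (idleSess c i (j :: js)) ≠ encS (idleSess (fun _ => false) i (j :: js)) := by
    intro c hc he
    have h3 := (h.success _ (idle_isTerm h.source c hd ha)).1
      ((idle_maySucceed_iff c hd ha).2 hc)
    change ∃ N, Relation.ReflTransGen SStep (encS (idleSess c i (j :: js))) N ∧ _ at h3
    rw [he] at h3
    have h4 := (idle_maySucceed_iff _ hd ha).1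
      ((h.success _ (idle_isTerm h.source (fun _ => false) hd ha)).2 h3)
    simp at h4
  refine IsParCtx.of_nodup (s := Fin.elim0) ?_ ?_ (L := encS X) (M := encS Y) (N := encS Z) ?_
  · by_contra h0
    refine hne (fun a => decide (a = i)) ⟨i, by simp⟩ ?_
    rw [hidle, hidle]
    refine Sess.fill_congr _ fun a ha' => ?_
    fin_cases a
    · exact absurd ha' h0
    · have : idleSess (fun a => decide (a = i)) j js = idleSess (fun _ => false) j js :=
        idleSess_congr fun b hb => by
          simp only [decide_eq_false_iff_not]
          rintro rfl
          exact (List.nodup_cons.1 hd).1 hb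
      simp [this]
  · by_contra h0
    refine hne (fun a => decide (a = j)) ⟨j, by simp⟩ ?_
    rw [hidle, hidle]
    refine Sess.fill_congr _ fun a ha' => ?_
    fin_cases a
    · have : i ≠ j := by
        rintro rfl
        exact (List.nodup_cons.1 hd).1 (by simp)
      simp [this]
    · exact absurd ha' h0
  · rw [← hK Y Z h2 ⟨_, ht, .parR _ (.refl _)⟩, ← hK X (.par Y Z) h1 ⟨_, ht, .refl _⟩]
    exact (h.isTerm _ ht).distinct

/-- The translation of the ring of three participants consists of the translations of its
participants, also if the participants are permuted. -/
theorem ring3 : (∀ r : Equiv.Perm ℕ, ({r 0, r 1, r 2} : Finset ℕ) = {0, 1, 2} →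
      encS (.loc (r 1) (cell (r 0) (r 2))) =
        (encS (.loc 1 (cell 0 2))).rename (induce φ r)) ∧
    (encS (MixedChoice.ring3 id)).locs.Perm ((encS (.loc 0 (cell 2 1))).locs ++
      ((encS (.loc 1 (cell 0 2))).locs ++ (encS (.loc 2 (cell 1 0))).locs)) := by
  have ht : ∀ r : Equiv.Perm ℕ, F.IsTerm (MixedChoice.ring3 r) :=
    fun r => ring3_isTerm h.source (r.injective.comp Fin.val_injective)
  have hr : Finset.range 3 = {0, 1, 2} := rfl
  obtain ⟨K, hK, hp⟩ := h.exists_parCtx (n := 3) (i := 0) (j := 1) (js := [2]) (by decide)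
    (by decide) (ht (.refl _)) (by simp [Sess.parts, cell_parts]; decide)
    (by simp [Sess.parts, cell_parts]; decide)
  have key : ∀ r : Equiv.Perm ℕ, ({r 0, r 1, r 2} : Finset ℕ) = {0, 1, 2} →
      encS (MixedChoice.ring3 r) = K.fill Fin.elim0 ![encS (.loc (r 0) (cell (r 2) (r 1))),
        K.fill Fin.elim0 ![encS (.loc (r 1) (cell (r 0) (r 2))),
          encS (.loc (r 2) (cell (r 1) (r 0)))]] := by
    intro r hs
    rw [MixedChoice.ring3, hp _ _ ?_ ⟨_, ht r, .refl _⟩, hp _ _ ?_ ⟨_, ht r, .parR _ (.refl _)⟩]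
    all_goals
      rw [hr, ← hs]
      ext a
      simp only [Sess.parts, cell_parts, Finset.mem_union, Finset.mem_insert,
        Finset.mem_singleton]
      tauto
  have hren : ∀ r : Equiv.Perm ℕ, encS (MixedChoice.ring3 r) =
      (encS (MixedChoice.ring3 (Equiv.refl ℕ))).rename (induce φ r) := by
    intro r
    rw [← h.rename _ r (ht _)]
    · exact congrArg encS (ring3_rename r).symm
    · exact (ring3_rename r).symm ▸ ht r
  refine ⟨fun r hs => ?_, ?_⟩
  · exact (hK.rename (hK.rename (((key r hs).symm.trans (hren r)).trans
      (congrArg (Sess.rename (induce φ r)) (key (.refl _) rfl)))).2).1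
  · have := key (.refl _) rfl
    change encS (MixedChoice.ring3 id) = _ at this
    rw [this]
    exact (hK.locs_perm _ _).trans ((hK.locs_perm _ _).append_left _)

/-- The translation of the ring of four participants consists of translations of participants, which
are renamings of the one that occurs in the ring of three participants. -/
theorem ring4 : (∀ r : Equiv.Perm ℕ, ({r 0, r 1, r 2, r 3} : Finset ℕ) = {0, 1, 2, 3} →
      encS (.loc (r 1) (cell (r 0) (r 2))) =
        (encS (.loc 1 (cell 0 2))).rename (induce φ r)) ∧
    (encS (MixedChoice.ring4 id)).locs.Perm ((encS (.loc 0 (cell 3 1))).locs ++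
      ((encS (.loc 1 (cell 0 2))).locs ++ ((encS (.loc 2 (cell 1 3))).locs ++
        (encS (.loc 3 (cell 2 0))).locs))) := by
  have ht : ∀ r : Equiv.Perm ℕ, F.IsTerm (MixedChoice.ring4 r) :=
    fun r => ring4_isTerm h.source (r.injective.comp Fin.val_injective)
  have hr : Finset.range 4 = {0, 1, 2, 3} := rfl
  obtain ⟨K, hK, hp⟩ := h.exists_parCtx (n := 4) (i := 0) (j := 1) (js := [2, 3]) (by decide)
    (by decide) (ht (.refl _)) (by simp [Sess.parts, cell_parts]; decide)
    (by simp [Sess.parts, cell_parts]; decide)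
  have key : ∀ r : Equiv.Perm ℕ, ({r 0, r 1, r 2, r 3} : Finset ℕ) = {0, 1, 2, 3} →
      encS (MixedChoice.ring4 r) = K.fill Fin.elim0 ![encS (.loc (r 0) (cell (r 3) (r 1))),
        K.fill Fin.elim0 ![encS (.loc (r 1) (cell (r 0) (r 2))),
          K.fill Fin.elim0 ![encS (.loc (r 2) (cell (r 1) (r 3))),
            encS (.loc (r 3) (cell (r 2) (r 0)))]]] := by
    intro r hs
    rw [MixedChoice.ring4, hp _ _ ?_ ⟨_, ht r, .refl _⟩, hp _ _ ?_ ⟨_, ht r, .parR _ (.refl _)⟩,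
      hp _ _ ?_ ⟨_, ht r, .parR _ (.parR _ (.refl _))⟩]
    all_goals
      rw [hr, ← hs]
      ext a
      simp only [Sess.parts, cell_parts, Finset.mem_union, Finset.mem_insert,
        Finset.mem_singleton]
      tauto
  have hren : ∀ r : Equiv.Perm ℕ, encS (MixedChoice.ring4 r) =
      (encS (MixedChoice.ring4 (Equiv.refl ℕ))).rename (induce φ r) := by
    intro r
    rw [← h.rename _ r (ht _)]
    · exact congrArg encS (ring4_rename r).symm
    · exact (ring4_rename r).symm ▸ ht r
  refine ⟨fun r hs => ?_, ?_⟩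
  · exact (hK.rename (hK.rename (((key r hs).symm.trans (hren r)).trans
      (congrArg (Sess.rename (induce φ r)) (key (.refl _) rfl)))).2).1
  · have := key (.refl _) rfl
    change encS (MixedChoice.ring4 id) = _ at this
    rw [this]
    exact (hK.locs_perm _ _).trans
      (((hK.locs_perm _ _).trans ((hK.locs_perm _ _).append_left _)).append_left _)

theorem nodup3 : (encS (MixedChoice.ring3 id)).names.Nodup :=
  (h.isTerm _ (ring3_isTerm h.source Fin.val_injective)).distinct

/-- The translation of a ring of three participants has at least three locations. -/
theorem three_le_card : 3 ≤ (encS (MixedChoice.ring3 id)).parts.card := by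
  have h1 : (encS (MixedChoice.ring3 id)).names.toFinset ⊆ (encS (MixedChoice.ring3 id)).parts :=
    fun b hb => Sess.names_subset_parts _ b (List.mem_toFinset.1 hb)
  refine le_trans ?_ (Finset.card_le_card h1)
  rw [List.toFinset_card_of_nodup h.nodup3]
  have h2 := (h.ring3.2.map Prod.fst).length_eq
  simp only [Sess.names, List.length_map, List.length_append] at h2 ⊢
  have h3 : ∀ M : Sess0, 0 < M.locs.length := fun M => by
    simpa [Sess.names] using List.length_pos_iff.2 (Sess.names_ne_nil M)
  have := h3 (encS (.loc 0 (cell 2 1)))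
  have := h3 (encS (.loc 1 (cell 0 2)))
  have := h3 (encS (.loc 2 (cell 1 0)))
  omega

/-- The translation of participant `1` only refers to the vectors of this participant and its
neighbours. -/
theorem parts_cell {c : ℕ} {j : Fin k} (hb : φ c j ∈ (encS (.loc 1 (cell 0 2))).parts) : c ≤ 2 := by
  by_contra hc
  have h0 : Equiv.swap c (c + 1) 0 = 0 := Equiv.swap_apply_of_ne_of_ne (by omega) (by omega)
  have h1 : Equiv.swap c (c + 1) 1 = 1 := Equiv.swap_apply_of_ne_of_ne (by omega) (by omega)
  have h2 : Equiv.swap c (c + 1) 2 = 2 := Equiv.swap_apply_of_ne_of_ne (by omega) (by omega)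
  have hr := h.ring3.1 (Equiv.swap c (c + 1)) (by rw [h0, h1, h2])
  rw [h0, h1, h2] at hr
  have he := Sess.rename_eq_self hr.symm _ hb
  rw [induce_apply h.inj, Equiv.swap_apply_left] at he
  have h3 : c + 1 = c := congrArg Prod.fst (h.inj (a₁ := (c + 1, j)) (a₂ := (c, j)) he)
  omega

/-- The locations of the translation of participant `1` are components of its own vector: they are
not components of the vectors of its neighbours, since exchanging the neighbours does not affect the
context that translates the location, and they are not reserved, since otherwise they would occur
again in the translation of participant `0`. -/
theorem names_cell {b : ℕ} (hb : b ∈ (encS (.loc 1 (cell 0 2))).names) : ∃ j, φ 1 j = b := by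
  -- Exchanging the neighbours maps the locations to themselves in order, hence fixes each of them.
  have hfix : induce φ (Equiv.swap 0 2) b = b := by
    have hr := h.ring3.1 (Equiv.swap 0 2) (by decide)
    obtain ⟨K, encP, hK⟩ := h.loc 1 {0, 2}
    have e1 : encS (.loc 1 (cell 0 2)) = K.fill (fun _ => encP (cell 0 2)) Fin.elim0 :=
      hK _ (cell_parts _ _) ⟨_, ring3_isTerm h.source (ν := id) Fin.val_injective,
        .parR _ (.parL _ (.refl _))⟩
    have e2 : encS (.loc 1 (cell 2 0)) = K.fill (fun _ => encP (cell 2 0)) Fin.elim0 :=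
      hK _ ((cell_parts _ _).trans (Finset.pair_comm _ _))
        ⟨_, ring3_isTerm h.source (ν := Equiv.swap 0 2)
          ((Equiv.injective _).comp Fin.val_injective), .parR _ (.parL _ (.refl _))⟩
    have hn := congrArg Sess.names hr
    rw [show Equiv.swap (0 : ℕ) 2 0 = 2 from rfl, show Equiv.swap (0 : ℕ) 2 1 = 1 from rfl,
      show Equiv.swap (0 : ℕ) 2 2 = 0 from rfl, Sess.names_rename] at hn
    have hn' : (encS (.loc 1 (cell 2 0))).names = (encS (.loc 1 (cell 0 2))).names := by
      rw [e1, e2, Sess.names_fill_of_isEmpty, Sess.names_fill_of_isEmpty]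
    rw [hn'] at hn
    exact (List.map_eq_map_iff.1 ((List.map_id _).trans hn) b hb).symm
  by_cases hφ : ∃ a j, φ a j = b
  · obtain ⟨a, j, rfl⟩ := hφ
    have ha : a ≤ 2 := h.parts_cell (Sess.names_subset_parts _ _ hb)
    rw [induce_apply h.inj] at hfix
    have h3 : Equiv.swap 0 2 a = a := congrArg Prod.fst (h.inj (a₁ := (_, j)) (a₂ := (a, j)) hfix)
    have : a = 1 := by
      interval_cases a
      · simp at h3
      · rfl
      · simp at h3
    exact ⟨j, by rw [this]⟩
  · exfalso
    have h0 := h.ring3.1 (rot 3 0) (by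
      rw [show rot 3 0 0 = 2 from rot_apply (n := 3) 0 0,
        show rot 3 0 1 = 0 from rot_apply (n := 3) 0 1,
        show rot 3 0 2 = 1 from rot_apply (n := 3) 0 2]
      decide)
    rw [show rot 3 0 0 = 2 from rot_apply (n := 3) 0 0,
      show rot 3 0 1 = 0 from rot_apply (n := 3) 0 1,
      show rot 3 0 2 = 1 from rot_apply (n := 3) 0 2] at h0
    have hb0 : b ∈ (encS (.loc 0 (cell 2 1))).names := by
      rw [h0, Sess.names_rename]
      exact List.mem_map.2 ⟨b, hb, induce_reserved _ fun a j hab => hφ ⟨a, j, hab⟩⟩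
    have hd := (h.ring3.2.map Prod.fst).nodup_iff.1 h.nodup3
    rw [List.map_append, List.nodup_append', List.map_append] at hd
    exact hd.2.2 hb0 (List.mem_append_left _ hb)

/-- If choices are restricted, then the translations of both rings are rings of cells with a common
template. -/
theorem exists_template (hT : ∀ n pre, T.Choice n pre → ∀ i j,
      (pre i).pol = (pre j).pol ∨ (pre i).partner = (pre j).partner) :
    ∃ (js : List (Fin k)) (τ : Fin k → Proc0), js.Nodup ∧ Restricted φ js τ ∧
      SCong true (encS (MixedChoice.ring3 id)) (ringSess φ js 3 τ) ∧
      SCong true (encS (MixedChoice.ring4 id)) (ringSess φ js 4 τ) := by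
  classical
  have hlocs : ∀ {a}, a ∈ (encS (.loc 1 (cell 0 2))).locs →
      a ∈ (encS (MixedChoice.ring3 id)).locs := fun {a} ha =>
    h.ring3.2.mem_iff.2 (List.mem_append_right _ (List.mem_append_left _ ha))
  have hd : (encS (.loc 1 (cell 0 2))).names.Nodup := by
    have hd := (h.ring3.2.map Prod.fst).nodup_iff.1 h.nodup3
    rw [List.map_append, List.map_append] at hd
    exact hd.of_append_right.of_append_left
  have hch := (h.isTerm _ (ring3_isTerm h.source (ν := id) Fin.val_injective)).choices
  have hnames : ∀ a ∈ (encS (.loc 1 (cell 0 2))).locs, ∃ j, φ 1 j = a.1 := fun a ha =>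
    h.names_cell (List.mem_map_of_mem ha)
  have hparts : ∀ a ∈ (encS (.loc 1 (cell 0 2))).locs, a.2.AllKeys (Restr φ) := by
    refine fun a ha => Proc.allKeys_of_allChoices (fun n pre hc hs i j => ⟨hT n pre hc i j, ?_⟩)
      (hch a (hlocs ha)) (Sess.parts_of_mem_locs ha)
    intro c j' hcj
    exact h.parts_cell (j := j') (by rw [hcj]; exact hs j)
  obtain ⟨js, τ, hL⟩ : ∃ (js : List (Fin k)) (τ : Fin k → Proc0),
      (encS (.loc 1 (cell 0 2))).locs = js.map fun j => (φ 1 j, τ j) := by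
    clear hlocs hch hparts
    revert hd hnames
    simp only [Sess.names]
    generalize (encS (.loc 1 (cell 0 2))).locs = L
    intro hd hnames
    induction L with
    | nil => exact ⟨[], fun _ => .nil, rfl⟩
    | cons a L ih =>
      rw [List.map_cons, List.nodup_cons] at hd
      obtain ⟨js, τ, hL⟩ := ih hd.2 fun b hb => hnames b (List.mem_cons_of_mem _ hb)
      obtain ⟨j, hj⟩ := hnames a (by simp)
      refine ⟨j :: js, Function.update τ j a.2, ?_⟩
      have hne : ∀ i ∈ js, i ≠ j := by
        rintro i hi rfl
        refine hd.1 (List.mem_map.2 ⟨(φ 1 i, τ i), ?_, hj⟩)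
        rw [hL]
        exact List.mem_map.2 ⟨i, hi, rfl⟩
      rw [List.map_cons, hL]
      congr 1
      · simp [hj]
      · exact List.map_congr_left fun i hi => by rw [Function.update_of_ne (hne i hi)]
  have hcell : ∀ {n : ℕ} [NeZero n] (hn : 1 < n) (i : Fin n),
      ((encS (.loc 1 (cell 0 2))).rename (induce φ (rot n i))).locs =
        js.map fun j => (φ i j, (τ j).map (induce φ (rot n i)) id id) := by
    intro n _ hn i
    rw [Sess.locs_rename, hL, List.map_map]
    simp [Function.comp_def, induce_apply h.inj, rot_one hn]
  refine ⟨js, τ, ?_, fun j hj => ?_, ?_, ?_⟩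
  · simp only [Sess.names, hL, List.map_map] at hd
    exact List.Nodup.of_map _ hd
  · exact hparts (φ 1 j, τ j) (by rw [hL]; exact List.mem_map.2 ⟨j, hj, rfl⟩)
  · refine (sessOf_locs _).trans (sessOf_perm (h.ring3.2.trans (.of_eq ?_)))
    have hr : ∀ i : Fin 3, (encS (.loc i (cell (i - 1 : Fin 3) (i + 1 : Fin 3)))).locs =
        js.map fun j => (φ i j, (τ j).map (induce φ (rot 3 i)) id id) := by
      intro i
      have hi := h.ring3.1 (rot 3 i) (by
        rw [rot_zero i, rot_one (by omega) i, rot_two le_rfl i]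
        revert i
        decide)
      rw [rot_zero i, rot_one (by omega) i, rot_two le_rfl i] at hi
      rw [hi, hcell (by omega) i]
    have hl : (List.product (List.finRange 3) js).map (fun a => (φ a.1 a.2,
        (τ a.2).map (induce φ (rot 3 a.1)) id id)) = (List.finRange 3).flatMap fun i : Fin 3 =>
          (encS (.loc i (cell (i - 1 : Fin 3) (i + 1 : Fin 3)))).locs := by
      simp only [List.product, List.map_flatMap, List.map_map, hr]
      rfl
    rw [hl, show List.finRange 3 = [0, 1, 2] from rfl]
    simp only [List.flatMap_cons, List.flatMap_nil, List.append_nil]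
    rfl
  · refine (sessOf_locs _).trans (sessOf_perm (h.ring4.2.trans (.of_eq ?_)))
    have hr : ∀ i : Fin 4, (encS (.loc i (cell (i - 1 : Fin 4) (i + 1 : Fin 4)))).locs =
        js.map fun j => (φ i j, (τ j).map (induce φ (rot 4 i)) id id) := by
      intro i
      have hi := h.ring4.1 (rot 4 i) (by
        rw [rot_zero i, rot_one (by omega) i, rot_two (by omega) i,
          show rot 4 i 3 = (3 + (i - 1) : Fin 4) from rot_apply i 3]
        revert i
        decide)
      rw [rot_zero i, rot_one (by omega) i, rot_two (by omega) i] at hi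
      rw [hi, hcell (by omega) i]
    have hl : (List.product (List.finRange 4) js).map (fun a => (φ a.1 a.2,
        (τ a.2).map (induce φ (rot 4 a.1)) id id)) = (List.finRange 4).flatMap fun i : Fin 4 =>
          (encS (.loc i (cell (i - 1 : Fin 4) (i + 1 : Fin 4)))).locs := by
      simp only [List.product, List.map_flatMap, List.map_map, hr]
      rfl
    rw [hl, show List.finRange 4 = [0, 1, 2, 3] from rfl]
    simp only [List.flatMap_cons, List.flatMap_nil, List.append_nil]
    rfl

end RingEncoding

theorem not_diverges_of_acc {F : Family} {M : Sess0} (h : Acc (fun N M => SStep M N) M) :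
    ¬ F.calculus.Diverges M := fun ⟨f, h0, hf⟩ =>
  not_acc_iff_exists_descending_chain.2 ⟨f, h0, hf⟩ h

theorem acc_of_not_diverges {F : Family} {M : Sess0} (h : ¬ F.calculus.Diverges M) :
    Acc (fun N M => SStep M N) M := by
  by_contra hM
  obtain ⟨f, h0, hf⟩ := not_acc_iff_exists_descending_chain.1 hM
  exact h ⟨f, h0, hf⟩

theorem acc_of_cong {M R : Sess0} (h : SCong true M R) (hM : Acc (fun N M => SStep M N) M) :
    Acc (fun N M => SStep M N) R :=
  ⟨_, fun _ hN => hM.inv (.cong h hN (.refl _))⟩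

theorem exists_final_of_cong {M R N : Sess0} (h : SCong true M R)
    (hN : Relation.ReflTransGen SStep R N) (hf : ∀ N', ¬ SStep N N') :
    ∃ N₁, Relation.ReflTransGen SStep M N₁ ∧ (∀ N', ¬ SStep N₁ N') ∧ (N₁.Success ↔ N.Success) := by
  rcases Relation.ReflTransGen.cases_head hN with rfl | ⟨R', h1, h2⟩
  · exact ⟨M, .refl, fun N' hs => hf N' (.cong h.symm hs (.refl _)), h.success_iff⟩
  · exact ⟨N, .head (.cong h h1 (.refl _)) h2, hf, Iff.rfl⟩

/-- A translation into a calculus of the family for which mixed choices with different partners do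
not exist cannot distinguish the ring of three participants, which must succeed, from the ring of
four participants, which never does. -/
theorem Family.not_hasGoodEncoding {F T : Family} (hF : F = .MSMP ∨ F = .MCMP)
    (hT : (∀ n pre, T.Choice n pre → ∀ i j,
      (pre i).pol = (pre j).pol ∨ (pre i).partner = (pre j).partner) ∨
      ∀ s, T.Parties s → s.card ≤ 2) : ¬ HasGoodEncoding F T.calculus := by
  rintro ⟨encP, encS, hterm, E, hE, hcomp, ⟨k, φ, hφ, hren⟩, hoc, hdiv, hsucc, -⟩
  have h : RingEncoding F T φ encS :=
    { source := hF
      isTerm := hterm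
      par := hcomp.par
      loc := fun p s => (hcomp.loc p s).imp fun K hK => ⟨encP, hK⟩
      inj := hφ
      rename := fun M r hM hr =>
        (hren M r (induce φ r) hM hr (induced_induce hφ r)).1 r.injective
      success := hsucc }
  have h3 : F.IsTerm (ring3 id) := ring3_isTerm hF Fin.val_injective
  have h4 : F.IsTerm (ring4 id) := ring4_isTerm hF Fin.val_injective
  rcases hT with hT | hT
  · obtain ⟨js, τ, hjs, hτ, hc3, hc4⟩ := h.exists_template hT
    have hacc := acc_of_cong hc3
      (acc_of_not_diverges fun hd => not_diverges_of_acc ring3_acc (hdiv _ h3 hd))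
    obtain ⟨b, hb⟩ := exists_final hφ hjs hτ hacc
    -- Every final state of the translation is equivalent to the translation of a derivative.
    have key : ∀ M N, F.IsTerm M → Relation.ReflTransGen SStep (encS M) N →
        (∀ N', ¬ SStep N N') → ∃ M', Relation.ReflTransGen SStep M M' ∧
          (N.Success ↔ ∃ M'', Relation.ReflTransGen SStep M' M'' ∧ M''.Success) := by
      intro M N hM hN hf
      obtain ⟨M', N', hM', hs, hN', hE'⟩ := hoc.sound M N hM hN
      refine ⟨M', hs, ?_⟩
      rcases Relation.ReflTransGen.cases_head hN' with rfl | ⟨R, hR, _⟩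
      · have hi : (∃ M'', Relation.ReflTransGen SStep M' M'' ∧ M''.Success) ↔
            ∃ N'', Relation.ReflTransGen SStep N N'' ∧ N''.Success :=
          (hsucc M' hM').trans (hE.success _ _ hE').symm
        rw [hi]
        constructor
        · exact fun hs => ⟨N, .refl, hs⟩
        · rintro ⟨N'', h1, h2⟩
          rcases Relation.ReflTransGen.cases_head h1 with rfl | ⟨R, hR, _⟩
          · exact h2
          · exact absurd hR (hf R)
      · exact absurd hR (hf R)
    have hb3 : b := by
      obtain ⟨N, hN, hf, hs⟩ := hb 3 le_rfl
      obtain ⟨N₁, hN₁, hf₁, hs₁⟩ := exists_final_of_cong hc3 hN hf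
      obtain ⟨M', hM', hi⟩ := key _ N₁ h3 hN₁ hf₁
      exact hs.1 (hs₁.1 (hi.2 (ring3_maySucceed hM')))
    obtain ⟨N, hN, hf, hs⟩ := hb 4 (by omega)
    obtain ⟨N₁, hN₁, hf₁, hs₁⟩ := exists_final_of_cong hc4 hN hf
    obtain ⟨M', hM', hi⟩ := key _ N₁ h4 hN₁ hf₁
    obtain ⟨M'', h5, h6⟩ := hi.1 (hs₁.2 (hs.2 hb3))
    exact ring4_not_success (hM'.trans h5) h6
  · -- Two parties are too few for the ring of three, whose cells have disjoint sets of locations.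
    have h1 := hT _ (hterm _ h3).parties
    have h2 := h.three_le_card
    omega

/-! ### Renaming and free names of mixed sessions -/

namespace BPre

@[simp] theorem map_map (f g : ℕ → ℕ) (a : BPre) : (a.map f).map g = a.map (g ∘ f) := by
  rcases a with ⟨l, _ | _⟩ | _ <;> rfl

@[simp] theorem map_id (a : BPre) : a.map id = a := by
  rcases a with ⟨l, _ | _⟩ | _ <;> rfl

theorem fv_map (f : ℕ → ℕ) (a : BPre) : (a.map f).fv = f '' a.fv := by
  rcases a with ⟨l, _ | _⟩ | _ <;> simp [map, Val.map, fv, Val.fv]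

theorem bv_map (f : ℕ → ℕ) (a : BPre) : (a.map f).bv = f '' a.bv := by
  rcases a with ⟨l, _ | _⟩ | _ <;> simp [map, bv]

end BPre

theorem Val.fv_map (f : ℕ → ℕ) (v : Val) : (v.map f).fv = f '' v.fv := by
  cases v <;> simp [Val.map, Val.fv]

theorem Val.map_map (f g : ℕ → ℕ) (v : Val) : (v.map f).map g = v.map (g ∘ f) := by
  cases v <;> rfl

theorem Val.map_id (v : Val) : v.map id = v := by
  cases v <;> rfl

namespace Mix

theorem map_map {H : Type} (f g : ℕ → ℕ) (P : Mix H) : (P.map f).map g = P.map (g ∘ f) := by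
  induction P <;> simp_all [map, Val.map_map]

@[simp] theorem map_id {H : Type} (P : Mix H) : P.map id = P := by
  induction P <;> simp_all [map, Val.map_id]

theorem map_fill {H K : Type} (f : ℕ → ℕ) (s : H → Mix K) (C : Mix H) :
    (C.fill s).map f = (C.map f).fill fun h => (s h).map f := by
  induction C <;> simp_all [map, fill]

theorem fv_map {H : Type} (e : Equiv.Perm ℕ) (P : Mix H) : (P.map e).fv = e '' P.fv := by
  induction P with
  | choice q y pre P ih =>
    simp only [map, fv, ih, BPre.fv_map, BPre.bv_map, ← Set.image_sdiff e.injective,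
      ← Set.image_union, ← Set.image_iUnion, ← Set.image_singleton]
  | bran y l P ih =>
    simp only [map, fv, ih, ← Set.image_union, ← Set.image_iUnion, ← Set.image_singleton]
  | res y z P ih =>
    simp only [map, fv, ih, ← Set.image_pair, ← Set.image_sdiff e.injective]
  | inp q y x P ih =>
    simp only [map, fv, ih, ← Set.image_sdiff e.injective, ← Set.image_union,
      ← Set.image_singleton]
  | cond v P Q ihP ihQ => simp only [map, fv, ihP, ihQ, Val.fv_map, ← Set.image_union]
  | par P Q ihP ihQ => simp only [map, fv, ihP, ihQ, ← Set.image_union]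
  | out y v P ih =>
    simp only [map, fv, ih, Val.fv_map, ← Set.image_union, ← Set.image_singleton]
  | sel y l P ih => simp only [map, fv, ih, ← Set.image_union, ← Set.image_singleton]
  | _ => simp [map, fv]

theorem fv_fill {H K : Type} {s t : H → Mix K} (h : ∀ k, (s k).fv = (t k).fv) (C : Mix H) :
    (C.fill s).fv = (C.fill t).fv := by
  induction C <;> simp_all [fill, fv]

theorem fv_finite {H : Type} (P : Mix H) : P.fv.Finite := by
  have hv : ∀ v : Val, v.fv.Finite := by intro v; cases v <;> simp [Val.fv]
  induction P with
  | choice q y pre P ih =>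
    refine (Set.finite_singleton _).union (Set.finite_iUnion fun i => ?_)
    refine Set.Finite.union ?_ ((ih i).subset Set.sdiff_subset)
    cases pre i <;> simp [BPre.fv, hv]
  | bran y l P ih => exact (Set.finite_singleton _).union (Set.finite_iUnion ih)
  | res y z P ih => exact ih.subset Set.sdiff_subset
  | inp q y x P ih => exact (Set.finite_singleton _).union (ih.subset Set.sdiff_subset)
  | cond v P Q ihP ihQ => exact ((hv v).union ihP).union ihQ
  | par P Q ihP ihQ => exact ihP.union ihQ
  | out y v P ih => exact ((Set.finite_singleton _).union (hv v)).union ih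
  | sel y l P ih => exact (Set.finite_singleton _).union ih
  | _ => exact Set.finite_empty

/-- The two names bound by a restriction are different, unless the restriction has no effect.  This
excludes processes in which structural congruence could confuse the two ends of a channel. -/
def Proper {H : Type} : Mix H → Prop
  | par P Q => P.Proper ∧ Q.Proper
  | res y z P => (y = z → y ∉ P.fv) ∧ P.Proper
  | cond _ P Q => P.Proper ∧ Q.Proper
  | choice _ _ _ P => ∀ i, (P i).Proper
  | out _ _ P => P.Proper
  | inp _ _ _ P => P.Proper
  | sel _ _ P => P.Proper
  | bran _ _ P => ∀ i, (P i).Proper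
  | _ => True

theorem proper_map {H : Type} (e : Equiv.Perm ℕ) (P : Mix H) : (P.map e).Proper ↔ P.Proper := by
  induction P with
  | res y z P ih => simp [map, Proper, ih, fv_map]
  | _ => simp_all [map, Proper]

theorem proper_fill {H K : Type} {s t : H → Mix K} (h : ∀ k, (s k).fv = (t k).fv)
    (h' : ∀ k, (s k).Proper ↔ (t k).Proper) (C : Mix H) :
    (C.fill s).Proper ↔ (C.fill t).Proper := by
  induction C with
  | res y z P ih => simp only [fill, Proper, ih, fv_fill h P]
  | _ => simp_all [fill, Proper]

theorem success_map {H : Type} (f : ℕ → ℕ) (P : Mix H) : (P.map f).Success ↔ P.Success := by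
  induction P <;> simp_all [map, Success]

theorem success_fill {H K : Type} {s t : H → Mix K} (h : ∀ k, (s k).Success ↔ (t k).Success)
    (C : Mix H) : (C.fill s).Success ↔ (C.fill t).Success := by
  induction C <;> simp_all [fill, Success]

end Mix

theorem swap_image_diff {s : Set ℕ} {x w : ℕ} (h : w ∉ s) :
    (Equiv.swap x w '' s) \ {w} = s \ {x} := by
  ext a
  simp only [Set.mem_sdiff, Set.mem_image, Set.mem_singleton_iff]
  constructor
  · rintro ⟨⟨b, hb, rfl⟩, h1⟩
    have hx : b ≠ x := fun hx => h1 (by simp [hx])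
    have hw : b ≠ w := fun hw => h (hw ▸ hb)
    rw [Equiv.swap_apply_of_ne_of_ne hx hw]
    exact ⟨hb, hx⟩
  · rintro ⟨ha, hx⟩
    have hw : a ≠ w := fun hw => h (hw ▸ ha)
    exact ⟨⟨a, ha, Equiv.swap_apply_of_ne_of_ne hx hw⟩, hw⟩

theorem diff_pair (s : Set ℕ) (y z : ℕ) : s \ {y, z} = (s \ {y}) \ {z} := by
  rw [Set.sdiff_sdiff]; rfl

theorem MIdent.fv_eq {P Q : Mix0} (h : MIdent P Q) : P.fv = Q.fv := by
  induction h with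
  | refl => rfl
  | symm _ ih => exact ih.symm
  | trans _ _ ih ih' => exact ih.trans ih'
  | ctx C _ ih => exact Mix.fv_fill (fun _ => ih) C
  | alphaResL y z w P hyz hwz hw =>
    simp only [Mix.fv, Mix.fv_map]
    rw [diff_pair, diff_pair, swap_image_diff hw]
  | alphaResR y z w P hyz hwy hw =>
    simp only [Mix.fv, Mix.fv_map]
    rw [Set.pair_comm, Set.pair_comm y w, diff_pair, diff_pair, swap_image_diff hw]
  | alphaBranch q y pre P i l x w h hw =>
    simp only [Mix.fv]
    congr 2
    funext j
    by_cases hj : j = i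
    · subst hj
      simp only [Function.update_self, h, Mix.fv_map, BPre.fv, BPre.bv]
      rw [swap_image_diff hw]
    · simp [hj]
  | alphaInp q y x w P hw =>
    simp only [Mix.fv, Mix.fv_map]
    rw [swap_image_diff hw]
  | permChoice q y pre P e =>
    simp only [Mix.fv, Function.comp]
    congr 1
    exact (e.surjective.iUnion_comp fun i => (pre i).fv ∪ ((P i).fv \ (pre i).bv)).symm
  | permBran y l P e =>
    simp only [Mix.fv, Function.comp]
    congr 1
    exact (e.surjective.iUnion_comp fun i => (P i).fv).symm

theorem MCong.fv_eq {P Q : Mix0} (h : MCong P Q) : P.fv = Q.fv := by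
  induction h with
  | ident h => exact h.fv_eq
  | symm _ ih => exact ih.symm
  | trans _ _ ih ih' => exact ih.trans ih'
  | ctx C _ ih => exact Mix.fv_fill (fun _ => ih) C
  | comm P Q => exact Set.union_comm _ _
  | assoc P Q R => exact Set.union_assoc _ _ _
  | nil P => exact Set.union_empty _
  | resNil y z => exact Set.empty_sdiff _
  | resSwap y z P => simp only [Mix.fv, Set.pair_comm]
  | extrude y z P Q hy hz =>
    simp only [Mix.fv, Set.union_sdiff_distrib]
    congr 1
    refine (sdiff_eq_left.2 ?_).symm
    simp [Set.disjoint_right, hy, hz]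
  | resRes w x y z P _ =>
    simp only [Mix.fv, Set.sdiff_sdiff, Set.union_comm]

theorem MIdent.proper_iff {P Q : Mix0} (h : MIdent P Q) : P.Proper ↔ Q.Proper := by
  induction h with
  | refl => rfl
  | symm _ ih => exact ih.symm
  | trans _ _ ih ih' => exact ih.trans ih'
  | ctx C h ih => exact Mix.proper_fill (fun _ => h.fv_eq) (fun _ => ih) C
  | alphaResL y z w P hyz hwz hw => simp [Mix.Proper, Mix.proper_map, hyz, hwz]
  | alphaResR y z w P hyz hwy hw => simp [Mix.Proper, Mix.proper_map, hyz, hwy.symm]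
  | alphaBranch q y pre P i l x w h hw =>
    refine forall_congr' fun j => ?_
    by_cases hj : j = i
    · subst hj; simp [Mix.proper_map]
    · simp [hj]
  | alphaInp q y x w P hw => exact (Mix.proper_map _ P).symm
  | permChoice q y pre P e =>
    exact ⟨fun h i => h (e i), fun h i => by simpa using h (e.symm i)⟩
  | permBran y l P e => exact ⟨fun h i => h (e i), fun h i => by simpa using h (e.symm i)⟩

theorem MCong.proper_iff {P Q : Mix0} (h : MCong P Q) : P.Proper ↔ Q.Proper := by
  induction h with
  | ident h => exact h.proper_iff
  | symm _ ih => exact ih.symm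
  | trans _ _ ih ih' => exact ih.trans ih'
  | ctx C h ih => exact Mix.proper_fill (fun _ => h.fv_eq) (fun _ => ih) C
  | comm P Q => exact and_comm
  | assoc P Q R => exact and_assoc
  | nil P => simp [Mix.Proper]
  | resNil y z => simp [Mix.Proper, Mix.fv]
  | resSwap y z P =>
    refine and_congr_left fun _ => ⟨?_, ?_⟩
    · rintro h rfl; exact h rfl
    · rintro h rfl; exact h rfl
  | extrude y z P Q hy hz =>
    simp only [Mix.Proper, Mix.fv, Set.mem_union, hy, false_or]
    tauto
  | resRes w x y z P h =>
    simp only [List.nodup_cons, List.mem_cons, not_or] at h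
    simp [Mix.Proper, h.1.1, h.2.2.1.1]

theorem MIdent.success_iff {P Q : Mix0} (h : MIdent P Q) : P.Success ↔ Q.Success := by
  induction h with
  | refl => rfl
  | symm _ ih => exact ih.symm
  | trans _ _ ih ih' => exact ih.trans ih'
  | ctx C _ ih => exact Mix.success_fill (fun _ => ih) C
  | alphaResL => exact (Mix.success_map _ _).symm
  | alphaResR => exact (Mix.success_map _ _).symm
  | _ => rfl

theorem MCong.success_iff {P Q : Mix0} (h : MCong P Q) : P.Success ↔ Q.Success := by
  induction h with
  | ident h => exact h.success_iff
  | symm _ ih => exact ih.symm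
  | trans _ _ ih ih' => exact ih.trans ih'
  | ctx C _ ih => exact Mix.success_fill (fun _ => ih) C
  | comm P Q => exact or_comm
  | assoc P Q R => exact or_assoc
  | nil P => simp [Mix.Success]
  | resNil y z => rfl
  | resSwap y z P => rfl
  | extrude y z P Q hy hz => rfl
  | resRes w x y z P h => rfl

theorem swap_conj (e : Equiv.Perm ℕ) (x w : ℕ) :
    (Equiv.swap (e x) (e w) : ℕ → ℕ) ∘ e = e ∘ Equiv.swap x w := by
  funext a
  simp only [Function.comp]
  by_cases hx : a = x
  · simp [hx]
  by_cases hw : a = w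
  · simp [hw]
  rw [Equiv.swap_apply_of_ne_of_ne hx hw,
    Equiv.swap_apply_of_ne_of_ne (by simpa using hx) (by simpa using hw)]

/-- Identification is preserved by permutations of names. -/
theorem MIdent.map {P Q : Mix0} (e : Equiv.Perm ℕ) (h : MIdent P Q) :
    MIdent (P.map e) (Q.map e) := by
  have hfv : ∀ {w : ℕ} {P : Mix0}, w ∉ P.fv → e w ∉ (P.map e).fv := by
    intro w P h
    rwa [Mix.fv_map, e.injective.mem_set_image]
  induction h with
  | refl P => exact .refl _
  | symm _ ih => exact ih.symm
  | trans _ _ ih ih' => exact ih.trans ih'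
  | ctx C _ ih =>
    rw [Mix.map_fill, Mix.map_fill]
    exact .ctx _ ih
  | alphaResL y z w P hyz hwz hw =>
    have := MIdent.alphaResL (e y) (e z) (e w) (P.map e) (e.injective.ne hyz)
      (e.injective.ne hwz) (hfv hw)
    rwa [Mix.map_map, swap_conj, ← Mix.map_map] at this
  | alphaResR y z w P hyz hwy hw =>
    have := MIdent.alphaResR (e y) (e z) (e w) (P.map e) (e.injective.ne hyz)
      (e.injective.ne hwy) (hfv hw)
    rwa [Mix.map_map, swap_conj, ← Mix.map_map] at this
  | alphaBranch q y pre P i l x w h hw =>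
    have := MIdent.alphaBranch q (e y) (fun j => (pre j).map e) (fun j => (P j).map e) i l (e x)
      (e w) (by simp [h, BPre.map]) (hfv hw)
    rw [Mix.map_map, swap_conj, ← Mix.map_map] at this
    simp only [Mix.map]
    convert this using 2
    · funext j
      by_cases hj : j = i
      · subst hj; simp [BPre.map]
      · simp [hj]
    · funext j
      by_cases hj : j = i
      · subst hj; simp
      · simp [hj]
  | alphaInp q y x w P hw =>
    have := MIdent.alphaInp q (e y) (e x) (e w) (P.map e) (hfv hw)
    rwa [Mix.map_map, swap_conj, ← Mix.map_map] at this
  | permChoice q y pre P e' =>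
    exact .permChoice q _ (fun j => (pre j).map e) (fun j => (P j).map e) e'
  | permBran y l P e' => exact .permBran _ l (fun j => (P j).map e) e'

theorem MCong.map {P Q : Mix0} (e : Equiv.Perm ℕ) (h : MCong P Q) : MCong (P.map e) (Q.map e) := by
  have hfv : ∀ {w : ℕ} {P : Mix0}, w ∉ P.fv → e w ∉ (P.map e).fv := by
    intro w P h
    rwa [Mix.fv_map, e.injective.mem_set_image]
  induction h with
  | ident h => exact .ident (h.map e)
  | symm _ ih => exact ih.symm
  | trans _ _ ih ih' => exact ih.trans ih'
  | ctx C _ ih =>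
    rw [Mix.map_fill, Mix.map_fill]
    exact .ctx _ ih
  | comm P Q => exact .comm _ _
  | assoc P Q R => exact .assoc _ _ _
  | nil P => exact .nil _
  | resNil y z => exact .resNil _ _
  | resSwap y z P => exact .resSwap _ _ _
  | extrude y z P Q hy hz => exact .extrude _ _ _ _ (hfv hy) (hfv hz)
  | resRes w x y z P h =>
    exact .resRes _ _ _ _ _ (by simpa using h.map e.injective)

/-! ### Renaming names that are not free -/

theorem Mix.fill_fill_elim {H : Type} (s : H → Mix0) (P : Mix0) :
    (P.fill (Empty.elim : Empty → Mix H)).fill s = P := by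
  induction P with
  | hole k => exact k.elim
  | _ => simp_all [Mix.fill]

namespace MCong

theorem refl (P : Mix0) : MCong P P := .ident (.refl P)

theorem parL {P P' : Mix0} (Q : Mix0) (h : MCong P P') : MCong (.par P Q) (.par P' Q) := by
  simpa [Mix.fill, Mix.fill_fill_elim] using
    MCong.ctx (.par (.hole 0) (Q.fill (Empty.elim : Empty → Mix (Fin 1)))) h

theorem par {P P' Q Q' : Mix0} (h : MCong P P') (h' : MCong Q Q') :
    MCong (.par P Q) (.par P' Q') :=
  (h.parL Q).trans ((MCong.comm _ _).trans ((h'.parL P').trans (.comm _ _)))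

theorem res {P P' : Mix0} (y z : Name) (h : MCong P P') : MCong (.res y z P) (.res y z P') := by
  simpa [Mix.fill] using MCong.ctx (.res y z (.hole 0)) h

theorem nilPar (P : Mix0) : MCong (.par .nil P) P := (MCong.comm _ _).trans (.nil _)

theorem choice_update (q y) {n : ℕ} (pre : Fin (n + 1) → BPre) (P : Fin (n + 1) → Mix0)
    (i : Fin (n + 1)) {Q Q' : Mix0} (h : MCong Q Q') :
    MCong (.choice q y pre (Function.update P i Q)) (.choice q y pre (Function.update P i Q')) := by
  have hf : ∀ R : Mix0, (Mix.choice q y pre (fun j => if j = i then .hole 0 else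
      (P j).fill (Empty.elim : Empty → Mix (Fin 1)))).fill (fun _ => R) =
      .choice q y pre (Function.update P i R) := by
    intro R
    simp only [Mix.fill]
    congr 1
    funext j
    by_cases hj : j = i <;> simp [hj, Mix.fill, Mix.fill_fill_elim]
  rw [← hf, ← hf]
  exact .ctx _ h

theorem bran_update (y) {n : ℕ} (l : Fin (n + 1) → Label) (P : Fin (n + 1) → Mix0)
    (i : Fin (n + 1)) {Q Q' : Mix0} (h : MCong Q Q') :
    MCong (.bran y l (Function.update P i Q)) (.bran y l (Function.update P i Q')) := by
  have hf : ∀ R : Mix0, (Mix.bran y l (fun j => if j = i then .hole 0 else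
      (P j).fill (Empty.elim : Empty → Mix (Fin 1)))).fill (fun _ => R) =
      .bran y l (Function.update P i R) := by
    intro R
    simp only [Mix.fill]
    congr 1
    funext j
    by_cases hj : j = i <;> simp [hj, Mix.fill, Mix.fill_fill_elim]
  rw [← hf, ← hf]
  exact .ctx _ h

/-- A restriction of one name twice has no effect if the name does not occur. -/
theorem res_self {y : Name} {P : Mix0} (h : y ∉ P.fv) : MCong (.res y y P) P :=
  ((MCong.res y y (MCong.nil P).symm).trans (MCong.extrude y y P .nil h h).symm).trans
    ((par (refl P) (.resNil y y)).trans (.nil P))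

end MCong

theorem Val.map_eq_self {f : ℕ → ℕ} {v : Val} (h : ∀ a ∈ v.fv, f a = a) : v.map f = v := by
  cases v with
  | var x => simp [Val.map, h x (by simp [Val.fv])]
  | const c => rfl

theorem BPre.map_eq_self {f : ℕ → ℕ} {a : BPre} (h : ∀ x ∈ a.fv, f x = x)
    (h' : ∀ x ∈ a.bv, f x = x) : a.map f = a := by
  cases a with
  | out l v => simp [BPre.map, Val.map_eq_self h]
  | inp l x => simp [BPre.map, h' x (by simp [BPre.bv])]

theorem swap_eq_self {a b : ℕ} {s : Set ℕ} (ha : a ∉ s) (hb : b ∉ s) :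
    ∀ x ∈ s, Equiv.swap a b x = x := fun _ hx =>
  Equiv.swap_apply_of_ne_of_ne (fun h => ha (h ▸ hx)) (fun h => hb (h ▸ hx))

/-- Renaming the bound names of a restriction. -/
theorem MCong.res_swap {y z a b : ℕ} {P : Mix0} (hyz : y ≠ z) (hab : a ≠ b)
    (ha : a ∉ (Mix.res y z P).fv) (hb : b ∉ (Mix.res y z P).fv)
    (ih : a ∉ P.fv → b ∉ P.fv → MCong P (P.map (Equiv.swap a b))) :
    MCong (.res y z P) ((Mix.res y z P).map (Equiv.swap a b)) := by
  simp only [Mix.fv, Set.mem_sdiff, Set.mem_insert_iff, Set.mem_singleton_iff, not_and, not_not]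
    at ha hb
  -- If exactly one of the two names is bound, then this is an instance of the renaming rules.
  have one : ∀ {y z a b : ℕ} {P : Mix0}, y ≠ z → a ≠ b → (b ∈ P.fv → b = y ∨ b = z) →
      (a = y ∨ a = z) → b ≠ y → b ≠ z →
      MCong (.res y z P) ((Mix.res y z P).map (Equiv.swap a b)) := by
    intro y z a b P hyz hab hb hya hby hbz
    have hbP : b ∉ P.fv := fun h => (hb h).elim hby hbz
    simp only [Mix.map]
    rcases hya with rfl | rfl
    · rw [Equiv.swap_apply_left, Equiv.swap_apply_of_ne_of_ne hyz.symm hbz.symm]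
      exact .ident (.alphaResL _ _ _ _ hyz hbz hbP)
    · rw [Equiv.swap_apply_left, Equiv.swap_apply_of_ne_of_ne hyz hby.symm]
      exact .ident (.alphaResR _ _ _ _ hyz hby hbP)
  by_cases hya : a = y ∨ a = z
  · by_cases hyb : b = y ∨ b = z
    · -- Both names are bound: a detour over a fresh name `c`.
      obtain ⟨c, hc⟩ := Set.Infinite.exists_notMem_finite Set.infinite_univ
        (P.fv_finite.union (Set.toFinite {y, z}))
      have hcP : c ∉ P.fv := fun h => hc.2 (.inl h)
      have hcy : c ≠ y := fun h => hc.2 (.inr (.inl h))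
      have hcz : c ≠ z := fun h => hc.2 (.inr (.inr h))
      have main : ∀ u v : ℕ, u ≠ v → c ≠ u → c ≠ v →
          MCong (.res u v P) (.res v u (P.map (Equiv.swap u v))) := by
        intro u v huv hcu hcv
        have e1 := MIdent.alphaResL u v c P huv hcv hcP
        have e2 := MIdent.alphaResR c v u (P.map (Equiv.swap u c)) hcv hcu.symm (by
          rw [Mix.fv_map]
          rintro ⟨x, hx, h⟩
          rw [Equiv.swap_apply_eq_iff, Equiv.swap_apply_left] at h
          exact hcP (h ▸ hx))
        have e3 := MIdent.alphaResL c u v ((P.map (Equiv.swap u c)).map (Equiv.swap v u))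
          hcu huv.symm (by
          rw [Mix.fv_map, Mix.fv_map]
          rintro ⟨_, ⟨x, hx, rfl⟩, h⟩
          rw [Equiv.swap_apply_eq_iff, Equiv.swap_apply_left, Equiv.swap_apply_eq_iff,
            Equiv.swap_apply_left] at h
          exact hcP (h ▸ hx))
        have e := (e1.trans e2).trans e3
        rw [Mix.map_map, Mix.map_map] at e
        convert MCong.ident e using 3
        funext x
        simp only [Function.comp, Equiv.swap_apply_def]
        split_ifs <;> simp_all
      simp only [Mix.map]
      rcases hya with rfl | rfl <;> rcases hyb with rfl | rfl
      · exact absurd rfl hab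
      · rw [Equiv.swap_apply_left, Equiv.swap_apply_right]
        exact main _ _ hab hcy hcz
      · rw [Equiv.swap_apply_left, Equiv.swap_apply_right, Equiv.swap_comm]
        exact main _ _ hyz hcy hcz
      · exact absurd rfl hab
    · rw [not_or] at hyb
      exact one hyz hab hb hya hyb.1 hyb.2
  · by_cases hyb : b = y ∨ b = z
    · rw [not_or] at hya
      rw [Equiv.swap_comm]
      exact one hyz hab.symm ha hyb hya.1 hya.2
    · rw [not_or] at hya hyb
      have h := ih (fun h => (ha h).elim hya.1 hya.2) (fun h => (hb h).elim hyb.1 hyb.2)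
      simp only [Mix.map]
      rw [Equiv.swap_apply_of_ne_of_ne (Ne.symm hya.1) (Ne.symm hyb.1),
        Equiv.swap_apply_of_ne_of_ne (Ne.symm hya.2) (Ne.symm hyb.2)]
      exact h.res _ _

/-- Two names that are not free may be exchanged. -/
theorem MCong.swap {a b : ℕ} (hab : a ≠ b) (P : Mix0) (hP : P.Proper) (ha : a ∉ P.fv)
    (hb : b ∉ P.fv) : MCong P (P.map (Equiv.swap a b)) := by
  induction P with
  | hole k => exact k.elim
  | nil => exact .refl _
  | tick => exact .refl _
  | par P Q ihP ihQ =>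
    simp only [Mix.fv, Set.mem_union, not_or] at ha hb
    exact (ihP hP.1 ha.1 hb.1).par (ihQ hP.2 ha.2 hb.2)
  | res y z P ih =>
    by_cases hyz : y = z
    · subst hyz
      have hy := hP.1 rfl
      have hna : a ∉ P.fv := fun h => ha ⟨h, by rintro (rfl | rfl) <;> exact hy h⟩
      have hnb : b ∉ P.fv := fun h => hb ⟨h, by rintro (rfl | rfl) <;> exact hy h⟩
      refine (MCong.res_self hy).trans ((ih hP.2 hna hnb).trans (.symm (MCong.res_self ?_)))
      rwa [Mix.fv_map, (Equiv.injective _).mem_set_image]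
    · exact .res_swap hyz hab ha hb (ih hP.2)
  | cond v P Q ihP ihQ =>
    simp only [Mix.fv, Set.mem_union, not_or] at ha hb
    simp only [Mix.map, Val.map_eq_self (swap_eq_self ha.1.1 hb.1.1)]
    have h1 := MCong.ctx (.cond v (.hole 0) (Q.fill (Empty.elim : Empty → Mix (Fin 1))))
      (ihP hP.1 ha.1.2 hb.1.2)
    have h2 := MCong.ctx (.cond v ((P.map (Equiv.swap a b)).fill
      (Empty.elim : Empty → Mix (Fin 1))) (.hole 0)) (ihQ hP.2 ha.2 hb.2)
    simp only [Mix.fill, Mix.fill_fill_elim] at h1 h2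
    exact h1.trans h2
  | out y v P ih =>
    simp only [Mix.fv, Set.mem_union, not_or] at ha hb
    simp only [Mix.map, Val.map_eq_self (swap_eq_self ha.1.2 hb.1.2),
      swap_eq_self ha.1.1 hb.1.1 y rfl]
    simpa [Mix.fill] using MCong.ctx (.out y v (.hole 0)) (ih hP ha.2 hb.2)
  | sel y l P ih =>
    simp only [Mix.fv, Set.mem_union, not_or] at ha hb
    simp only [Mix.map, swap_eq_self ha.1 hb.1 y rfl]
    simpa [Mix.fill] using MCong.ctx (.sel y l (.hole 0)) (ih hP ha.2 hb.2)
  | inp q y x P ih =>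
    simp only [Mix.fv, Set.mem_union, not_or, Set.mem_sdiff, Set.mem_singleton_iff, not_and,
      not_not] at ha hb
    simp only [Mix.map, Equiv.swap_apply_of_ne_of_ne (Ne.symm ha.1) (Ne.symm hb.1)]
    by_cases hxa : a = x
    · subst hxa
      rw [Equiv.swap_apply_left]
      exact .ident (.alphaInp _ _ _ _ _ fun h => hab (hb.2 h).symm)
    by_cases hxb : b = x
    · subst hxb
      rw [Equiv.swap_apply_right, Equiv.swap_comm]
      exact .ident (.alphaInp _ _ _ _ _ fun h => hab (ha.2 h))
    · rw [Equiv.swap_apply_of_ne_of_ne (Ne.symm hxa) (Ne.symm hxb)]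
      simpa [Mix.fill] using MCong.ctx (.inp q y x (.hole 0))
        (ih hP (fun h => hxa (ha.2 h)) (fun h => hxb (hb.2 h)))
  | bran y l P ih =>
    simp only [Mix.fv, Set.mem_union, not_or, Set.mem_iUnion, not_exists] at ha hb
    simp only [Mix.map, swap_eq_self ha.1 hb.1 y rfl]
    -- The branches are renamed one after the other.
    have key : ∀ s : Finset (Fin _), MCong (.bran y l P)
        (.bran y l fun i => if i ∈ s then (P i).map (Equiv.swap a b) else P i) := by
      intro s
      induction s using Finset.induction_on with
      | empty => simpa using MCong.refl _
      | insert i s hi ihs =>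
        refine ihs.trans ?_
        have h := MCong.bran_update y l
          (fun i => if i ∈ s then (P i).map (Equiv.swap a b) else P i) i
          (ih i (hP i) (ha.2 i) (hb.2 i))
        convert h using 2
        · exact (Function.update_eq_self_iff.2 (by simp [hi])).symm
        · funext j
          by_cases hj : j = i
          · subst hj; simp
          · simp [hj]
    simpa using key Finset.univ
  | choice q y pre P ih =>
    simp only [Mix.fv, Set.mem_union, not_or, Set.mem_iUnion, not_exists, Set.mem_sdiff, not_and,
      not_not] at ha hb
    simp only [Mix.map, swap_eq_self ha.1 hb.1 y rfl]
    have one : ∀ (pre' : Fin _ → BPre) (P' : Fin _ → Mix0) (i : Fin _), pre' i = pre i →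
        P' i = P i → MCong (.choice q y pre' P')
          (.choice q y (Function.update pre' i ((pre i).map (Equiv.swap a b)))
            (Function.update P' i ((P i).map (Equiv.swap a b)))) := by
      intro pre' P' i hpre hP'
      have step : a ∉ (P i).fv → b ∉ (P i).fv → (pre i).map (Equiv.swap a b) = pre i →
          MCong (.choice q y pre' P')
          (.choice q y (Function.update pre' i ((pre i).map (Equiv.swap a b)))
            (Function.update P' i ((P i).map (Equiv.swap a b)))) := by
        intro h1 h2 h3
        rw [h3, Function.update_eq_self_iff.2 hpre.symm]
        have h := MCong.choice_update q y pre' P' i (ih i (hP i) h1 h2)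
        rwa [Function.update_eq_self_iff.2 hP'.symm] at h
      cases hi : pre i with
      | out l v =>
        have ha' := ha.2 i
        have hb' := hb.2 i
        rw [hi] at ha' hb' step
        refine step (fun h => ha'.2 h) (fun h => hb'.2 h) ?_
        exact BPre.map_eq_self (swap_eq_self ha'.1 hb'.1) (by simp [BPre.bv])
      | inp l x =>
        have ha' := (ha.2 i).2
        have hb' := (hb.2 i).2
        rw [hi] at ha' hb' step
        simp only [BPre.bv, Set.mem_singleton_iff] at ha' hb'
        by_cases hxa : a = x
        · subst hxa
          have h := MIdent.alphaBranch q y pre' P' i l a b (hpre.trans hi)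
            (by rw [hP']; exact fun h => hab (hb' h).symm)
          rw [hP'] at h
          simpa [BPre.map] using MCong.ident h
        by_cases hxb : b = x
        · subst hxb
          have h := MIdent.alphaBranch q y pre' P' i l b a (hpre.trans hi)
            (by rw [hP']; exact fun h => hab (ha' h))
          rw [hP', Equiv.swap_comm] at h
          simpa [BPre.map] using MCong.ident h
        · refine step (fun h => hxa (ha' h)) (fun h => hxb (hb' h)) ?_
          simp [BPre.map, Equiv.swap_apply_of_ne_of_ne (Ne.symm hxa) (Ne.symm hxb)]
    have key : ∀ s : Finset (Fin _), MCong (.choice q y pre P)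
        (.choice q y (fun i => if i ∈ s then (pre i).map (Equiv.swap a b) else pre i)
          fun i => if i ∈ s then (P i).map (Equiv.swap a b) else P i) := by
      intro s
      induction s using Finset.induction_on with
      | empty => simpa using MCong.refl _
      | insert i s hi ihs =>
        refine ihs.trans ?_
        have h := one (fun i => if i ∈ s then (pre i).map (Equiv.swap a b) else pre i)
          (fun i => if i ∈ s then (P i).map (Equiv.swap a b) else P i) i (by simp [hi])
          (by simp [hi])
        convert h using 2
        · funext j
          by_cases hj : j = i
          · subst hj; simp
          · simp [hj]
        · funext j
          by_cases hj : j = i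
          · subst hj; simp
          · simp [hj]
    simpa using key Finset.univ

/-! ### Session types up to unfolding and subtyping -/

namespace Ty

/-- The number of recursions at the top of a type. -/
def muDepth : Ty → ℕ
  | mu T => T.muDepth + 1
  | _ => 0

theorem muDepth_subst {S T : Ty} {k : ℕ} (h : Guards k T) :
    (subst S k T).muDepth = T.muDepth := by
  induction T generalizing k with
  | tvar m => simp [subst, show m ≠ k from h, muDepth]
  | mu T ih => simp [subst, muDepth, ih (k := k + 1) h]
  | _ => simp [subst, muDepth]

theorem un_subst {S T : Ty} {k : ℕ} (h : Guards k T) : (subst S k T).Un ↔ T.Un := by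
  induction T generalizing k with
  | tvar m => simp [subst, show m ≠ k from h, Un]
  | mu T ih => exact ih (k := k + 1) h
  | _ => simp [subst, Un]

theorem WFAt.mono {T : Ty} {k m : ℕ} (h : WFAt k T) (hkm : k ≤ m) : WFAt m T := by
  induction T generalizing k m with
  | tvar i => exact lt_of_lt_of_le h hkm
  | mu T ih => exact ⟨h.1, ih h.2 (Nat.succ_le_succ hkm)⟩
  | choice q w l d T U ihT ihU =>
    exact ⟨h.1, fun i => ⟨ihT i (h.2 i).1 hkm, ihU i (h.2 i).2 hkm⟩⟩
  | com q d T U ihT ihU => exact ⟨ihT h.1 hkm, ihU h.2 hkm⟩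
  | lab q w l T ih => exact ⟨h.1, fun i => ih i (h.2 i) hkm⟩
  | _ => trivial

theorem WFAt.guards {T : Ty} {k m : ℕ} (h : WFAt k T) (hkm : k ≤ m) : Guards m T := by
  induction T generalizing k m with
  | tvar i =>
    have h : i < k := h
    exact (lt_of_lt_of_le h hkm).ne
  | mu T ih => exact ih h.2 (Nat.succ_le_succ hkm)
  | _ => trivial

theorem Guards.subst {S T : Ty} {k j : ℕ} (hS : S.WF) (h : Guards j T) :
    Guards j (Ty.subst S k T) := by
  induction T generalizing k j with
  | tvar m =>
    by_cases hm : m = k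
    · simp only [Ty.subst, hm, if_true]
      exact WFAt.guards hS (Nat.zero_le _)
    · simpa only [Ty.subst, hm, if_false] using h
  | mu T ih => exact ih (j := j + 1) h
  | _ => trivial

theorem WFAt.subst {S T : Ty} {k : ℕ} (hS : S.WF) (h : WFAt (k + 1) T) :
    WFAt k (Ty.subst S k T) := by
  induction T generalizing k with
  | tvar m =>
    by_cases hm : m = k
    · simp only [Ty.subst, hm, if_true]
      exact WFAt.mono hS (Nat.zero_le _)
    · simp only [Ty.subst, hm, if_false]
      have h : m < k + 1 := h
      exact lt_of_le_of_ne (Nat.lt_succ_iff.1 h) hm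
  | mu T ih => exact ⟨Guards.subst hS h.1, ih h.2⟩
  | choice q w l d T U ihT ihU =>
    exact ⟨h.1, fun i => ⟨ihT i (h.2 i).1, ihU i (h.2 i).2⟩⟩
  | com q d T U ihT ihU => exact ⟨ihT h.1, ihU h.2⟩
  | lab q w l T ih => exact ⟨h.1, fun i => ih i (h.2 i)⟩
  | _ => trivial

theorem WF.unfold {T : Ty} (h : (mu T).WF) : (subst (mu T) 0 T).WF := WFAt.subst h h.2

theorem muDepth_unfold {T : Ty} (h : (mu T).WF) :
    (subst (mu T) 0 T).muDepth < (mu T).muDepth := by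
  rw [muDepth_subst h.1]
  exact Nat.lt_succ_self _

theorem un_unfold {T : Ty} (h : (mu T).WF) : (subst (mu T) 0 T).Un ↔ (mu T).Un := un_subst h.1

/-- `Br T w d l A B`: up to unfolding, `T` is a choice with view `w` and a branch with polarity `d`,
label `l`, payload `A` and continuation `B`.  An input or output has a single branch with label `0`;
selections and branchings have the payload `nat`. -/
inductive Br : Ty → View → Pol → Label → Ty → Ty → Prop
  | choice (q w) {n : ℕ} (l d) (T U : Fin (n + 1) → Ty) (i) :
      Br (choice q w l d T U) w (d i) (l i) (T i) (U i)
  | snd (q T U) : Br (com q .snd T U) .int .snd 0 T U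
  | rcv (q T U) : Br (com q .rcv T U) .ext .rcv 0 T U
  | int (q) {n : ℕ} (l) (T : Fin (n + 1) → Ty) (i) : Br (lab q .int l T) .int .snd (l i) nat (T i)
  | ext (q) {n : ℕ} (l) (T : Fin (n + 1) → Ty) (i) : Br (lab q .ext l T) .ext .rcv (l i) nat (T i)
  | mu {T w d l A B} : Br (subst (mu T) 0 T) w d l A B → Br (mu T) w d l A B

theorem Br.wf {T : Ty} {w d l A B} (h : Br T w d l A B) (hT : T.WF) : A.WF ∧ B.WF := by
  induction h with
  | choice q w l d T U i => exact hT.2 i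
  | snd => exact hT
  | rcv => exact hT
  | int q l T i => exact ⟨trivial, hT.2 i⟩
  | ext q l T i => exact ⟨trivial, hT.2 i⟩
  | mu _ ih => exact ih hT.unfold

/-- A well-formed type has at most one branch with given polarity and label, and one view. -/
theorem Br.unique {T : Ty} {w d l A B w' d' l' A' B'} (h : Br T w d l A B) (hT : T.WF)
    (h' : Br T w' d' l' A' B') : w = w' ∧ (d = d' → l = l' → A = A' ∧ B = B') := by
  induction h with
  | choice q w l d T U i =>
    cases h' with
    | choice _ _ _ _ _ _ j =>
      refine ⟨rfl, fun h1 h2 => ?_⟩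
      have : i = j := hT.1 (Prod.ext h2 h1)
      subst this
      exact ⟨rfl, rfl⟩
  | snd => cases h'; exact ⟨rfl, fun _ _ => ⟨rfl, rfl⟩⟩
  | rcv => cases h'; exact ⟨rfl, fun _ _ => ⟨rfl, rfl⟩⟩
  | int q l T i =>
    cases h' with
    | int _ _ _ j =>
      refine ⟨rfl, fun _ h2 => ⟨rfl, ?_⟩⟩
      rw [hT.1 h2]
  | ext q l T i =>
    cases h' with
    | ext _ _ _ j =>
      refine ⟨rfl, fun _ h2 => ⟨rfl, ?_⟩⟩
      rw [hT.1 h2]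
  | mu _ ih =>
    cases h' with
    | mu h' => exact ih hT.unfold h'

/-- Type equivalence is symmetric. -/
theorem Eqv.symm {T U : Ty} (h : Eqv T U) : Eqv U T := by
  obtain ⟨R, h, hR⟩ := h
  refine ⟨fun T U => R U T, h, fun T U h => ?_⟩
  cases hR _ _ h with
  | fin => exact .fin
  | nat => exact .nat
  | bool => exact .bool
  | choice q w l d T U l' d' T' U' e h1 h2 h3 =>
    refine .choice q w _ _ _ _ _ _ _ _ e.symm (fun i => ?_) (fun i => ?_) (fun i => ?_)
    · have := h1 (e.symm i)
      simp only [Equiv.apply_symm_apply] at this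
      exact ⟨this.1.symm, this.2.symm⟩
    · simpa using h2 (e.symm i)
    · simpa using h3 (e.symm i)
  | com q d h1 h2 => exact .com q d h1 h2
  | lab q w l T l' T' e h1 h2 =>
    refine .lab q w _ _ _ _ e.symm (fun i => ?_) (fun i => ?_)
    · simpa using (h1 (e.symm i)).symm
    · simpa using h2 (e.symm i)
  | muL hh => exact .muR hh
  | muR hh => exact .muL hh

theorem Eqv.subtype {T U : Ty} (h : Eqv T U) : Subtype T U := by
  have key : ∀ T U, Eqv T U → SubStep Eqv T U := by
    rintro T U ⟨R, h, hR⟩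
    have lift : ∀ {S S'}, R S S' → Eqv S S' := fun h => ⟨R, h, hR⟩
    cases hR _ _ h with
    | fin => exact .fin
    | nat => exact .nat
    | bool => exact .bool
    | choice q w l d T U l' d' T' U' e h1 h2 h3 =>
      have hp : ∀ d i, PaySub Eqv d (T i) (T' (e i)) := by
        intro d i
        cases d
        · exact (lift (h2 i)).symm
        · exact lift (h2 i)
      cases w with
      | int =>
        refine .int q _ _ _ _ _ _ _ _ e.symm (fun i => ?_) (fun i => ?_) (fun i => ?_)
        · simpa using h1 (e.symm i)
        · simpa using hp (d' i) (e.symm i)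
        · simpa using lift (h3 (e.symm i))
      | ext =>
        exact .ext q _ _ _ _ _ _ _ _ e (fun i => ⟨(h1 i).1.symm, (h1 i).2.symm⟩)
          (fun i => hp _ i) (fun i => lift (h3 i))
    | com q d h1 h2 =>
      refine .com q d ?_ (lift h2)
      cases d
      · exact (lift h1).symm
      · exact lift h1
    | lab q w l T l' T' e h1 h2 =>
      cases w with
      | int =>
        refine .labInt q _ _ _ _ e.symm (fun i => ?_) (fun i => ?_)
        · simpa using h1 (e.symm i)
        · simpa using lift (h2 (e.symm i))
      | ext => exact .labExt q _ _ _ _ e (fun i => (h1 i).symm) (fun i => lift (h2 i))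
    | muL hh => exact .muL (lift hh)
    | muR hh => exact .muR (lift hh)
  exact ⟨Eqv, h, key⟩

theorem Dual.symm {T U : Ty} (h : Dual T U) : Dual U T := by
  obtain ⟨R, h, hR⟩ := h
  refine ⟨fun T U => R U T, h, fun T U h => ?_⟩
  have hp : ∀ d : Pol, d.dual.dual = d := fun d => by cases d <;> rfl
  cases hR _ _ h with
  | fin => exact .fin
  | choice q w l d T U l' d' T' U' e h1 h2 h3 =>
    have := DualStep.choice (R := fun T U => R U T) q w.dual l' d' T' U' l d T U e.symm
      (fun i => ?_) (fun i => ?_) (fun i => ?_)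
    · cases w <;> exact this
    · have := h1 (e.symm i)
      simp only [Equiv.apply_symm_apply] at this
      exact ⟨this.1.symm, by rw [this.2, hp]⟩
    · simpa using (h2 (e.symm i)).symm
    · simpa using h3 (e.symm i)
  | com q d h1 h2 =>
    have := DualStep.com (R := fun T U => R U T) q d.dual h1.symm h2
    rwa [hp] at this
  | lab q w l T l' T' e h1 h2 =>
    have := DualStep.lab (R := fun T U => R U T) q w.dual l' T' l T e.symm
      (fun i => ?_) (fun i => ?_)
    · cases w <;> exact this
    · simpa using (h1 (e.symm i)).symm
    · simpa using h2 (e.symm i)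
  | muL hh => exact .muR hh
  | muR hh => exact .muL hh

/-- The reflexive and transitive closure of subtyping between well-formed types, which spares a proof
that subtyping itself is transitive. -/
def Le : Ty → Ty → Prop := Relation.ReflTransGen fun T U => T.WF ∧ U.WF ∧ T.Subtype U

theorem Le.refl (T : Ty) : Le T T := Relation.ReflTransGen.refl

theorem Le.trans {T U V : Ty} (h : Le T U) (h' : Le U V) : Le T V := Relation.ReflTransGen.trans h h'

/-- The branches of types in the subtype relation match, depending on the view. -/
structure Matches (T S : Ty) : Prop where
  un : T.Un ↔ S.Un
  int : ∀ d l A B, Br S .int d l A B → ∃ A' B', Br T .int d l A' B' ∧ PaySub Le d A' A ∧ Le B' B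
  ext : ∀ d l A B, Br T .ext d l A B → ∃ A' B', Br S .ext d l A' B' ∧ PaySub Le d A A' ∧ Le B B'
  view : ∀ w d l A B, Br S w d l A B → ∃ d' l' A' B', Br T w d' l' A' B'

theorem Subtype.matches {T S : Ty} (hT : T.WF) (hS : S.WF) (h : T.Subtype S) : Matches T S := by
  obtain ⟨R, h, hR⟩ := h
  have lift : ∀ {S S'}, R S S' → S.WF → S'.WF → Le S S' :=
    fun h h1 h2 => .single ⟨h1, h2, R, h, hR⟩
  have pay : ∀ {d S S'}, PaySub R d S S' → S.WF → S'.WF → PaySub Le d S S' := by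
    intro d S S' h h1 h2
    cases d
    · exact lift h h2 h1
    · exact lift h h1 h2
  generalize hn : T.muDepth + S.muDepth = n
  induction n using Nat.strong_induction_on generalizing T S with
  | _ n ih =>
    cases hR _ _ h with
    | fin => exact ⟨Iff.rfl, by rintro _ _ _ _ ⟨⟩, by rintro _ _ _ _ ⟨⟩, by rintro _ _ _ _ _ ⟨⟩⟩
    | nat => exact ⟨Iff.rfl, by rintro _ _ _ _ ⟨⟩, by rintro _ _ _ _ ⟨⟩, by rintro _ _ _ _ _ ⟨⟩⟩
    | bool => exact ⟨Iff.rfl, by rintro _ _ _ _ ⟨⟩, by rintro _ _ _ _ ⟨⟩, by rintro _ _ _ _ _ ⟨⟩⟩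
    | int q l d T U l' d' T' U' f h1 h2 h3 =>
      refine ⟨Iff.rfl, ?_, by rintro _ _ _ _ ⟨⟩, ?_⟩
      · rintro _ _ _ _ ⟨_, _, _, _, _, _, j⟩
        refine ⟨T (f j), U (f j), ?_, pay (h2 j) (hT.2 _).1 (hS.2 _).1,
          lift (h3 j) (hT.2 _).2 (hS.2 _).2⟩
        rw [← (h1 j).1, ← (h1 j).2]
        exact .choice _ _ _ _ _ _ _
      · rintro _ _ _ _ _ ⟨_, _, _, _, _, _, j⟩
        exact ⟨_, _, _, _, .choice _ _ _ _ _ _ (f j)⟩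
    | ext q l d T U l' d' T' U' f h1 h2 h3 =>
      refine ⟨Iff.rfl, by rintro _ _ _ _ ⟨⟩, ?_, ?_⟩
      · rintro _ _ _ _ ⟨_, _, _, _, _, _, j⟩
        refine ⟨T' (f j), U' (f j), ?_, pay (h2 j) (hT.2 _).1 (hS.2 _).1,
          lift (h3 j) (hT.2 _).2 (hS.2 _).2⟩
        rw [← (h1 j).1, ← (h1 j).2]
        exact .choice _ _ _ _ _ _ _
      · rintro _ _ _ _ _ ⟨_, _, _, _, _, _, j⟩
        exact ⟨_, _, _, _, .choice _ _ _ _ _ _ 0⟩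
    | com q d h1 h2 =>
      refine ⟨Iff.rfl, ?_, ?_, ?_⟩
      · rintro _ _ _ _ ⟨⟩
        exact ⟨_, _, .snd _ _ _, pay h1 hT.1 hS.1, lift h2 hT.2 hS.2⟩
      · rintro _ _ _ _ ⟨⟩
        exact ⟨_, _, .rcv _ _ _, pay h1 hT.1 hS.1, lift h2 hT.2 hS.2⟩
      · rintro _ _ _ _ _ ⟨⟩
        · exact ⟨_, _, _, _, .snd _ _ _⟩
        · exact ⟨_, _, _, _, .rcv _ _ _⟩
    | labInt q l T l' T' f h1 h2 =>
      refine ⟨Iff.rfl, ?_, by rintro _ _ _ _ ⟨⟩, ?_⟩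
      · rintro _ _ _ _ (_ | _ | _ | ⟨_, _, _, j⟩)
        refine ⟨nat, T (f j), ?_, Le.refl _, lift (h2 j) (hT.2 _) (hS.2 _)⟩
        rw [← h1 j]
        exact .int _ _ _ _
      · rintro _ _ _ _ _ (_ | _ | _ | ⟨_, _, _, j⟩)
        exact ⟨_, _, _, _, .int _ _ _ 0⟩
    | labExt q l T l' T' f h1 h2 =>
      refine ⟨Iff.rfl, by rintro _ _ _ _ ⟨⟩, ?_, ?_⟩
      · rintro _ _ _ _ (_ | _ | _ | _ | ⟨_, _, _, j⟩)
        refine ⟨nat, T' (f j), ?_, Le.refl _, lift (h2 j) (hT.2 _) (hS.2 _)⟩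
        rw [← h1 j]
        exact .ext _ _ _ _
      · rintro _ _ _ _ _ (_ | _ | _ | _ | ⟨_, _, _, j⟩)
        exact ⟨_, _, _, _, .ext _ _ _ 0⟩
    | muL hh =>
      have := ih _ (by have := muDepth_unfold hT; omega) hT.unfold hS hh rfl
      refine ⟨(un_unfold hT).symm.trans this.un, ?_, ?_, ?_⟩
      · intro d l A B hB
        obtain ⟨A', B', h1, h2⟩ := this.int d l A B hB
        exact ⟨A', B', .mu h1, h2⟩
      · rintro d l A B ⟨⟩
        exact this.ext d l A B (by assumption)
      · intro w d l A B hB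
        obtain ⟨d', l', A', B', h1⟩ := this.view w d l A B hB
        exact ⟨d', l', A', B', .mu h1⟩
    | muR hh =>
      have := ih _ (by have := muDepth_unfold hS; omega) hT hS.unfold hh rfl
      refine ⟨this.un.trans (un_unfold hS), ?_, ?_, ?_⟩
      · rintro d l A B ⟨⟩
        exact this.int d l A B (by assumption)
      · intro d l A B hB
        obtain ⟨A', B', h1, h2⟩ := this.ext d l A B hB
        exact ⟨A', B', .mu h1, h2⟩
      · rintro w d l A B ⟨⟩
        exact this.view w d l A B (by assumption)

theorem paySub_trans {d : Pol} {A B C : Ty} (h : PaySub Le d A B) (h' : PaySub Le d B C) :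
    PaySub Le d A C := by
  cases d
  · exact Le.trans h' h
  · exact Le.trans h h'

theorem Le.matches {T S : Ty} (h : Le T S) : Matches T S := by
  have hp : ∀ d A, PaySub Le d A A := fun d A => by cases d <;> exact Le.refl _
  induction h with
  | refl =>
    exact ⟨Iff.rfl, fun d l A B h => ⟨A, B, h, hp _ _, Le.refl _⟩,
      fun d l A B h => ⟨A, B, h, hp _ _, Le.refl _⟩, fun w d l A B h => ⟨d, l, A, B, h⟩⟩
  | tail _ hs ih =>
    have hs := hs.2.2.matches hs.1 hs.2.1
    refine ⟨ih.un.trans hs.un, ?_, ?_, ?_⟩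
    · intro d l A B h
      obtain ⟨A', B', h1, h2, h3⟩ := hs.int d l A B h
      obtain ⟨A'', B'', h4, h5, h6⟩ := ih.int d l A' B' h1
      exact ⟨A'', B'', h4, paySub_trans h5 h2, h6.trans h3⟩
    · intro d l A B h
      obtain ⟨A', B', h1, h2, h3⟩ := ih.ext d l A B h
      obtain ⟨A'', B'', h4, h5, h6⟩ := hs.ext d l A' B' h1
      exact ⟨A'', B'', h4, paySub_trans h2 h5, h3.trans h6⟩
    · intro w d l A B h
      obtain ⟨d', l', A', B', h1⟩ := hs.view w d l A B h
      exact ih.view w d' l' A' B' h1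

theorem Dual.matches {T U : Ty} (hT : T.WF) (hU : U.WF) (h : T.Dual U) : (T.Un ↔ U.Un) ∧
    ∀ w d l A B, Br T w d l A B →
      ∃ A' B', Br U w.dual d.dual l A' B' ∧ Eqv A A' ∧ Dual B B' := by
  obtain ⟨R, h, hR⟩ := h
  have lift : ∀ {S S'}, R S S' → Dual S S' := fun h => ⟨R, h, hR⟩
  have hnat : Eqv nat nat := ⟨fun S S' => S = nat ∧ S' = nat, ⟨rfl, rfl⟩, by
    rintro _ _ ⟨rfl, rfl⟩; exact .nat⟩
  generalize hn : T.muDepth + U.muDepth = n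
  induction n using Nat.strong_induction_on generalizing T U with
  | _ n ih =>
    cases hR _ _ h with
    | fin => exact ⟨Iff.rfl, by rintro _ _ _ _ _ ⟨⟩⟩
    | choice q w l d T U l' d' T' U' e h1 h2 h3 =>
      refine ⟨Iff.rfl, ?_⟩
      rintro _ _ _ _ _ ⟨_, _, _, _, _, _, i⟩
      refine ⟨T' (e i), U' (e i), ?_, h2 i, lift (h3 i)⟩
      rw [(h1 i).1, ← (h1 i).2]
      exact .choice _ _ _ _ _ _ _
    | com q d h1 h2 =>
      refine ⟨Iff.rfl, ?_⟩
      rintro _ _ _ _ _ ⟨⟩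
      · exact ⟨_, _, .rcv _ _ _, h1, lift h2⟩
      · exact ⟨_, _, .snd _ _ _, h1, lift h2⟩
    | lab q w l T l' T' e h1 h2 =>
      refine ⟨Iff.rfl, ?_⟩
      rintro _ _ _ _ _ (_ | _ | _ | ⟨_, _, _, j⟩ | ⟨_, _, _, j⟩)
      · rw [h1 j]
        exact ⟨_, _, .ext _ _ _ _, hnat, lift (h2 j)⟩
      · rw [h1 j]
        exact ⟨_, _, .int _ _ _ _, hnat, lift (h2 j)⟩
    | muL hh =>
      have := ih _ (by have := muDepth_unfold hT; omega) hT.unfold hU hh rfl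
      refine ⟨(un_unfold hT).symm.trans this.1, ?_⟩
      rintro w d l A B ⟨⟩
      exact this.2 w d l A B (by assumption)
    | muR hh =>
      have := ih _ (by have := muDepth_unfold hU; omega) hT hU.unfold hh rfl
      refine ⟨this.1.trans (un_unfold hU), ?_⟩
      intro w d l A B hB
      obtain ⟨A', B', h1, h2⟩ := this.2 w d l A B hB
      exact ⟨A', B', .mu h1, h2⟩

/-- The types that the two ends of a channel may have: they are dual up to subtyping. -/
def Comp (S V : Ty) : Prop := ∃ T U : Ty, T.WF ∧ U.WF ∧ Dual T U ∧ Le T S ∧ Le U V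

theorem Comp.symm {S V : Ty} (h : Comp S V) : Comp V S := by
  obtain ⟨T, U, hT, hU, h, h1, h2⟩ := h
  exact ⟨U, T, hU, hT, h.symm, h2, h1⟩

theorem Comp.mono {S V S' V' : Ty} (h : Comp S V) (h1 : Le S S') (h2 : Le V V') : Comp S' V' := by
  obtain ⟨T, U, hT, hU, h, h3, h4⟩ := h
  exact ⟨T, U, hT, hU, h, h3.trans h1, h4.trans h2⟩

theorem Comp.un_iff {S V : Ty} (h : Comp S V) : S.Un ↔ V.Un := by
  obtain ⟨T, U, hT, hU, h, h1, h2⟩ := h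
  exact h1.matches.un.symm.trans ((h.matches hT hU).1.trans h2.matches.un)

theorem Eqv.le {T U : Ty} (h : Eqv T U) (hT : T.WF) (hU : U.WF) : Le T U :=
  .single ⟨hT, hU, h.subtype⟩

/-- If one end of a channel sends what the other end receives, then the payload and the continuations
fit. -/
theorem Comp.comm {S V : Ty} (hS : S.WF) (hV : V.WF) (h : Comp S V) {w w' : View} {l : Label}
    {A₁ B₁ A₂ B₂ : Ty} (h1 : Br S w .snd l A₁ B₁) (h2 : Br V w' .rcv l A₂ B₂) :
    Le A₁ A₂ ∧ Comp B₁ B₂ := by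
  obtain ⟨T, U, hT, hU, h, hTS, hUV⟩ := h
  have hm := h.matches hT hU
  have hm' := h.symm.matches hU hT
  cases w with
  | int =>
    obtain ⟨A, B, k1, k2, k3⟩ := hTS.matches.int _ _ _ _ h1
    obtain ⟨A', B', k4, k5, k6⟩ := hm.2 _ _ _ _ _ k1
    obtain ⟨A'', B'', k7, k8, k9⟩ := hUV.matches.ext _ _ _ _ k4
    obtain ⟨rfl, rfl⟩ := (k7.unique hV h2).2 rfl rfl
    exact ⟨Le.trans k2 ((k5.le (k1.wf hT).1 (k4.wf hU).1).trans k8),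
      B, B', (k1.wf hT).2, (k4.wf hU).2, k6, k3, k9⟩
  | ext =>
    cases w' with
    | int =>
      obtain ⟨A, B, k1, k2, k3⟩ := hUV.matches.int _ _ _ _ h2
      obtain ⟨A', B', k4, k5, k6⟩ := hm'.2 _ _ _ _ _ k1
      obtain ⟨A'', B'', k7, k8, k9⟩ := hTS.matches.ext _ _ _ _ k4
      obtain ⟨rfl, rfl⟩ := (k7.unique hS h1).2 rfl rfl
      exact ⟨Le.trans k8 ((k5.symm.le (k4.wf hT).1 (k1.wf hU).1).trans k2),
        B', B, (k4.wf hT).2, (k1.wf hU).2, k6.symm, k9, k3⟩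
    | ext =>
      obtain ⟨_, _, _, _, k1⟩ := hTS.matches.view _ _ _ _ _ h1
      obtain ⟨_, _, _, _, k2⟩ := hUV.matches.view _ _ _ _ _ h2
      obtain ⟨_, _, k3, _⟩ := hm.2 _ _ _ _ _ k1
      exact absurd (k3.unique hU k2).1 (by simp [View.dual])

end Ty

/-! ### Typing environments that assign a type to every name -/

open Ty

/-- The type of a value, for names with the types `Γ`. -/
def Val.ty (Γ : ℕ → Ty) : Val → Ty
  | .var x => Γ x
  | .const (.num _) => .nat
  | .const (.bool _) => .bool

theorem Val.ty_eq {v : Val} {u : ℕ} (h : u ∈ v.fv) (Γ : ℕ → Ty) : v.ty Γ = Γ u := by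
  cases v with
  | var w => rw [show u = w from h]; rfl
  | const c => exact h.elim

open Classical in
/-- The types after a communication on `y` with continuation type `B`: an unrestricted endpoint keeps
its type. -/
noncomputable def advance (Γ : ℕ → Ty) (y : ℕ) (B : Ty) : ℕ → Ty :=
  if (Γ y).Un then Γ else Function.update Γ y B

theorem advance_of_un {Γ : ℕ → Ty} {y : ℕ} {B : Ty} (h : (Γ y).Un) : advance Γ y B = Γ := if_pos h

theorem advance_of_not_un {Γ : ℕ → Ty} {y : ℕ} {B : Ty} (h : ¬ (Γ y).Un) :
    advance Γ y B = Function.update Γ y B := if_neg h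

theorem advance_of_ne {Γ : ℕ → Ty} {y u : ℕ} {B : Ty} (h : u ≠ y) : advance Γ y B u = Γ u := by
  by_cases hu : (Γ y).Un
  · rw [advance_of_un hu]
  · rw [advance_of_not_un hu, Function.update_of_ne h]

/-- The endpoint `y` may be used for a communication with polarity `d`, label `l`, payload `A` and
continuation `B`. -/
def Uses (Γ : ℕ → Ty) (y : ℕ) (d : Pol) (l : Label) (A B : Ty) : Prop :=
  ∃ S w, S.WF ∧ Le (Γ y) S ∧ Br S w d l A B

theorem Uses.le {Γ Δ : ℕ → Ty} {y y' : ℕ} {d l A B} (h : Uses Δ y d l A B)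
    (hle : Le (Γ y') (Δ y)) : Uses Γ y' d l A B := by
  obtain ⟨S, w, h1, h2, h3⟩ := h
  exact ⟨S, w, h1, hle.trans h2, h3⟩

/-- The names in both sets have unrestricted types. -/
def Shared (Γ : ℕ → Ty) (E F : Set ℕ) : Prop := ∀ u ∈ E, u ∈ F → (Γ u).Un

theorem Shared.mono {Γ : ℕ → Ty} {E F E' F' : Set ℕ} (h : Shared Γ E F) (hE : E' ⊆ E)
    (hF : F' ⊆ F) : Shared Γ E' F' := fun u h1 h2 => h u (hE h1) (hF h2)

/-- A branch with the prefix `a` on the endpoint `y`, whose continuation has the free names `F` and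
satisfies `K`, respects the types `Γ`. -/
def BranchSec (Γ : ℕ → Ty) (y : ℕ) (a : BPre) (F : Set ℕ) (K : (ℕ → Ty) → Prop) : Prop :=
  match a with
  | .out l v => ∃ A B, Uses Γ y .snd l A B ∧ Le (v.ty (advance Γ y B)) A ∧
      Shared (advance Γ y B) v.fv F ∧ K (advance Γ y B)
  | .inp l x => ∃ A B, Uses Γ y .rcv l A B ∧ K (Function.update (advance Γ y B) x A)

/-- A relaxed type system with total environments: linear names have at most one owner, and every
endpoint is used according to its type.  Its purpose is to be preserved by reduction and to
prevent a constant from being substituted for a name that is used as an endpoint. -/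
def Sec : (ℕ → Ty) → Mix0 → Prop
  | Γ, .par P Q => Shared Γ P.fv Q.fv ∧ Sec Γ P ∧ Sec Γ Q
  | Γ, .res y z P => ∃ S V, Comp S V ∧ Sec (Function.update (Function.update Γ y S) z V) P
  | Γ, .cond _ P Q => Sec Γ P ∧ Sec Γ Q
  | Γ, .choice q y pre P =>
      (q = .un → ∀ u ∈ (Mix.choice q y pre P).fv, (Γ u).Un) ∧
        ∀ j, BranchSec Γ y (pre j) (P j).fv fun Γ' => Sec Γ' (P j)
  | Γ, .out y v P => BranchSec Γ y (.out 0 v) P.fv fun Γ' => Sec Γ' P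
  | Γ, .inp q y x P =>
      (q = .un → ∀ u ∈ (Mix.inp q y x P).fv, (Γ u).Un) ∧
        BranchSec Γ y (.inp 0 x) P.fv fun Γ' => Sec Γ' P
  | Γ, .sel y l P => ∃ B, Uses Γ y .snd l .nat B ∧ Sec (advance Γ y B) P
  | Γ, .bran y l P => ∀ j, ∃ B, Uses Γ y .rcv (l j) .nat B ∧ Sec (advance Γ y B) (P j)
  | _, _ => True

/-! ### Renaming and weakening for the relaxed types -/

theorem le_advance {Γ Δ : ℕ → Ty} {y y' u u' : ℕ} {B : Ty} (hy : Le (Γ y') (Δ y))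
    (hu : Le (Γ u') (Δ u)) (h : u' = y' ↔ u = y) : Le (advance Γ y' B u') (advance Δ y B u) := by
  by_cases hu : (Γ y').Un
  · rw [advance_of_un hu, advance_of_un (hy.matches.un.1 hu)]; assumption
  · rw [advance_of_not_un hu, advance_of_not_un (fun h => hu (hy.matches.un.2 h))]
    by_cases hh : u = y
    · rw [h.2 hh, hh, Function.update_self, Function.update_self]
      exact Le.refl _
    · rwa [Function.update_of_ne hh, Function.update_of_ne (fun h' => hh (h.1 h'))]

theorem le_update {Γ Δ : ℕ → Ty} {y y' u u' : ℕ} {B : Ty} (hu : u ≠ y → Le (Γ u') (Δ u))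
    (h : u' = y' ↔ u = y) : Le (Function.update Γ y' B u') (Function.update Δ y B u) := by
  by_cases hh : u = y
  · rw [h.2 hh, hh, Function.update_self, Function.update_self]
    exact Le.refl _
  · rw [Function.update_of_ne hh, Function.update_of_ne (fun h' => hh (h.1 h'))]
    exact hu hh

theorem BranchSec.map {Γ Δ : ℕ → Ty} {y : ℕ} {a : BPre} {F : Set ℕ} {K K' : (ℕ → Ty) → Prop}
    (e : Equiv.Perm ℕ) (h : BranchSec Δ y a F K) (hy : Le (Γ (e y)) (Δ y))
    (ha : ∀ u ∈ a.fv, Le (Γ (e u)) (Δ u)) (hF : ∀ u ∈ F \ a.bv, Le (Γ (e u)) (Δ u))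
    (hK : ∀ Γ' Δ', K Δ' → (∀ u ∈ F, Le (Γ' (e u)) (Δ' u)) → K' Γ') :
    BranchSec Γ (e y) (a.map e) (e '' F) K' := by
  have hadv : ∀ B u, Le (Γ (e u)) (Δ u) → Le (advance Γ (e y) B (e u)) (advance Δ y B u) :=
    fun B u hu => le_advance hy hu e.apply_eq_iff_eq
  cases a with
  | out l v =>
    obtain ⟨A, B, h1, h2, h3, h4⟩ := h
    refine ⟨A, B, h1.le hy, ?_, ?_, hK _ _ h4 fun u hu => hadv B u (hF u ⟨hu, fun h => h⟩)⟩
    · cases v with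
      | var x => exact (hadv B x (ha x rfl)).trans h2
      | const c => cases c <;> exact h2
    · rw [Val.fv_map]
      rintro _ ⟨u, hu, rfl⟩ ⟨u', hu', he⟩
      rw [e.injective he] at hu'
      exact (hadv B u (ha u hu)).matches.un.2 (h3 u hu hu')
  | inp l x =>
    obtain ⟨A, B, h1, h2⟩ := h
    refine ⟨A, B, h1.le hy, hK _ _ h2 fun u hu => ?_⟩
    exact le_update (fun hux => hadv B u (hF u ⟨hu, hux⟩)) e.apply_eq_iff_eq

/-- The types of the names may be replaced by subtypes, also along a permutation of the names. -/
theorem Sec.map {Γ Δ : ℕ → Ty} (e : Equiv.Perm ℕ) {P : Mix0} (h : Sec Δ P)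
    (hle : ∀ u ∈ P.fv, Le (Γ (e u)) (Δ u)) : Sec Γ (P.map e) := by
  have hun : ∀ {q : Qual} {P : Mix0} {Γ Δ : ℕ → Ty}, (∀ u ∈ P.fv, Le (Γ (e u)) (Δ u)) →
      (q = .un → ∀ u ∈ P.fv, (Δ u).Un) → q = .un → ∀ u ∈ (P.map e).fv, (Γ u).Un := by
    intro q P Γ Δ hle h hq u hu
    rw [Mix.fv_map] at hu
    obtain ⟨u, hu, rfl⟩ := hu
    exact (hle u hu).matches.un.2 (h hq u hu)
  induction P generalizing Γ Δ with
  | hole k => exact k.elim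
  | nil => trivial
  | tick => trivial
  | par P Q ihP ihQ =>
    refine ⟨?_, ihP h.2.1 fun u hu => hle u (.inl hu), ihQ h.2.2 fun u hu => hle u (.inr hu)⟩
    rw [Mix.fv_map, Mix.fv_map]
    rintro _ ⟨u, hu, rfl⟩ ⟨u', hu', he⟩
    rw [e.injective he] at hu'
    exact (hle u (.inl hu)).matches.un.2 (h.1 u hu hu')
  | res y z P ih =>
    obtain ⟨S, V, h1, h2⟩ := h
    refine ⟨S, V, h1, ih h2 fun u hu => ?_⟩
    refine le_update (fun hz => le_update (fun hy => hle u ⟨hu, ?_⟩) e.apply_eq_iff_eq)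
      e.apply_eq_iff_eq
    simp [hy, hz]
  | cond v P Q ihP ihQ =>
    exact ⟨ihP h.1 fun u hu => hle u (.inl (.inr hu)), ihQ h.2 fun u hu => hle u (.inr hu)⟩
  | choice q y pre P ih =>
    refine ⟨hun hle h.1, fun j => ?_⟩
    have := (h.2 j).map (Γ := Γ) (K' := fun Γ' => Sec Γ' ((P j).map e)) e
      (hle y (.inl rfl))
      (fun u hu => hle u (.inr (Set.mem_iUnion.2 ⟨j, .inl hu⟩)))
      (fun u hu => hle u (.inr (Set.mem_iUnion.2 ⟨j, .inr hu⟩)))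
      (fun Γ' Δ' h1 h2 => ih j h1 h2)
    rwa [← Mix.fv_map] at this
  | out y v P ih =>
    have := BranchSec.map (Γ := Γ) (K' := fun Γ' => Sec Γ' (P.map e)) e h (hle y (.inl (.inl rfl)))
      (fun u hu => hle u (.inl (.inr hu))) (fun u hu => hle u (.inr hu.1))
      (fun Γ' Δ' h1 h2 => ih h1 h2)
    rwa [← Mix.fv_map] at this
  | inp q y x P ih =>
    refine ⟨hun hle h.1, ?_⟩
    have := BranchSec.map (Γ := Γ) (K' := fun Γ' => Sec Γ' (P.map e)) e h.2 (hle y (.inl rfl))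
      (fun u hu => hu.elim) (fun u hu => hle u (.inr hu)) (fun Γ' Δ' h1 h2 => ih h1 h2)
    rwa [← Mix.fv_map] at this
  | sel y l P ih =>
    obtain ⟨B, h1, h2⟩ := h
    exact ⟨B, h1.le (hle y (.inl rfl)), ih h2 fun u hu =>
      le_advance (hle y (.inl rfl)) (hle u (.inr hu)) e.apply_eq_iff_eq⟩
  | bran y l P ih =>
    intro j
    obtain ⟨B, h1, h2⟩ := h j
    exact ⟨B, h1.le (hle y (.inl rfl)), ih j h2 fun u hu =>
      le_advance (hle y (.inl rfl)) (hle u (.inr (Set.mem_iUnion.2 ⟨j, hu⟩))) e.apply_eq_iff_eq⟩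

theorem Sec.mono {Γ Δ : ℕ → Ty} {P : Mix0} (h : Sec Δ P) (hle : ∀ u ∈ P.fv, Le (Γ u) (Δ u)) :
    Sec Γ P := by
  have := h.map (Γ := Γ) (Equiv.refl ℕ) hle
  rwa [Equiv.coe_refl, Mix.map_id] at this

theorem Sec.congr {Γ Δ : ℕ → Ty} {P : Mix0} (h : Sec Δ P) (hle : ∀ u ∈ P.fv, Γ u = Δ u) :
    Sec Γ P := h.mono fun u hu => by rw [hle u hu]; exact Le.refl _

/-! ### Substitution for the relaxed types -/

/-- The free names after the substitution of `v` for `x`. -/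
def substFv (x : ℕ) (v : Val) (F : Set ℕ) : Set ℕ := {u | (u ∈ F ∧ u ≠ x) ∨ (x ∈ F ∧ u ∈ v.fv)}

theorem substFv_mono {x : ℕ} {v : Val} {E F : Set ℕ} (h : E ⊆ F) : substFv x v E ⊆ substFv x v F := by
  rintro u (⟨h1, h2⟩ | ⟨h1, h2⟩)
  · exact .inl ⟨h h1, h2⟩
  · exact .inr ⟨h h1, h2⟩

/-- Over the names in `F`, the substitution of `v` for `x` respects the types `Δ` before and `Γ` after
the substitution. -/
structure Fits (Γ Δ : ℕ → Ty) (x : ℕ) (v : Val) (F : Set ℕ) : Prop where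
  le : ∀ u ∈ F, u ≠ x → Le (Γ u) (Δ u)
  val : Le (v.ty Γ) (Δ x)
  shared : ∀ u ∈ v.fv, u ∈ F → u ≠ x → (Γ u).Un

namespace Fits

variable {Γ Δ : ℕ → Ty} {x : ℕ} {v : Val} {F : Set ℕ}

theorem subset {F' : Set ℕ} (h : Fits Γ Δ x v F) (hF : F' ⊆ F) : Fits Γ Δ x v F' :=
  ⟨fun u hu => h.le u (hF hu), h.val, fun u h1 h2 => h.shared u h1 (hF h2)⟩

theorem val_le (h : Fits Γ Δ x v F) {v' : Val} {A : Ty} (hv : v'.fv ⊆ F) (hA : Le (v'.ty Δ) A) :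
    Le ((Val.subst x v v').ty Γ) A := by
  cases v' with
  | var a =>
    by_cases ha : a = x
    · simp only [Val.subst, ha, if_true]
      rw [ha] at hA
      exact h.val.trans hA
    · simp only [Val.subst, ha, if_false]
      exact (h.le a (hv rfl) ha).trans hA
  | const c => cases c <;> exact hA

theorem un (h : Fits Γ Δ x v F) {u : ℕ} {E : Set ℕ} (hE : E ⊆ F) (hu : u ∈ substFv x v E)
    (hun : ∀ u ∈ E, (Δ u).Un) : (Γ u).Un := by
  rcases hu with ⟨h1, h2⟩ | ⟨h1, h2⟩
  · exact (h.le u (hE h1) h2).matches.un.2 (hun u h1)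
  · rw [← Val.ty_eq h2 Γ]
    exact h.val.matches.un.2 (hun x h1)

theorem share (h : Fits Γ Δ x v F) {E E' : Set ℕ} (hE : E ⊆ F) (hE' : E' ⊆ F)
    (hs : Shared Δ E E') : Shared Γ (substFv x v E) (substFv x v E') := by
  rintro u (⟨h1, h2⟩ | ⟨h1, h2⟩) (⟨h3, h4⟩ | ⟨h3, h4⟩)
  · exact (h.le u (hE h1) h2).matches.un.2 (hs u h1 h3)
  · exact h.shared u h4 (hE h1) h2
  · exact h.shared u h2 (hE' h3) h4
  · rw [← Val.ty_eq h2 Γ]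
    exact h.val.matches.un.2 (hs x h1 h3)

theorem bind (h : Fits Γ Δ x v F) {F' : Set ℕ} {b : ℕ} {A : Ty} (hF : F' \ {b} ⊆ F)
    (hx : x ≠ b) (hb : b ∉ v.fv) :
    Fits (Function.update Γ b A) (Function.update Δ b A) x v F' := by
  refine ⟨fun u hu hux => le_update (fun hub => h.le u (hF ⟨hu, hub⟩) hux) Iff.rfl, ?_, ?_⟩
  · rw [Function.update_of_ne hx]
    cases v with
    | var w =>
      have := h.val
      rwa [Val.ty, Function.update_of_ne (fun hw => hb hw.symm)]
    | const c => cases c <;> exact h.val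
  · intro u h1 h2 h3
    have hub : u ≠ b := fun hub => hb (hub ▸ h1)
    rw [Function.update_of_ne hub]
    exact h.shared u h1 (hF ⟨h2, hub⟩) h3

/-- Base types have no branches, so a constant is not substituted for an endpoint that is used. -/
theorem not_uses_base {c : Const} {T : Ty} {y : ℕ} {d l A B} (h : Uses Δ y d l A B)
    (hle : Le ((Val.const c).ty Γ) T) : Δ y ≠ T := by
  rintro rfl
  obtain ⟨S, w, -, h2, h3⟩ := h
  obtain ⟨_, _, _, _, h4⟩ := (hle.trans h2).matches.view _ _ _ _ _ h3
  cases c <;> cases h4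

theorem advance (h : Fits Γ Δ x v F) {y : ℕ} {d l A B} (hu : Uses Δ y d l A B) (hy : y ∈ F) :
    Uses Γ (v.substChan x y) d l A B ∧ v.substChan x y ∈ substFv x v {y} ∧
      Fits (advance Γ (v.substChan x y) B) (MixedChoice.advance Δ y B) x v F := by
  cases v with
  | const c =>
    have hyx : y ≠ x := fun hyx => not_uses_base hu h.val (by rw [hyx])
    refine ⟨hu.le (h.le y hy hyx), .inl ⟨rfl, hyx⟩, fun u h1 h2 => ?_, ?_, fun u hu => hu.elim⟩
    · exact le_advance (h.le y hy hyx) (h.le u h1 h2) Iff.rfl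
    · rw [advance_of_ne hyx.symm]
      have := h.val
      cases c <;> exact this
  | var w =>
    by_cases hyx : y = x
    · subst hyx
      simp only [Val.substChan, if_true]
      have hv : Le (Γ w) (Δ y) := h.val
      refine ⟨hu.le hv, .inr ⟨rfl, rfl⟩, ?_⟩
      by_cases hun : (Γ w).Un
      · rwa [advance_of_un hun, advance_of_un (hv.matches.un.1 hun)]
      · have hw : ∀ u ∈ F, u ≠ y → u ≠ w := by
          rintro u h1 h2 rfl
          exact hun (h.shared u rfl h1 h2)
        refine ⟨fun u h1 h2 => ?_, le_advance hv hv (by simp), ?_⟩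
        · rw [advance_of_ne h2, advance_of_ne (hw u h1 h2)]
          exact h.le u h1 h2
        · rintro u rfl h1 h2
          exact (hw u h1 h2 rfl).elim
    · simp only [Val.substChan, hyx, if_false]
      have hv : Le (Γ y) (Δ y) := h.le y hy hyx
      refine ⟨hu.le hv, .inl ⟨rfl, hyx⟩, fun u h1 h2 => le_advance hv (h.le u h1 h2) Iff.rfl, ?_, ?_⟩
      · by_cases hwy : w = y
        · subst hwy
          rw [advance_of_un (h.shared w rfl hy hyx),
            advance_of_un (hv.matches.un.1 (h.shared w rfl hy hyx))]
          exact h.val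
        · rw [Val.ty, advance_of_ne hwy, advance_of_ne (Ne.symm hyx)]
          exact h.val
      · rintro u rfl h1 h2
        by_cases hwy : u = y
        · subst hwy
          rw [advance_of_un (h.shared u rfl h1 h2)]
          exact h.shared u rfl h1 h2
        · rw [advance_of_ne hwy]
          exact h.shared u rfl h1 h2

end Fits

open Ty

theorem BPre.fv_subst_subset (x : ℕ) (v : Val) (a : BPre) : (a.subst x v).fv ⊆ substFv x v a.fv := by
  rcases a with ⟨l, y | c⟩ | ⟨l, y⟩
  · intro u hu
    by_cases h : y = x
    · simp only [BPre.subst, Val.subst, h, if_true] at hu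
      exact .inr ⟨h.symm, hu⟩
    · simp only [BPre.subst, Val.subst, h, if_false] at hu
      have hu : u = y := hu
      exact .inl ⟨hu, hu ▸ h⟩
  · exact fun u hu => hu.elim
  · exact fun u hu => hu.elim

theorem BPre.bv_subst (x : ℕ) (v : Val) (a : BPre) : (a.subst x v).bv = a.bv := by cases a <;> rfl

theorem BranchSec.subst {Γ Δ : ℕ → Ty} {x y : ℕ} {v : Val} {a : BPre} {F F' G : Set ℕ}
    {K K' : (ℕ → Ty) → Prop} (h : BranchSec Δ y a F K) (hf : Fits Γ Δ x v G) (hy : y ∈ G)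
    (ha : a.fv ⊆ G) (hF : F \ a.bv ⊆ G) (hd : Disjoint v.fv a.bv)
    (hK : ∀ Γ' Δ', K Δ' → x ∉ a.bv → Fits Γ' Δ' x v F → K' Γ' ∧ F' ⊆ substFv x v F)
    (hK' : ∀ Γ' Δ', K Δ' → x ∈ a.bv → (∀ u ∈ F, Le (Γ' u) (Δ' u)) → K' Γ') :
    BranchSec Γ (v.substChan x y) (a.subst x v) F' K' ∧ v.substChan x y ∈ substFv x v {y} ∧
      (x ∉ a.bv → F' ⊆ substFv x v F) := by
  cases a with
  | out l v' =>
    obtain ⟨A, B, h1, h2, h3, h4⟩ := h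
    obtain ⟨h5, h6, h7⟩ := hf.advance h1 hy
    have hF : F ⊆ G := fun u hu => hF ⟨hu, fun h => h⟩
    obtain ⟨h8, h9⟩ := hK _ _ h4 (fun h => h) (h7.subset hF)
    exact ⟨⟨A, B, h5, h7.val_le ha h2,
      (h7.share ha hF h3).mono (BPre.fv_subst_subset x v (.out l v')) h9, h8⟩, h6, fun _ => h9⟩
  | inp l b =>
    obtain ⟨A, B, h1, h2⟩ := h
    obtain ⟨h5, h6, h7⟩ := hf.advance h1 hy
    by_cases hx : x = b
    · refine ⟨⟨A, B, h5, hK' _ _ h2 hx fun u hu => ?_⟩, h6, fun h => (h hx).elim⟩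
      exact le_update (fun hb => h7.le u (hF ⟨hu, hb⟩) (hx ▸ hb)) Iff.rfl
    · obtain ⟨h8, h9⟩ := hK _ _ h2 hx (h7.bind (A := A) hF hx
        fun hb => Set.disjoint_left.1 hd hb rfl)
      exact ⟨⟨A, B, h5, h8⟩, h6, fun _ => h9⟩

open Classical in
/-- Substitution respects the relaxed types, and the substituted name does not survive. -/
theorem Sec.subst {Γ Δ : ℕ → Ty} {x : ℕ} {v : Val} {Q : Mix0} (h : Sec Δ Q)
    (hf : Fits Γ Δ x v Q.fv) (hd : Disjoint v.fv Q.bv) :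
    Sec Γ (Q.subst x v) ∧ (Q.subst x v).fv ⊆ substFv x v Q.fv := by
  have hval : ∀ w : Val, (Val.subst x v w).fv ⊆ substFv x v w.fv :=
    fun w => BPre.fv_subst_subset x v (.out 0 w)
  induction Q generalizing Γ Δ with
  | hole k => exact k.elim
  | nil => exact ⟨trivial, fun u hu => hu.elim⟩
  | tick => exact ⟨trivial, fun u hu => hu.elim⟩
  | par P Q ihP ihQ =>
    rw [Mix.bv, Set.disjoint_union_right] at hd
    obtain ⟨h1, h2⟩ := ihP h.2.1 (hf.subset Set.subset_union_left) hd.1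
    obtain ⟨h3, h4⟩ := ihQ h.2.2 (hf.subset Set.subset_union_right) hd.2
    refine ⟨⟨?_, h1, h3⟩, ?_⟩
    · exact (hf.share Set.subset_union_left Set.subset_union_right h.1).mono h2 h4
    · exact Set.union_subset (h2.trans (substFv_mono Set.subset_union_left))
        (h4.trans (substFv_mono Set.subset_union_right))
  | res y z P ih =>
    rw [Mix.bv, Set.disjoint_union_right] at hd
    obtain ⟨S, V, h1, h2⟩ := h
    by_cases hx : x = y ∨ x = z
    · simp only [Mix.subst, hx, if_true]
      have hne : ∀ u ∈ (Mix.res y z P).fv, u ≠ x := by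
        rintro u ⟨_, hu⟩ rfl
        exact hu hx
      exact ⟨Sec.mono (P := .res y z P) ⟨S, V, h1, h2⟩ fun u hu => hf.le u hu (hne u hu),
        fun u hu => .inl ⟨hu, hne u hu⟩⟩
    · simp only [Mix.subst, hx, if_false]
      push Not at hx
      have hy : y ∉ v.fv := fun hy => Set.disjoint_left.1 hd.1 hy (.inl rfl)
      have hz : z ∉ v.fv := fun hz => Set.disjoint_left.1 hd.1 hz (.inr rfl)
      have hf' := (hf.bind (F' := P.fv \ {z}) (A := S) (b := y) (by
        rintro u ⟨⟨hu, hz⟩, hy⟩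
        exact ⟨hu, by rintro (h | h); exacts [hy h, hz h]⟩) hx.1 hy).bind (A := V) (b := z)
        (F' := P.fv) subset_rfl hx.2 hz
      obtain ⟨h3, h4⟩ := ih h2 hf' hd.2
      refine ⟨⟨S, V, h1, h3⟩, ?_⟩
      rintro u ⟨hu, hu'⟩
      rcases h4 hu with ⟨h5, h6⟩ | ⟨h5, h6⟩
      · exact .inl ⟨⟨h5, hu'⟩, h6⟩
      · exact .inr ⟨⟨h5, by rintro (h | h); exacts [hx.1 h, hx.2 h]⟩, h6⟩
  | cond w P Q ihP ihQ =>
    rw [Mix.bv, Set.disjoint_union_right] at hd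
    have hP : P.fv ⊆ (Mix.cond w P Q).fv := fun u hu => .inl (.inr hu)
    obtain ⟨h1, h2⟩ := ihP h.1 (hf.subset hP) hd.1
    obtain ⟨h3, h4⟩ := ihQ h.2 (hf.subset Set.subset_union_right) hd.2
    refine ⟨⟨h1, h3⟩, Set.union_subset (Set.union_subset ?_ ?_) ?_⟩
    · exact (hval w).trans (substFv_mono fun u hu => .inl (.inl hu))
    · exact h2.trans (substFv_mono hP)
    · exact h4.trans (substFv_mono Set.subset_union_right)
  | choice q y pre P ih =>
    rw [Mix.bv, Set.disjoint_iUnion_right] at hd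
    have hsub : ∀ j, (P j).fv \ (pre j).bv ⊆ (Mix.choice q y pre P).fv :=
      fun j u hu => .inr (Set.mem_iUnion.2 ⟨j, .inr hu⟩)
    have hpre : ∀ j, (pre j).fv ⊆ (Mix.choice q y pre P).fv :=
      fun j u hu => .inr (Set.mem_iUnion.2 ⟨j, .inl hu⟩)
    have key : ∀ j, BranchSec Γ (v.substChan x y) ((pre j).subst x v)
        (if x ∈ (pre j).bv then P j else (P j).subst x v).fv
        (fun Γ' => Sec Γ' (if x ∈ (pre j).bv then P j else (P j).subst x v)) ∧ _ ∧ _ := fun j => by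
      have hdj := Set.disjoint_union_right.1 (hd j)
      refine (h.2 j).subst hf (.inl rfl) (hpre j) (hsub j) hdj.1 ?_ ?_
      · intro Γ' Δ' h1 h2 h3
        simp only [h2, if_false]
        exact ih j h1 h3 hdj.2
      · intro Γ' Δ' h1 h2 h3
        simp only [h2, if_true]
        exact h1.mono h3
    have hfv : (Mix.subst x v (.choice q y pre P)).fv ⊆ substFv x v (Mix.choice q y pre P).fv := by
      refine Set.union_subset ?_ (Set.iUnion_subset fun j => Set.union_subset ?_ ?_)
      · rintro u rfl
        exact substFv_mono (Set.singleton_subset_iff.2 (.inl rfl)) (key 0).2.1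
      · exact (BPre.fv_subst_subset x v _).trans (substFv_mono (hpre j))
      · rw [BPre.bv_subst]
        rintro u ⟨hu, hu'⟩
        by_cases hx : x ∈ (pre j).bv
        · simp only [hx, if_true] at hu
          exact .inl ⟨hsub j ⟨hu, hu'⟩, fun h => hu' (h ▸ hx)⟩
        · rcases (key j).2.2 hx hu with ⟨h5, h6⟩ | ⟨h5, h6⟩
          · exact .inl ⟨hsub j ⟨h5, hu'⟩, h6⟩
          · exact .inr ⟨hsub j ⟨h5, hx⟩, h6⟩
    exact ⟨⟨fun hq u hu => hf.un subset_rfl (hfv hu) (h.1 hq), fun j => (key j).1⟩, hfv⟩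
  | out y w P ih =>
    have key : BranchSec Γ (v.substChan x y) ((BPre.out 0 w).subst x v) (P.subst x v).fv
        (fun Γ' => Sec Γ' (P.subst x v)) ∧ _ ∧ _ :=
      BranchSec.subst h hf (.inl (.inl rfl)) (fun u hu => .inl (.inr hu))
        (fun u hu => .inr hu.1) (Set.disjoint_empty _)
        (fun Γ' Δ' h1 _ h3 => ih h1 h3 hd) (fun _ _ _ h => h.elim)
    refine ⟨key.1, Set.union_subset (Set.union_subset ?_ ?_) ?_⟩
    · rintro u rfl
      exact substFv_mono (Set.singleton_subset_iff.2 (.inl (.inl rfl))) key.2.1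
    · exact (hval w).trans (substFv_mono fun u hu => .inl (.inr hu))
    · exact (key.2.2 fun h => h).trans (substFv_mono Set.subset_union_right)
  | inp q y b P ih =>
    rw [Mix.bv, Set.disjoint_union_right] at hd
    have hsub : P.fv \ {b} ⊆ (Mix.inp q y b P).fv := fun u hu => .inr hu
    have key : BranchSec Γ (v.substChan x y) ((BPre.inp 0 b).subst x v)
        (if x = b then P else P.subst x v).fv
        (fun Γ' => Sec Γ' (if x = b then P else P.subst x v)) ∧ v.substChan x y ∈ substFv x v {y} ∧
          (x ∉ (BPre.inp 0 b).bv →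
            (if x = b then P else P.subst x v).fv ⊆ substFv x v P.fv) := by
      refine BranchSec.subst h.2 hf (.inl rfl) (fun u hu => hu.elim) hsub hd.1 ?_ ?_
      · intro Γ' Δ' h1 h2 h3
        simp only [show x ≠ b from h2, if_false]
        exact ih h1 h3 hd.2
      · intro Γ' Δ' h1 h2 h3
        simp only [show x = b from h2, if_true]
        exact h1.mono h3
    have hfv : (Mix.subst x v (.inp q y b P)).fv ⊆ substFv x v (Mix.inp q y b P).fv := by
      refine Set.union_subset ?_ ?_
      · rintro u rfl
        exact substFv_mono (Set.singleton_subset_iff.2 (.inl rfl)) key.2.1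
      · rintro u ⟨hu, hu'⟩
        by_cases hx : x = b
        · simp only [hx, if_true] at hu
          exact .inl ⟨hsub ⟨hu, hu'⟩, hx ▸ hu'⟩
        · rcases key.2.2 hx hu with ⟨h5, h6⟩ | ⟨h5, h6⟩
          · exact .inl ⟨hsub ⟨h5, hu'⟩, h6⟩
          · exact .inr ⟨hsub ⟨h5, hx⟩, h6⟩
    exact ⟨⟨fun hq u hu => hf.un subset_rfl (hfv hu) (h.1 hq), key.1⟩, hfv⟩
  | sel y l P ih =>
    obtain ⟨B, h1, h2⟩ := h
    obtain ⟨h5, h6, h7⟩ := hf.advance h1 (.inl rfl)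
    obtain ⟨h8, h9⟩ := ih h2 (h7.subset Set.subset_union_right) hd
    refine ⟨⟨B, h5, h8⟩, Set.union_subset ?_ (h9.trans (substFv_mono Set.subset_union_right))⟩
    rintro u rfl
    exact substFv_mono (Set.singleton_subset_iff.2 (.inl rfl)) h6
  | bran y l P ih =>
    rw [Mix.bv, Set.disjoint_iUnion_right] at hd
    have hsub : ∀ j, (P j).fv ⊆ (Mix.bran y l P).fv :=
      fun j u hu => .inr (Set.mem_iUnion.2 ⟨j, hu⟩)
    have key : ∀ j, (∃ B, Uses Γ (v.substChan x y) .rcv (l j) .nat B ∧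
        Sec (advance Γ (v.substChan x y) B) ((P j).subst x v)) ∧
        v.substChan x y ∈ substFv x v {y} ∧ ((P j).subst x v).fv ⊆ substFv x v (P j).fv := by
      intro j
      obtain ⟨B, h1, h2⟩ := h j
      obtain ⟨h5, h6, h7⟩ := hf.advance h1 (.inl rfl)
      obtain ⟨h8, h9⟩ := ih j h2 (h7.subset (hsub j)) (hd j)
      exact ⟨⟨B, h5, h8⟩, h6, h9⟩
    refine ⟨fun j => (key j).1, Set.union_subset ?_ (Set.iUnion_subset fun j =>
      (key j).2.2.trans (substFv_mono (hsub j)))⟩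
    rintro u rfl
    exact substFv_mono (Set.singleton_subset_iff.2 (.inl rfl)) (key 0).2.1

/-- Without types, the substituted name may survive as an endpoint. -/
theorem Mix.fv_subst_subset (x : ℕ) (v : Val) (P : Mix0) : (P.subst x v).fv ⊆ P.fv ∪ v.fv := by
  have hval : ∀ w : Val, (Val.subst x v w).fv ⊆ w.fv ∪ v.fv := by
    rintro (y | c) u hu
    · simp only [Val.subst] at hu
      split_ifs at hu
      · exact .inr hu
      · exact .inl hu
    · exact hu.elim
  have hpre : ∀ a : BPre, (a.subst x v).fv ⊆ a.fv ∪ v.fv := by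
    rintro (⟨l, w⟩ | ⟨l, y⟩)
    · exact hval w
    · exact fun u hu => hu.elim
  have hch : ∀ y, v.substChan x y = y ∨ v.substChan x y ∈ v.fv := by
    intro y
    cases v with
    | const c => exact .inl rfl
    | var w =>
      simp only [Val.substChan]
      split_ifs
      · exact .inr rfl
      · exact .inl rfl
  induction P with
  | hole k => exact k.elim
  | nil => exact fun u hu => hu.elim
  | tick => exact fun u hu => hu.elim
  | par P Q ihP ihQ =>
    intro u hu
    have := @ihP u
    have := @ihQ u
    simp only [subst, fv, Set.mem_union] at *
    tauto
  | res y z P ih =>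
    intro u hu
    have := @ih u
    simp only [subst] at hu
    split_ifs at hu
    · exact .inl hu
    · simp only [fv, Set.mem_union, Set.mem_sdiff] at *
      tauto
  | cond w P Q ihP ihQ =>
    intro u hu
    have := @ihP u
    have := @ihQ u
    have := @hval w u
    simp only [subst, fv, Set.mem_union] at *
    tauto
  | choice q y pre P ih =>
    intro u hu
    simp only [subst, fv, Set.mem_union, Set.mem_iUnion, Set.mem_singleton_iff, Set.mem_sdiff,
      BPre.bv_subst] at hu ⊢
    rcases hu with rfl | ⟨j, hu | ⟨hu, hu'⟩⟩
    · rcases hch y with h | h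
      · exact .inl (.inl h)
      · exact .inr h
    · rcases hpre _ hu with h | h
      · exact .inl (.inr ⟨j, .inl h⟩)
      · exact .inr h
    · split_ifs at hu
      · exact .inl (.inr ⟨j, .inr ⟨hu, hu'⟩⟩)
      · rcases ih j hu with h | h
        · exact .inl (.inr ⟨j, .inr ⟨h, hu'⟩⟩)
        · exact .inr h
  | out y w P ih =>
    intro u hu
    have := @ih u
    have := @hval w u
    have := hch y
    simp only [subst, fv, Set.mem_union, Set.mem_singleton_iff] at *
    rcases hu with (rfl | hu) | hu <;> tauto
  | inp q y b P ih =>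
    intro u hu
    have := @ih u
    have := hch y
    simp only [subst, fv, Set.mem_union, Set.mem_singleton_iff, Set.mem_sdiff] at *
    rcases hu with rfl | ⟨hu, hu'⟩
    · tauto
    · split_ifs at hu <;> tauto
  | sel y l P ih =>
    intro u hu
    have := @ih u
    have := hch y
    simp only [subst, fv, Set.mem_union, Set.mem_singleton_iff] at *
    rcases hu with rfl | hu <;> tauto
  | bran y l P ih =>
    intro u hu
    simp only [subst, fv, Set.mem_union, Set.mem_iUnion, Set.mem_singleton_iff] at hu ⊢
    rcases hu with rfl | ⟨j, hu⟩
    · rcases hch y with h | h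
      · exact .inl (.inl h)
      · exact .inr h
    · rcases ih j hu with h | h
      · exact .inl (.inr ⟨j, h⟩)
      · exact .inr h

theorem Mix.Proper.subst {x : ℕ} {v : Val} {P : Mix0} (h : P.Proper) (hd : Disjoint v.fv P.bv) :
    (P.subst x v).Proper := by
  induction P with
  | hole k => exact k.elim
  | nil => trivial
  | tick => trivial
  | par P Q ihP ihQ =>
    rw [bv, Set.disjoint_union_right] at hd
    exact ⟨ihP h.1 hd.1, ihQ h.2 hd.2⟩
  | res y z P ih =>
    rw [bv, Set.disjoint_union_right] at hd
    simp only [Mix.subst]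
    split_ifs
    · exact h
    · refine ⟨fun hyz hy => ?_, ih h.2 hd.2⟩
      rcases fv_subst_subset x v P hy with h' | h'
      · exact h.1 hyz h'
      · exact Set.disjoint_left.1 hd.1 h' (.inl rfl)
  | cond w P Q ihP ihQ =>
    rw [bv, Set.disjoint_union_right] at hd
    exact ⟨ihP h.1 hd.1, ihQ h.2 hd.2⟩
  | choice q y pre P ih =>
    rw [bv, Set.disjoint_iUnion_right] at hd
    intro j
    simp only
    split_ifs
    · exact h j
    · exact ih j (h j) (Set.disjoint_union_right.1 (hd j)).2
  | out y w P ih => exact ih h hd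
  | inp q y b P ih =>
    rw [bv, Set.disjoint_union_right] at hd
    simp only [Mix.subst, Proper]
    split_ifs
    · exact h
    · exact ih h hd.2
  | sel y l P ih => exact ih h hd
  | bran y l P ih =>
    rw [bv, Set.disjoint_iUnion_right] at hd
    exact fun j => ih j (h j) (hd j)

open Ty

/-! ### Structural congruence and reduction respect the relaxed types -/

theorem comp_fin : Comp .fin .fin :=
  ⟨.fin, .fin, trivial, trivial, ⟨fun S T => S = .fin ∧ T = .fin, ⟨rfl, rfl⟩, by
    rintro _ _ ⟨rfl, rfl⟩; exact .fin⟩, Le.refl _, Le.refl _⟩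

/-- Renaming a bound name `x` to a fresh name `w`. -/
theorem Sec.swap_iff {Γ Δ : ℕ → Ty} {x w : ℕ} {P : Mix0} (hw : w ∉ P.fv)
    (hx : Γ w = Δ x) (h : ∀ u ∈ P.fv, u ≠ x → Γ u = Δ u) :
    Sec Δ P ↔ Sec Γ (P.map (Equiv.swap x w)) := by
  have key : ∀ u ∈ P.fv, Γ (Equiv.swap x w u) = Δ u := by
    intro u hu
    by_cases hux : u = x
    · rw [hux, Equiv.swap_apply_left, hx]
    · rw [Equiv.swap_apply_of_ne_of_ne hux (by rintro rfl; exact hw hu), h u hu hux]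
  refine ⟨fun hP => hP.map _ fun u hu => by rw [key u hu]; exact Le.refl _, fun hP => ?_⟩
  have := hP.map (Γ := Δ) (Equiv.swap x w) (by
    intro u hu
    rw [Mix.fv_map] at hu
    obtain ⟨u, hu, rfl⟩ := hu
    rw [key u hu, Equiv.swap_apply_self]
    exact Le.refl _)
  rwa [Mix.map_map, ← Equiv.Perm.coe_mul, Equiv.swap_mul_self, Equiv.Perm.coe_one,
    Mix.map_id] at this

theorem Sec.fill_iff {H : Type} {s t : H → Mix0} (hfv : ∀ k, (s k).fv = (t k).fv)
    (h : ∀ k Γ, Sec Γ (s k) ↔ Sec Γ (t k)) (C : Mix H) (Γ : ℕ → Ty) :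
    Sec Γ (C.fill s) ↔ Sec Γ (C.fill t) := by
  induction C generalizing Γ with
  | hole k => exact h k Γ
  | _ => simp_all only [Mix.fill, Sec, Mix.fv, Mix.fv_fill hfv]

theorem MIdent.sec_iff {P Q : Mix0} (h : MIdent P Q) (Γ : ℕ → Ty) : Sec Γ P ↔ Sec Γ Q := by
  induction h generalizing Γ with
  | refl => rfl
  | symm _ ih => exact (ih Γ).symm
  | trans _ _ ih ih' => exact (ih Γ).trans (ih' Γ)
  | ctx C h ih => exact Sec.fill_iff (fun _ => h.fv_eq) (fun _ => ih) C Γ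
  | alphaResL y z w P hyz hwz hw =>
    refine exists_congr fun S => exists_congr fun V => and_congr_right fun _ => ?_
    refine Sec.swap_iff hw (by simp [hwz, hyz]) fun u hu huy => ?_
    have huw : u ≠ w := fun h => hw (h ▸ hu)
    by_cases huz : u = z <;> simp [huz, huy, huw]
  | alphaResR y z w P hyz hwy hw =>
    refine exists_congr fun S => exists_congr fun V => and_congr_right fun _ => ?_
    refine Sec.swap_iff hw (by simp) fun u hu huy => ?_
    have huw : u ≠ w := fun h => hw (h ▸ hu)
    by_cases huz : u = z <;> simp [Function.update_apply, huy, huw]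
  | alphaBranch q y pre P i l x w hi hw =>
    have hfv := (MIdent.alphaBranch q y pre P i l x w hi hw).fv_eq
    simp only [Sec, ← hfv]
    refine and_congr_right fun _ => forall_congr' fun j => ?_
    by_cases hj : j = i
    · subst hj
      simp only [Function.update_self, hi, BranchSec]
      refine exists_congr fun A => exists_congr fun B => and_congr_right fun _ => ?_
      refine Sec.swap_iff hw (by simp) fun u hu hux => ?_
      have huw : u ≠ w := fun h => hw (h ▸ hu)
      simp [hux, huw]
    · simp only [Function.update_of_ne hj]
  | alphaInp q y x w P hw =>
    have hfv := (MIdent.alphaInp q y x w P hw).fv_eq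
    simp only [Sec, ← hfv]
    refine and_congr_right fun _ => ?_
    refine exists_congr fun A => exists_congr fun B => and_congr_right fun _ => ?_
    refine Sec.swap_iff hw (by simp) fun u hu hux => ?_
    have huw : u ≠ w := fun h => hw (h ▸ hu)
    simp [hux, huw]
  | permChoice q y pre P e =>
    have hfv := (MIdent.permChoice q y pre P e).fv_eq
    simp only [Sec, ← hfv]
    exact and_congr_right fun _ => (e.forall_congr_right (q := fun j =>
      BranchSec Γ y (pre j) (P j).fv fun Γ' => Sec Γ' (P j))).symm
  | permBran y l P e =>
    simp only [Sec]
    exact (e.forall_congr_right (q := fun j =>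
      ∃ B, Uses Γ y .rcv (l j) .nat B ∧ Sec (advance Γ y B) (P j))).symm

theorem MCong.sec_iff {P Q : Mix0} (h : MCong P Q) (Γ : ℕ → Ty) : Sec Γ P ↔ Sec Γ Q := by
  induction h generalizing Γ with
  | ident h => exact h.sec_iff Γ
  | symm _ ih => exact (ih Γ).symm
  | trans _ _ ih ih' => exact (ih Γ).trans (ih' Γ)
  | ctx C h ih => exact Sec.fill_iff (fun _ => h.fv_eq) (fun _ => ih) C Γ
  | comm P Q =>
    have : ∀ E F, Shared Γ E F → Shared Γ F E := fun E F h u h1 h2 => h u h2 h1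
    exact ⟨fun h => ⟨this _ _ h.1, h.2.2, h.2.1⟩, fun h => ⟨this _ _ h.1, h.2.2, h.2.1⟩⟩
  | assoc P Q R =>
    simp only [Sec, Mix.fv, Shared, Set.mem_union]
    grind
  | nil P => simp [Sec, Mix.fv, Shared]
  | resNil y z => exact ⟨fun _ => trivial, fun _ => ⟨.fin, .fin, comp_fin, trivial⟩⟩
  | resSwap y z P =>
    by_cases hyz : y = z
    · rw [hyz]
    · constructor
      · rintro ⟨S, V, h1, h2⟩
        exact ⟨V, S, h1.symm, by rwa [Function.update_comm (Ne.symm hyz)]⟩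
      · rintro ⟨S, V, h1, h2⟩
        exact ⟨V, S, h1.symm, by rwa [Function.update_comm hyz]⟩
  | extrude y z P Q hy hz =>
    have hP : ∀ S V, ∀ u ∈ P.fv, Function.update (Function.update Γ y S) z V u = Γ u := by
      intro S V u hu
      rw [Function.update_of_ne (by rintro rfl; exact hz hu), Function.update_of_ne (by rintro rfl; exact hy hu)]
    constructor
    · rintro ⟨h1, h2, S, V, h3, h4⟩
      refine ⟨S, V, h3, fun u hu hu' => ?_, h2.congr (hP S V), h4⟩
      rw [hP S V u hu]
      exact h1 u hu ⟨hu', by rintro (rfl | rfl); exacts [hy hu, hz hu]⟩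
    · rintro ⟨S, V, h3, h1, h2, h4⟩
      refine ⟨fun u hu hu' => ?_, h2.congr fun u hu => (hP S V u hu).symm, S, V, h3, h4⟩
      rw [← hP S V u hu]
      exact h1 u hu hu'.1
  | resRes w x y z P hd =>
    simp only [List.nodup_cons, List.mem_cons, List.not_mem_nil, not_or, or_false] at hd
    obtain ⟨⟨-, hwy, hwz⟩, ⟨hxy, hxz⟩, -⟩ := hd
    have key : ∀ S V S' V', Function.update (Function.update (Function.update
        (Function.update Γ w S) x V) y S') z V' = Function.update (Function.update (Function.update
        (Function.update Γ y S') z V') w S) x V := by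
      intro S V S' V'
      rw [Function.update_comm hxy, Function.update_comm hxz, Function.update_comm hwy,
        Function.update_comm hwz]
    constructor
    · rintro ⟨S, V, h1, S', V', h2, h3⟩
      exact ⟨S', V', h2, S, V, h1, key S V S' V' ▸ h3⟩
    · rintro ⟨S', V', h2, S, V, h1, h3⟩
      exact ⟨S, V, h1, S', V', h2, (key S V S' V').symm ▸ h3⟩

theorem keep_fv_subset (q : Qual) (C P : Mix0) : (keep q C P).fv ⊆ P.fv ∪ C.fv := by
  cases q
  · exact Set.subset_union_left
  · exact subset_rfl

/-- The process `L` can send `v` with label `l` on `y` and become `K`. -/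
def Sends (L : Mix0) (y : ℕ) (l : Label) (v : Val) (K : Mix0) : Prop :=
  y ∈ L.fv ∧ v.fv ⊆ L.fv ∧ K.fv ⊆ L.fv ∧ ∀ Γ, Sec Γ L → ∃ A B, Uses Γ y .snd l A B ∧
    Le (v.ty (advance Γ y B)) A ∧ Shared (advance Γ y B) v.fv K.fv ∧ Sec (advance Γ y B) K

/-- The process `L` can receive `v` with label `l` on `y` and become `K`. -/
def Receives (L : Mix0) (y : ℕ) (l : Label) (v : Val) (K : Mix0) : Prop :=
  y ∈ L.fv ∧ ∀ Γ, Sec Γ L → ∃ A B, Uses Γ y .rcv l A B ∧ ∀ Γ' : ℕ → Ty,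
    (∀ u ∈ L.fv, Γ' u = advance Γ y B u) → Le (v.ty Γ') A → Shared Γ' v.fv L.fv →
      Sec Γ' K ∧ K.fv ⊆ L.fv ∪ v.fv

theorem sends_choice {q : Qual} {y : ℕ} {n : ℕ} {pre : Fin (n + 1) → BPre}
    {P : Fin (n + 1) → Mix0} {i : Fin (n + 1)} {l : Label} {v : Val} (hi : pre i = .out l v) :
    Sends (.choice q y pre P) y l v (keep q (.choice q y pre P) (P i)) := by
  have hP : (P i).fv ⊆ (Mix.choice q y pre P).fv := fun u hu =>
    .inr (Set.mem_iUnion.2 ⟨i, .inr ⟨hu, by rw [hi]; exact fun h => h⟩⟩)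
  refine ⟨.inl rfl, fun u hu => .inr (Set.mem_iUnion.2 ⟨i, .inl (by rw [hi]; exact hu)⟩), ?_, ?_⟩
  · exact (keep_fv_subset _ _ _).trans (Set.union_subset hP subset_rfl)
  · intro Γ h
    have hi' := h.2 i
    rw [hi] at hi'
    obtain ⟨A, B, h1, h2, h3, h4⟩ := hi'
    refine ⟨A, B, h1, h2, ?_⟩
    cases q with
    | lin => exact ⟨h3, h4⟩
    | un =>
      have hun := h.1 rfl
      rw [advance_of_un (hun y (.inl rfl))] at h3 h4 ⊢
      exact ⟨fun u h5 h6 => h6.elim (h3 u h5) (hun u), fun u _ => hun u, h4, h⟩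

theorem sends_out {y : ℕ} {v : Val} {P : Mix0} : Sends (.out y v P) y 0 v P :=
  ⟨.inl (.inl rfl), fun _ hu => .inl (.inr hu), fun _ hu => .inr hu, fun _ h => h⟩

theorem sends_sel {y : ℕ} {l : Label} {P : Mix0} :
    Sends (.sel y l P) y l (.const (.num 0)) P := by
  refine ⟨.inl rfl, fun _ hu => hu.elim, fun _ hu => .inr hu, fun Γ h => ?_⟩
  obtain ⟨B, h1, h2⟩ := h
  exact ⟨_, B, h1, Le.refl _, fun u hu => hu.elim, h2⟩

/-- The continuation of an input, after the substitution and with a persistent copy. -/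
theorem receive_aux {Γ Γ' : ℕ → Ty} {q : Qual} {y x : ℕ} {v : Val} {A B : Ty} {C Q : Mix0}
    (hC : Sec Γ C) (hy : y ∈ C.fv) (hq : q = .un → ∀ u ∈ C.fv, (Γ u).Un)
    (hQ : Sec (Function.update (advance Γ y B) x A) Q) (hfv : Q.fv \ {x} ⊆ C.fv)
    (hd : Disjoint v.fv Q.bv) (h1 : ∀ u ∈ C.fv, Γ' u = advance Γ y B u) (h2 : Le (v.ty Γ') A)
    (h3 : Shared Γ' v.fv C.fv) :
    Sec Γ' (keep q C (Q.subst x v)) ∧ (keep q C (Q.subst x v)).fv ⊆ C.fv ∪ v.fv := by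
  obtain ⟨h4, h5⟩ := hQ.subst (Γ := Γ') (x := x) (v := v) ⟨fun u hu hux => by
      rw [h1 u (hfv ⟨hu, hux⟩), Function.update_of_ne hux]; exact Le.refl _,
    by rwa [Function.update_self], fun u hu hu' hux => h3 u hu (hfv ⟨hu', hux⟩)⟩ hd
  have h6 : (Q.subst x v).fv ⊆ C.fv ∪ v.fv := by
    intro u hu
    rcases h5 hu with ⟨h6, h7⟩ | ⟨-, h7⟩
    · exact .inl (hfv ⟨h6, h7⟩)
    · exact .inr h7
  cases q with
  | lin => exact ⟨h4, h6⟩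
  | un =>
    have hun := hq rfl
    rw [advance_of_un (hun y hy)] at h1
    refine ⟨⟨fun u _ hu => ?_, h4, hC.congr h1⟩, Set.union_subset h6 Set.subset_union_left⟩
    rw [h1 u hu]
    exact hun u hu

theorem receives_choice {q : Qual} {y : ℕ} {n : ℕ} {pre : Fin (n + 1) → BPre}
    {P : Fin (n + 1) → Mix0} {i : Fin (n + 1)} {l : Label} {x : ℕ} {v : Val}
    (hi : pre i = .inp l x) (hd : Disjoint v.fv (P i).bv) :
    Receives (.choice q y pre P) y l v (keep q (.choice q y pre P) ((P i).subst x v)) := by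
  refine ⟨.inl rfl, fun Γ h => ?_⟩
  have hi' := h.2 i
  rw [hi] at hi'
  obtain ⟨A, B, h1, h2⟩ := hi'
  refine ⟨A, B, h1, fun Γ' h3 h4 h5 => receive_aux h (.inl rfl) h.1 h2 ?_ hd h3 h4 h5⟩
  exact fun u hu => .inr (Set.mem_iUnion.2 ⟨i, .inr ⟨hu.1, by rw [hi]; exact hu.2⟩⟩)

theorem receives_inp {q : Qual} {y x : ℕ} {v : Val} {P : Mix0} (hd : Disjoint v.fv P.bv) :
    Receives (.inp q y x P) y 0 v (keep q (.inp q y x P) (P.subst x v)) := by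
  refine ⟨.inl rfl, fun Γ h => ?_⟩
  obtain ⟨A, B, h1, h2⟩ := h.2
  exact ⟨A, B, h1, fun Γ' h3 h4 h5 => receive_aux h (.inl rfl) h.1 h2 (fun u hu => .inr hu) hd h3 h4 h5⟩

theorem receives_bran {y : ℕ} {n : ℕ} {l : Fin (n + 1) → Label} {P : Fin (n + 1) → Mix0}
    (i : Fin (n + 1)) : Receives (.bran y l P) y (l i) (.const (.num 0)) (P i) := by
  refine ⟨.inl rfl, fun Γ h => ?_⟩
  obtain ⟨B, h1, h2⟩ := h i
  have hP : (P i).fv ⊆ (Mix.bran y l P).fv := fun u hu => .inr (Set.mem_iUnion.2 ⟨i, hu⟩)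
  exact ⟨_, B, h1, fun Γ' h3 _ _ => ⟨h2.congr fun u hu => h3 u (hP hu),
    hP.trans Set.subset_union_left⟩⟩

/-- A communication respects the relaxed types. -/
theorem Sec.comm {Γ : ℕ → Ty} {y z : ℕ} {l : Label} {v : Val} {L M R K K' : Mix0} (hyz : y ≠ z)
    (hL : Sends L y l v K) (hM : Receives M z l v K')
    (h : Sec Γ (.res y z (.par (.par L M) R))) :
    Sec Γ (.res y z (.par (.par K K') R)) ∧
      (Mix.res y z (.par (.par K K') R)).fv ⊆ (Mix.res y z (.par (.par L M) R)).fv := by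
  obtain ⟨S, V, hSV, hR, ⟨hLM, hL', hM'⟩, hR'⟩ := h
  obtain ⟨hy, hv, hK, hL⟩ := hL
  obtain ⟨hz, hM⟩ := hM
  set Δ := Function.update (Function.update Γ y S) z V with hΔ
  have hΔy : Δ y = S := by simp [hΔ, hyz]
  have hΔz : Δ z = V := by simp [hΔ]
  obtain ⟨A, B, ⟨S₁, w, h1, h2, h3⟩, h4, h5, h6⟩ := hL Δ hL'
  obtain ⟨A', B', ⟨V₁, w', h7, h8, h9⟩, h10⟩ := hM Δ hM'
  rw [hΔy] at h2
  rw [hΔz] at h8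
  obtain ⟨hA, hB⟩ := (hSV.mono h2 h8).comm h1 h7 h3 h9
  have hun := hSV.un_iff
  -- The types after the communication: those of the continuations at both ends if the channel is
  -- linear, and the types from before otherwise.
  obtain ⟨Δ', S', V', hΔ', hSV', e1, e2, e3, e4⟩ : ∃ Δ' S' V',
      Δ' = Function.update (Function.update Γ y S') z V' ∧ Comp S' V' ∧
      (∀ u ∈ L.fv, Δ' u = advance Δ y B u) ∧ (∀ u ∈ M.fv, Δ' u = advance Δ z B' u) ∧
      (∀ u ∈ R.fv, Δ' u = Δ u) ∧ (∀ u, (Δ u).Un → Δ' u = Δ u) := by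
    by_cases hS : S.Un
    · refine ⟨Δ, S, V, hΔ, hSV, ?_, ?_, fun _ _ => rfl, fun _ _ => rfl⟩
      · rw [advance_of_un (hΔy.symm ▸ hS)]; exact fun _ _ => rfl
      · rw [advance_of_un (hΔz.symm ▸ hun.1 hS)]; exact fun _ _ => rfl
    · have hV : ¬ V.Un := fun h => hS (hun.2 h)
      have ny : ∀ u, (Δ u).Un → u ≠ y := by rintro u hu rfl; exact hS (hΔy ▸ hu)
      have nz : ∀ u, (Δ u).Un → u ≠ z := by rintro u hu rfl; exact hV (hΔz ▸ hu)
      refine ⟨_, B, B', rfl, hB, fun u hu => ?_, fun u hu => ?_, fun u hu => ?_, fun u hu => ?_⟩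
      · rw [advance_of_not_un (by rwa [hΔy])]
        have : u ≠ z := by rintro rfl; exact nz u (hLM u hu hz) rfl
        by_cases huy : u = y <;> simp [hΔ, this, huy, hyz]
      · rw [advance_of_not_un (by rwa [hΔz])]
        have : u ≠ y := by rintro rfl; exact ny u (hLM u hy hu) rfl
        by_cases huz : u = z <;> simp [hΔ, this, huz]
      · have h11 : u ≠ y := by rintro rfl; exact ny u (hR u (.inl hy) hu) rfl
        have h12 : u ≠ z := by rintro rfl; exact nz u (hR u (.inr hz) hu) rfl
        simp [hΔ, h11, h12]
      · simp [hΔ, ny u hu, nz u hu]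
  have h4' : Le (v.ty Δ') A := by
    cases v with
    | var u => rw [Val.ty, e1 u (hv rfl)]; exact h4
    | const c => cases c <;> exact h4
  obtain ⟨h11, h12⟩ := h10 Δ' e2 (h4'.trans hA) fun u h13 h14 => by
    rw [e4 u (hLM u (hv h13) h14)]
    exact hLM u (hv h13) h14
  have h13 : (K.par K').fv ⊆ (L.par M).fv := Set.union_subset (hK.trans Set.subset_union_left)
    (h12.trans (Set.union_subset Set.subset_union_right (hv.trans Set.subset_union_left)))
  refine ⟨⟨S', V', hSV', ?_, ⟨fun u h14 h15 => ?_, ?_, ?_⟩, ?_⟩, ?_⟩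
  · rw [← hΔ']
    intro u h14 h15
    rw [e4 u (hR u (h13 h14) h15)]
    exact hR u (h13 h14) h15
  · rw [← hΔ']
    rcases h12 h15 with h16 | h16
    · rw [e4 u (hLM u (hK h14) h16)]
      exact hLM u (hK h14) h16
    · rw [e1 u (hv h16)]
      exact h5 u h16 h14
  · rw [← hΔ']
    exact h6.congr fun u hu => e1 u (hK hu)
  · rwa [← hΔ']
  · rw [← hΔ']
    exact hR'.congr e3
  · exact Set.sdiff_subset_sdiff_left (Set.union_subset_union_left _ h13)

/-- Reduction respects the relaxed types and does not create free names. -/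
theorem Sec.step {Γ : ℕ → Ty} {P P' : Mix0} (hs : MStep P P') (h : Sec Γ P) :
    Sec Γ P' ∧ P'.fv ⊆ P.fv := by
  induction hs generalizing Γ with
  | ifTrue P Q => exact ⟨h.1, fun u hu => .inl (.inr hu)⟩
  | ifFalse P Q => exact ⟨h.2, fun u hu => .inr hu⟩
  | choice y z q q' l v x R pre P pre' Q i j hyz hi hj hd =>
    exact h.comm hyz (sends_choice hi) (receives_choice hj hd)
  | com y z q v x P Q R hyz hd => exact h.comm hyz sends_out (receives_inp hd)
  | case y z P R l Q j hyz => exact h.comm hyz sends_sel (receives_bran j)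
  | par Q _ ih =>
    obtain ⟨h1, h2⟩ := ih h.2.1
    exact ⟨⟨h.1.mono h2 subset_rfl, h1, h.2.2⟩, Set.union_subset_union_left _ h2⟩
  | res y z _ ih =>
    obtain ⟨S, V, h1, h2⟩ := h
    obtain ⟨h3, h4⟩ := ih h2
    exact ⟨⟨S, V, h1, h3⟩, Set.sdiff_subset_sdiff_left h4⟩
  | struct h1 _ h2 ih =>
    obtain ⟨h3, h4⟩ := ih ((h1.sec_iff Γ).1 h)
    rw [← h2.fv_eq, h1.fv_eq]
    exact ⟨(h2.sec_iff Γ).1 h3, h4⟩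

theorem Mix.Proper.step {Γ : ℕ → Ty} {P P' : Mix0} (hs : MStep P P') (hΓ : Sec Γ P)
    (h : P.Proper) : P'.Proper := by
  have hkeep : ∀ {q : Qual} {C P : Mix0}, C.Proper → P.Proper → (keep q C P).Proper := by
    intro q C P hC hP
    cases q
    · exact hP
    · exact ⟨hP, hC⟩
  induction hs generalizing Γ with
  | ifTrue P Q => exact h.1
  | ifFalse P Q => exact h.2
  | choice y z q q' l v x R pre P pre' Q i j hyz hi hj hd =>
    obtain ⟨-, ⟨h1, h2⟩, h3⟩ := h
    exact ⟨fun h => (hyz h).elim, ⟨hkeep h1 (h1 i), hkeep h2 ((h2 j).subst hd)⟩, h3⟩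
  | com y z q v x P Q R hyz hd =>
    obtain ⟨-, ⟨h1, h2⟩, h3⟩ := h
    exact ⟨fun h => (hyz h).elim, ⟨h1, hkeep h2 (Mix.Proper.subst h2 hd)⟩, h3⟩
  | case y z P R l Q j hyz =>
    obtain ⟨-, ⟨h1, h2⟩, h3⟩ := h
    exact ⟨fun h => (hyz h).elim, ⟨h1, h2 j⟩, h3⟩
  | par Q _ ih => exact ⟨ih hΓ.2.1 h.1, h.2⟩
  | res y z hs ih =>
    obtain ⟨S, V, -, hΓ⟩ := hΓ
    exact ⟨fun hyz hy => h.1 hyz ((hΓ.step hs).2 hy), ih hΓ h.2⟩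
  | struct h1 _ h2 ih => exact h2.proper_iff.1 (ih ((h1.sec_iff Γ).1 hΓ) (h1.proper_iff.1 h))

open Ty

/-! ### Typed processes respect the relaxed types -/

namespace Env

/-- The total environment of a typing context. -/
def tot (G : Env) : ℕ → Ty := fun x => (G x).getD .fin

theorem tot_eq {G : Env} {x : ℕ} {T : Ty} (h : G x = some T) : G.tot x = T := by
  simp [tot, h]

/-- All types in the context are well-formed. -/
def WF (G : Env) : Prop := ∀ x T, G x = some T → T.WF

/-- `G'` is part of `G`. -/
def Sub (G' G : Env) : Prop := ∀ x T, G' x = some T → G x = some T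

theorem Split.left {G G₁ G₂ : Env} (h : G.Split G₁ G₂) : G₁.Sub G := by
  intro x T hx
  rcases h x with ⟨_, h1, _⟩ | ⟨S, h1, ⟨_, h2, _⟩ | ⟨_, h2, _⟩ | ⟨_, h2, _⟩⟩ <;> simp_all

theorem Split.right {G G₁ G₂ : Env} (h : G.Split G₁ G₂) : G₂.Sub G := by
  intro x T hx
  rcases h x with ⟨_, _, h1⟩ | ⟨S, h1, ⟨_, _, h2⟩ | ⟨_, _, h2⟩ | ⟨_, _, h2⟩⟩ <;> simp_all

theorem Split.un {G G₁ G₂ : Env} (h : G.Split G₁ G₂) {x : ℕ} (h1 : G₁ x ≠ none)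
    (h2 : G₂ x ≠ none) : (G.tot x).Un := by
  rcases h x with ⟨_, h3, _⟩ | ⟨S, h3, ⟨h4, _, _⟩ | ⟨_, _, h4⟩ | ⟨_, h4, _⟩⟩
  · exact (h1 h3).elim
  · rwa [tot_eq h3]
  · exact (h2 h4).elim
  · exact (h1 h4).elim

theorem Sub.ne_none {G G' : Env} (h : G'.Sub G) {x : ℕ} (hx : G' x ≠ none) : G x ≠ none := by
  obtain ⟨T, hT⟩ := Option.ne_none_iff_exists'.1 hx
  simp [h x T hT]

theorem Sub.tot_eq {G G' : Env} (h : G'.Sub G) {x : ℕ} (hx : G' x ≠ none) : G'.tot x = G.tot x := by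
  obtain ⟨T, hT⟩ := Option.ne_none_iff_exists'.1 hx
  rw [Env.tot_eq hT, Env.tot_eq (h x T hT)]

theorem Sub.wf {G G' : Env} (h : G'.Sub G) (hG : G.WF) : G'.WF := fun x T hx => hG x T (h x T hx)

theorem WF.ext {G : Env} (hG : G.WF) {x : ℕ} {T : Ty} (hT : T.WF) : (G.ext x T).WF := by
  intro u S hu
  by_cases hux : u = x
  · rw [hux, Env.ext, Function.update_self] at hu
    exact Option.some_inj.1 hu ▸ hT
  · rw [Env.ext, Function.update_of_ne hux] at hu
    exact hG u S hu

theorem tot_ext (G : Env) (x : ℕ) (T : Ty) : (G.ext x T).tot = Function.update G.tot x T := by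
  funext u
  by_cases hux : u = x
  · simp [hux, tot, Env.ext]
  · simp [hux, tot, Env.ext]

theorem ext_ne_none {G : Env} {x u : ℕ} {T : Ty} (h : G.ext x T u ≠ none) (hu : u ≠ x) :
    G u ≠ none := by
  rwa [Env.ext, Function.update_of_ne hu] at h

end Env

theorem MVTyped.le {ok : Ty → Prop} {G : Env} {v : Val} {T : Ty} (h : MVTyped ok G v T)
    (hG : G.WF) : Le (v.ty G.tot) T ∧ T.WF ∧ ∀ u ∈ v.fv, G u ≠ none := by
  induction h with
  | num n _ => exact ⟨Le.refl _, trivial, fun u hu => hu.elim⟩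
  | bool b _ => exact ⟨Le.refl _, trivial, fun u hu => hu.elim⟩
  | var hx _ =>
    refine ⟨?_, hG _ _ hx, ?_⟩
    · rw [Val.ty, Env.tot_eq hx]
      exact Le.refl _
    · rintro u rfl
      simp [hx]
  | sub _ hU _ hs ih =>
    obtain ⟨h1, h2, h3⟩ := ih
    exact ⟨h1.tail ⟨h2, hU, hs⟩, hU, h3⟩

theorem Val.ty_congr {Γ Δ : ℕ → Ty} {v : Val} (h : ∀ u ∈ v.fv, Γ u = Δ u) : v.ty Γ = v.ty Δ := by
  cases v with
  | var u => exact h u rfl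
  | const c => cases c <;> rfl

/-- The typing context of a continuation agrees with the relaxed types after the communication. -/
theorem advance_eq {ok : Ty → Prop} {G G₁ G₂ : Env} {y : ℕ} {S U : Ty} (hG : G.WF)
    (hs : G.Split G₁ G₂) (hy : MVTyped ok G₁ (.var y) S) (hU : G₂.CanAdd y U) :
    G y ≠ none ∧ Le (G.tot y) S ∧ S.WF ∧ (∀ u, G₂.ext y U u ≠ none → G u ≠ none) ∧
      ∀ u, G₂.ext y U u ≠ none → advance G.tot y U u = (G₂.ext y U).tot u := by
  obtain ⟨h1, h2, h3⟩ := hy.le (hs.left.wf hG)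
  have hy1 := h3 y rfl
  have hy := hs.left.ne_none hy1
  have he : G₁.tot y = G.tot y := hs.left.tot_eq hy1
  have h1 : Le (G.tot y) S := he ▸ h1
  refine ⟨hy, h1, h2, fun u hu => ?_, fun u hu => ?_⟩
  · by_cases huy : u = y
    · rwa [huy]
    · exact hs.right.ne_none (Env.ext_ne_none hu huy)
  · rw [Env.tot_ext]
    by_cases huy : u = y
    · subst huy
      rw [Function.update_self]
      by_cases hun : (G.tot u).Un
      · rw [advance_of_un hun]
        rcases hU with hU | ⟨_, hU⟩
        · rcases hs u with ⟨h4, _⟩ | ⟨T, h4, ⟨_, _, h5⟩ | ⟨h5, _⟩ | ⟨h5, _⟩⟩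
          · exact (hy h4).elim
          · simp [hU] at h5
          · exact (h5 (Env.tot_eq h4 ▸ hun)).elim
          · exact (h5 (Env.tot_eq h4 ▸ hun)).elim
        · exact Env.tot_eq (hs.right u U hU)
      · rw [advance_of_not_un hun, Function.update_self]
    · rw [advance_of_ne huy, Function.update_of_ne huy]
      exact (hs.right.tot_eq (Env.ext_ne_none hu huy)).symm

/-- A typed process respects the types of its context, and all its free names are typed. -/
theorem MTyped.sec {ok : Ty → Prop} {G : Env} {P : Mix0} (h : MTyped ok G P) (hG : G.WF) :
    P.Proper ∧ (∀ u ∈ P.fv, G u ≠ none) ∧ Sec G.tot P := by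
  induction h with
  | nil _ => exact ⟨trivial, fun u hu => hu.elim, trivial⟩
  | tick _ => exact ⟨trivial, fun u hu => hu.elim, trivial⟩
  | par hs _ _ ih ih' =>
    obtain ⟨h1, h2, h3⟩ := ih (hs.left.wf hG)
    obtain ⟨h4, h5, h6⟩ := ih' (hs.right.wf hG)
    refine ⟨⟨h1, h4⟩, ?_, fun u hu hu' => hs.un (h2 u hu) (h5 u hu'), ?_, ?_⟩
    · rintro u (hu | hu)
      · exact hs.left.ne_none (h2 u hu)
      · exact hs.right.ne_none (h5 u hu)
    · exact h3.congr fun u hu => (hs.left.tot_eq (h2 u hu)).symm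
    · exact h6.congr fun u hu => (hs.right.tot_eq (h5 u hu)).symm
  | cond hs hv _ _ ih ih' =>
    obtain ⟨h1, h2, h3⟩ := ih (hs.right.wf hG)
    obtain ⟨h4, h5, h6⟩ := ih' (hs.right.wf hG)
    refine ⟨⟨h1, h4⟩, ?_, ?_, ?_⟩
    · rintro u ((hu | hu) | hu)
      · exact hs.left.ne_none ((hv.le (hs.left.wf hG)).2.2 u hu)
      · exact hs.right.ne_none (h2 u hu)
      · exact hs.right.ne_none (h5 u hu)
    · exact h3.congr fun u hu => (hs.right.tot_eq (h2 u hu)).symm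
    · exact h6.congr fun u hu => (hs.right.tot_eq (h5 u hu)).symm
  | @res G y z P T U hT hU _ _ hd hyz _ _ _ ih =>
    obtain ⟨h1, h2, h3⟩ := ih ((hG.ext hT).ext hU)
    refine ⟨⟨fun h => (hyz h).elim, h1⟩, ?_, T, U, ⟨T, U, hT, hU, hd, Le.refl _, Le.refl _⟩, ?_⟩
    · rintro u ⟨hu, hu'⟩
      exact Env.ext_ne_none (Env.ext_ne_none (h2 u hu) fun h => hu' (.inr h))
        fun h => hu' (.inl h)
    · rwa [Env.tot_ext, Env.tot_ext] at h3
  | @choice G G₁ G₂ q y n m pre P q' w l d T U f A B hs hq hy _ hf hU hAB hv _ _ _ ih ih' =>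
    have hj : ∀ j, ((P j).Proper ∧ (∀ u ∈ (pre j).fv, G u ≠ none) ∧
        ∀ u ∈ (P j).fv \ (pre j).bv, G u ≠ none) ∧
        BranchSec G.tot y (pre j) (P j).fv fun Γ' => Sec Γ' (P j) := by
      intro j
      obtain ⟨-, h2, h3, h4, h5⟩ := advance_eq hG hs hy (hU j)
      have hbr := h3.2 (f j)
      have huse : Uses G.tot y (pre j).pol (pre j).label (T (f j)) (U (f j)) :=
        ⟨_, w, h3, h2, by rw [(hf j).1, (hf j).2]; exact .choice _ _ _ _ _ _ _⟩
      have hext := (hs.right.wf hG).ext (x := y) hbr.2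
      cases hpre : pre j with
      | out l₀ v =>
        have hAB := hAB j l₀ v hpre
        obtain ⟨h6, -, h8⟩ := (hv j l₀ v hpre).le (hAB.left.wf hext)
        obtain ⟨h9, h10, h11⟩ := ih j l₀ v hpre (hAB.right.wf hext)
        rw [hpre] at huse
        refine ⟨⟨h9, fun u hu => h4 u (hAB.left.ne_none (h8 u hu)),
          fun u hu => h4 u (hAB.right.ne_none (h10 u hu.1))⟩, T (f j), U (f j), huse, ?_, ?_, ?_⟩
        · rwa [Val.ty_congr (Δ := (A j).tot)]
          intro u hu
          rw [h5 u (hAB.left.ne_none (h8 u hu)), hAB.left.tot_eq (h8 u hu)]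
        · intro u hu hu'
          rw [h5 u (hAB.left.ne_none (h8 u hu))]
          exact hAB.un (h8 u hu) (h10 u hu')
        · refine h11.congr fun u hu => ?_
          rw [h5 u (hAB.right.ne_none (h10 u hu)), hAB.right.tot_eq (h10 u hu)]
      | inp l₀ x =>
        obtain ⟨h9, h10, h11⟩ := ih' j l₀ x hpre (hext.ext hbr.1)
        rw [hpre] at huse
        refine ⟨⟨h9, fun u hu => hu.elim,
          fun u hu => h4 u (Env.ext_ne_none (h10 u hu.1) hu.2)⟩, T (f j), U (f j), huse, ?_⟩
        rw [Env.tot_ext] at h11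
        refine h11.congr fun u hu => ?_
        by_cases hux : u = x
        · rw [hux, Function.update_self, Function.update_self]
        · rw [Function.update_of_ne hux, Function.update_of_ne hux,
            h5 u (Env.ext_ne_none (h10 u hu) hux)]
    have hfv : ∀ u ∈ (Mix.choice q y pre P).fv, G u ≠ none := by
      rintro u (rfl | hu)
      · exact (advance_eq hG hs hy (hU 0)).1
      · obtain ⟨j, hu | hu⟩ := Set.mem_iUnion.1 hu
        · exact (hj j).1.2.1 u hu
        · exact (hj j).1.2.2 u hu
    refine ⟨fun j => (hj j).1.1, hfv, fun h u hu => ?_, fun j => (hj j).2⟩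
    obtain ⟨T, hT⟩ := Option.ne_none_iff_exists'.1 (hfv u hu)
    rw [Env.tot_eq hT]
    exact hq h u T hT
  | @out G G₁ G₂ G₃ G₄ y v P q T U hs hy hU hAB hv _ ih =>
    obtain ⟨h1, h2, h3, h4, h5⟩ := advance_eq hG hs hy hU
    have hext := (hs.right.wf hG).ext (x := y) h3.2
    obtain ⟨h6, -, h8⟩ := hv.le (hAB.left.wf hext)
    obtain ⟨h9, h10, h11⟩ := ih (hAB.right.wf hext)
    refine ⟨h9, ?_, T, U, ⟨_, _, h3, h2, .snd _ _ _⟩, ?_, ?_, ?_⟩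
    · rintro u ((rfl | hu) | hu)
      · exact h1
      · exact h4 u (hAB.left.ne_none (h8 u hu))
      · exact h4 u (hAB.right.ne_none (h10 u hu))
    · rw [Val.ty_congr fun u hu => ?_]
      · exact h6
      · rw [h5 u (hAB.left.ne_none (h8 u hu)), hAB.left.tot_eq (h8 u hu)]
    · intro u hu hu'
      rw [h5 u (hAB.left.ne_none (h8 u hu))]
      exact hAB.un (h8 u hu) (h10 u hu')
    · refine h11.congr fun u hu => ?_
      rw [h5 u (hAB.right.ne_none (h10 u hu)), hAB.right.tot_eq (h10 u hu)]
  | @inp G G₁ G₂ q y x P q' T U hs hq hy hU _ _ ih =>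
    obtain ⟨h1, h2, h3, h4, h5⟩ := advance_eq hG hs hy hU
    obtain ⟨h9, h10, h11⟩ := ih (((hs.right.wf hG).ext h3.2).ext h3.1)
    have hfv : ∀ u ∈ (Mix.inp q y x P).fv, G u ≠ none := by
      rintro u (rfl | hu)
      · exact h1
      · exact h4 u (Env.ext_ne_none (h10 u hu.1) hu.2)
    refine ⟨h9, hfv, fun h u hu => ?_, T, U, ⟨_, _, h3, h2, .rcv _ _ _⟩, ?_⟩
    · obtain ⟨T, hT⟩ := Option.ne_none_iff_exists'.1 (hfv u hu)
      rw [Env.tot_eq hT]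
      exact hq h u T hT
    · rw [Env.tot_ext] at h11
      refine h11.congr fun u hu => ?_
      by_cases hux : u = x
      · rw [hux, Function.update_self, Function.update_self]
      · rw [Function.update_of_ne hux, Function.update_of_ne hux,
          h5 u (Env.ext_ne_none (h10 u hu) hux)]
  | @bran G G₁ G₂ y n l P q l' T e hs hy hl hU _ ih =>
    have key : ∀ j, (P j).Proper ∧ (∀ u ∈ (P j).fv, G u ≠ none) ∧
        ∃ B, Uses G.tot y .rcv (l j) .nat B ∧ Sec (advance G.tot y B) (P j) := by
      intro j
      obtain ⟨h1, h2, h3, h4, h5⟩ := advance_eq hG hs hy (hU j)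
      obtain ⟨h9, h10, h11⟩ := ih j ((hs.right.wf hG).ext (h3.2 _))
      refine ⟨h9, fun u hu => h4 u (h10 u hu), _,
        ⟨_, _, h3, h2, by rw [hl j]; exact .ext _ _ _ _⟩, ?_⟩
      exact h11.congr fun u hu => h5 u (h10 u hu)
    refine ⟨fun j => (key j).1, ?_, fun j => (key j).2.2⟩
    rintro u (rfl | hu)
    · exact (advance_eq hG hs hy (hU 0)).1
    · obtain ⟨j, hu⟩ := Set.mem_iUnion.1 hu
      exact (key j).2.1 u hu
  | sel q T hs hy hU _ ih =>
    obtain ⟨h1, h2, h3, h4, h5⟩ := advance_eq hG hs hy hU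
    obtain ⟨h9, h10, h11⟩ := ih ((hs.right.wf hG).ext (h3.2 0))
    refine ⟨h9, ?_, _, ⟨_, _, h3, h2, .int _ _ _ 0⟩, h11.congr fun u hu => h5 u (h10 u hu)⟩
    rintro u (rfl | hu)
    · exact h1
    · exact h4 u (h10 u hu)

/-! ### Splitting a mixed session into two independent parts -/

/-- `Proj P R B`: every thread of `P` belongs to one of the two parts `R` and `B`, and no channel
connects the parts, i.e. every restriction belongs to one part and its names are not used by the
other one. -/
inductive Proj : Mix0 → Mix0 → Mix0 → Prop
  | left (P) : Proj P P .nil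
  | right (P) : Proj P .nil P
  | par {P Q R B R' B'} : Proj P R B → Proj Q R' B' → Proj (.par P Q) (.par R R') (.par B B')
  | resL (y z) {P R B} : Proj P R B → y ∉ B.fv → z ∉ B.fv → Proj (.res y z P) (.res y z R) B
  | resR (y z) {P R B} : Proj P R B → y ∉ R.fv → z ∉ R.fv → Proj (.res y z P) R (.res y z B)
  | cong {P R B R' B'} : Proj P R B → MCong R R' → MCong B B' → Proj P R' B'

/-- Processes that are neither compositions nor restrictions. -/
def Mix.IsLeaf : Mix0 → Prop
  | .par _ _ => False
  | .res _ _ _ => False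
  | _ => True

namespace Proj

variable {P Q R B : Mix0}

theorem symm (h : Proj P R B) : Proj P B R := by
  induction h with
  | left P => exact .right P
  | right P => exact .left P
  | par _ _ ih ih' => exact ih.par ih'
  | resL y z _ h1 h2 ih => exact .resR y z ih h1 h2
  | resR y z _ h1 h2 ih => exact .resL y z ih h1 h2
  | cong _ h1 h2 ih => exact ih.cong h2 h1

theorem fv_subset (h : Proj P R B) : R.fv ⊆ P.fv ∧ B.fv ⊆ P.fv := by
  induction h with
  | left P => exact ⟨subset_rfl, fun u hu => hu.elim⟩
  | right P => exact ⟨fun u hu => hu.elim, subset_rfl⟩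
  | par _ _ ih ih' => exact ⟨Set.union_subset_union ih.1 ih'.1, Set.union_subset_union ih.2 ih'.2⟩
  | resL y z _ h1 h2 ih =>
    refine ⟨Set.sdiff_subset_sdiff_left ih.1, fun u hu => ⟨ih.2 hu, ?_⟩⟩
    rintro (rfl | rfl)
    exacts [h1 hu, h2 hu]
  | resR y z _ h1 h2 ih =>
    refine ⟨fun u hu => ⟨ih.1 hu, ?_⟩, Set.sdiff_subset_sdiff_left ih.2⟩
    rintro (rfl | rfl)
    exacts [h1 hu, h2 hu]
  | cong _ h1 h2 ih => rwa [← h1.fv_eq, ← h2.fv_eq]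

theorem proper (h : Proj P R B) (hP : P.Proper) : R.Proper ∧ B.Proper := by
  induction h with
  | left P => exact ⟨hP, trivial⟩
  | right P => exact ⟨trivial, hP⟩
  | par _ _ ih ih' =>
    obtain ⟨h1, h2⟩ := ih hP.1
    obtain ⟨h3, h4⟩ := ih' hP.2
    exact ⟨⟨h1, h3⟩, h2, h4⟩
  | resL y z h _ _ ih =>
    exact ⟨⟨fun hyz hy => hP.1 hyz (h.fv_subset.1 hy), (ih hP.2).1⟩, (ih hP.2).2⟩
  | resR y z h _ _ ih =>
    exact ⟨(ih hP.2).1, fun hyz hy => hP.1 hyz (h.fv_subset.2 hy), (ih hP.2).2⟩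
  | cong _ h1 h2 ih => exact ⟨h1.proper_iff.1 (ih hP).1, h2.proper_iff.1 (ih hP).2⟩

theorem sec {Γ : ℕ → Ty} (h : Proj P R B) (hP : Sec Γ P) : Sec Γ R ∧ Sec Γ B := by
  have key : ∀ {y z : ℕ} {S V : Ty} {Γ : ℕ → Ty} {P : Mix0}, y ∉ P.fv → z ∉ P.fv →
      Sec (Function.update (Function.update Γ y S) z V) P → Sec Γ P := by
    intro y z S V Γ P hy hz h
    refine h.congr fun u hu => ?_
    rw [Function.update_of_ne (by rintro rfl; exact hz hu),
      Function.update_of_ne (by rintro rfl; exact hy hu)]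
  induction h generalizing Γ with
  | left P => exact ⟨hP, trivial⟩
  | right P => exact ⟨trivial, hP⟩
  | par h h' ih ih' =>
    obtain ⟨h1, h2⟩ := ih hP.2.1
    obtain ⟨h3, h4⟩ := ih' hP.2.2
    exact ⟨⟨hP.1.mono h.fv_subset.1 h'.fv_subset.1, h1, h3⟩,
      hP.1.mono h.fv_subset.2 h'.fv_subset.2, h2, h4⟩
  | resL y z _ hy hz ih =>
    obtain ⟨S, V, h1, h2⟩ := hP
    exact ⟨⟨S, V, h1, (ih h2).1⟩, key hy hz (ih h2).2⟩
  | resR y z _ hy hz ih =>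
    obtain ⟨S, V, h1, h2⟩ := hP
    exact ⟨key hy hz (ih h2).1, S, V, h1, (ih h2).2⟩
  | cong _ h1 h2 ih => exact ⟨(h1.sec_iff Γ).1 (ih hP).1, (h2.sec_iff Γ).1 (ih hP).2⟩

theorem success (h : Proj P R B) (hP : P.Success) : R.Success ∨ B.Success := by
  induction h with
  | left P => exact .inl hP
  | right P => exact .inr hP
  | par _ _ ih ih' =>
    rcases hP with hP | hP
    · exact (ih hP).imp .inl .inl
    · exact (ih' hP).imp .inr .inr
  | resL y z _ _ _ ih => exact ih hP
  | resR y z _ _ _ ih => exact ih hP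
  | cong _ h1 h2 ih => exact (ih hP).imp h1.success_iff.1 h2.success_iff.1

theorem map (e : Equiv.Perm ℕ) (h : Proj P R B) : Proj (P.map e) (R.map e) (B.map e) := by
  have hfv : ∀ {y : ℕ} {P : Mix0}, y ∉ P.fv → e y ∉ (P.map e).fv := by
    rintro y P hy h
    rw [Mix.fv_map] at h
    obtain ⟨u, hu, he⟩ := h
    exact hy (e.injective he ▸ hu)
  induction h with
  | left P => exact .left _
  | right P => exact .right _
  | par _ _ ih ih' => exact ih.par ih'
  | resL y z _ h1 h2 ih => exact .resL _ _ ih (hfv h1) (hfv h2)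
  | resR y z _ h1 h2 ih => exact .resR _ _ ih (hfv h1) (hfv h2)
  | cong _ h1 h2 ih => exact ih.cong (h1.map e) (h2.map e)

theorem par_inv (h : Proj (.par P Q) R B) : ∃ R₁ B₁ R₂ B₂, Proj P R₁ B₁ ∧ Proj Q R₂ B₂ ∧
    MCong (.par R₁ R₂) R ∧ MCong (.par B₁ B₂) B := by
  generalize hX : Mix.par P Q = X at h
  induction h with
  | left => subst hX; exact ⟨_, _, _, _, .left _, .left _, .refl _, .nil _⟩
  | right => subst hX; exact ⟨_, _, _, _, .right _, .right _, .nil _, .refl _⟩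
  | par h h' => cases hX; exact ⟨_, _, _, _, h, h', .refl _, .refl _⟩
  | resL => cases hX
  | resR => cases hX
  | cong _ h1 h2 ih =>
    obtain ⟨_, _, _, _, h3, h4, h5, h6⟩ := ih hX
    exact ⟨_, _, _, _, h3, h4, h5.trans h1, h6.trans h2⟩

theorem res_inv {y z : ℕ} (h : Proj (.res y z P) R B) : ∃ R₀ B₀, Proj P R₀ B₀ ∧
    ((y ∉ B₀.fv ∧ z ∉ B₀.fv ∧ MCong (.res y z R₀) R ∧ MCong B₀ B) ∨
      (y ∉ R₀.fv ∧ z ∉ R₀.fv ∧ MCong R₀ R ∧ MCong (.res y z B₀) B)) := by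
  generalize hX : Mix.res y z P = X at h
  induction h with
  | left =>
    subst hX
    exact ⟨_, _, .left _, .inl ⟨fun h => h, fun h => h, .refl _, .refl _⟩⟩
  | right =>
    subst hX
    exact ⟨_, _, .right _, .inr ⟨fun h => h, fun h => h, .refl _, .refl _⟩⟩
  | par => cases hX
  | resL y z h h1 h2 => cases hX; exact ⟨_, _, h, .inl ⟨h1, h2, .refl _, .refl _⟩⟩
  | resR y z h h1 h2 => cases hX; exact ⟨_, _, h, .inr ⟨h1, h2, .refl _, .refl _⟩⟩
  | cong _ h1 h2 ih =>
    obtain ⟨_, _, h, h3⟩ := ih hX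
    exact ⟨_, _, h, h3.imp (fun h => ⟨h.1, h.2.1, h.2.2.1.trans h1, h.2.2.2.trans h2⟩)
      fun h => ⟨h.1, h.2.1, h.2.2.1.trans h1, h.2.2.2.trans h2⟩⟩

theorem leaf_inv (h : Proj P R B) (hP : P.IsLeaf) :
    (MCong P R ∧ MCong .nil B) ∨ (MCong .nil R ∧ MCong P B) := by
  induction h with
  | left P => exact .inl ⟨.refl _, .refl _⟩
  | right P => exact .inr ⟨.refl _, .refl _⟩
  | par => exact hP.elim
  | resL => exact hP.elim
  | resR => exact hP.elim
  | cong _ h1 h2 ih =>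
    exact (ih hP).imp (fun h => ⟨h.1.trans h1, h.2.trans h2⟩) fun h => ⟨h.1.trans h1, h.2.trans h2⟩

theorem leaf_cong (hPQ : MCong P Q) (h : Proj P R B) (hP : P.IsLeaf) : Proj Q R B := by
  rcases h.leaf_inv hP with ⟨h1, h2⟩ | ⟨h1, h2⟩
  · exact (Proj.left Q).cong (hPQ.symm.trans h1) h2
  · exact (Proj.right Q).cong h1 (hPQ.symm.trans h2)

/-- Replacing a process by a congruent one inside a context.  Below a prefix the replacement concerns
a single thread, which is not split. -/
theorem fill (hPQ : MCong P Q) (h : ∀ R B, P.Proper → Proj P R B → Proj Q R B) (C : Mix (Fin 1))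
    (hC : (C.fill fun _ => P).Proper) (hR : Proj (C.fill fun _ => P) R B) :
    Proj (C.fill fun _ => Q) R B := by
  induction C generalizing R B with
  | hole k => exact h R B hC hR
  | nil => exact hR
  | tick => exact hR
  | par C C' ih ih' =>
    obtain ⟨_, _, _, _, h1, h2, h3, h4⟩ := hR.par_inv
    exact ((ih hC.1 h1).par (ih' hC.2 h2)).cong h3 h4
  | res y z C ih =>
    obtain ⟨_, _, h1, ⟨h2, h3, h4, h5⟩ | ⟨h2, h3, h4, h5⟩⟩ := hR.res_inv
    · exact (Proj.resL y z (ih hC.2 h1) h2 h3).cong h4 h5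
    · exact (Proj.resR y z (ih hC.2 h1) h2 h3).cong h4 h5
  | cond v C C' => exact hR.leaf_cong (MCong.ctx (.cond v C C') hPQ) trivial
  | choice q y pre C => exact hR.leaf_cong (MCong.ctx (.choice q y pre C) hPQ) trivial
  | out y v C => exact hR.leaf_cong (MCong.ctx (.out y v C) hPQ) trivial
  | inp q y x C => exact hR.leaf_cong (MCong.ctx (.inp q y x C) hPQ) trivial
  | sel y l C => exact hR.leaf_cong (MCong.ctx (.sel y l C) hPQ) trivial
  | bran y l C => exact hR.leaf_cong (MCong.ctx (.bran y l C) hPQ) trivial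

/-- Renaming one of the two restricted names: here the names of the restriction are renamed in the
part that does not know them, which does not matter up to structural congruence. -/
theorem alpha {y z y' z' a w : ℕ} (hyz : y ≠ z) (haw : a ≠ w) (hw : w ∉ P.fv)
    (hy : Equiv.swap a w y = y') (hz : Equiv.swap a w z = z') (ha : a = y ∨ a = z)
    (hP : P.Proper) (hc : ∀ X : Mix0, w ∉ X.fv →
      MCong (.res y z X) (.res y' z' (X.map (Equiv.swap a w))))
    (h : Proj (.res y z P) R B) : Proj (.res y' z' (P.map (Equiv.swap a w))) R B := by
  have key : ∀ {R₀ : Mix0}, R₀.Proper → R₀.fv ⊆ P.fv → y ∉ R₀.fv → z ∉ R₀.fv →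
      y' ∉ (R₀.map (Equiv.swap a w)).fv ∧ z' ∉ (R₀.map (Equiv.swap a w)).fv ∧
        MCong (R₀.map (Equiv.swap a w)) R₀ := by
    intro R₀ hR hfv h1 h2
    have hmem : ∀ {u}, u ∉ R₀.fv → Equiv.swap a w u ∉ (R₀.map (Equiv.swap a w)).fv := by
      intro u hu h
      rw [Mix.fv_map] at h
      obtain ⟨b, hb, he⟩ := h
      exact hu ((Equiv.swap a w).injective he ▸ hb)
    have haR : a ∉ R₀.fv := by rcases ha with rfl | rfl <;> assumption
    exact ⟨hy ▸ hmem h1, hz ▸ hmem h2, (MCong.swap haw R₀ hR haR fun h => hw (hfv h)).symm⟩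
  obtain ⟨R₀, B₀, h1, h2⟩ := h.res_inv
  have hs := h1.fv_subset
  have hp := h1.proper hP
  rcases h2 with ⟨h2, h3, h4, h5⟩ | ⟨h2, h3, h4, h5⟩
  · obtain ⟨h6, h7, h8⟩ := key hp.2 hs.2 h2 h3
    exact (Proj.resL y' z' (h1.map _) h6 h7).cong
      ((hc R₀ fun h => hw (hs.1 h)).symm.trans h4) (h8.trans h5)
  · obtain ⟨h6, h7, h8⟩ := key hp.1 hs.1 h2 h3
    exact (Proj.resR y' z' (h1.map _) h6 h7).cong (h8.trans h4)
      ((hc B₀ fun h => hw (hs.2 h)).symm.trans h5)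

end Proj

theorem Mix.notMem_fv_map_swap {P : Mix0} {a w : ℕ} (hw : w ∉ P.fv) :
    a ∉ (P.map (Equiv.swap a w)).fv := by
  rw [fv_map]
  rintro ⟨u, hu, h⟩
  rw [Equiv.swap_apply_eq_iff, Equiv.swap_apply_left] at h
  exact hw (h ▸ hu)

theorem Mix.map_swap_swap (P : Mix0) (a w : ℕ) :
    (P.map (Equiv.swap a w)).map (Equiv.swap w a) = P := by
  rw [Equiv.swap_comm w a, map_map, ← Equiv.Perm.coe_mul, Equiv.swap_mul_self, Equiv.Perm.coe_one,
    map_id]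

theorem MIdent.proj_iff {P Q : Mix0} (h : MIdent P Q) (hP : P.Proper) {R B : Mix0} :
    Proj P R B ↔ Proj Q R B := by
  induction h generalizing R B with
  | refl => rfl
  | symm h ih => exact (ih (h.proper_iff.2 hP)).symm
  | trans h _ ih ih' => exact (ih hP).trans (ih' (h.proper_iff.1 hP))
  | ctx C h ih =>
    have hQ := (MIdent.ctx C h).proper_iff.1 hP
    exact ⟨Proj.fill (.ident h) (fun R B hp => (ih hp).1) C hP,
      Proj.fill (.ident h.symm) (fun R B hp => (ih (h.proper_iff.2 hp)).2) C hQ⟩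
  | alphaResL y z w P hyz hwz hw =>
    by_cases hyw : y = w
    · subst hyw
      simp
    have h1 : ∀ {y w : ℕ} {P : Mix0} {R B}, y ≠ w → y ≠ z → w ≠ z → w ∉ P.fv → P.Proper →
        Proj (.res y z P) R B → Proj (.res w z (P.map (Equiv.swap y w))) R B :=
      fun hyw hyz hwz hw hP => Proj.alpha hyz hyw hw (Equiv.swap_apply_left _ _)
        (Equiv.swap_apply_of_ne_of_ne hyz.symm hwz.symm) (.inl rfl) hP
        fun X hX => .ident (.alphaResL _ _ _ _ hyz hwz hX)
    refine ⟨h1 hyw hyz hwz hw hP.2, fun h => ?_⟩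
    have := h1 (Ne.symm hyw) hwz hyz (Mix.notMem_fv_map_swap hw)
      ((Mix.proper_map _ _).2 hP.2) h
    rwa [Mix.map_swap_swap] at this
  | alphaResR y z w P hyz hwy hw =>
    by_cases hzw : z = w
    · subst hzw
      simp
    have h1 : ∀ {z w : ℕ} {P : Mix0} {R B}, z ≠ w → y ≠ z → w ≠ y → w ∉ P.fv → P.Proper →
        Proj (.res y z P) R B → Proj (.res y w (P.map (Equiv.swap z w))) R B :=
      fun hzw hyz hwy hw hP => Proj.alpha hyz hzw hw
        (Equiv.swap_apply_of_ne_of_ne hyz hwy.symm) (Equiv.swap_apply_left _ _) (.inr rfl) hP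
        fun X hX => .ident (.alphaResR _ _ _ _ hyz hwy hX)
    refine ⟨h1 hzw hyz hwy hw hP.2, fun h => ?_⟩
    have := h1 (Ne.symm hzw) hwy.symm hyz.symm (Mix.notMem_fv_map_swap hw)
      ((Mix.proper_map _ _).2 hP.2) h
    rwa [Mix.map_swap_swap] at this
  | alphaBranch q y pre P i l x w hi hw =>
    have h := MCong.ident (MIdent.alphaBranch q y pre P i l x w hi hw)
    exact ⟨fun h' => h'.leaf_cong h trivial, fun h' => h'.leaf_cong h.symm trivial⟩
  | alphaInp q y x w P hw =>
    have h := MCong.ident (MIdent.alphaInp q y x w P hw)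
    exact ⟨fun h' => h'.leaf_cong h trivial, fun h' => h'.leaf_cong h.symm trivial⟩
  | permChoice q y pre P e =>
    have h := MCong.ident (MIdent.permChoice q y pre P e)
    exact ⟨fun h' => h'.leaf_cong h trivial, fun h' => h'.leaf_cong h.symm trivial⟩
  | permBran y l P e =>
    have h := MCong.ident (MIdent.permBran y l P e)
    exact ⟨fun h' => h'.leaf_cong h trivial, fun h' => h'.leaf_cong h.symm trivial⟩

theorem Proj.resSwap {y z : ℕ} {P R B : Mix0} (h : Proj (.res y z P) R B) :
    Proj (.res z y P) R B := by
  obtain ⟨_, _, h1, ⟨h2, h3, h4, h5⟩ | ⟨h2, h3, h4, h5⟩⟩ := h.res_inv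
  · exact (Proj.resL z y h1 h3 h2).cong ((MCong.resSwap _ _ _).trans h4) h5
  · exact (Proj.resR z y h1 h3 h2).cong h4 ((MCong.resSwap _ _ _).trans h5)

theorem Proj.resRes {w x y z : ℕ} {P R B : Mix0} (hd : [w, x, y, z].Nodup)
    (h : Proj (.res w x (.res y z P)) R B) : Proj (.res y z (.res w x P)) R B := by
  have hd' := hd
  simp only [List.nodup_cons, List.mem_cons, List.not_mem_nil, not_or, or_false] at hd'
  obtain ⟨⟨-, hwy, hwz⟩, ⟨hxy, hxz⟩, -⟩ := hd'
  have hout : ∀ {X : Mix0} {u y z : ℕ}, u ≠ y → u ≠ z → u ∉ (Mix.res y z X).fv → u ∉ X.fv := by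
    intro X u y z h1 h2 h3 h4
    exact h3 ⟨h4, by rintro (h | h); exacts [h1 h, h2 h]⟩
  have hin : ∀ {X : Mix0} {u y z : ℕ}, u ∉ X.fv → u ∉ (Mix.res y z X).fv := fun h h' => h h'.1
  obtain ⟨R₁, B₁, h1, h2⟩ := h.res_inv
  obtain ⟨R₂, B₂, h3, h4⟩ := h1.res_inv
  rcases h2 with ⟨h5, h6, h7, h8⟩ | ⟨h5, h6, h7, h8⟩ <;>
    rcases h4 with ⟨h9, h10, h11, h12⟩ | ⟨h9, h10, h11, h12⟩
  · rw [← h12.fv_eq] at h5 h6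
    exact (Proj.resL y z (.resL w x h3 h5 h6) h9 h10).cong
      ((MCong.resRes _ _ _ _ _ hd).symm.trans ((h11.res w x).trans h7)) (h12.trans h8)
  · rw [← h12.fv_eq] at h5 h6
    exact (Proj.resR y z (.resL w x h3 (hout hwy hwz h5) (hout hxy hxz h6)) (hin h9) (hin h10)).cong
      ((h11.res w x).trans h7) (h12.trans h8)
  · rw [← h11.fv_eq] at h5 h6
    exact (Proj.resL y z (.resR w x h3 (hout hwy hwz h5) (hout hxy hxz h6)) (hin h9) (hin h10)).cong
      (h11.trans h7) ((h12.res w x).trans h8)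
  · rw [← h11.fv_eq] at h5 h6
    exact (Proj.resR y z (.resR w x h3 h5 h6) h9 h10).cong (h11.trans h7)
      ((MCong.resRes _ _ _ _ _ hd).symm.trans ((h12.res w x).trans h8))

/-- Structurally congruent processes have the same splittings. -/
theorem MCong.proj_iff {P Q : Mix0} (h : MCong P Q) (hP : P.Proper) {R B : Mix0} :
    Proj P R B ↔ Proj Q R B := by
  induction h generalizing R B with
  | ident h => exact h.proj_iff hP
  | symm h ih => exact (ih (h.proper_iff.2 hP)).symm
  | trans h _ ih ih' => exact (ih hP).trans (ih' (h.proper_iff.1 hP))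
  | ctx C h ih =>
    have hQ := (MCong.ctx C h).proper_iff.1 hP
    exact ⟨Proj.fill h (fun R B hp => (ih hp).1) C hP,
      Proj.fill h.symm (fun R B hp => (ih (h.proper_iff.2 hp)).2) C hQ⟩
  | comm P Q =>
    have key : ∀ {P Q : Mix0}, Proj (.par P Q) R B → Proj (.par Q P) R B := by
      intro P Q h
      obtain ⟨_, _, _, _, h1, h2, h3, h4⟩ := h.par_inv
      exact (h2.par h1).cong ((MCong.comm _ _).trans h3) ((MCong.comm _ _).trans h4)
    exact ⟨key, key⟩
  | assoc P Q S =>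
    constructor
    · intro h
      obtain ⟨_, _, _, _, h1, h2, h3, h4⟩ := h.par_inv
      obtain ⟨_, _, _, _, h5, h6, h7, h8⟩ := h1.par_inv
      exact (h5.par (h6.par h2)).cong
        ((MCong.assoc _ _ _).symm.trans ((h7.par (.refl _)).trans h3))
        ((MCong.assoc _ _ _).symm.trans ((h8.par (.refl _)).trans h4))
    · intro h
      obtain ⟨_, _, _, _, h1, h2, h3, h4⟩ := h.par_inv
      obtain ⟨_, _, _, _, h5, h6, h7, h8⟩ := h2.par_inv
      exact ((h1.par h5).par h6).cong
        ((MCong.assoc _ _ _).trans (((MCong.refl _).par h7).trans h3))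
        ((MCong.assoc _ _ _).trans (((MCong.refl _).par h8).trans h4))
  | nil P =>
    constructor
    · intro h
      obtain ⟨_, _, _, _, h1, h2, h3, h4⟩ := h.par_inv
      have h5 : ∀ {X Y : Mix0}, MCong .nil Y → MCong X (.par X Y) :=
        fun h => (MCong.nil _).symm.trans ((MCong.refl _).par h)
      rcases h2.leaf_inv trivial with ⟨h6, h7⟩ | ⟨h6, h7⟩
      · exact h1.cong ((h5 h6).trans h3) ((h5 h7).trans h4)
      · exact h1.cong ((h5 h6).trans h3) ((h5 h7).trans h4)
    · intro h
      exact (h.par (.left .nil)).cong (.nil _) (.nil _)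
  | resNil y z =>
    constructor
    · intro h
      obtain ⟨R₀, B₀, h1, h2⟩ := h.res_inv
      have h3 : MCong .nil R₀ ∧ MCong .nil B₀ := by
        rcases h1.leaf_inv trivial with h | h <;> exact h
      have h4 : ∀ {X : Mix0}, MCong .nil X → MCong .nil (.res y z X) :=
        fun h => (MCong.resNil y z).symm.trans (h.res y z)
      rcases h2 with ⟨-, -, h5, h6⟩ | ⟨-, -, h5, h6⟩
      · exact (Proj.left .nil).cong ((h4 h3.1).trans h5) (h3.2.trans h6)
      · exact (Proj.left .nil).cong (h3.1.trans h5) ((h4 h3.2).trans h6)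
    · intro h
      refine (Proj.resL y z h ?_ ?_).cong ?_ (.refl _)
      all_goals
        have h3 : MCong .nil R ∧ MCong .nil B := by
          rcases h.leaf_inv trivial with h | h <;> exact h
      · rw [← h3.2.fv_eq]; exact fun h => h
      · rw [← h3.2.fv_eq]; exact fun h => h
      · exact (h3.1.symm.res y z).trans ((MCong.resNil y z).trans h3.1)
  | resSwap y z P => exact ⟨Proj.resSwap, Proj.resSwap⟩
  | extrude y z P Q hy hz =>
    constructor
    · intro h
      obtain ⟨R₁, B₁, R₂, B₂, h1, h2, h3, h4⟩ := h.par_inv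
      have hs := h1.fv_subset
      obtain ⟨R₀, B₀, h5, ⟨h6, h7, h8, h9⟩ | ⟨h6, h7, h8, h9⟩⟩ := h2.res_inv
      · refine (Proj.resL y z (h1.par h5) ?_ ?_).cong
          ((MCong.extrude y z R₁ R₀ (fun h => hy (hs.1 h)) fun h => hz (hs.1 h)).symm.trans
            (((MCong.refl _).par h8).trans h3)) (((MCong.refl _).par h9).trans h4)
        · rintro (h | h); exacts [hy (hs.2 h), h6 h]
        · rintro (h | h); exacts [hz (hs.2 h), h7 h]
      · refine (Proj.resR y z (h1.par h5) ?_ ?_).cong (((MCong.refl _).par h8).trans h3)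
          ((MCong.extrude y z B₁ B₀ (fun h => hy (hs.2 h)) fun h => hz (hs.2 h)).symm.trans
            (((MCong.refl _).par h9).trans h4))
        · rintro (h | h); exacts [hy (hs.1 h), h6 h]
        · rintro (h | h); exacts [hz (hs.1 h), h7 h]
    · intro h
      obtain ⟨R₀, B₀, h1, h2⟩ := h.res_inv
      obtain ⟨R₁, B₁, R₂, B₂, h3, h4, h5, h6⟩ := h1.par_inv
      have hs := h3.fv_subset
      rcases h2 with ⟨h7, h8, h9, h10⟩ | ⟨h7, h8, h9, h10⟩
      · rw [← h6.fv_eq] at h7 h8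
        exact (h3.par (.resL y z h4 (fun h => h7 (.inr h)) fun h => h8 (.inr h))).cong
          ((MCong.extrude y z R₁ R₂ (fun h => hy (hs.1 h)) fun h => hz (hs.1 h)).trans
            ((h5.res y z).trans h9)) (h6.trans h10)
      · rw [← h5.fv_eq] at h7 h8
        exact (h3.par (.resR y z h4 (fun h => h7 (.inr h)) fun h => h8 (.inr h))).cong
          (h5.trans h9) ((MCong.extrude y z B₁ B₂ (fun h => hy (hs.2 h))
            fun h => hz (hs.2 h)).trans ((h6.res y z).trans h10))
  | resRes w x y z P hd =>
    refine ⟨Proj.resRes hd, Proj.resRes ?_⟩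
    exact (List.perm_append_comm (l₁ := [w, x]) (l₂ := [y, z])).nodup_iff.1 hd

/-! ### The two parts of a mixed session evolve independently -/

/-- Reduction and structural congruence. -/
def Evolves : Mix0 → Mix0 → Prop := Relation.ReflTransGen fun P Q => MStep P Q ∨ MCong P Q

namespace Evolves

variable {P P' Q : Mix0}

theorem par (Q : Mix0) (h : Evolves P P') : Evolves (.par P Q) (.par P' Q) :=
  Relation.ReflTransGen.lift (fun P => Mix.par P Q)
    (fun _ _ h => h.imp (MStep.par Q) fun h => h.par (.refl Q)) _ _ h

theorem res (y z : ℕ) (h : Evolves P P') : Evolves (.res y z P) (.res y z P') :=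
  Relation.ReflTransGen.lift (Mix.res y z) (fun _ _ h => h.imp (MStep.res y z) (MCong.res y z)) _ _ h

theorem cong_left (h : MCong P Q) (h' : Evolves Q P') : Evolves P P' := .head (.inr h) h'

theorem of_cong (h : MCong P Q) : Evolves P Q := .single (.inr h)

theorem sec {Γ : ℕ → Ty} (h : Evolves P P') (hP : Sec Γ P) : Sec Γ P' ∧ P'.fv ⊆ P.fv := by
  induction h with
  | refl => exact ⟨hP, subset_rfl⟩
  | tail _ h ih =>
    rcases h with h | h
    · exact ⟨(ih.1.step h).1, (ih.1.step h).2.trans ih.2⟩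
    · exact ⟨(h.sec_iff Γ).1 ih.1, h.fv_eq ▸ ih.2⟩

theorem maySucceed (h : Evolves P P') (hP : P'.Success) :
    ∃ Q, Relation.ReflTransGen MStep P Q ∧ Q.Success := by
  induction h using Relation.ReflTransGen.head_induction_on with
  | refl => exact ⟨_, .refl, hP⟩
  | head h _ ih =>
    obtain ⟨Q, h1, h2⟩ := ih
    rcases h with h | h
    · exact ⟨Q, h1.head h, h2⟩
    · rcases h1.cases_head with rfl | ⟨S, h3, h4⟩
      · exact ⟨_, .refl, h.success_iff.2 h2⟩
      · exact ⟨Q, h4.head (.struct h h3 (.refl _)), h2⟩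

end Evolves

/-- Both partners of a communication belong to the part that owns their channel. -/
theorem Proj.comm_left {y z : ℕ} {L M K K' X R₀ B₀ R B : Mix0} (hL : L.IsLeaf) (hM : M.IsLeaf)
    (hy : y ∈ L.fv) (hz : z ∈ M.fv)
    (hs : ∀ X, MStep (.res y z (.par (.par L M) X)) (.res y z (.par (.par K K') X)))
    (h : Proj (.par (.par L M) X) R₀ B₀) (hyB : y ∉ B₀.fv) (hzB : z ∉ B₀.fv)
    (hR : MCong (.res y z R₀) R) (hB : MCong B₀ B) :
    ∃ R' B', Proj (.res y z (.par (.par K K') X)) R' B' ∧ Evolves R R' ∧ Evolves B B' := by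
  obtain ⟨R₁, B₁, R₂, B₂, h1, h2, h3, h4⟩ := h.par_inv
  obtain ⟨R₃, B₃, R₄, B₄, h5, h6, h7, h8⟩ := h1.par_inv
  rw [← h4.fv_eq] at hyB hzB
  have hy1 : y ∉ B₃.fv := fun h => hyB (.inl (h8.fv_eq ▸ .inl h))
  have hz1 : z ∉ B₄.fv := fun h => hzB (.inl (h8.fv_eq ▸ .inr h))
  rcases h5.leaf_inv hL with ⟨h9, h10⟩ | ⟨-, h9⟩
  swap
  · exact (hy1 (h9.fv_eq ▸ hy)).elim
  rcases h6.leaf_inv hM with ⟨h11, h12⟩ | ⟨-, h11⟩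
  swap
  · exact (hz1 (h11.fv_eq ▸ hz)).elim
  have hR' : MCong (.par (.par L M) R₂) R₀ := (((h9.par h11).trans h7).par (.refl _)).trans h3
  have hB' : MCong B₂ B₀ := by
    refine MCong.trans ?_ ((((h10.par h12).trans h8).par (.refl _)).trans h4)
    exact (MCong.nilPar _).symm.trans ((MCong.nil _).symm.par (.refl _))
  refine ⟨.res y z (.par (.par K K') R₂), .par (.par .nil .nil) B₂,
    .resL y z (((Proj.left K).par (.left K')).par h2) ?_ ?_, ?_, ?_⟩
  · rintro (h | h)
    · exact h.elim id id
    · exact hyB (.inr h)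
  · rintro (h | h)
    · exact h.elim id id
    · exact hzB (.inr h)
  · exact .cong_left (hR.symm.trans (hR'.symm.res y z)) (.single (.inl (hs R₂)))
  · exact .of_cong (hB.symm.trans (hB'.symm.trans
      ((MCong.nilPar _).symm.trans ((MCong.nil _).symm.par (.refl _)))))

theorem Proj.comm {y z : ℕ} {L M K K' X R B : Mix0}
    (h : Proj (.res y z (.par (.par L M) X)) R B) (hL : L.IsLeaf) (hM : M.IsLeaf)
    (hy : y ∈ L.fv) (hz : z ∈ M.fv)
    (hs : ∀ X, MStep (.res y z (.par (.par L M) X)) (.res y z (.par (.par K K') X))) :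
    ∃ R' B', Proj (.res y z (.par (.par K K') X)) R' B' ∧ Evolves R R' ∧ Evolves B B' := by
  obtain ⟨R₀, B₀, h1, ⟨h2, h3, h4, h5⟩ | ⟨h2, h3, h4, h5⟩⟩ := h.res_inv
  · exact h1.comm_left hL hM hy hz hs h2 h3 h4 h5
  · obtain ⟨B', R', h6, h7, h8⟩ := h1.symm.comm_left hL hM hy hz hs h2 h3 h5 h4
    exact ⟨R', B', h6.symm, h8, h7⟩

/-- A step of a process is a step of one of its two parts. -/
theorem Proj.step {Γ : ℕ → Ty} {P P' R B : Mix0} (hs : MStep P P') (hΓ : Sec Γ P)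
    (hP : P.Proper) (h : Proj P R B) :
    ∃ R' B', Proj P' R' B' ∧ Evolves R R' ∧ Evolves B B' := by
  have hcond : ∀ {v : Val} {P Q P' R B : Mix0}, MStep (.cond v P Q) P' → Proj (.cond v P Q) R B →
      ∃ R' B', Proj P' R' B' ∧ Evolves R R' ∧ Evolves B B' := by
    intro v P Q P' R B hs h
    rcases h.leaf_inv trivial with ⟨h1, h2⟩ | ⟨h1, h2⟩
    · exact ⟨P', .nil, .left _, .cong_left h1.symm (.single (.inl hs)), .of_cong h2.symm⟩
    · exact ⟨.nil, P', .right _, .of_cong h1.symm, .cong_left h2.symm (.single (.inl hs))⟩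
  induction hs generalizing Γ R B with
  | ifTrue P Q => exact hcond (.ifTrue P Q) h
  | ifFalse P Q => exact hcond (.ifFalse P Q) h
  | choice y z q q' l v x X pre P pre' Q i j hyz hi hj hd =>
    exact h.comm trivial trivial (.inl rfl) (.inl rfl)
      fun X => .choice y z q q' l v x X pre P pre' Q i j hyz hi hj hd
  | com y z q v x P Q X hyz hd =>
    exact h.comm trivial trivial (.inl (.inl rfl)) (.inl rfl)
      fun X => .com y z q v x P Q X hyz hd
  | case y z P X l Q j hyz =>
    exact h.comm trivial trivial (.inl rfl) (.inl rfl) fun X => .case y z P X l Q j hyz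
  | par Q _ ih =>
    obtain ⟨R₁, B₁, R₂, B₂, h1, h2, h3, h4⟩ := h.par_inv
    obtain ⟨R', B', h5, h6, h7⟩ := ih hΓ.2.1 hP.1 h1
    exact ⟨_, _, h5.par h2, .cong_left h3.symm (h6.par R₂), .cong_left h4.symm (h7.par B₂)⟩
  | res y z _ ih =>
    obtain ⟨S, V, -, hΓ⟩ := hΓ
    obtain ⟨R₀, B₀, h1, h2⟩ := h.res_inv
    obtain ⟨R', B', h5, h6, h7⟩ := ih hΓ hP.2 h1
    -- The parts do not gain free names, so the names of the restriction remain in one part.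
    have h8 := (h6.sec (h1.sec hΓ).1).2
    have h9 := (h7.sec (h1.sec hΓ).2).2
    rcases h2 with ⟨hy, hz, h3, h4⟩ | ⟨hy, hz, h3, h4⟩
    · exact ⟨_, _, .resL y z h5 (fun h => hy (h9 h)) fun h => hz (h9 h),
        .cong_left h3.symm (h6.res y z), .cong_left h4.symm h7⟩
    · exact ⟨_, _, .resR y z h5 (fun h => hy (h8 h)) fun h => hz (h8 h),
        .cong_left h3.symm h6, .cong_left h4.symm (h7.res y z)⟩
  | struct h1 hs h2 ih =>
    have hP' := h1.proper_iff.1 hP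
    have hΓ' := (h1.sec_iff Γ).1 hΓ
    obtain ⟨R', B', h3, h4, h5⟩ := ih hΓ' hP' ((h1.proj_iff hP).1 h)
    exact ⟨R', B', (h2.proj_iff (hP'.step hs hΓ')).1 h3, h4, h5⟩

/-- If the composition of two processes may succeed, then so may one of the two processes. -/
theorem maySucceed_of_par {ok : Ty → Prop} {P N₀ N₁ Q : Mix0} (hP : MixTyped ok P)
    (hc : MCong P (.par N₀ N₁)) (hs : Relation.ReflTransGen MStep P Q) (hQ : Q.Success) :
    ∃ N, (N = N₀ ∨ N = N₁) ∧ ∃ Q', Relation.ReflTransGen MStep N Q' ∧ Q'.Success := by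
  obtain ⟨G, hG, hP⟩ := hP
  obtain ⟨hp, -, hΓ⟩ := hP.sec fun x T h => (hG x T h).1
  have key : Proj P N₀ N₁ := (hc.proj_iff hp).2
    (((Proj.left N₀).par (.right N₁)).cong (.nil _) (.nilPar _))
  have : ∃ R B, Proj Q R B ∧ Evolves N₀ R ∧ Evolves N₁ B ∧ Sec G.tot Q ∧ Q.Proper := by
    clear hQ
    induction hs with
    | refl => exact ⟨N₀, N₁, key, .refl, .refl, hΓ, hp⟩
    | tail _ hs ih =>
      obtain ⟨R, B, h1, h2, h3, h4, h5⟩ := ih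
      obtain ⟨R', B', h6, h7, h8⟩ := h1.step hs h4 h5
      exact ⟨R', B', h6, h2.trans h7, h3.trans h8, (h4.step hs).1, h5.step hs h4⟩
  obtain ⟨R, B, h1, h2, h3, -⟩ := this
  rcases h1.success hQ with h | h
  · exact ⟨N₀, .inl rfl, h2.maySucceed h⟩
  · exact ⟨N₁, .inr rfl, h3.maySucceed h⟩

/-- The two rows of the square succeed only together, but their translations, being independent, are
no more successful together than on their own. -/
theorem not_hasGoodEncoding_mixCalculus {F : Family} {isTerm : Mix0 → Prop}
    (hF : F = .MSMP ∨ F = .MCMP) (hT : ∀ P, isTerm P → ∃ ok, MixTyped ok P) :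
    ¬ HasGoodEncoding F (mixCalculus isTerm) := by
  rintro ⟨encP, encS, henc, E, hE, -, -, -, -, hsucc, hdist⟩
  obtain ⟨N, hN, hNE⟩ := hdist rows 1 ![row0, row1] (rows_isTerm hF)
    (Fin.forall_fin_two.2 ⟨row0_isTerm hF, row1_isTerm hF⟩) rows_cong
  obtain ⟨Q, hQ, hQs⟩ := (hsucc rows (rows_isTerm hF)).1 rows_maySucceed
  obtain ⟨ok, hok⟩ := hT _ (henc rows (rows_isTerm hF))
  obtain ⟨N', hN', Q', h1, h2⟩ := maySucceed_of_par hok hN hQ hQs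
  rcases hN' with rfl | rfl
  · obtain ⟨M, h3, h4⟩ := (hsucc row0 (row0_isTerm hF)).2 ((hE.success _ _ (hNE 0)).1 ⟨Q', h1, h2⟩)
    exact row0_not_success h3 h4
  · obtain ⟨M, h3, h4⟩ := (hsucc row1 (row1_isTerm hF)).2 ((hE.success _ _ (hNE 1)).1 ⟨Q', h1, h2⟩)
    exact row1_not_success h3 h4

end MixedChoice

theorem mainTheorem4 :
    ∀ F ∈ [MixedChoice.Family.MSMP, MixedChoice.Family.MCMP],
      ∀ C ∈ [MixedChoice.Family.SCMP.calculus, MixedChoice.Family.DMP.calculus,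
          MixedChoice.Family.SMP.calculus, MixedChoice.Family.MP.calculus,
          MixedChoice.Family.MCBS.calculus, MixedChoice.Family.SCBS.calculus,
          MixedChoice.Family.BS.calculus, MixedChoice.CMV, MixedChoice.CMVplus,
          MixedChoice.LCMV, MixedChoice.LCMVplus],
        ¬ MixedChoice.HasGoodEncoding F C := by
  intro F hF C hC
  have hF : F = .MSMP ∨ F = .MCMP := by simpa using hF
  simp only [List.mem_cons, List.not_mem_nil, or_false] at hC
  rcases hC with rfl | rfl | rfl | rfl | rfl | rfl | rfl | rfl | rfl | rfl | rfl
  · exact MixedChoice.Family.not_hasGoodEncoding hF (.inl fun _ _ h i j => .inl (h i j))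
  · exact MixedChoice.Family.not_hasGoodEncoding hF (.inl fun _ _ h i j => .inr (h i j))
  · exact MixedChoice.Family.not_hasGoodEncoding hF (.inl fun _ _ h i j => .inl (h i j).2)
  · refine MixedChoice.Family.not_hasGoodEncoding hF (.inl ?_)
    rintro n pre (h | ⟨-, h⟩) i j
    · exact .inr (h i j).2
    · exact .inl ((h i).trans (h j).symm)
  · exact MixedChoice.Family.not_hasGoodEncoding hF (.inr fun _ h => h)
  · exact MixedChoice.Family.not_hasGoodEncoding hF (.inr fun _ h => h)
  · exact MixedChoice.Family.not_hasGoodEncoding hF (.inr fun _ h => h)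
  · exact MixedChoice.not_hasGoodEncoding_mixCalculus hF fun _ h => ⟨_, h.2⟩
  · exact MixedChoice.not_hasGoodEncoding_mixCalculus hF fun _ h => ⟨_, h.2⟩
  · exact MixedChoice.not_hasGoodEncoding_mixCalculus hF fun _ h => ⟨_, h.2.2⟩
  · exact MixedChoice.not_hasGoodEncoding_mixCalculus hF fun _ h => ⟨_, h.2.2⟩
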